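/- Let $n,m\ge 0$ be integers and let $\mathcal A^j:\mathbb R^m\to\mathbb R^{m\times m}$, $j=1,\dots,n$, be smooth functions whose values are symmetric matrices. Consider the symmetric hyperbolic system $$\partial_t u=\sum_{j=1}^n\mathcal A^j(u)\,\partial_j u,\qquad u:[0,T]\times\mathbb R^n\to\mathbb R^m. \qquad (*)$$ For a solution $u$ set $A=\|u\|_{L^\infty([0,T]\times\mathbb R^n)}$ and $B(t)=\|\nabla u(t)\|_{L^\infty(\mathbb R^n)}$. For every $s\ge 0$ there are a constant $K$ and a nondecreasing function $C:\mathbb R\to\mathbb R$, depending only on $s,n,m$ and the functions $\mathcal A^j$, such that for every $T\ge 0$ and every Lipschitz solution $u$ of $(*)$ on $[0,T]\times\mathbb R^n$ with $A<\infty$ and $\int_0^T B(\tau)\,d\tau<\infty$, and for every $t\in[0,T]$, $$\|u(t)\|_{H^s(\mathbb R^n)}\le K\,e^{\,C(A)\int_0^t B(\tau)\,d\tau}\,\|u(0)\|_{H^s(\mathbb R^n)} .$$ Here a Lipschitz solution is a continuous function $u$ on $[0,T]\times\mathbb R^n$ such that $u(t)$ is Lipschitz in $x$ for almost every $t$ and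 $(*)$ holds almost everywhere in integrated form: for almost every $x$ and all $t\in[0,T]$, $u(t,x)=u(0,x)+\int_0^t\sum_j\mathcal A^j(u)\,\partial_j u\,(\tau,x)\,d\tau$. The norm $\|\cdot\|_{H^s}$ takes the value $+\infty$ outside $H^s$; in particular, if $u(0)\in H^s$ then $u(t)\in H^s$ for all $t\in[0,T]$. -/

import Mathlib

open MeasureTheory Set
open scoped ENNReal NNReal ContDiff

noncomputable section

/-- A function with values in `ℝᵐ`, viewed as a function with values in `ℂᵐ`. -/
def complexify {n m : ℕ} (f : EuclideanSpace ℝ (Fin n) → EuclideanSpace ℝ (Fin m)) :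
    EuclideanSpace ℝ (Fin n) → EuclideanSpace ℂ (Fin m) :=
  fun x => WithLp.toLp 2 (fun i => ((f x i : ℝ) : ℂ))

/-- The norm of the Sobolev space `Hˢ(ℝⁿ; ℝᵐ)`, for `s ≥ 0`, as a number in `[0, ∞]`:
`(∫ (1 + |2πξ|²)ˢ |f̂(ξ)|² dξ)^(1/2)` if `f` is square integrable, where `f̂` is the `L²` Fourier
transform with the kernel `e^(-2πi x·ξ)`, and `∞` if `f` is not square integrable (an infimum over
the empty set). It is finite exactly if `f` belongs to `Hˢ`. -/
def sobolevNorm {n m : ℕ} (s : ℝ)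
    (f : EuclideanSpace ℝ (Fin n) → EuclideanSpace ℝ (Fin m)) : ℝ≥0∞ :=
  ⨅ hf : MemLp (complexify f) 2 (volume : Measure (EuclideanSpace ℝ (Fin n))),
    (∫⁻ ξ, ENNReal.ofReal ((1 + (2 * Real.pi * ‖ξ‖) ^ 2) ^ s) *
      ‖(Lp.fourierTransformₗᵢ (EuclideanSpace ℝ (Fin n)) (EuclideanSpace ℂ (Fin m))
          (hf.toLp (complexify f))) ξ‖ₑ ^ 2) ^ (1 / 2 : ℝ)

/-- `‖∇f‖_{L^∞}`: the essential supremum of the norm of the derivative. It is used for Lipschitz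
functions `f`, which are differentiable almost everywhere. -/
def gradNorm {n m : ℕ}
    (f : EuclideanSpace ℝ (Fin n) → EuclideanSpace ℝ (Fin m)) : ℝ≥0∞ :=
  eLpNorm (fderiv ℝ f) ⊤ volume

/-- The control parameter `A = ‖u‖_{L^∞([0,T] × ℝⁿ)}`. -/
def controlA {n m : ℕ} (T : ℝ)
    (u : ℝ → EuclideanSpace ℝ (Fin n) → EuclideanSpace ℝ (Fin m)) : ℝ≥0∞ :=
  ⨆ t ∈ Icc (0 : ℝ) T, eLpNorm (u t) ⊤ volume

/-- The time integral `∫₀ᵗ B(τ) dτ` of the control parameter `B(τ) = ‖∇u(τ)‖_{L^∞(ℝⁿ)}`. -/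
def integralB {n m : ℕ} (t : ℝ)
    (u : ℝ → EuclideanSpace ℝ (Fin n) → EuclideanSpace ℝ (Fin m)) : ℝ≥0∞ :=
  ∫⁻ τ in Icc (0 : ℝ) t, gradNorm (u τ)

/-- The quasilinear right-hand side `∑ⱼ 𝒜ʲ(f) ∂ⱼ f` at the point `x`. -/
def quasilinearTerm {n m : ℕ}
    (𝒜 : Fin n → EuclideanSpace ℝ (Fin m) → Matrix (Fin m) (Fin m) ℝ)
    (f : EuclideanSpace ℝ (Fin n) → EuclideanSpace ℝ (Fin m)) (x : EuclideanSpace ℝ (Fin n)) :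
    EuclideanSpace ℝ (Fin m) :=
  ∑ j, (𝒜 j (f x)).toEuclideanLin (fderiv ℝ f x (EuclideanSpace.single j 1))

/-- `u` is a Lipschitz solution of `∂ₜ u = ∑ⱼ 𝒜ʲ(u) ∂ⱼ u` on `[0, T] × ℝⁿ` with finite control
parameters: `u` is bounded and continuous, `u(t)` is Lipschitz in `x` for almost every `t`,
`B(t) = ‖∇u(t)‖_{L^∞}` is integrable in time, and the equation holds almost everywhere, in its
time-integrated form. No Sobolev regularity is required. -/
structure IsLipschitzSolution {n m : ℕ}
    (𝒜 : Fin n → EuclideanSpace ℝ (Fin m) → Matrix (Fin m) (Fin m) ℝ) (T : ℝ)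
    (u : ℝ → EuclideanSpace ℝ (Fin n) → EuclideanSpace ℝ (Fin m)) : Prop where
  continuousOn : ContinuousOn (Function.uncurry u) (Icc (0 : ℝ) T ×ˢ univ)
  controlA_ne_top : controlA T u ≠ ⊤
  lipschitz : ∀ᵐ t ∂(volume.restrict (Icc (0 : ℝ) T)), ∃ L : ℝ≥0, LipschitzWith L (u t)
  integralB_ne_top : integralB T u ≠ ⊤
  equation : ∀ᵐ x, ∀ t ∈ Icc (0 : ℝ) T,
    IntervalIntegrable (fun τ => quasilinearTerm 𝒜 (u τ) x) volume 0 t ∧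
      u t x = u 0 x + ∫ τ in (0 : ℝ)..t, quasilinearTerm 𝒜 (u τ) x

end

/-!
The estimate is proved by energy estimates for the frequency-localized solution. Write `S_r`
(`lowPass`) for the smooth restriction to frequencies below about `r`, `R_r = 1 - S_r` (`highPass`),
and `P = S_σ - S_ρ` (`bandPass`). The filters are convolutions with rescaled Schwartz kernels, so they
are bounded on `L²` and on `L^∞`. For `s > 0`, the square of the `Hˢ` norm is comparable to
`‖u‖² + ∑ₖ 4^{sk} ‖R_{2ᵏ} u‖²` (`sobolevNorm_sq_le_dyadicEnergy`, `dyadicEnergy_le_sobolevNorm_sq`).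

*Localized energy.* A Lipschitz solution is only once differentiable, so the equation is first
band-pass filtered. Up to an error, `P (a ∂u)` is `(S_{ρ/8} a) ∂ (P u)`
(`exists_eLpNorm_bandPass_mul_fderiv_sub_le`). The error consists of commutators `[S_r, S_{ρ/8} a] ∂u`,
bounded by `B ‖R_{ρ/4} u‖` since the kernel gains `1 / r` from the Lipschitz bound of `a`
(`eLpNorm_lpCommutator_fderiv_le`), and of `P ((R_{ρ/8} a) ∂u)`, bounded by `B ‖R_{ρ/8} a‖` since `∂u`
is bounded by `B`. The principal part has smooth symmetric coefficients, and an integration by parts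
leaves a factor `∂ (S_{ρ/8} a)`, bounded by `B` (`integral_symmetric_form`). Letting `σ → ∞`, the
growth of `‖R_ρ u‖²` is at most `B (‖R_{ρ/4} u‖ + ‖R_{ρ/8} a‖)²` (`exists_sum_eLpNorm_highPass_sq_le`).

*Coefficients.* For `a = F(u)` with `F` smooth and `|u| ≤ A`, telescoping `F(S_{2ˡ} u)` over `l` bounds
`‖R_{2ʲ} a‖` by `∑_{l ≤ j} 2^{-N(j-l)} ‖R_{2ˡ} u‖`, up to `2^{-Nj} ‖u‖`, for arbitrary `N`
(`exists_eLpNorm_highPass_comp_le`). This is where the constant depends on `A`. For `N ≥ s + 1`, the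
convolution is bounded on `ℓ²` with the weights `2^{sk}`, and Grönwall's inequality closes the
estimate for a finite number of frequencies, with constants that do not depend on that number
(`exists_dyadicEnergy_le`). Truncation makes every quantity in the argument finite, so that no
regularity of `u(t)` for `t > 0` is presupposed.

*The `L²` norm.* Since square integrability is only known at time `0`, the `L²` estimate uses the
integrable weight `(1 + ε|x|)^{-(n+1)}`, whose contribution vanishes as `ε → 0`
(`SystemSolution.lintegral_sq_le`). This is also the case `s = 0`.
-/

noncomputable section

set_option linter.unusedSectionVars false

/-! ### The low-pass kernel -/

section Kernel

open scoped FourierTransform SchwartzMap RealInnerProductSpace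

variable {E : Type} [NormedAddCommGroup E] [InnerProductSpace ℝ E] [FiniteDimensional ℝ E]
  [MeasurableSpace E] [BorelSpace E]

/-- A smooth radial frequency cutoff: it equals `1` on the unit ball and vanishes outside the ball
of radius `2`. -/
def unitBump (E : Type) [NormedAddCommGroup E] [InnerProductSpace ℝ E] : ContDiffBump (0 : E) :=
  ⟨1, 2, one_pos, one_lt_two⟩

/-- The cutoff at frequency scale `r`: equal to `1` for `‖ξ‖ ≤ r` and to `0` for `‖ξ‖ ≥ 2r`. -/
def cutoff (r : ℝ) (ξ : E) : ℝ := unitBump E (r⁻¹ • ξ)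

lemma cutoff_nonneg (r : ℝ) (ξ : E) : 0 ≤ cutoff r ξ := (unitBump E).nonneg

lemma cutoff_le_one (r : ℝ) (ξ : E) : cutoff r ξ ≤ 1 := (unitBump E).le_one

lemma cutoff_eq_one {r : ℝ} (hr : 0 < r) {ξ : E} (h : ‖ξ‖ ≤ r) : cutoff r ξ = 1 := by
  apply (unitBump E).one_of_mem_closedBall
  have : (unitBump E).rIn = 1 := rfl
  rw [this, mem_closedBall_zero_iff, norm_smul, norm_inv, Real.norm_of_nonneg hr.le]
  rw [inv_mul_le_iff₀ hr]; simpa using h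

lemma cutoff_eq_zero {r : ℝ} (hr : 0 < r) {ξ : E} (h : 2 * r ≤ ‖ξ‖) : cutoff r ξ = 0 := by
  apply (unitBump E).zero_of_le_dist
  have : (unitBump E).rOut = 2 := rfl
  rw [this, dist_zero_right, norm_smul, norm_inv, Real.norm_of_nonneg hr.le]
  rw [le_inv_mul_iff₀ hr]; linarith

lemma continuous_cutoff (r : ℝ) : Continuous (cutoff r : E → ℝ) :=
  (unitBump E).continuous.comp (continuous_const_smul _)

/-- The unit frequency cutoff as a complex Schwartz function. -/
def unitBumpSchwartz (E : Type) [NormedAddCommGroup E] [InnerProductSpace ℝ E]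
    [FiniteDimensional ℝ E] : 𝓢(E, ℂ) :=
  HasCompactSupport.toSchwartzMap (f := fun ξ => ((unitBump E ξ : ℝ) : ℂ))
    ((unitBump E).hasCompactSupport.comp_left (g := Complex.ofReal) Complex.ofReal_zero)
    (Complex.ofRealCLM.contDiff.comp (unitBump E).contDiff)

lemma unitBumpSchwartz_apply (ξ : E) : unitBumpSchwartz E ξ = ((unitBump E ξ : ℝ) : ℂ) := rfl

/-- The low-pass kernel at unit scale: the inverse Fourier transform of the unit cutoff. -/
def unitKernel (E : Type) [NormedAddCommGroup E] [InnerProductSpace ℝ E]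
    [FiniteDimensional ℝ E] [MeasurableSpace E] [BorelSpace E] : 𝓢(E, ℝ) :=
  SchwartzMap.postcompCLM Complex.reCLM (𝓕⁻ (unitBumpSchwartz E))

lemma fourierInv_unitBump_conj (x : E) :
    (starRingEnd ℂ) (𝓕⁻ (unitBumpSchwartz E) x) = 𝓕⁻ (unitBumpSchwartz E) x := by
  rw [SchwartzMap.fourierInv_coe, Real.fourierInv_eq', ← integral_conj, ← integral_neg_eq_self]
  congr 1
  ext v
  rw [unitBumpSchwartz_apply, unitBumpSchwartz_apply, ContDiffBump.neg]
  simp only [smul_eq_mul, map_mul, Complex.conj_ofReal, ← Complex.exp_conj, Complex.conj_I,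
    inner_neg_left]
  push_cast
  congr 2
  ring

lemma ofReal_unitKernel (x : E) : ((unitKernel E x : ℝ) : ℂ) = 𝓕⁻ (unitBumpSchwartz E) x := by
  have := Complex.conj_eq_iff_re.1 (fourierInv_unitBump_conj x)
  rw [← this]; rfl

/-- The low-pass kernel `χ_r(x) = rⁿ χ(r x)` at frequency scale `r`. -/
def lpKernel (r : ℝ) (x : E) : ℝ := r ^ Module.finrank ℝ E * unitKernel E (r • x)

lemma exists_schwartz_lpKernel {r : ℝ} (hr : 0 < r) : ∃ K : 𝓢(E, ℝ), ⇑K = lpKernel r := by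
  refine ⟨(r ^ Module.finrank ℝ E) • SchwartzMap.compCLMOfContinuousLinearEquiv ℝ
    (ContinuousLinearEquiv.smulLeft (Units.mk0 r hr.ne')) (unitKernel E), ?_⟩
  ext x
  simp [lpKernel, SchwartzMap.compCLMOfContinuousLinearEquiv_apply]

lemma unitKernel_neg (x : E) : unitKernel E (-x) = unitKernel E x := by
  have : ((unitKernel E (-x) : ℝ) : ℂ) = unitKernel E x := by
    rw [ofReal_unitKernel, ofReal_unitKernel, SchwartzMap.fourierInv_coe, Real.fourierInv_eq',
      Real.fourierInv_eq', ← integral_neg_eq_self]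
    congr 1
    ext v
    rw [unitBumpSchwartz_apply, unitBumpSchwartz_apply, ContDiffBump.neg, inner_neg_neg]
  exact_mod_cast this

lemma lpKernel_neg (r : ℝ) (x : E) : lpKernel r (-x) = lpKernel r x := by
  simp only [lpKernel, smul_neg, unitKernel_neg]

lemma lpKernel_sub_comm (r : ℝ) (x y : E) : lpKernel r (x - y) = lpKernel r (y - x) := by
  rw [← neg_sub, lpKernel_neg]

/-- The kernel `χ_r` is the superposition of the characters of frequency at most `2r`. -/
lemma ofReal_lpKernel {r : ℝ} (hr : 0 < r) (x : E) :
    ((lpKernel r x : ℝ) : ℂ) = ∫ ξ : E, Complex.exp (↑(2 * Real.pi * ⟪ξ, x⟫) * Complex.I) *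
      (cutoff r ξ : ℂ) := by
  have h1 : ((lpKernel r x : ℝ) : ℂ) = (r : ℂ) ^ Module.finrank ℝ E *
      𝓕⁻ (unitBumpSchwartz E) (r • x) := by
    rw [lpKernel, ← ofReal_unitKernel]; push_cast; rfl
  rw [h1, SchwartzMap.fourierInv_coe, Real.fourierInv_eq']
  have h2 := Measure.integral_comp_smul (μ := (volume : Measure E))
    (fun v => Complex.exp (↑(2 * Real.pi * ⟪v, r • x⟫) * Complex.I) • unitBumpSchwartz E v) r⁻¹
  simp only [unitBumpSchwartz_apply, smul_eq_mul] at h2 ⊢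
  have h3 : ∀ ξ : E, ⟪r⁻¹ • ξ, r • x⟫ = ⟪ξ, x⟫ := by
    intro ξ
    rw [real_inner_smul_left, real_inner_smul_right, ← mul_assoc, inv_mul_cancel₀ hr.ne', one_mul]
  simp only [h3] at h2
  unfold cutoff
  rw [h2]
  rw [inv_pow, inv_inv, abs_of_pos (by positivity)]
  rw [Complex.real_smul]
  push_cast
  rfl

lemma integrable_lpKernel {r : ℝ} (hr : 0 < r) : Integrable (lpKernel r : E → ℝ) := by
  obtain ⟨K, hK⟩ := exists_schwartz_lpKernel (E := E) hr
  rw [← hK]; exact K.integrable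

lemma continuous_lpKernel (r : ℝ) : Continuous (lpKernel r : E → ℝ) :=
  continuous_const.mul ((unitKernel E).continuous.comp (continuous_const_smul _))

/-- The Fourier transform of `χ_r` is the cutoff at scale `r`. -/
lemma integral_lpKernel_character {r : ℝ} (hr : 0 < r) (ξ : E) :
    ∫ y : E, Complex.exp (↑(-2 * Real.pi * ⟪y, ξ⟫) * Complex.I) * (lpKernel r y : ℂ)
      = cutoff r ξ := by
  have h1 : 𝓕 (𝓕⁻ (unitBumpSchwartz E)) (r⁻¹ • ξ) = cutoff r ξ := by
    rw [FourierTransform.fourier_fourierInv_eq]; rfl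
  rw [← h1, SchwartzMap.fourier_coe, Real.fourier_eq']
  have h2 := Measure.integral_comp_smul (μ := (volume : Measure E))
    (fun v => Complex.exp (↑(-2 * Real.pi * ⟪v, r⁻¹ • ξ⟫) * Complex.I) •
      𝓕⁻ (unitBumpSchwartz E) v) r
  have h3 : ∀ y : E, ⟪r • y, r⁻¹ • ξ⟫ = ⟪y, ξ⟫ := by
    intro y
    rw [real_inner_smul_left, real_inner_smul_right, ← mul_assoc, mul_inv_cancel₀ hr.ne', one_mul]
  simp only [h3, ← ofReal_unitKernel] at h2 ⊢
  have h4 : ∀ y : E, Complex.exp (↑(-2 * Real.pi * ⟪y, ξ⟫) * Complex.I) * (lpKernel r y : ℂ) =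
    (r : ℂ) ^ Module.finrank ℝ E * (Complex.exp (↑(-2 * Real.pi * ⟪y, ξ⟫) * Complex.I) •
      ((unitKernel E (r • y) : ℝ) : ℂ)) := by
    intro y; rw [lpKernel, smul_eq_mul]; push_cast; ring
  simp only [h4]
  rw [integral_const_mul, h2, abs_of_pos (by positivity), Complex.real_smul]
  push_cast
  rw [← mul_assoc, mul_inv_cancel₀, one_mul]
  exact pow_ne_zero _ (by exact_mod_cast hr.ne')

lemma integral_lpKernel {r : ℝ} (hr : 0 < r) : ∫ y : E, lpKernel r y = 1 := by
  have h := integral_lpKernel_character (E := E) hr 0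
  rw [cutoff_eq_one hr (by simpa using hr.le)] at h
  simp only [inner_zero_right, mul_zero, Complex.ofReal_zero, zero_mul, Complex.exp_zero,
    one_mul] at h
  rw [integral_complex_ofReal] at h
  exact_mod_cast h

lemma integrable_cutoff {r : ℝ} (hr : 0 < r) : Integrable (cutoff r : E → ℝ) := by
  refine (continuous_cutoff r).integrable_of_hasCompactSupport ?_
  refine HasCompactSupport.of_support_subset_isCompact (isCompact_closedBall (0 : E) (2 * r)) ?_
  intro ξ hξ
  rw [mem_closedBall_zero_iff]
  by_contra! hlt
  exact hξ (cutoff_eq_zero hr hlt.le)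

/-- `χ_r` reproduces every superposition of characters of frequency at most `r`. -/
lemma integral_lpKernel_mul_superposition {r : ℝ} (hr : 0 < r) {Ω : Type*} [MeasurableSpace Ω]
    (ν : Measure Ω) [SFinite ν] {G : Ω → ℂ} (hG : Integrable G ν) {φ : Ω → E}
    (hφ : Measurable φ) (hsupp : ∀ p, G p ≠ 0 → ‖φ p‖ ≤ r) (x : E) :
    ∫ y : E, (lpKernel r y : ℂ) *
        ∫ p, Complex.exp (↑(2 * Real.pi * ⟪φ p, x - y⟫) * Complex.I) * G p ∂ν =
      ∫ p, Complex.exp (↑(2 * Real.pi * ⟪φ p, x⟫) * Complex.I) * G p ∂ν := by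
  have hexp : ∀ t : ℝ, ‖Complex.exp (↑t * Complex.I)‖ = 1 := Complex.norm_exp_ofReal_mul_I
  simp_rw [← integral_const_mul]
  rw [integral_integral_swap]
  · congr 1
    ext p
    by_cases h0 : G p = 0
    · simp [h0]
    have h1 : ∀ y : E, (lpKernel r y : ℂ) *
        (Complex.exp (↑(2 * Real.pi * ⟪φ p, x - y⟫) * Complex.I) * G p) =
        (Complex.exp (↑(2 * Real.pi * ⟪φ p, x⟫) * Complex.I) * G p) *
          (Complex.exp (↑(-2 * Real.pi * ⟪y, φ p⟫) * Complex.I) * (lpKernel r y : ℂ)) := by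
      intro y
      have : Complex.exp (↑(2 * Real.pi * ⟪φ p, x - y⟫) * Complex.I) =
          Complex.exp (↑(2 * Real.pi * ⟪φ p, x⟫) * Complex.I) *
          Complex.exp (↑(-2 * Real.pi * ⟪y, φ p⟫) * Complex.I) := by
        rw [← Complex.exp_add, inner_sub_right, real_inner_comm y]
        congr 1; push_cast; ring
      rw [this]; ring
    simp_rw [h1]
    rw [integral_const_mul, integral_lpKernel_character hr, cutoff_eq_one hr (hsupp p h0)]
    simp
  · have hK : Integrable (fun y : E => (lpKernel r y : ℂ)) := (integrable_lpKernel hr).ofReal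
    have hm : Measurable fun q : E × Ω =>
        Complex.exp (↑(2 * Real.pi * ⟪φ q.2, x - q.1⟫) * Complex.I) := by fun_prop
    refine ((hK.mul_prod hG).bdd_mul (c := 1) hm.aestronglyMeasurable
      (Filter.Eventually.of_forall fun q => (hexp _).le)).congr
      (Filter.Eventually.of_forall fun q => ?_)
    simp only [Function.uncurry]
    ring

lemma lpKernel_reproduce {r r₁ : ℝ} (h₁ : 0 < r₁) (h : 2 * r₁ ≤ r) (x z : E) :
    ∫ y : E, lpKernel r (x - y) * lpKernel r₁ (y - z) = lpKernel r₁ (x - z) := by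
  have hr : 0 < r := by linarith
  have h1 := integral_lpKernel_mul_superposition (E := E) hr (volume : Measure E)
    (G := fun ξ => (cutoff r₁ ξ : ℂ)) (integrable_cutoff h₁).ofReal (φ := id) measurable_id
    (fun ξ hξ => by
      by_contra! hlt
      exact hξ (by rw [cutoff_eq_zero (ξ := ξ) h₁ (h.trans (le_of_lt hlt)), Complex.ofReal_zero])) (x - z)
  simp only [id, ← ofReal_lpKernel h₁] at h1
  have h2 : ∫ y : E, lpKernel r y * lpKernel r₁ (x - z - y) = lpKernel r₁ (x - z) := by
    rw [← Complex.ofReal_inj, ← h1, ← integral_complex_ofReal]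
    push_cast; rfl
  rw [← h2, ← integral_sub_left_eq_self _ volume x]
  congr 1; ext y
  congr 2 <;> abel_nf

/-- The product of two low-pass kernels of scales `r₁`, `r₂` has frequencies at most `2r₁ + 2r₂`,
so it is reproduced by the low-pass kernel of that scale. -/
lemma lpKernel_reproduce_mul {r r₁ r₂ : ℝ} (h₁ : 0 < r₁) (h₂ : 0 < r₂)
    (h : 2 * r₁ + 2 * r₂ ≤ r) (x z w : E) :
    ∫ y : E, lpKernel r (x - y) * (lpKernel r₁ (y - z) * lpKernel r₂ (y - w)) =
      lpKernel r₁ (x - z) * lpKernel r₂ (x - w) := by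
  have hr : 0 < r := by linarith
  set G : E × E → ℂ := fun p =>
    (Complex.exp (↑(-2 * Real.pi * ⟪p.1, z⟫) * Complex.I) * (cutoff r₁ p.1 : ℂ)) *
    (Complex.exp (↑(-2 * Real.pi * ⟪p.2, w⟫) * Complex.I) * (cutoff r₂ p.2 : ℂ)) with hGdef
  have hexp : ∀ t : ℝ, ‖Complex.exp (↑t * Complex.I)‖ = 1 := Complex.norm_exp_ofReal_mul_I
  have hc : ∀ {s : ℝ} (_ : 0 < s) (q : E), Integrable fun ξ : E =>
      Complex.exp (↑(-2 * Real.pi * ⟪ξ, q⟫) * Complex.I) * (cutoff s ξ : ℂ) := by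
    intro s hs q
    have hm : Measurable fun ξ : E =>
      Complex.exp (↑(-2 * Real.pi * ⟪ξ, q⟫) * Complex.I) := by fun_prop
    exact (integrable_cutoff hs).ofReal.bdd_mul (c := 1) hm.aestronglyMeasurable
      (Filter.Eventually.of_forall fun q => (hexp _).le)
  have hG : Integrable G ((volume : Measure E).prod volume) := (hc h₁ z).mul_prod (hc h₂ w)
  have key : ∀ y : E, ∫ p : E × E, Complex.exp (↑(2 * Real.pi * ⟪p.1 + p.2, y⟫) * Complex.I) * G p
      ∂((volume : Measure E).prod volume) = ((lpKernel r₁ (y - z) * lpKernel r₂ (y - w) : ℝ) : ℂ) := by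
    intro y
    rw [Complex.ofReal_mul, ofReal_lpKernel h₁, ofReal_lpKernel h₂, ← integral_prod_mul]
    congr 1; ext p
    have e : ∀ ξ q : E, Complex.exp (↑(2 * Real.pi * ⟪ξ, y - q⟫) * Complex.I) =
        Complex.exp (↑(2 * Real.pi * ⟪ξ, y⟫) * Complex.I) *
        Complex.exp (↑(-2 * Real.pi * ⟪ξ, q⟫) * Complex.I) := by
      intro ξ q
      rw [← Complex.exp_add, inner_sub_right]
      congr 1; push_cast; ring
    have e2 : Complex.exp (↑(2 * Real.pi * ⟪p.1 + p.2, y⟫) * Complex.I) =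
        Complex.exp (↑(2 * Real.pi * ⟪p.1, y⟫) * Complex.I) *
        Complex.exp (↑(2 * Real.pi * ⟪p.2, y⟫) * Complex.I) := by
      rw [← Complex.exp_add, inner_add_left]
      congr 1; push_cast; ring
    rw [e, e, e2, hGdef]
    ring
  have h1 := integral_lpKernel_mul_superposition (E := E) hr ((volume : Measure E).prod volume)
    hG (φ := fun p => p.1 + p.2) (by fun_prop)
    (fun p hp => by
      have a1 : ‖p.1‖ ≤ 2 * r₁ := by
        by_contra! hlt
        exact hp (by simp [hGdef, cutoff_eq_zero h₁ hlt.le])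
      have a2 : ‖p.2‖ ≤ 2 * r₂ := by
        by_contra! hlt
        exact hp (by simp [hGdef, cutoff_eq_zero h₂ hlt.le])
      exact (norm_add_le _ _).trans ((add_le_add a1 a2).trans h)) x
  simp only [key] at h1
  rw [← integral_sub_left_eq_self _ volume x, ← Complex.ofReal_inj, ← h1, ← integral_complex_ofReal]
  congr 1; ext y
  simp

/-- The `L¹` norm of the `i`-th derivative of the unit low-pass kernel. -/
def kernelMass (E : Type) [NormedAddCommGroup E] [InnerProductSpace ℝ E]
    [FiniteDimensional ℝ E] [MeasurableSpace E] [BorelSpace E] (i : ℕ) : ℝ :=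
  ∫ y : E, ‖iteratedFDeriv ℝ i (unitKernel E) y‖

/-- The first absolute moment of the unit low-pass kernel. -/
def kernelMoment (E : Type) [NormedAddCommGroup E] [InnerProductSpace ℝ E]
    [FiniteDimensional ℝ E] [MeasurableSpace E] [BorelSpace E] : ℝ :=
  ∫ y : E, ‖unitKernel E y‖ * ‖y‖

lemma kernelMass_nonneg (i : ℕ) : 0 ≤ kernelMass E i := integral_nonneg fun _ => norm_nonneg _

lemma kernelMoment_nonneg : 0 ≤ kernelMoment E := integral_nonneg fun _ => by positivity

lemma integral_norm_iteratedFDeriv_lpKernel {r : ℝ} (hr : 0 < r) (i : ℕ) :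
    ∫ y : E, ‖iteratedFDeriv ℝ i (lpKernel r) y‖ = r ^ i * kernelMass E i := by
  have h1 : ∀ y : E, ‖iteratedFDeriv ℝ i (lpKernel r) y‖ =
      r ^ Module.finrank ℝ E * r ^ i * ‖iteratedFDeriv ℝ i (unitKernel E) (r • y)‖ := by
    intro y
    have hs : ContDiff ℝ i (unitKernel E) := (unitKernel E).smooth i
    have hs' : ContDiff ℝ i (fun x : E => unitKernel E (r • x)) := hs.comp (contDiff_const_smul r)
    have : (lpKernel r : E → ℝ) = (r ^ Module.finrank ℝ E) • fun x => unitKernel E (r • x) := rfl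
    rw [this, iteratedFDeriv_const_smul_apply hs'.contDiffAt, iteratedFDeriv_comp_const_smul r hs,
      norm_smul, norm_smul, norm_pow, norm_pow, Real.norm_of_nonneg hr.le, mul_assoc]
  simp_rw [h1]
  rw [integral_const_mul, Measure.integral_comp_smul (μ := (volume : Measure E))
    (fun v => ‖iteratedFDeriv ℝ i (unitKernel E) v‖) r, abs_of_pos (by positivity), smul_eq_mul,
    kernelMass]
  field_simp

lemma integral_norm_lpKernel {r : ℝ} (hr : 0 < r) :
    ∫ y : E, ‖lpKernel r y‖ = kernelMass E 0 := by
  simpa using integral_norm_iteratedFDeriv_lpKernel (E := E) hr 0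

lemma one_le_kernelMass_zero : 1 ≤ kernelMass E 0 := by
  rw [← integral_norm_lpKernel (E := E) one_pos]
  have := norm_integral_le_integral_norm (μ := volume) (lpKernel 1 : E → ℝ)
  rwa [integral_lpKernel one_pos, norm_one] at this

lemma integrable_lpKernel_mul_norm {r : ℝ} (hr : 0 < r) :
    Integrable fun y : E => ‖lpKernel r y‖ * ‖y‖ := by
  obtain ⟨K, hK⟩ := exists_schwartz_lpKernel (E := E) hr
  rw [← hK]
  simpa [mul_comm] using K.integrable_pow_mul volume 1

lemma integral_norm_lpKernel_mul_norm {r : ℝ} (hr : 0 < r) :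
    ∫ y : E, ‖lpKernel r y‖ * ‖y‖ = r⁻¹ * kernelMoment E := by
  have h1 : ∀ y : E, ‖lpKernel r y‖ * ‖y‖ =
      r ^ Module.finrank ℝ E * r⁻¹ * (‖unitKernel E (r • y)‖ * ‖r • y‖) := by
    intro y
    rw [lpKernel, norm_mul, norm_pow, norm_smul, Real.norm_of_nonneg hr.le]
    field_simp
  simp_rw [h1]
  rw [integral_const_mul, Measure.integral_comp_smul (μ := (volume : Measure E))
    (fun v => ‖unitKernel E v‖ * ‖v‖) r, abs_of_pos (by positivity), smul_eq_mul,
    kernelMoment]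
  field_simp

end Kernel

/-! ### The low-pass filter -/

section LowPass

open scoped SchwartzMap RealInnerProductSpace

variable {E : Type} [NormedAddCommGroup E] [InnerProductSpace ℝ E] [FiniteDimensional ℝ E]
  [MeasurableSpace E] [BorelSpace E]
  {V W Z : Type} [NormedAddCommGroup V] [NormedSpace ℝ V] [NormedAddCommGroup W] [NormedSpace ℝ W]
  [NormedAddCommGroup Z] [NormedSpace ℝ Z]

lemma eLpNorm_two_sq (f : E → V) : eLpNorm f 2 volume ^ 2 = ∫⁻ x, ‖f x‖ₑ ^ 2 := by
  have := eLpNorm_nnreal_pow_eq_lintegral (μ := (volume : Measure E)) (f := f) (p := 2) (by simp)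
  simpa using this

lemma aestronglyMeasurable_comp_sub_left {f : E → V} (hf : AEStronglyMeasurable f volume) (x : E) :
    AEStronglyMeasurable (fun y => f (x - y)) volume :=
  hf.comp_quasiMeasurePreserving (quasiMeasurePreserving_sub_left_of_right_invariant volume x)

/-- **Young's inequality** `L¹ * L² → L²`, for functions dominated by a convolution. -/
lemma eLpNorm_two_le_of_kernel {h : E → W} {f : E → V} {k : E → ℝ}
    (hk : AEStronglyMeasurable k volume)
    (hf : AEStronglyMeasurable f volume)
    (hh : ∀ x, ‖h x‖ₑ ≤ ∫⁻ y, ‖k y‖ₑ * ‖f (x - y)‖ₑ) :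
    eLpNorm h 2 volume ≤ (∫⁻ y, ‖k y‖ₑ) * eLpNorm f 2 volume := by
  have hsq : eLpNorm h 2 volume ^ 2 ≤ ((∫⁻ y, ‖k y‖ₑ) * eLpNorm f 2 volume) ^ 2 := by
    rw [mul_pow, eLpNorm_two_sq, eLpNorm_two_sq]
    have hmeas : AEMeasurable (fun p : E × E => ‖k p.2‖ₑ * ‖f (p.1 - p.2)‖ₑ ^ 2)
        ((volume : Measure E).prod volume) := by
      have h1 : AEMeasurable (fun p : E × E => ‖k p.2‖ₑ) ((volume : Measure E).prod volume) :=
        hk.comp_snd.enorm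
      have h2 : AEMeasurable (fun p : E × E => ‖f (p.1 - p.2)‖ₑ) ((volume : Measure E).prod volume) :=
        (hf.comp_quasiMeasurePreserving (quasiMeasurePreserving_sub volume volume)).enorm
      exact h1.mul (h2.pow_const 2)
    calc ∫⁻ x, ‖h x‖ₑ ^ 2 ≤ ∫⁻ x, (∫⁻ y, ‖k y‖ₑ) * ∫⁻ y, ‖k y‖ₑ * ‖f (x - y)‖ₑ ^ 2 := by
          refine lintegral_mono fun x => ?_
          have hfx := (aestronglyMeasurable_comp_sub_left hf x).enorm
          have hCS := ENNReal.lintegral_mul_le_Lp_mul_Lq (volume : Measure E)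
            Real.HolderConjugate.two_two (f := fun y => ‖k y‖ₑ ^ (1/2 : ℝ))
            (g := fun y => ‖k y‖ₑ ^ (1/2 : ℝ) * ‖f (x - y)‖ₑ)
            (hk.enorm.pow_const _) ((hk.enorm.pow_const _).mul hfx)
          have e1 : ∀ y, ‖k y‖ₑ ^ (1/2 : ℝ) * (‖k y‖ₑ ^ (1/2 : ℝ) * ‖f (x - y)‖ₑ) =
              ‖k y‖ₑ * ‖f (x - y)‖ₑ := by
            intro y
            rw [← mul_assoc, ← ENNReal.rpow_add_of_nonneg _ _ (by norm_num) (by norm_num)]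
            norm_num
          have e2 : ∀ y, (‖k y‖ₑ ^ (1/2 : ℝ)) ^ (2 : ℝ) = ‖k y‖ₑ := by
            intro y; rw [← ENNReal.rpow_mul]; norm_num
          have e3 : ∀ y, (‖k y‖ₑ ^ (1/2 : ℝ) * ‖f (x - y)‖ₑ) ^ (2 : ℝ) =
              ‖k y‖ₑ * ‖f (x - y)‖ₑ ^ 2 := by
            intro y
            rw [ENNReal.mul_rpow_of_nonneg _ _ (by norm_num), e2]; norm_num
          simp only [Pi.mul_apply, e1, e2, e3] at hCS
          calc ‖h x‖ₑ ^ 2 ≤ ((∫⁻ y, ‖k y‖ₑ) ^ (1/2 : ℝ) *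
                (∫⁻ y, ‖k y‖ₑ * ‖f (x - y)‖ₑ ^ 2) ^ (1/2 : ℝ)) ^ 2 := by
                gcongr; exact (hh x).trans hCS
            _ = _ := by
                rw [mul_pow, ← ENNReal.rpow_natCast, ← ENNReal.rpow_natCast, ← ENNReal.rpow_mul,
                  ← ENNReal.rpow_mul]
                norm_num
      _ ≤ (∫⁻ y, ‖k y‖ₑ) * ∫⁻ x, ∫⁻ y, ‖k y‖ₑ * ‖f (x - y)‖ₑ ^ 2 := by
          rw [lintegral_const_mul'' _ hmeas.lintegral_prod_right']
      _ = (∫⁻ y, ‖k y‖ₑ) * ∫⁻ y, ∫⁻ x, ‖k y‖ₑ * ‖f (x - y)‖ₑ ^ 2 := by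
          rw [lintegral_lintegral_swap hmeas]
      _ = (∫⁻ y, ‖k y‖ₑ) * ∫⁻ y, ‖k y‖ₑ * ∫⁻ x, ‖f x‖ₑ ^ 2 := by
          congr 1
          refine lintegral_congr fun y => ?_
          rw [lintegral_const_mul' _ _ enorm_ne_top]
          congr 1
          exact lintegral_sub_right_eq_self (fun x => ‖f x‖ₑ ^ 2) y
      _ = _ := by
          rw [lintegral_mul_const'' _ hk.enorm, ← mul_assoc, sq]
  exact (ENNReal.pow_le_pow_left_iff two_ne_zero).1 hsq

/-- The low-pass filter `S_r f = χ_r * f` at frequency scale `r`. -/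
def lowPass (r : ℝ) (f : E → V) (x : E) : V := ∫ y, lpKernel r y • f (x - y)

lemma lowPass_eq (r : ℝ) (f : E → V) (x : E) :
    lowPass r f x = ∫ y, lpKernel r (x - y) • f y := by
  rw [lowPass, ← integral_sub_left_eq_self _ volume x]
  simp

lemma integrable_kernel_smul {k : E → ℝ} (hk : Integrable k) {f : E → V}
    (hf : AEStronglyMeasurable f volume) {M : ℝ} (hM : ∀ x, ‖f x‖ ≤ M) (x : E) :
    Integrable fun y => k y • f (x - y) :=
  hk.smul_bdd M (aestronglyMeasurable_comp_sub_left hf x)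
    (Filter.Eventually.of_forall fun _ => hM _)

lemma integrable_lpKernel_smul {r : ℝ} (hr : 0 < r) {f : E → V}
    (hf : AEStronglyMeasurable f volume) {M : ℝ} (hM : ∀ x, ‖f x‖ ≤ M) (x : E) :
    Integrable fun y => lpKernel r y • f (x - y) :=
  integrable_kernel_smul (integrable_lpKernel hr) hf hM x

lemma norm_lowPass_le {r : ℝ} (hr : 0 < r) {f : E → V} {M : ℝ} (hM : ∀ x, ‖f x‖ ≤ M) (x : E) :
    ‖lowPass r f x‖ ≤ kernelMass E 0 * M := by
  rw [← integral_norm_lpKernel (E := E) hr, ← integral_mul_const]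
  refine norm_integral_le_of_norm_le ((integrable_lpKernel hr).norm.mul_const M)
    (Filter.Eventually.of_forall fun y => ?_)
  rw [norm_smul]
  gcongr
  exact hM _

lemma lowPass_add {r : ℝ} (hr : 0 < r) {f g : E → V} (hf : AEStronglyMeasurable f volume)
    {M N : ℝ} (hM : ∀ x, ‖f x‖ ≤ M) (hg : AEStronglyMeasurable g volume)
    (hN : ∀ x, ‖g x‖ ≤ N) (x : E) :
    lowPass r (fun y => f y + g y) x = lowPass r f x + lowPass r g x := by
  simp only [lowPass, smul_add]
  exact integral_add (integrable_lpKernel_smul hr hf hM x) (integrable_lpKernel_smul hr hg hN x)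

lemma lowPass_sub {r : ℝ} (hr : 0 < r) {f g : E → V} (hf : AEStronglyMeasurable f volume)
    {M N : ℝ} (hM : ∀ x, ‖f x‖ ≤ M) (hg : AEStronglyMeasurable g volume)
    (hN : ∀ x, ‖g x‖ ≤ N) (x : E) :
    lowPass r (fun y => f y - g y) x = lowPass r f x - lowPass r g x := by
  simp only [lowPass, smul_sub]
  exact integral_sub (integrable_lpKernel_smul hr hf hM x) (integrable_lpKernel_smul hr hg hN x)

lemma lowPass_sum {r : ℝ} (hr : 0 < r) {ι : Type*} (s : Finset ι) {f : ι → E → V}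
    (hf : ∀ i, AEStronglyMeasurable (f i) volume) {M : ι → ℝ} (hM : ∀ i x, ‖f i x‖ ≤ M i) (x : E) :
    lowPass r (fun y => ∑ i ∈ s, f i y) x = ∑ i ∈ s, lowPass r (f i) x := by
  simp only [lowPass, Finset.smul_sum]
  exact integral_finsetSum _ fun i _ => integrable_lpKernel_smul hr (hf i) (hM i) x

lemma lowPass_const [CompleteSpace V] {r : ℝ} (hr : 0 < r) (c : V) (x : E) :
    lowPass r (fun _ => c) x = c := by
  simp only [lowPass]
  rw [integral_smul_const, integral_lpKernel hr, one_smul]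

lemma lowPass_clm [CompleteSpace V] [CompleteSpace W] {r : ℝ} (hr : 0 < r) (L : V →L[ℝ] W)
    {f : E → V} (hf : AEStronglyMeasurable f volume) {M : ℝ} (hM : ∀ x, ‖f x‖ ≤ M) (x : E) :
    lowPass r (fun y => L (f y)) x = L (lowPass r f x) := by
  rw [lowPass, lowPass, ← L.integral_comp_comm (integrable_lpKernel_smul hr hf hM x)]
  simp

lemma lintegral_enorm_lpKernel {r : ℝ} (hr : 0 < r) :
    ∫⁻ y : E, ‖lpKernel r y‖ₑ = ENNReal.ofReal (kernelMass E 0) := by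
  rw [← ofReal_integral_norm_eq_lintegral_enorm (integrable_lpKernel hr),
    integral_norm_lpKernel hr]

lemma eLpNorm_lowPass_le {r : ℝ} (hr : 0 < r) {f : E → V} (hf : AEStronglyMeasurable f volume) :
    eLpNorm (lowPass r f) 2 volume ≤ ENNReal.ofReal (kernelMass E 0) * eLpNorm f 2 volume := by
  rw [← lintegral_enorm_lpKernel hr]
  refine eLpNorm_two_le_of_kernel (integrable_lpKernel hr).aestronglyMeasurable hf fun x => ?_
  refine (enorm_integral_le_lintegral_enorm _).trans_eq ?_
  simp [enorm_smul]

lemma aestronglyMeasurable_lowPass {r : ℝ} {f : E → V} (hf : AEStronglyMeasurable f volume) :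
    AEStronglyMeasurable (lowPass r f) volume := by
  have h : AEStronglyMeasurable (fun p : E × E => lpKernel r p.2 • f (p.1 - p.2))
      ((volume : Measure E).prod volume) :=
    ((continuous_lpKernel r).comp continuous_snd).aestronglyMeasurable.smul
      (hf.comp_quasiMeasurePreserving (quasiMeasurePreserving_sub volume volume))
  exact h.integral_prod_right'

lemma memLp_lowPass {r : ℝ} (hr : 0 < r) {f : E → V} (hf : MemLp f 2 volume) :
    MemLp (lowPass r f) 2 volume :=
  ⟨aestronglyMeasurable_lowPass hf.1, (eLpNorm_lowPass_le hr hf.1).trans_lt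
    (ENNReal.mul_lt_top ENNReal.ofReal_lt_top hf.2)⟩

lemma lipschitzWith_lowPass {r : ℝ} (hr : 0 < r) {f : E → V} {L : ℝ≥0} (hL : LipschitzWith L f)
    {M : ℝ} (hM : ∀ x, ‖f x‖ ≤ M) :
    LipschitzWith (Real.toNNReal (kernelMass E 0) * L) (lowPass r f) := by
  refine LipschitzWith.of_dist_le_mul fun x x' => ?_
  have hf := hL.continuous.aestronglyMeasurable (μ := (volume : Measure E))
  rw [dist_eq_norm, lowPass, lowPass, ← integral_sub (integrable_lpKernel_smul hr hf hM x)
    (integrable_lpKernel_smul hr hf hM x')]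
  rw [NNReal.coe_mul, Real.coe_toNNReal _ (kernelMass_nonneg 0), mul_assoc,
    ← integral_norm_lpKernel (E := E) hr, ← integral_mul_const]
  refine norm_integral_le_of_norm_le ((integrable_lpKernel hr).norm.mul_const _)
    (Filter.Eventually.of_forall fun y => ?_)
  rw [← smul_sub, norm_smul]
  gcongr
  have := hL.dist_le_mul (x - y) (x' - y)
  rwa [dist_sub_right, dist_eq_norm] at this

/-! ### Convolution of Schwartz kernels with bounded functions -/

/-- All derivatives of a Schwartz function are dominated, uniformly on unit balls, by an
integrable function. -/
lemma SchwartzMap.exists_integrable_bound (K : 𝓢(E, W)) (i : ℕ) : ∃ b : E → ℝ, Integrable b ∧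
    ∀ x h : E, ‖h‖ ≤ 1 → ‖iteratedFDeriv ℝ i K (x + h)‖ ≤ b x := by
  set N := Module.finrank ℝ E + 1 with hN
  obtain ⟨C, hC0, hC⟩ : ∃ C : ℝ, 0 ≤ C ∧
      ∀ x, (1 + ‖x‖) ^ N * ‖iteratedFDeriv ℝ i K x‖ ≤ C :=
    ⟨_, le_trans (by positivity) (SchwartzMap.one_add_le_sup_seminorm_apply (𝕜 := ℝ) (m := (N, i))
      le_rfl le_rfl K 0), fun x => SchwartzMap.one_add_le_sup_seminorm_apply (𝕜 := ℝ)
      (m := (N, i)) le_rfl le_rfl K x⟩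
  refine ⟨fun x => C * 2 ^ N * (1 + ‖x‖) ^ (-(N : ℝ)), ?_, fun x h hh => ?_⟩
  · refine (integrable_one_add_norm ?_).const_mul _
    rw [hN]; push_cast; linarith
  · beta_reduce
    rw [Real.rpow_neg (by positivity), Real.rpow_natCast, ← div_eq_mul_inv,
      le_div_iff₀ (by positivity)]
    have h1 : 1 + ‖x‖ ≤ 2 * (1 + ‖x + h‖) := by
      have : ‖x‖ ≤ ‖x + h‖ + ‖h‖ := by
        simpa using norm_sub_le (x + h) h
      nlinarith [norm_nonneg (x + h)]
    calc ‖iteratedFDeriv ℝ i K (x + h)‖ * (1 + ‖x‖) ^ N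
        ≤ ‖iteratedFDeriv ℝ i K (x + h)‖ * (2 * (1 + ‖x + h‖)) ^ N := by gcongr
      _ = 2 ^ N * ((1 + ‖x + h‖) ^ N * ‖iteratedFDeriv ℝ i K (x + h)‖) := by rw [mul_pow]; ring
      _ ≤ 2 ^ N * C := by gcongr; exact hC _
      _ = C * 2 ^ N := mul_comm _ _

/-- The convolution `∫ B(K(x - y), f(y)) dy`. -/
def kernelConv (B : W →L[ℝ] V →L[ℝ] Z) (K : 𝓢(E, W)) (f : E → V) (x : E) : Z :=
  ∫ y, B (K (x - y)) (f y)

lemma integrable_kernelConv (B : W →L[ℝ] V →L[ℝ] Z) (K : 𝓢(E, W)) {f : E → V}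
    (hf : AEStronglyMeasurable f volume) {M : ℝ} (hM : ∀ x, ‖f x‖ ≤ M) (x : E) :
    Integrable fun y => B (K (x - y)) (f y) := by
  have h0 : Integrable fun y => K (x - y) := K.integrable.comp_sub_left x
  refine (h0.norm.const_mul (‖B‖ * M)).mono'
    (B.aestronglyMeasurable_comp₂ h0.aestronglyMeasurable hf)
    (Filter.Eventually.of_forall fun y => ?_)
  calc ‖B (K (x - y)) (f y)‖ ≤ ‖B‖ * ‖K (x - y)‖ * ‖f y‖ := B.le_opNorm₂ _ _
    _ ≤ ‖B‖ * ‖K (x - y)‖ * M := by gcongr; exact hM y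
    _ = _ := by ring

/-- `precompL` does not increase the constant of a bilinear bound, so that the constant is kept along
repeated differentiation. -/
lemma norm_precompL_apply_le (B : W →L[ℝ] V →L[ℝ] Z) {C : ℝ} (hC : 0 ≤ C)
    (hB : ∀ w v, ‖B w v‖ ≤ C * ‖w‖ * ‖v‖) (w : E →L[ℝ] W) (v : V) :
    ‖B.precompL E w v‖ ≤ C * ‖w‖ * ‖v‖ := by
  refine ContinuousLinearMap.opNorm_le_bound _ (by positivity) fun e => ?_
  rw [ContinuousLinearMap.precompL_apply]
  calc _ ≤ C * ‖w e‖ * ‖v‖ := hB _ _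
    _ ≤ C * (‖w‖ * ‖e‖) * ‖v‖ := by gcongr; exact w.le_opNorm e
    _ = _ := by ring

/-- The derivative of a convolution falls on the kernel. It is again a convolution, for the bilinear
map `B.precompL E`. -/
lemma hasFDerivAt_kernelConv [CompleteSpace Z] (B : W →L[ℝ] V →L[ℝ] Z) (K : 𝓢(E, W)) {f : E → V}
    (hf : AEStronglyMeasurable f volume) {M : ℝ} (hM : ∀ x, ‖f x‖ ≤ M) (x : E) :
    HasFDerivAt (kernelConv B K f)
      (kernelConv (B.precompL E) (SchwartzMap.fderivCLM ℝ E W K) f x) x := by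
  obtain ⟨b, hb, hbK⟩ := K.exists_integrable_bound 1
  obtain ⟨C, hC0, hC⟩ : ∃ C : ℝ, 0 ≤ C ∧ ∀ w v, ‖B w v‖ ≤ C * ‖w‖ * ‖v‖ :=
    ⟨‖B‖, by positivity, B.le_opNorm₂⟩
  refine hasFDerivAt_integral_of_dominated_of_fderiv_le (s := Metric.closedBall x 1)
    (F' := fun x y => B.precompL E (SchwartzMap.fderivCLM ℝ E W K (x - y)) (f y))
    (bound := fun y => C * b (x - y) * M)
    (Metric.closedBall_mem_nhds x one_pos)
    (Filter.Eventually.of_forall fun x' => (integrable_kernelConv B K hf hM x').1)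
    (integrable_kernelConv B K hf hM x)
    (integrable_kernelConv (B.precompL E) _ hf hM x).1
    (Filter.Eventually.of_forall fun y x' hx' => ?_)
    (((hb.comp_sub_left x).const_mul _).mul_const _)
    (Filter.Eventually.of_forall fun y x' hx' => ?_)
  · have h1 : ‖SchwartzMap.fderivCLM ℝ E W K (x' - y)‖ ≤ b (x - y) := by
      have := hbK (x - y) (x' - x) (by rwa [← dist_eq_norm])
      rwa [show x - y + (x' - x) = x' - y by abel, norm_iteratedFDeriv_one] at this
    have hb0 : 0 ≤ b (x - y) := (norm_nonneg _).trans h1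
    refine (norm_precompL_apply_le B hC0 hC _ _).trans ?_
    have := hM y
    gcongr
  · have h1 : HasFDerivAt K (fderiv ℝ K (x' - y)) (x' - y) :=
      (K.differentiableAt).hasFDerivAt
    have h2 : HasFDerivAt (fun z => K (z - y)) (fderiv ℝ K (x' - y)) x' := by
      have := h1.comp x' ((hasFDerivAt_id x').sub_const y)
      rwa [ContinuousLinearMap.comp_id] at this
    have h3 := ((B.flip (f y)).hasFDerivAt (x := K (x' - y))).comp x' h2
    convert! h3 using 1

/-- Convolutions with Schwartz kernels are smooth, and their derivatives are bounded by those of the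
kernel. The spaces and the bilinear map vary along the induction on the order `N`. -/
lemma contDiff_kernelConv (N : ℕ) : ∀ {W Z : Type} [NormedAddCommGroup W]
    [NormedSpace ℝ W] [NormedAddCommGroup Z] [NormedSpace ℝ Z] [CompleteSpace Z]
    (B : W →L[ℝ] V →L[ℝ] Z) {C : ℝ} (_ : 0 ≤ C) (_ : ∀ w v, ‖B w v‖ ≤ C * ‖w‖ * ‖v‖)
    (K : 𝓢(E, W)) {f : E → V} (_ : AEStronglyMeasurable f volume) {M : ℝ} (_ : ∀ x, ‖f x‖ ≤ M),
    ContDiff ℝ N (kernelConv B K f) ∧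
    ∀ x, ‖iteratedFDeriv ℝ N (kernelConv B K f) x‖ ≤
      C * ∫ y, ‖iteratedFDeriv ℝ N K (x - y)‖ * ‖f y‖ := by
  induction N with
  | zero =>
    intro W Z _ _ _ _ _ B C hC hB K f hf M hM
    refine ⟨contDiff_zero.2 (continuous_iff_continuousAt.2 fun x =>
      (hasFDerivAt_kernelConv B K hf hM x).continuousAt), fun x => ?_⟩
    simp only [norm_iteratedFDeriv_zero]
    rw [← integral_const_mul]
    have h0 : Integrable fun y => K (x - y) := K.integrable.comp_sub_left x
    refine norm_integral_le_of_norm_le ?_ (Filter.Eventually.of_forall fun y => ?_)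
    · exact (h0.norm.mul_bdd (c := M) hf.norm
        (Filter.Eventually.of_forall fun y => by simpa using hM y)).const_mul _
    · rw [← mul_assoc]; exact hB _ _
  | succ N ih =>
    intro W Z _ _ _ _ _ B C hC hB K f hf M hM
    have hfd : fderiv ℝ (kernelConv B K f) =
        kernelConv (B.precompL E) (SchwartzMap.fderivCLM ℝ E W K) f :=
      funext fun x => (hasFDerivAt_kernelConv B K hf hM x).fderiv
    obtain ⟨h1, h2⟩ := ih (B.precompL E) hC (norm_precompL_apply_le B hC hB) (SchwartzMap.fderivCLM ℝ E W K) hf hM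
    refine ⟨?_, fun x => ?_⟩
    · push_cast
      rw [contDiff_succ_iff_fderiv]
      refine ⟨fun x => (hasFDerivAt_kernelConv B K hf hM x).differentiableAt, by simp, ?_⟩
      rw [hfd]; exact h1
    · rw [← norm_iteratedFDeriv_fderiv, hfd]
      refine (h2 x).trans ?_
      have e : ∀ y, ‖iteratedFDeriv ℝ N (SchwartzMap.fderivCLM ℝ E W K) y‖ =
          ‖iteratedFDeriv ℝ (N + 1) K y‖ := by
        intro y
        rw [← norm_iteratedFDeriv_fderiv]; rfl
      simp only [e]
      exact le_rfl

/-! ### Derivatives of low-pass filtered functions -/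

lemma exists_kernelConv_lowPass {r : ℝ} (hr : 0 < r) : ∃ K : 𝓢(E, ℝ), ⇑K = lpKernel r ∧
    ∀ f : E → V, lowPass r f = kernelConv (ContinuousLinearMap.lsmul ℝ ℝ) K f := by
  obtain ⟨K, hK⟩ := exists_schwartz_lpKernel (E := E) hr
  refine ⟨K, hK, fun f => ?_⟩
  ext x
  rw [lowPass_eq, kernelConv, hK]
  rfl

lemma contDiff_lowPass [CompleteSpace V] {r : ℝ} (hr : 0 < r) {f : E → V}
    (hf : AEStronglyMeasurable f volume) {M : ℝ} (hM : ∀ x, ‖f x‖ ≤ M) :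
    ContDiff ℝ ∞ (lowPass r f) := by
  obtain ⟨K, hK, h⟩ := exists_kernelConv_lowPass (E := E) (V := V) hr
  rw [h, contDiff_infty]
  exact fun N => (contDiff_kernelConv N _ zero_le_one (fun w v => by simp [norm_smul]) K hf hM).1

lemma norm_iteratedFDeriv_lowPass_le [CompleteSpace V] {r : ℝ} (hr : 0 < r) {f : E → V}
    (hf : AEStronglyMeasurable f volume) {M : ℝ} (hM : ∀ x, ‖f x‖ ≤ M) (i : ℕ) (x : E) :
    ‖iteratedFDeriv ℝ i (lowPass r f) x‖ ≤
      ∫ y, ‖iteratedFDeriv ℝ i (lpKernel r) y‖ * ‖f (x - y)‖ := by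
  obtain ⟨K, hK, h⟩ := exists_kernelConv_lowPass (E := E) (V := V) hr
  rw [h]
  refine ((contDiff_kernelConv i _ zero_le_one (fun w v => by simp [norm_smul]) K hf hM).2 x).trans
    ?_
  rw [hK, one_mul, ← integral_sub_left_eq_self _ volume x]
  simp

lemma integrable_norm_iteratedFDeriv_lpKernel {r : ℝ} (hr : 0 < r) (i : ℕ) :
    Integrable fun y : E => ‖iteratedFDeriv ℝ i (lpKernel r) y‖ := by
  obtain ⟨K, hK⟩ := exists_schwartz_lpKernel (E := E) hr
  rw [← hK]
  simpa using K.integrable_pow_mul_iteratedFDeriv volume 0 i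

lemma norm_iteratedFDeriv_lowPass_le_of_bound [CompleteSpace V] {r : ℝ} (hr : 0 < r) {f : E → V}
    (hf : AEStronglyMeasurable f volume) {M : ℝ} (hM : ∀ x, ‖f x‖ ≤ M) (i : ℕ) (x : E) :
    ‖iteratedFDeriv ℝ i (lowPass r f) x‖ ≤ r ^ i * kernelMass E i * M := by
  refine (norm_iteratedFDeriv_lowPass_le hr hf hM i x).trans ?_
  rw [← integral_norm_iteratedFDeriv_lpKernel hr, ← integral_mul_const]
  have hi := integrable_norm_iteratedFDeriv_lpKernel (E := E) hr i
  refine integral_mono_of_nonneg (Filter.Eventually.of_forall fun y => by positivity)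
    (hi.mul_const M) (Filter.Eventually.of_forall fun y => ?_)
  have := hM (x - y)
  beta_reduce
  gcongr

/-- Derivatives of a low-pass filtered function are bounded in `L²` by powers of the scale. -/
lemma eLpNorm_iteratedFDeriv_lowPass_le [CompleteSpace V] {r : ℝ} (hr : 0 < r) {f : E → V}
    (hf : AEStronglyMeasurable f volume) {M : ℝ} (hM : ∀ x, ‖f x‖ ≤ M) (i : ℕ) :
    eLpNorm (iteratedFDeriv ℝ i (lowPass r f)) 2 volume ≤
      ENNReal.ofReal (r ^ i * kernelMass E i) * eLpNorm f 2 volume := by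
  have hi := integrable_norm_iteratedFDeriv_lpKernel (E := E) hr i
  have h0 : ∫⁻ y : E, ‖(‖iteratedFDeriv ℝ i (lpKernel r) y‖ : ℝ)‖ₑ =
      ENNReal.ofReal (r ^ i * kernelMass E i) := by
    rw [← ofReal_integral_norm_eq_lintegral_enorm hi, ← integral_norm_iteratedFDeriv_lpKernel hr]
    simp
  rw [← h0]
  refine eLpNorm_two_le_of_kernel hi.1 hf fun x => ?_
  have h1 := norm_iteratedFDeriv_lowPass_le hr hf hM i x
  have h2 : Integrable fun y => ‖iteratedFDeriv ℝ i (lpKernel r) y‖ * ‖f (x - y)‖ := by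
    have := hi.mul_bdd (c := M) (aestronglyMeasurable_comp_sub_left hf x).norm
      (Filter.Eventually.of_forall fun y => by simpa using hM (x - y))
    exact this
  calc ‖iteratedFDeriv ℝ i (lowPass r f) x‖ₑ = ENNReal.ofReal ‖iteratedFDeriv ℝ i (lowPass r f) x‖ :=
        (ofReal_norm _).symm
    _ ≤ ENNReal.ofReal (∫ y, ‖iteratedFDeriv ℝ i (lpKernel r) y‖ * ‖f (x - y)‖) :=
        ENNReal.ofReal_le_ofReal h1
    _ = _ := by
        rw [ofReal_integral_eq_lintegral_ofReal h2
          (Filter.Eventually.of_forall fun y => by positivity)]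
        refine lintegral_congr fun y => ?_
        rw [ENNReal.ofReal_mul (norm_nonneg _), ofReal_norm, ofReal_norm,
          enorm_norm]

/-- Low-pass filtering commutes with differentiation of Lipschitz functions. -/
lemma fderiv_lowPass_apply [FiniteDimensional ℝ V] {r : ℝ} (hr : 0 < r) {f : E → V} {L : ℝ≥0}
    (hL : LipschitzWith L f) {M : ℝ} (hM : ∀ x, ‖f x‖ ≤ M) (x e : E) :
    fderiv ℝ (lowPass r f) x e = lowPass r (fun y => fderiv ℝ f y e) x := by
  have : CompleteSpace V := FiniteDimensional.complete ℝ V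
  have hf := hL.continuous.aestronglyMeasurable (μ := (volume : Measure E))
  have hd : DifferentiableAt ℝ (lowPass r f) x :=
    ((contDiff_lowPass hr hf hM).differentiable (by simp)).differentiableAt
  have h1 : Filter.Tendsto (fun t : ℝ => t⁻¹ • (lowPass r f (x + t • e) - lowPass r f x))
      (nhdsWithin 0 {0}ᶜ) (nhds (fderiv ℝ (lowPass r f) x e)) := by
    have := (hd.hasFDerivAt.hasLineDerivAt e)
    exact this.tendsto_slope_zero
  have h2 : Filter.Tendsto (fun t : ℝ => t⁻¹ • (lowPass r f (x + t • e) - lowPass r f x))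
      (nhdsWithin 0 {0}ᶜ) (nhds (lowPass r (fun y => fderiv ℝ f y e) x)) := by
    have e1 : ∀ t : ℝ, t⁻¹ • (lowPass r f (x + t • e) - lowPass r f x) =
        ∫ y, lpKernel r y • (t⁻¹ • (f (x - y + t • e) - f (x - y))) := by
      intro t
      rw [lowPass, lowPass, ← integral_sub (integrable_lpKernel_smul hr hf hM _)
        (integrable_lpKernel_smul hr hf hM _), ← integral_smul]
      congr 1; ext y
      rw [← smul_sub, smul_comm, show x + t • e - y = x - y + t • e by abel]
    simp_rw [e1]
    have hae : ∀ᵐ y : E, DifferentiableAt ℝ f (x - y) :=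
      (quasiMeasurePreserving_sub_left_of_right_invariant volume x).ae hL.ae_differentiableAt
    refine tendsto_integral_filter_of_dominated_convergence
      (fun y => ‖lpKernel r y‖ * (L * ‖e‖)) (Filter.Eventually.of_forall fun t => ?_) ?_
      ((integrable_lpKernel hr).norm.mul_const _) ?_
    · refine ((continuous_lpKernel r).smul (continuous_const.smul
        ((hL.continuous.comp (by fun_prop)).sub
        (hL.continuous.comp (by fun_prop))))).aestronglyMeasurable
    · filter_upwards [self_mem_nhdsWithin] with t ht
      refine Filter.Eventually.of_forall fun y => ?_
      rw [norm_smul, norm_smul]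
      refine mul_le_mul_of_nonneg_left ?_ (norm_nonneg _)
      have := hL.dist_le_mul (x - y + t • e) (x - y)
      rw [dist_eq_norm, dist_eq_norm, add_sub_cancel_left, norm_smul] at this
      have ht' : 0 < ‖t‖ := norm_pos_iff.2 ht
      rw [norm_inv, inv_mul_le_iff₀ ht']
      linarith
    · filter_upwards [hae] with y hy
      exact (hy.hasFDerivAt.hasLineDerivAt e).tendsto_slope_zero.const_smul _
  exact tendsto_nhds_unique h1 h2

end LowPass

/-! ### Functions reproduced by the low-pass filter -/

section Reproducing

variable {E : Type} [NormedAddCommGroup E] [InnerProductSpace ℝ E] [FiniteDimensional ℝ E]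
  [MeasurableSpace E] [BorelSpace E]
  {V : Type} [NormedAddCommGroup V] [NormedSpace ℝ V]

/-- If every `H(·, p)` is reproduced by `χ_r`, so is `∫ H(·, p) g(p) dν(p)`. -/
lemma lowPass_integral_eq_self [CompleteSpace V] {r : ℝ} (hr : 0 < r) {Ω : Type*}
    [MeasurableSpace Ω] {ν : Measure Ω} [SFinite ν] {H : E → Ω → ℝ} {g : Ω → V}
    (hH : AEStronglyMeasurable (Function.uncurry fun y p => H y p • g p)
      ((volume : Measure E).prod ν))
    (hint : ∀ y, Integrable (fun p => H y p • g p) ν) {C : ℝ}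
    (hC : ∀ y, ∫ p, ‖H y p • g p‖ ∂ν ≤ C) (x : E)
    (hrep : ∀ p, ∫ y, lpKernel r (x - y) * H y p = H x p) :
    lowPass r (fun y => ∫ p, H y p • g p ∂ν) x = ∫ p, H x p • g p ∂ν := by
  rw [lowPass_eq]
  simp_rw [← integral_smul]
  have hk : Integrable fun y => lpKernel r (x - y) := (integrable_lpKernel hr).comp_sub_left x
  rw [integral_integral_swap]
  · refine integral_congr_ae (Filter.Eventually.of_forall fun p => ?_)
    beta_reduce
    simp_rw [smul_smul]
    rw [integral_smul_const, hrep]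
  · have hm : AEStronglyMeasurable (Function.uncurry fun y p => lpKernel r (x - y) • H y p • g p)
        ((volume : Measure E).prod ν) :=
      (hk.1.comp_fst).smul hH
    rw [integrable_prod_iff hm]
    refine ⟨Filter.Eventually.of_forall fun y => (hint y).smul (lpKernel r (x - y)), ?_⟩
    refine (hk.norm.mul_const C).mono' hm.norm.integral_prod_right'
      (Filter.Eventually.of_forall fun y => ?_)
    simp only [Function.uncurry, norm_smul (lpKernel r (x - y))]
    rw [integral_const_mul, norm_mul, norm_norm, Real.norm_of_nonneg
      (integral_nonneg fun p => norm_nonneg _)]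
    gcongr
    exact hC y

lemma aestronglyMeasurable_kernel_smul (r : ℝ) {f : E → V} (hf : AEStronglyMeasurable f volume) :
    AEStronglyMeasurable (Function.uncurry fun y z : E => lpKernel r (y - z) • f z)
      ((volume : Measure E).prod volume) :=
  ((continuous_lpKernel r).comp (continuous_fst.sub continuous_snd)).aestronglyMeasurable.smul
    hf.comp_snd

lemma integrable_lpKernel_sub_smul {r : ℝ} (hr : 0 < r) {f : E → V}
    (hf : AEStronglyMeasurable f volume) {M : ℝ} (hM : ∀ x, ‖f x‖ ≤ M) (x : E) :
    Integrable fun y => lpKernel r (x - y) • f y :=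
  ((integrable_lpKernel hr).comp_sub_left x).smul_bdd M hf (Filter.Eventually.of_forall hM)

lemma integral_norm_lpKernel_sub_smul_le {r : ℝ} (hr : 0 < r) {f : E → V} {M : ℝ}
    (hM : ∀ x, ‖f x‖ ≤ M) (x : E) :
    ∫ y, ‖lpKernel r (x - y) • f y‖ ≤ kernelMass E 0 * M := by
  rw [← integral_norm_lpKernel (E := E) hr,
    ← integral_sub_left_eq_self (fun y => ‖lpKernel r y‖) volume x, ← integral_mul_const]
  refine integral_mono_of_nonneg (Filter.Eventually.of_forall fun y => norm_nonneg _)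
    (((integrable_lpKernel hr).norm.comp_sub_left x).mul_const M)
    (Filter.Eventually.of_forall fun y => ?_)
  have := hM y
  beta_reduce
  rw [norm_smul]
  gcongr

lemma lowPass_lowPass [CompleteSpace V] {r r₁ : ℝ} (h₁ : 0 < r₁) (h : 2 * r₁ ≤ r) {f : E → V}
    (hf : AEStronglyMeasurable f volume) {M : ℝ} (hM : ∀ x, ‖f x‖ ≤ M) (x : E) :
    lowPass r (lowPass r₁ f) x = lowPass r₁ f x := by
  have hr : 0 < r := by linarith
  have e : lowPass r₁ f = fun y => ∫ z, lpKernel r₁ (y - z) • f z := funext fun y => lowPass_eq _ _ _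
  rw [e]
  exact lowPass_integral_eq_self hr (aestronglyMeasurable_kernel_smul r₁ hf)
    (integrable_lpKernel_sub_smul h₁ hf hM) (integral_norm_lpKernel_sub_smul_le h₁ hM) x
    fun z => lpKernel_reproduce h₁ h x z

/-- The product of two low-pass filtered functions is reproduced at a slightly larger scale. -/
lemma lowPass_mul_eq_self [CompleteSpace V] {r r₁ r₂ : ℝ} (h₁ : 0 < r₁) (h₂ : 0 < r₂)
    (h : 2 * r₁ + 2 * r₂ ≤ r) {a : E → ℝ} (ha : AEStronglyMeasurable a volume) {A : ℝ}
    (hA : ∀ x, ‖a x‖ ≤ A) {f : E → V}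
    (hf : AEStronglyMeasurable f volume) {M : ℝ} (hM : ∀ x, ‖f x‖ ≤ M) (x : E) :
    lowPass r (fun y => lowPass r₁ a y • lowPass r₂ f y) x = lowPass r₁ a x • lowPass r₂ f x := by
  have hr : 0 < r := by linarith
  have e : ∀ y, lowPass r₁ a y • lowPass r₂ f y =
      ∫ p : E × E, (lpKernel r₁ (y - p.1) * lpKernel r₂ (y - p.2)) • (a p.1 • f p.2) := by
    intro y
    rw [lowPass_eq, lowPass_eq, ← integral_prod_smul]
    congr 1; ext p
    rw [smul_smul, smul_smul, smul_eq_mul]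
    congr 1; ring
  have hi : ∀ y, Integrable (fun p : E × E =>
      (lpKernel r₁ (y - p.1) * lpKernel r₂ (y - p.2)) • (a p.1 • f p.2)) := by
    intro y
    refine ((integrable_lpKernel_sub_smul h₁ ha hA y).smul_prod
      (integrable_lpKernel_sub_smul h₂ hf hM y)).congr (Filter.Eventually.of_forall fun p => ?_)
    beta_reduce
    rw [smul_smul, smul_smul, smul_eq_mul]
    congr 1; ring
  simp only [e]
  refine lowPass_integral_eq_self hr (C := (kernelMass E 0 * A) * (kernelMass E 0 * M)) ?_ hi
    (fun y => ?_) x fun p => lpKernel_reproduce_mul h₁ h₂ h x p.1 p.2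
  · have hc : Continuous fun q : E × E × E => lpKernel r₁ (q.1 - q.2.1) * lpKernel r₂ (q.1 - q.2.2) :=
      ((continuous_lpKernel r₁).comp (by fun_prop)).mul ((continuous_lpKernel r₂).comp (by fun_prop))
    exact hc.aestronglyMeasurable.smul ((ha.comp_fst.smul hf.comp_snd).comp_snd)
  · have e2 : ∀ p : E × E, ‖(lpKernel r₁ (y - p.1) * lpKernel r₂ (y - p.2)) • (a p.1 • f p.2)‖ =
        ‖lpKernel r₁ (y - p.1) • a p.1‖ * ‖lpKernel r₂ (y - p.2) • f p.2‖ := by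
      intro p; simp only [norm_smul, norm_mul]; ring
    simp_rw [e2]
    rw [show (volume : Measure (E × E)) = (volume : Measure E).prod volume from rfl,
      integral_prod_mul (fun z => ‖lpKernel r₁ (y - z) • a z‖)
      (fun w => ‖lpKernel r₂ (y - w) • f w‖)]
    gcongr
    · exact (norm_nonneg _).trans (norm_lowPass_le h₁ hA y)
    · exact integral_norm_lpKernel_sub_smul_le h₁ hA y
    · exact integral_norm_lpKernel_sub_smul_le h₂ hM y

/-- The low-pass filter is symmetric. -/
lemma integral_smul_lowPass [CompleteSpace V] {r : ℝ} (hr : 0 < r) {k : E → ℝ} (hk : Integrable k)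
    {f : E → V} (hf : AEStronglyMeasurable f volume) {M : ℝ} (hM : ∀ x, ‖f x‖ ≤ M) :
    ∫ y, k y • lowPass r f y = ∫ y, lowPass r k y • f y := by
  simp_rw [lowPass_eq, ← integral_smul, ← integral_smul_const]
  rw [integral_integral_swap]
  · congr 1; ext z; congr 1; ext y
    rw [smul_smul, lpKernel_sub_comm, smul_eq_mul, mul_comm]
  · have hm : AEStronglyMeasurable (Function.uncurry fun y z : E => k y • lpKernel r (y - z) • f z)
        ((volume : Measure E).prod volume) :=
      (hk.1.comp_fst).smul (aestronglyMeasurable_kernel_smul r hf)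
    rw [integrable_prod_iff hm]
    refine ⟨Filter.Eventually.of_forall fun y => (integrable_lpKernel_sub_smul hr hf hM y).smul (k y),
      ?_⟩
    refine (hk.norm.mul_const (kernelMass E 0 * M)).mono' hm.norm.integral_prod_right'
      (Filter.Eventually.of_forall fun y => ?_)
    simp only [Function.uncurry, norm_smul (k y)]
    rw [integral_const_mul, norm_mul, norm_norm, Real.norm_of_nonneg
      (integral_nonneg fun p => norm_nonneg _)]
    gcongr
    exact integral_norm_lpKernel_sub_smul_le hr hM y

lemma lowPass_lowPass_of_le [CompleteSpace V] {r r₁ : ℝ} (h₁ : 0 < r₁) (h : 2 * r₁ ≤ r) {f : E → V}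
    (hf : AEStronglyMeasurable f volume) {M : ℝ} (hM : ∀ x, ‖f x‖ ≤ M) (x : E) :
    lowPass r₁ (lowPass r f) x = lowPass r₁ f x := by
  have hr : 0 < r := by linarith
  rw [lowPass_eq, lowPass_eq,
    integral_smul_lowPass hr ((integrable_lpKernel h₁).comp_sub_left x) hf hM]
  congr 1; ext y
  congr 1
  rw [lowPass_eq]
  simp_rw [lpKernel_sub_comm r₁ x, smul_eq_mul]
  exact lpKernel_reproduce h₁ h y x

/-- The low frequencies of a product with a low-frequency factor do not depend on the high frequencies
of the other factor. -/
lemma lowPass_mul_lowPass [CompleteSpace V] {r r₁ r₂ : ℝ} (h₁ : 0 < r₁) (h₂ : 0 < r₂)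
    (h : 2 * r₁ + 2 * r₂ ≤ r) {a : E → ℝ} (ha : AEStronglyMeasurable a volume) {A : ℝ}
    (hA : ∀ x, ‖a x‖ ≤ A) {f : E → V}
    (hf : AEStronglyMeasurable f volume) {M : ℝ} (hM : ∀ x, ‖f x‖ ≤ M) (x : E) :
    lowPass r₂ (fun y => lowPass r₁ a y • lowPass r f y) x =
      lowPass r₂ (fun y => lowPass r₁ a y • f y) x := by
  have hr : 0 < r := by linarith
  set k : E → ℝ := fun y => lpKernel r₂ (x - y) * lowPass r₁ a y with hk
  have hki : Integrable k := ((integrable_lpKernel h₂).comp_sub_left x).mul_bdd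
    (c := kernelMass E 0 * A) (aestronglyMeasurable_lowPass ha)
    (Filter.Eventually.of_forall (norm_lowPass_le h₁ hA))
  have hkr : ∀ y, lowPass r k y = k y := by
    intro y
    have e : k = fun y => ∫ z, (lpKernel r₂ (y - x) * lpKernel r₁ (y - z)) • a z := by
      ext y
      rw [hk]
      beta_reduce
      rw [lowPass_eq, ← integral_const_mul]
      congr 1; ext z
      rw [lpKernel_sub_comm, smul_eq_mul, smul_eq_mul, mul_assoc]
    have hb : ∀ y : E, ‖lpKernel r₂ y‖ ≤ ∫ ξ : E, ‖cutoff r₂ ξ‖ := by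
      intro y
      have := norm_integral_le_integral_norm (μ := volume) fun ξ : E =>
        Complex.exp (↑(2 * Real.pi * inner ℝ ξ y) * Complex.I) * (cutoff r₂ ξ : ℂ)
      rw [← ofReal_lpKernel h₂, Complex.norm_real] at this
      simpa only [norm_mul, Complex.norm_exp_ofReal_mul_I, one_mul, Complex.norm_real] using this
    rw [e]
    refine lowPass_integral_eq_self hr (C := (∫ ξ : E, ‖cutoff r₂ ξ‖) * (kernelMass E 0 * A)) ?_
      (fun y => ?_) (fun y => ?_) y fun z => ?_
    · have hc : Continuous fun q : E × E => lpKernel r₂ (q.1 - x) * lpKernel r₁ (q.1 - q.2) :=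
        ((continuous_lpKernel r₂).comp (by fun_prop)).mul
          ((continuous_lpKernel r₁).comp (by fun_prop))
      exact hc.aestronglyMeasurable.smul ha.comp_snd
    · simp_rw [mul_smul]
      exact (integrable_lpKernel_sub_smul h₁ ha hA y).smul (lpKernel r₂ (y - x))
    · simp_rw [mul_smul]
      simp_rw [norm_smul (lpKernel r₂ (y - x))]
      rw [integral_const_mul]
      gcongr
      · exact hb _
      · exact integral_norm_lpKernel_sub_smul_le h₁ hA y
    · exact lpKernel_reproduce_mul h₂ h₁ (by linarith) y x z
  have h1 := integral_smul_lowPass hr hki hf hM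
  simp only [hkr] at h1
  rw [lowPass_eq, lowPass_eq]
  simp only [smul_smul]
  exact h1

/-- The high-pass filter `R_r f = f - S_r f`. -/
def highPass (r : ℝ) (f : E → V) (x : E) : V := f x - lowPass r f x

lemma memLp_highPass {r : ℝ} (hr : 0 < r) {f : E → V} (hf : MemLp f 2 volume) :
    MemLp (highPass r f) 2 volume := hf.sub (memLp_lowPass hr hf)

lemma norm_highPass_le {r : ℝ} (hr : 0 < r) {f : E → V} {M : ℝ} (hM : ∀ x, ‖f x‖ ≤ M) (x : E) :
    ‖highPass r f x‖ ≤ (1 + kernelMass E 0) * M := by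
  have := norm_sub_le (f x) (lowPass r f x)
  have := hM x
  have := norm_lowPass_le hr hM x
  rw [highPass]; linarith

lemma aestronglyMeasurable_highPass {r : ℝ} {f : E → V} (hf : AEStronglyMeasurable f volume) :
    AEStronglyMeasurable (highPass r f) volume := hf.sub (aestronglyMeasurable_lowPass hf)

lemma eLpNorm_highPass_le {r : ℝ} (hr : 0 < r) {f : E → V} (hf : AEStronglyMeasurable f volume) :
    eLpNorm (highPass r f) 2 volume ≤ ENNReal.ofReal (1 + kernelMass E 0) * eLpNorm f 2 volume := by
  have h1 : highPass r f = f - lowPass r f := rfl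
  rw [h1, ENNReal.ofReal_add zero_le_one (kernelMass_nonneg 0), add_mul, ENNReal.ofReal_one, one_mul]
  exact (eLpNorm_sub_le hf (aestronglyMeasurable_lowPass hf) one_le_two).trans
    (add_le_add_right (eLpNorm_lowPass_le hr hf) _)

/-- Band-pass pieces are controlled by the high-pass filter at the lower scale. -/
lemma eLpNorm_lowPass_sub_lowPass_le [CompleteSpace V] {r r₁ : ℝ} (h₁ : 0 < r₁) (h : 2 * r₁ ≤ r)
    {f : E → V} (hf : AEStronglyMeasurable f volume) {M : ℝ} (hM : ∀ x, ‖f x‖ ≤ M) :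
    eLpNorm (fun x => lowPass r f x - lowPass r₁ f x) 2 volume ≤
      ENNReal.ofReal (kernelMass E 0) * eLpNorm (highPass r₁ f) 2 volume := by
  have hr : 0 < r := by linarith
  have e : (fun x => lowPass r f x - lowPass r₁ f x) = lowPass r (highPass r₁ f) := by
    ext x
    have := lowPass_sub hr hf hM (aestronglyMeasurable_lowPass (r := r₁) hf)
      (norm_lowPass_le h₁ hM) x
    rw [lowPass_lowPass h₁ h hf hM] at this
    exact this.symm
  rw [e]
  exact eLpNorm_lowPass_le hr (aestronglyMeasurable_highPass hf)

/-- The high-pass filter at a larger scale is controlled by the one at a smaller scale. -/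
lemma eLpNorm_highPass_le_highPass [CompleteSpace V] {r r₁ : ℝ} (h₁ : 0 < r₁) (h : 2 * r₁ ≤ r)
    {f : E → V} (hf : AEStronglyMeasurable f volume) {M : ℝ} (hM : ∀ x, ‖f x‖ ≤ M) :
    eLpNorm (highPass r f) 2 volume ≤
      ENNReal.ofReal (1 + kernelMass E 0) * eLpNorm (highPass r₁ f) 2 volume := by
  have hr : 0 < r := by linarith
  have e : highPass r f = highPass r (highPass r₁ f) := by
    ext x
    have := lowPass_sub hr hf hM (aestronglyMeasurable_lowPass (r := r₁) hf)
      (norm_lowPass_le h₁ hM) x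
    rw [lowPass_lowPass h₁ h hf hM] at this
    have e2 : lowPass r (highPass r₁ f) x = lowPass r f x - lowPass r₁ f x := this
    rw [highPass, highPass, e2, highPass]; abel
  rw [e]
  exact eLpNorm_highPass_le hr (aestronglyMeasurable_highPass hf)

end Reproducing

/-! ### Commutators of the low-pass filter with multiplications -/

section Commutator

variable {E : Type} [NormedAddCommGroup E] [InnerProductSpace ℝ E] [FiniteDimensional ℝ E]
  [MeasurableSpace E] [BorelSpace E]

/-- The commutator `[S_r, b] f = S_r (b f) - b S_r f` of the low-pass filter with a multiplication. -/
def lpCommutator (r : ℝ) (b f : E → ℝ) (x : E) : ℝ :=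
  lowPass r (fun y => b y * f y) x - b x * lowPass r f x

/-- If `b` has frequencies well below `r`, then `[S_r, b]` only sees frequencies comparable to
`r`. -/
lemma lpCommutator_lowPass_eq {r r₁ : ℝ} (h₁ : 0 < r₁) (h : 8 * r₁ ≤ r) {a : E → ℝ}
    (ha : AEStronglyMeasurable a volume) {A : ℝ} (hA : ∀ x, ‖a x‖ ≤ A) {f : E → ℝ}
    (hf : AEStronglyMeasurable f volume) {M : ℝ} (hM : ∀ x, ‖f x‖ ≤ M) (x : E) :
    lpCommutator r (lowPass r₁ a) f x =
      lpCommutator r (lowPass r₁ a) (fun y => lowPass (4 * r) f y - lowPass (r / 4) f y) x := by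
  have hr : 0 < r := by linarith
  have hb := aestronglyMeasurable_lowPass (r := r₁) ha
  have hbB := norm_lowPass_le h₁ hA
  have hm1 := aestronglyMeasurable_lowPass (r := 4 * r) hf
  have hm2 := aestronglyMeasurable_lowPass (r := r / 4) hf
  have hB1 := norm_lowPass_le (r := 4 * r) (by linarith) hM
  have hB2 := norm_lowPass_le (r := r / 4) (by linarith) hM
  have hprod : ∀ {g : E → ℝ} {N : ℝ}, (∀ x, ‖g x‖ ≤ N) → ∀ x, ‖lowPass r₁ a x * g x‖ ≤
      (kernelMass E 0 * A) * N := by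
    intro g N hN x
    rw [norm_mul]
    have := hbB x
    have := hN x
    gcongr
    exact (norm_nonneg _).trans (hbB x)
  have e1 := lowPass_mul_lowPass (r := 4 * r) h₁ hr (by linarith) ha hA hf hM x
  have e2 := lowPass_mul_eq_self (r := r) (r₂ := r / 4) h₁ (by linarith) (by linarith) ha hA hf hM x
  have e3 := lowPass_lowPass_of_le (r := 4 * r) hr (by linarith) hf hM x
  have e4 := lowPass_lowPass (r := r) (r₁ := r / 4) (by linarith) (by linarith) hf hM x
  simp only [smul_eq_mul] at e1 e2
  rw [lpCommutator, lpCommutator]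
  simp only [mul_sub (lowPass r₁ a _)]
  rw [lowPass_sub (f := fun y => lowPass r₁ a y * lowPass (4 * r) f y)
    (g := fun y => lowPass r₁ a y * lowPass (r / 4) f y) hr (hb.mul hm1) (hprod hB1) (hb.mul hm2)
    (hprod hB2), lowPass_sub hr hm1 hB1 hm2 hB2]
  rw [e1, e2, e3, e4]
  ring

/-- The commutator with a Lipschitz function has the kernel `χ_r(y) (b(x - y) - b(x))`, which gains a
factor `r⁻¹`. -/
lemma eLpNorm_lpCommutator_le {r : ℝ} (hr : 0 < r) {b : E → ℝ} {L : ℝ≥0} (hL : LipschitzWith L b)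
    {A : ℝ} (hA : ∀ x, ‖b x‖ ≤ A) {f : E → ℝ}
    (hf : AEStronglyMeasurable f volume) {M : ℝ} (hM : ∀ x, ‖f x‖ ≤ M) :
    eLpNorm (lpCommutator r b f) 2 volume ≤
      ENNReal.ofReal (L * (r⁻¹ * kernelMoment E)) * eLpNorm f 2 volume := by
  have hi := (integrable_lpKernel_mul_norm (E := E) hr).const_mul (L : ℝ)
  have h0 : ∫⁻ y : E, ‖(L : ℝ) * (‖lpKernel r y‖ * ‖y‖)‖ₑ =
      ENNReal.ofReal (L * (r⁻¹ * kernelMoment E)) := by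
    rw [← ofReal_integral_norm_eq_lintegral_enorm hi, ← integral_norm_lpKernel_mul_norm hr,
      ← integral_const_mul]
    congr 1
    refine integral_congr_ae (Filter.Eventually.of_forall fun y => ?_)
    exact Real.norm_of_nonneg (by positivity)
  rw [← h0]
  refine eLpNorm_two_le_of_kernel hi.1 hf fun x => ?_
  have hb := hL.continuous.aestronglyMeasurable (μ := (volume : Measure E))
  have hbf : ∀ x, ‖b x * f x‖ ≤ A * M := by
    intro x
    rw [norm_mul]
    have := hA x
    have := hM x
    gcongr
    exact (norm_nonneg _).trans (hA x)
  have e : lpCommutator r b f x = ∫ y, lpKernel r y * ((b (x - y) - b x) * f (x - y)) := by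
    rw [lpCommutator, lowPass, lowPass, ← integral_const_mul, ← integral_sub
      (integrable_lpKernel_smul (f := fun y => b y * f y) hr (hb.mul hf) hbf x)
      ((integrable_lpKernel_smul hr hf hM x).const_mul _)]
    congr 1; ext y
    simp only [smul_eq_mul]
    ring
  rw [e]
  refine (enorm_integral_le_lintegral_enorm _).trans (lintegral_mono fun y => ?_)
  rw [← enorm_mul, enorm_le_iff_norm_le, norm_mul, norm_mul, norm_mul, norm_mul, norm_mul, norm_norm,
    norm_norm, NNReal.norm_eq]
  have := hL.dist_le_mul (x - y) x
  rw [dist_eq_norm, dist_eq_norm, sub_sub_cancel_left, norm_neg] at this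
  calc ‖lpKernel r y‖ * (‖b (x - y) - b x‖ * ‖f (x - y)‖)
      ≤ ‖lpKernel r y‖ * ((L * ‖y‖) * ‖f (x - y)‖) := by gcongr
    _ = _ := by ring

/-- The constant in the commutator estimate. -/
def commutatorConst (E : Type) [NormedAddCommGroup E] [InnerProductSpace ℝ E]
    [FiniteDimensional ℝ E] [MeasurableSpace E] [BorelSpace E] : ℝ :=
  8 * kernelMass E 0 * kernelMoment E * kernelMass E 1 * kernelMass E 0

lemma commutatorConst_nonneg : 0 ≤ commutatorConst E := by
  have := kernelMass_nonneg (E := E) 0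
  have := kernelMass_nonneg (E := E) 1
  have := kernelMoment_nonneg (E := E)
  unfold commutatorConst
  positivity

/-- **Commutator estimate** for a Lipschitz coefficient and a derivative: no derivative is lost, and
only frequencies of `g` above `r / 4` contribute. -/
lemma eLpNorm_lpCommutator_fderiv_le {r r₁ : ℝ} (h₁ : 0 < r₁) (h : 8 * r₁ ≤ r) {a : E → ℝ}
    {L : ℝ≥0} (hL : LipschitzWith L a) {A : ℝ} (hA : ∀ x, ‖a x‖ ≤ A) {g : E → ℝ} {L' : ℝ≥0}
    (hg : LipschitzWith L' g) {M : ℝ} (hM : ∀ x, ‖g x‖ ≤ M) {e : E} (he : ‖e‖ ≤ 1) :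
    eLpNorm (lpCommutator r (lowPass r₁ a) fun y => fderiv ℝ g y e) 2 volume ≤
      ENNReal.ofReal (commutatorConst E * L) * eLpNorm (highPass (r / 4) g) 2 volume := by
  have hr : 0 < r := by linarith
  have ha := hL.continuous.aestronglyMeasurable (μ := (volume : Measure E))
  have hgm := hg.continuous.aestronglyMeasurable (μ := (volume : Measure E))
  have hv : AEStronglyMeasurable (fun y => fderiv ℝ g y e) volume :=
    (measurable_fderiv_apply_const ℝ g e).aestronglyMeasurable
  have hvM : ∀ y, ‖fderiv ℝ g y e‖ ≤ L' := by
    intro y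
    have h1 := (fderiv ℝ g y).le_opNorm e
    have h2 := norm_fderiv_le_of_lipschitz ℝ hg (x₀ := y)
    nlinarith [norm_nonneg (fderiv ℝ g y), norm_nonneg e]
  set p : E → ℝ := fun y => lowPass (4 * r) g y - lowPass (r / 4) g y with hp
  have hpm : AEStronglyMeasurable p volume :=
    (aestronglyMeasurable_lowPass hgm).sub (aestronglyMeasurable_lowPass hgm)
  have hpM : ∀ y, ‖p y‖ ≤ kernelMass E 0 * M + kernelMass E 0 * M := fun y =>
    (norm_sub_le _ _).trans (add_le_add (norm_lowPass_le (by linarith) hM y)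
      (norm_lowPass_le (by linarith) hM y))
  have hpself : lowPass (8 * r) p = p := by
    ext x
    rw [hp, lowPass_sub (by linarith) (aestronglyMeasurable_lowPass hgm)
      (norm_lowPass_le (by linarith) hM) (aestronglyMeasurable_lowPass hgm)
      (norm_lowPass_le (by linarith) hM), lowPass_lowPass (by linarith) (by linarith) hgm hM,
      lowPass_lowPass (by linarith) (by linarith) hgm hM]
  have hdp : ∀ y, lowPass (4 * r) (fun y => fderiv ℝ g y e) y -
      lowPass (r / 4) (fun y => fderiv ℝ g y e) y = fderiv ℝ p y e := by
    intro y
    rw [← fderiv_lowPass_apply (by linarith) hg hM, ← fderiv_lowPass_apply (by linarith) hg hM, hp,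
      fderiv_fun_sub, sub_apply]
    · exact ((contDiff_lowPass (by linarith) hgm hM).differentiable (by simp)).differentiableAt
    · exact ((contDiff_lowPass (by linarith) hgm hM).differentiable (by simp)).differentiableAt
  have hdpM : ∀ y, ‖fderiv ℝ p y e‖ ≤ kernelMass E 0 * L' + kernelMass E 0 * L' := fun y => by
    rw [← hdp]
    exact (norm_sub_le _ _).trans (add_le_add (norm_lowPass_le (by linarith) hvM y)
      (norm_lowPass_le (by linarith) hvM y))
  have h1 : lpCommutator r (lowPass r₁ a) (fun y => fderiv ℝ g y e) =
      lpCommutator r (lowPass r₁ a) fun y => fderiv ℝ p y e := by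
    ext x
    rw [lpCommutator_lowPass_eq h₁ h ha hA hv hvM]
    simp_rw [hdp]
  rw [h1]
  refine (eLpNorm_lpCommutator_le hr (lipschitzWith_lowPass h₁ hL hA) (norm_lowPass_le h₁ hA)
    (measurable_fderiv_apply_const ℝ p e).aestronglyMeasurable hdpM).trans ?_
  have h2 : eLpNorm (fun y => fderiv ℝ p y e) 2 volume ≤
      ENNReal.ofReal (8 * r * kernelMass E 1) * eLpNorm p 2 volume := by
    have := eLpNorm_iteratedFDeriv_lowPass_le (r := 8 * r) (by linarith) hpm hpM 1
    rw [hpself, pow_one] at this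
    refine le_trans (eLpNorm_mono fun y => ?_) this
    rw [norm_iteratedFDeriv_one]
    exact ((fderiv ℝ p y).le_opNorm e).trans (mul_le_of_le_one_right (norm_nonneg _) he)
  have h3 := eLpNorm_lowPass_sub_lowPass_le (r := 4 * r) (r₁ := r / 4) (by linarith) (by linarith)
    hgm hM
  have m0 := kernelMass_nonneg (E := E) 0
  have m1 := kernelMass_nonneg (E := E) 1
  have m2 := kernelMoment_nonneg (E := E)
  calc _ ≤ ENNReal.ofReal (↑(Real.toNNReal (kernelMass E 0) * L) * (r⁻¹ * kernelMoment E)) *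
        (ENNReal.ofReal (8 * r * kernelMass E 1) * (ENNReal.ofReal (kernelMass E 0) *
          eLpNorm (highPass (r / 4) g) 2 volume)) := by
        gcongr
        exact h2.trans (by gcongr)
    _ = _ := by
        rw [← mul_assoc, ← mul_assoc, ← ENNReal.ofReal_mul (by positivity),
          ← ENNReal.ofReal_mul (by positivity), NNReal.coe_mul, Real.coe_toNNReal _ m0]
        congr 2
        unfold commutatorConst
        field_simp

end Commutator

/-! ### The Fourier transform on `L²` -/

section FourierL2

open scoped FourierTransform SchwartzMap RealInnerProductSpace

variable {E : Type} [NormedAddCommGroup E] [InnerProductSpace ℝ E] [FiniteDimensional ℝ E]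
  [MeasurableSpace E] [BorelSpace E]
  {F : Type} [NormedAddCommGroup F] [InnerProductSpace ℂ F] [CompleteSpace F]

/-- The `L²` Fourier transform of a square integrable function. -/
def l2Fourier {f : E → F} (hf : MemLp f 2 volume) : E → F :=
  ⇑(Lp.fourierTransformₗᵢ E F (hf.toLp f))

lemma eLpNorm_l2Fourier {f : E → F} (hf : MemLp f 2 volume) :
    eLpNorm (l2Fourier hf) 2 volume = eLpNorm f 2 volume := by
  have h := (Lp.fourierTransformₗᵢ E F).norm_map (hf.toLp f)
  rw [Lp.norm_def, Lp.norm_toLp, ENNReal.toReal_eq_toReal_iff' (Lp.eLpNorm_ne_top _)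
    hf.eLpNorm_ne_top] at h
  exact h

lemma aestronglyMeasurable_l2Fourier {f : E → F} (hf : MemLp f 2 volume) :
    AEStronglyMeasurable (l2Fourier hf) volume := Lp.aestronglyMeasurable _

/-- The `L²` Fourier transform is an isometry that extends the transform of Schwartz functions. -/
lemma eLpNorm_l2Fourier_sub_fourier {f : E → F} (hf : MemLp f 2 volume) (g : 𝓢(E, F)) :
    eLpNorm (fun ξ => l2Fourier hf ξ - 𝓕 g ξ) 2 volume = eLpNorm (fun x => f x - g x) 2 volume := by
  have h1 := (Lp.fourierTransformₗᵢ E F).isometry.edist_eq (hf.toLp f) (g.toLp 2)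
  have h2 : Lp.fourierTransformₗᵢ E F (g.toLp 2) = (𝓕 g : 𝓢(E, F)).toLp 2 := SchwartzMap.toLp_fourier_eq g
  rw [h2, Lp.edist_def, Lp.edist_def] at h1
  have h3 : eLpNorm (fun ξ => l2Fourier hf ξ - 𝓕 g ξ) 2 volume =
      eLpNorm (⇑(Lp.fourierTransformₗᵢ E F (hf.toLp f)) -
        ⇑(SchwartzMap.toLp (𝓕 g) 2 volume)) 2 volume := by
    refine eLpNorm_congr_ae ?_
    filter_upwards [(𝓕 g).coeFn_toLp 2 volume] with ξ hξ
    rw [Pi.sub_apply, hξ]; rfl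
  have h4 : eLpNorm (fun x => f x - g x) 2 volume =
      eLpNorm (⇑(hf.toLp f) - ⇑(g.toLp 2 volume)) 2 volume := by
    refine eLpNorm_congr_ae ?_
    filter_upwards [g.coeFn_toLp 2 volume, hf.coeFn_toLp] with ξ hξ hξ'
    rw [Pi.sub_apply, hξ, hξ']
  rw [h3, h4]
  exact h1

lemma exists_schwartz_eLpNorm_sub_lt {f : E → F} (hf : MemLp f 2 volume) {ε : ℝ≥0∞} (hε : 0 < ε) :
    ∃ g : 𝓢(E, F), eLpNorm (fun x => f x - g x) 2 volume < ε := by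
  have hd := SchwartzMap.denseRange_toLpCLM (E := E) (F := F) (p := 2) (μ := volume)
    ENNReal.ofNat_ne_top
  obtain ⟨y, ⟨g, rfl⟩, hy⟩ := EMetric.mem_closure_iff.1 (hd (hf.toLp f)) ε hε
  refine ⟨g, ?_⟩
  rw [Lp.edist_def] at hy
  refine lt_of_eq_of_lt (eLpNorm_congr_ae ?_) hy
  filter_upwards [g.coeFn_toLp 2 volume, hf.coeFn_toLp] with ξ hξ hξ'
  rw [Pi.sub_apply, hξ']
  congr 1
  exact hξ.symm

/-- An `L²`-bounded operator that acts as a bounded Fourier multiplier on Schwartz functions acts as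
that multiplier on all of `L²`. -/
lemma l2Fourier_multiplier {f : E → F} (hf : MemLp f 2 volume) {T : (E → F) → E → F}
    (hTf : MemLp (T f) 2 volume) {m : E → ℂ} (hm : AEStronglyMeasurable m volume) {C : ℝ≥0}
    (hmC : ∀ ξ, ‖m ξ‖ ≤ C)
    (hT : ∀ g : 𝓢(E, F), ∃ Tg : 𝓢(E, F), (∀ ξ, 𝓕 Tg ξ = m ξ • 𝓕 g ξ) ∧
      eLpNorm (fun x => T f x - Tg x) 2 volume ≤ C * eLpNorm (fun x => f x - g x) 2 volume) :
    l2Fourier hTf =ᵐ[volume] fun ξ => m ξ • l2Fourier hf ξ := by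
  have hmf := hm.smul (aestronglyMeasurable_l2Fourier hf)
  have h0 : eLpNorm (fun ξ => l2Fourier hTf ξ - m ξ • l2Fourier hf ξ) 2 volume = 0 := by
    by_contra hne
    set η := eLpNorm (fun ξ => l2Fourier hTf ξ - m ξ • l2Fourier hf ξ) 2 volume with hη
    have key : ∀ ε : ℝ≥0∞, 0 < ε → η ≤ (2 * C : ℝ≥0) * ε := by
      intro ε hε
      obtain ⟨g, hg⟩ := exists_schwartz_eLpNorm_sub_lt hf hε
      obtain ⟨Tg, hTg, hTg2⟩ := hT g
      have e : (fun ξ => l2Fourier hTf ξ - m ξ • l2Fourier hf ξ) =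
          (fun ξ => l2Fourier hTf ξ - 𝓕 Tg ξ) - fun ξ => m ξ • (l2Fourier hf ξ - 𝓕 g ξ) := by
        ext ξ; rw [Pi.sub_apply, hTg, smul_sub]; abel
      have h1 : eLpNorm (fun ξ => m ξ • (l2Fourier hf ξ - 𝓕 g ξ)) 2 volume ≤
          C * eLpNorm (fun ξ => l2Fourier hf ξ - 𝓕 g ξ) 2 volume := by
        have := eLpNorm_le_nnreal_smul_eLpNorm_of_ae_le_mul
          (f := fun ξ => m ξ • (l2Fourier hf ξ - 𝓕 g ξ))
          (g := fun ξ => l2Fourier hf ξ - 𝓕 g ξ) (c := C) (μ := volume)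
          (Filter.Eventually.of_forall fun ξ => ?_) 2
        · simpa [ENNReal.smul_def] using this
        · rw [← NNReal.coe_le_coe]
          push_cast
          rw [norm_smul]
          gcongr
          exact hmC ξ
      have hgm : AEStronglyMeasurable (fun ξ => 𝓕 g ξ) (volume : Measure E) :=
        (𝓕 g).continuous.aestronglyMeasurable
      have hTgm : AEStronglyMeasurable (fun ξ => 𝓕 Tg ξ) (volume : Measure E) :=
        (𝓕 Tg).continuous.aestronglyMeasurable
      calc η ≤ eLpNorm (fun ξ => l2Fourier hTf ξ - 𝓕 Tg ξ) 2 volume +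
            eLpNorm (fun ξ => m ξ • (l2Fourier hf ξ - 𝓕 g ξ)) 2 volume := by
            rw [hη, e]
            exact eLpNorm_sub_le ((aestronglyMeasurable_l2Fourier hTf).sub hTgm)
              (hm.smul ((aestronglyMeasurable_l2Fourier hf).sub hgm)) one_le_two
        _ ≤ C * ε + C * ε := by
            rw [eLpNorm_l2Fourier_sub_fourier]
            rw [eLpNorm_l2Fourier_sub_fourier] at h1
            exact add_le_add (hTg2.trans (by gcongr)) (h1.trans (by gcongr))
        _ = _ := by push_cast; ring
    have hlim : η ≤ 0 := by
      have ht : Filter.Tendsto (fun ε : ℝ≥0∞ => (2 * C : ℝ≥0) * ε) (nhdsWithin 0 (Ioi 0))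
          (nhds 0) := by
        have := (ENNReal.Tendsto.const_mul (a := ((2 * C : ℝ≥0) : ℝ≥0∞)) (b := 0)
          (f := nhds 0) (m := id) Filter.tendsto_id (Or.inr ENNReal.coe_ne_top))
        rw [mul_zero] at this
        exact this.mono_left nhdsWithin_le_nhds
      exact ge_of_tendsto ht (by filter_upwards [self_mem_nhdsWithin] with ε hε using key ε hε)
    exact hne (le_antisymm hlim bot_le)
  replace h0 := (eLpNorm_eq_zero_iff ((aestronglyMeasurable_l2Fourier hTf).sub hmf)
    two_ne_zero).1 h0
  filter_upwards [h0] with ξ hξ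
  exact sub_eq_zero.1 hξ

lemma l2Fourier_lowPass {r : ℝ} (hr : 0 < r) {f : E → F}
    (hf : MemLp f 2 volume) {M : ℝ} (hM : ∀ x, ‖f x‖ ≤ M) :
    l2Fourier (memLp_lowPass hr hf) =ᵐ[volume] fun ξ => (cutoff r ξ : ℂ) • l2Fourier hf ξ := by
  refine l2Fourier_multiplier hf (memLp_lowPass hr hf) (C := max 1 (Real.toNNReal (kernelMass E 0)))
    (Complex.continuous_ofReal.comp (continuous_cutoff r)).aestronglyMeasurable (fun ξ => ?_)
    fun g => ?_
  · rw [Complex.norm_real, Real.norm_of_nonneg (cutoff_nonneg r ξ)]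
    exact (cutoff_le_one r ξ).trans (by simp)
  · obtain ⟨K, hK⟩ := exists_schwartz_lpKernel (E := E) hr
    set Kc : 𝓢(E, ℂ) := SchwartzMap.postcompCLM Complex.ofRealCLM K with hKc
    have hKc' : ∀ x, Kc x = (lpKernel r x : ℂ) := by
      intro x; rw [hKc, SchwartzMap.postcompCLM_apply, hK]; rfl
    have hT : ∀ x, SchwartzMap.convolution (ContinuousLinearMap.lsmul ℂ ℂ) Kc g x =
        lowPass r g x := by
      intro x
      rw [SchwartzMap.convolution_apply, convolution, lowPass]
      congr 1; ext y
      rw [hKc', ContinuousLinearMap.lsmul_apply, ← Complex.coe_smul]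
    refine ⟨SchwartzMap.convolution (ContinuousLinearMap.lsmul ℂ ℂ) Kc g, fun ξ => ?_, ?_⟩
    · rw [SchwartzMap.fourier_convolution, SchwartzMap.pairing_apply_apply,
        ContinuousLinearMap.lsmul_apply]
      congr 1
      rw [SchwartzMap.fourier_coe, Real.fourier_eq', ← integral_lpKernel_character hr]
      simp only [hKc', smul_eq_mul]
    · have e : (fun x => lowPass r f x - SchwartzMap.convolution (ContinuousLinearMap.lsmul ℂ ℂ)
          Kc g x) = lowPass r (fun y => f y - g y) := by
        ext x
        rw [hT, lowPass_sub hr hf.1 hM g.continuous.aestronglyMeasurable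
          (fun x => SchwartzMap.norm_le_seminorm ℝ g x)]
      rw [e]
      refine (eLpNorm_lowPass_le hr (hf.1.sub g.continuous.aestronglyMeasurable)).trans ?_
      have hc : ENNReal.ofReal (kernelMass E 0) ≤
          ((max 1 (Real.toNNReal (kernelMass E 0)) : ℝ≥0) : ℝ≥0∞) := by
        simp [ENNReal.ofReal]
      exact mul_le_mul_left hc _

lemma l2Fourier_translate {f : E → F} (hf : MemLp f 2 volume) (h : E)
    (hfh : MemLp (fun x => f (x + h)) 2 volume) :
    l2Fourier hfh =ᵐ[volume] fun ξ => Complex.exp (↑(2 * Real.pi * ⟪h, ξ⟫) * Complex.I) •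
      l2Fourier hf ξ := by
  refine l2Fourier_multiplier (T := fun f x => f (x + h)) hf hfh (C := 1)
    (Continuous.aestronglyMeasurable (by fun_prop)) (fun ξ => ?_) fun g => ?_
  · rw [Complex.norm_exp_ofReal_mul_I]; simp
  · refine ⟨SchwartzMap.compSubConstCLM ℂ (-h) g, fun ξ => ?_, ?_⟩
    · rw [SchwartzMap.fourier_coe, SchwartzMap.fourier_coe, Real.fourier_eq', Real.fourier_eq',
        ← integral_smul, ← integral_add_right_eq_self _ (-h)]
      congr 1; ext v
      rw [SchwartzMap.compSubConstCLM_apply, smul_smul, ← Complex.exp_add]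
      simp only [sub_neg_eq_add, neg_add_cancel_right]
      congr 2
      rw [inner_add_left, inner_neg_left]
      push_cast; ring
    · simp only [SchwartzMap.compSubConstCLM_apply, sub_neg_eq_add, ENNReal.coe_one, one_mul]
      have := eLpNorm_comp_measurePreserving (p := 2)
        (hf.1.sub g.continuous.aestronglyMeasurable)
        (measurePreserving_add_right (volume : Measure E) h)
      exact this.le

end FourierL2

/-! ### The high-pass filter and derivatives -/

section HighFrequency

open scoped RealInnerProductSpace

variable {E : Type} [NormedAddCommGroup E] [InnerProductSpace ℝ E] [FiniteDimensional ℝ E]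
  [MeasurableSpace E] [BorelSpace E]
  {F : Type} [NormedAddCommGroup F] [InnerProductSpace ℂ F] [CompleteSpace F]

lemma l2Fourier_congr {f g : E → F} (hf : MemLp f 2 volume) (hg : MemLp g 2 volume)
    (h : f = g) : l2Fourier hf = l2Fourier hg := by
  subst h; rfl

lemma l2Fourier_sub {f g : E → F} (hf : MemLp f 2 volume) (hg : MemLp g 2 volume)
    (hfg : MemLp (fun x => f x - g x) 2 volume) :
    l2Fourier hfg =ᵐ[volume] fun ξ => l2Fourier hf ξ - l2Fourier hg ξ := by
  have h : hfg.toLp (fun x => f x - g x) = hf.toLp f - hg.toLp g := MemLp.toLp_sub hf hg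
  unfold l2Fourier
  rw [h, map_sub]
  exact Lp.coeFn_sub _ _

lemma lintegral_enorm_l2Fourier_sq {f : E → F} (hf : MemLp f 2 volume) :
    ∫⁻ ξ, ‖l2Fourier hf ξ‖ₑ ^ 2 = ∫⁻ x, ‖f x‖ₑ ^ 2 := by
  rw [← eLpNorm_two_sq, ← eLpNorm_two_sq, eLpNorm_l2Fourier]

lemma eLpNorm_highPass_sq {r : ℝ} (hr : 0 < r) {f : E → F} (hf : MemLp f 2 volume) {M : ℝ}
    (hM : ∀ x, ‖f x‖ ≤ M) :
    eLpNorm (highPass r f) 2 volume ^ 2 =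
      ∫⁻ ξ, ENNReal.ofReal ((1 - cutoff r ξ) ^ 2) * ‖l2Fourier hf ξ‖ₑ ^ 2 := by
  rw [eLpNorm_two_sq, ← lintegral_enorm_l2Fourier_sq (memLp_highPass hr hf)]
  refine lintegral_congr_ae ?_
  filter_upwards [l2Fourier_sub hf (memLp_lowPass hr hf) (memLp_highPass hr hf),
    l2Fourier_lowPass hr hf hM] with ξ h1 h2
  have e : l2Fourier (memLp_highPass hr hf) ξ = ((1 - cutoff r ξ : ℝ) : ℂ) • l2Fourier hf ξ := by
    refine (show l2Fourier (memLp_highPass hr hf) ξ = _ from h1).trans ?_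
    rw [h2]; push_cast; rw [sub_smul, one_smul]
  rw [e, enorm_smul, mul_pow]
  congr 1
  rw [← ofReal_norm, Complex.norm_real, ← ENNReal.ofReal_pow (norm_nonneg _), Real.norm_eq_abs,
    sq_abs]

/-- The finite difference `f(x + h) - f(x)`. -/
def fdiff {G : Type*} [AddCommGroup G] (h : E) (f : E → G) (x : E) : G := f (x + h) - f x

lemma memLp_translate {G : Type*} [NormedAddCommGroup G] {f : E → G} (hf : MemLp f 2 volume)
    (h : E) : MemLp (fun x => f (x + h)) 2 volume :=
  hf.comp_measurePreserving (measurePreserving_add_right volume h)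

lemma memLp_fdiff_iterate {G : Type*} [NormedAddCommGroup G] {f : E → G} (hf : MemLp f 2 volume)
    (h : E) (N : ℕ) : MemLp ((fdiff h)^[N] f) 2 volume := by
  induction N with
  | zero => simpa using hf
  | succ N ih =>
    rw [Function.iterate_succ_apply']
    exact (memLp_translate ih h).sub ih

lemma l2Fourier_fdiff_iterate {f : E → F} (hf : MemLp f 2 volume) (h : E) (N : ℕ) :
    l2Fourier (memLp_fdiff_iterate hf h N) =ᵐ[volume] fun ξ =>
      (Complex.exp (↑(2 * Real.pi * ⟪h, ξ⟫) * Complex.I) - 1) ^ N • l2Fourier hf ξ := by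
  induction N with
  | zero => exact Filter.Eventually.of_forall fun ξ => by beta_reduce; rw [pow_zero, one_smul]; rfl
  | succ N ih =>
    have ih' := memLp_fdiff_iterate hf h N
    have e : (fdiff h)^[N + 1] f = fun x => (fdiff h)^[N] f (x + h) - (fdiff h)^[N] f x := by
      rw [Function.iterate_succ_apply']; rfl
    have h1 := l2Fourier_sub (memLp_translate ih' h) ih' (e ▸ memLp_fdiff_iterate hf h (N + 1))
    have h2 := l2Fourier_translate ih' h (memLp_translate ih' h)
    rw [l2Fourier_congr (memLp_fdiff_iterate hf h (N + 1)) (e ▸ memLp_fdiff_iterate hf h (N + 1)) e]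
    filter_upwards [ih, h1, h2] with ξ a1 a2 a3
    rw [a2, a3, a1, smul_smul, ← sub_smul]
    congr 1
    ring

/-- Finite differences are bounded in `L²` by the derivative, by integration along segments. -/
lemma eLpNorm_fdiff_le {G : Type} [NormedAddCommGroup G] [NormedSpace ℝ G] [CompleteSpace G]
    {g : E → G} (hg : ContDiff ℝ 1 g) (h : E) :
    eLpNorm (fdiff h g) 2 volume ≤ ‖h‖ₑ * eLpNorm (fderiv ℝ g) 2 volume := by
  have hc : Continuous (fderiv ℝ g) := hg.continuous_fderiv (by simp)
  have hsq : eLpNorm (fdiff h g) 2 volume ^ 2 ≤ (‖h‖ₑ * eLpNorm (fderiv ℝ g) 2 volume) ^ 2 := by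
    rw [mul_pow, eLpNorm_two_sq, eLpNorm_two_sq]
    have hpt : ∀ x, ‖fdiff h g x‖ₑ ^ 2 ≤
        ‖h‖ₑ ^ 2 * ∫⁻ s in Ioc (0 : ℝ) 1, ‖fderiv ℝ g (x + s • h)‖ₑ ^ 2 := by
      intro x
      have hcs : Continuous fun s : ℝ => fderiv ℝ g (x + s • h) := hc.comp (by fun_prop)
      have h1 : fdiff h g x = ∫ s in (0 : ℝ)..1, fderiv ℝ g (x + s • h) h := by
        have hd : ∀ s ∈ uIcc (0 : ℝ) 1, HasDerivAt (fun s : ℝ => g (x + s • h))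
            (fderiv ℝ g (x + s • h) h) s := by
          intro s _
          have h2 : HasFDerivAt g (fderiv ℝ g (x + s • h)) (x + s • h) :=
            (hg.differentiable (by simp)).differentiableAt.hasFDerivAt
          have h3 : HasDerivAt (fun s : ℝ => x + s • h) h s := by
            simpa using ((hasDerivAt_id s).smul_const h).const_add x
          exact h2.comp_hasDerivAt s h3
        rw [intervalIntegral.integral_eq_sub_of_hasDerivAt hd
          ((hcs.clm_apply continuous_const).intervalIntegrable _ _)]
        simp [fdiff]
      have h2 : ‖fdiff h g x‖ₑ ≤ ∫⁻ s in Ioc (0 : ℝ) 1, ‖fderiv ℝ g (x + s • h)‖ₑ * ‖h‖ₑ := by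
        rw [h1, intervalIntegral.integral_of_le zero_le_one]
        refine (enorm_integral_le_lintegral_enorm _).trans (lintegral_mono fun s => ?_)
        exact ContinuousLinearMap.le_opENorm _ _
      have h3 := ENNReal.lintegral_mul_le_Lp_mul_Lq (volume.restrict (Ioc (0 : ℝ) 1))
            Real.HolderConjugate.two_two (f := fun s => ‖fderiv ℝ g (x + s • h)‖ₑ)
            (g := fun _ => 1) hcs.enorm.aemeasurable aemeasurable_const
      simp only [Pi.mul_apply, mul_one, ENNReal.one_rpow, lintegral_const, Measure.restrict_apply,
        MeasurableSet.univ, univ_inter, Real.volume_Ioc, sub_zero, ENNReal.ofReal_one] at h3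
      calc ‖fdiff h g x‖ₑ ^ 2 ≤ ((∫⁻ s in Ioc (0 : ℝ) 1, ‖fderiv ℝ g (x + s • h)‖ₑ ^ (2 : ℝ)) ^
            (1 / 2 : ℝ) * ‖h‖ₑ) ^ 2 := by
            gcongr
            refine h2.trans ?_
            rw [lintegral_mul_const' _ _ enorm_ne_top]
            gcongr
        _ = _ := by
            rw [mul_pow, ← ENNReal.rpow_natCast, ← ENNReal.rpow_mul, mul_comm]
            norm_num
    calc ∫⁻ x, ‖fdiff h g x‖ₑ ^ 2
        ≤ ∫⁻ x, ‖h‖ₑ ^ 2 * ∫⁻ s in Ioc (0 : ℝ) 1, ‖fderiv ℝ g (x + s • h)‖ₑ ^ 2 :=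
          lintegral_mono hpt
      _ = ‖h‖ₑ ^ 2 * ∫⁻ x, ∫⁻ s in Ioc (0 : ℝ) 1, ‖fderiv ℝ g (x + s • h)‖ₑ ^ 2 := by
          rw [lintegral_const_mul' _ _ (by simp)]
      _ = ‖h‖ₑ ^ 2 * ∫⁻ s in Ioc (0 : ℝ) 1, ∫⁻ x, ‖fderiv ℝ g (x + s • h)‖ₑ ^ 2 := by
          rw [lintegral_lintegral_swap]
          have : Continuous fun p : E × ℝ => ‖fderiv ℝ g (p.1 + p.2 • h)‖ₑ ^ 2 :=
            (ENNReal.continuous_pow 2).comp (hc.comp (by fun_prop)).enorm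
          exact this.measurable.aemeasurable
      _ = ‖h‖ₑ ^ 2 * ∫⁻ s in Ioc (0 : ℝ) 1, ∫⁻ x, ‖fderiv ℝ g x‖ₑ ^ 2 := by
          congr 1
          refine lintegral_congr fun s => ?_
          exact lintegral_add_right_eq_self (fun x => ‖fderiv ℝ g x‖ₑ ^ 2) (s • h)
      _ = _ := by simp
  exact (ENNReal.pow_le_pow_left_iff two_ne_zero).1 hsq

lemma contDiff_fdiff_iterate {G : Type*} [NormedAddCommGroup G] [NormedSpace ℝ G] {g : E → G}
    {k : ℕ∞} (hg : ContDiff ℝ k g) (h : E) (N : ℕ) : ContDiff ℝ k ((fdiff h)^[N] g) := by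
  induction N with
  | zero => simpa using hg
  | succ N ih =>
    rw [Function.iterate_succ_apply']
    exact (ih.comp (contDiff_id.add contDiff_const)).sub ih

lemma fderiv_fdiff_iterate {G : Type*} [NormedAddCommGroup G] [NormedSpace ℝ G] {g : E → G}
    (hg : ContDiff ℝ 1 g) (h : E) (N : ℕ) :
    fderiv ℝ ((fdiff h)^[N] g) = (fdiff h)^[N] (fderiv ℝ g) := by
  induction N with
  | zero => rfl
  | succ N ih =>
    have hd : Differentiable ℝ ((fdiff h)^[N] g) :=
      (contDiff_fdiff_iterate (k := 1) (by exact_mod_cast hg) h N).differentiable (by simp)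
    rw [Function.iterate_succ_apply', Function.iterate_succ_apply', ← ih]
    ext1 x
    change fderiv ℝ (fun x => (fdiff h)^[N] g (x + h) - (fdiff h)^[N] g x) x =
      fderiv ℝ ((fdiff h)^[N] g) (x + h) - fderiv ℝ ((fdiff h)^[N] g) x
    rw [fderiv_fun_sub (f := fun x => (fdiff h)^[N] g (x + h)) (hd.comp (differentiable_id.add_const h)).differentiableAt
      hd.differentiableAt, fderiv_comp_add_right]

/-- Iterated differences are bounded in `L²` by iterated derivatives. -/
lemma eLpNorm_fdiff_iterate_le (N : ℕ) : ∀ {G : Type} [NormedAddCommGroup G] [NormedSpace ℝ G]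
    [CompleteSpace G] {g : E → G} (_ : ContDiff ℝ N g) (h : E),
    eLpNorm ((fdiff h)^[N] g) 2 volume ≤ ‖h‖ₑ ^ N * eLpNorm (iteratedFDeriv ℝ N g) 2 volume := by
  induction N with
  | zero =>
    intro G _ _ _ g hg h
    simp only [Function.iterate_zero, id, pow_zero, one_mul]
    refine eLpNorm_mono fun x => ?_
    rw [norm_iteratedFDeriv_zero]
  | succ N ih =>
    intro G _ _ _ g hg h
    have hg1 : ContDiff ℝ 1 g := hg.of_le (by exact_mod_cast Nat.le_add_left 1 N)
    have hg' : ContDiff ℝ N (fderiv ℝ g) := hg.fderiv_right (by push_cast; exact le_rfl)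
    rw [Function.iterate_succ_apply']
    refine (eLpNorm_fdiff_le (contDiff_fdiff_iterate (k := 1) (by exact_mod_cast hg1) h N) h).trans ?_
    rw [fderiv_fdiff_iterate hg1, pow_succ', mul_assoc]
    gcongr
    refine (ih hg' h).trans ?_
    gcongr
    refine eLpNorm_mono fun x => ?_
    rw [norm_iteratedFDeriv_fderiv]

lemma tendsto_exp_sub_one_div (c : ℝ) :
    Filter.Tendsto (fun k : ℕ => ‖Complex.exp (↑(((k : ℝ) + 1)⁻¹ * c) * Complex.I) - 1‖ₑ *
      ENNReal.ofReal ((k : ℝ) + 1)) Filter.atTop (nhds (ENNReal.ofReal |c|)) := by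
  have h1 : HasDerivAt (fun t : ℝ => Complex.exp (↑(t * c) * Complex.I)) (c * Complex.I) 0 := by
    have h2 : HasDerivAt (fun t : ℝ => (↑(t * c) * Complex.I : ℂ)) (c * Complex.I) 0 := by
      have : HasDerivAt (fun t : ℝ => t * c) c 0 := by simpa using (hasDerivAt_id (0 : ℝ)).mul_const c
      exact (this.ofReal_comp).mul_const _
    simpa using h2.cexp
  have h3 := h1.tendsto_slope_zero
  have h4 : Filter.Tendsto (fun k : ℕ => ((k : ℝ) + 1)⁻¹) Filter.atTop (nhdsWithin 0 {0}ᶜ) := by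
    refine tendsto_nhdsWithin_iff.2 ⟨?_, Filter.Eventually.of_forall fun k => ?_⟩
    · simpa [one_div] using tendsto_one_div_add_atTop_nhds_zero_nat (𝕜 := ℝ)
    · simp only [mem_compl_iff, mem_singleton_iff]; positivity
  have h5 := (h3.comp h4).norm
  have h6 := ENNReal.tendsto_ofReal h5
  have e : ‖(c * Complex.I : ℂ)‖ = |c| := by simp
  rw [e] at h6
  refine h6.congr fun k => ?_
  simp only [Function.comp, zero_add, zero_mul, Complex.ofReal_zero, Complex.exp_zero, norm_smul]
  rw [ENNReal.ofReal_mul (norm_nonneg _), ofReal_norm, mul_comm, ← ofReal_norm,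
    inv_inv, ofReal_norm]
  congr 2
  rw [Real.norm_of_nonneg (by positivity)]

/-- The `L²` norm of the `N`-th derivative controls `⟪e, ξ⟫ᴺ ĝ`. The difference quotients of order `N`
are explicit multipliers, and their limit is taken by Fatou's lemma. -/
lemma lintegral_inner_pow_l2Fourier_le {g : E → F} (hg : MemLp g 2 volume) {N : ℕ}
    (hgN : ContDiff ℝ N g) {e : E} (he : ‖e‖ = 1) :
    ∫⁻ ξ, ENNReal.ofReal |2 * Real.pi * ⟪e, ξ⟫| ^ (2 * N) * ‖l2Fourier hg ξ‖ₑ ^ 2 ≤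
      eLpNorm (iteratedFDeriv ℝ N g) 2 volume ^ 2 := by
  set φ : ℕ → E → ℝ≥0∞ := fun k ξ =>
    (‖Complex.exp (↑(((k : ℝ) + 1)⁻¹ * (2 * Real.pi * ⟪e, ξ⟫)) * Complex.I) - 1‖ₑ *
      ENNReal.ofReal ((k : ℝ) + 1)) ^ (2 * N) * ‖l2Fourier hg ξ‖ₑ ^ 2 with hφ
  have hlim : ∀ ξ, Filter.liminf (fun k => φ k ξ) Filter.atTop =
      ENNReal.ofReal |2 * Real.pi * ⟪e, ξ⟫| ^ (2 * N) * ‖l2Fourier hg ξ‖ₑ ^ 2 := by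
    intro ξ
    refine Filter.Tendsto.liminf_eq ?_
    refine ENNReal.Tendsto.mul_const ?_ (Or.inr (by simp))
    exact ((ENNReal.continuous_pow (2 * N)).tendsto _).comp (tendsto_exp_sub_one_div _)
  simp_rw [← hlim]
  have hFm : AEMeasurable (fun ξ => ‖l2Fourier hg ξ‖ₑ) volume :=
    (aestronglyMeasurable_l2Fourier hg).enorm
  refine (lintegral_liminf_le' fun k => ?_).trans ?_
  · refine AEMeasurable.mul (Measurable.aemeasurable ?_) (hFm.pow_const 2)
    have : Continuous fun ξ : E =>
      Complex.exp (↑(((k : ℝ) + 1)⁻¹ * (2 * Real.pi * ⟪e, ξ⟫)) * Complex.I) - 1 := by fun_prop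
    exact (this.enorm.measurable.mul_const _).pow_const _
  · refine Filter.liminf_le_of_le (by isBoundedDefault) fun b hb => ?_
    obtain ⟨k, hk⟩ := hb.exists
    refine hk.trans ?_
    set t : ℝ := ((k : ℝ) + 1)⁻¹ with ht
    have ht0 : 0 < t := by positivity
    have h1 := eLpNorm_fdiff_iterate_le N hgN (t • e)
    rw [enorm_smul, ← ofReal_norm e, he, ENNReal.ofReal_one, mul_one] at h1
    have h2 : eLpNorm ((fdiff (t • e))^[N] g) 2 volume ^ 2 =
        ∫⁻ ξ, ‖Complex.exp (↑(t * (2 * Real.pi * ⟪e, ξ⟫)) * Complex.I) - 1‖ₑ ^ (2 * N) *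
          ‖l2Fourier hg ξ‖ₑ ^ 2 := by
      rw [eLpNorm_two_sq, ← lintegral_enorm_l2Fourier_sq (memLp_fdiff_iterate hg (t • e) N)]
      refine lintegral_congr_ae ?_
      filter_upwards [l2Fourier_fdiff_iterate hg (t • e) N] with ξ hξ
      rw [hξ, enorm_smul, mul_pow, enorm_pow, ← pow_mul, mul_comm N 2, real_inner_smul_left,
        mul_left_comm (2 * Real.pi) t]
    have h3 : ∀ ξ, φ k ξ = ENNReal.ofReal ((k : ℝ) + 1) ^ (2 * N) *
        (‖Complex.exp (↑(t * (2 * Real.pi * ⟪e, ξ⟫)) * Complex.I) - 1‖ₑ ^ (2 * N) *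
          ‖l2Fourier hg ξ‖ₑ ^ 2) := by
      intro ξ; rw [hφ]; beta_reduce; rw [mul_pow]; ring
    simp_rw [h3]
    rw [lintegral_const_mul' _ _ (by simp), ← h2]
    have e1 : ENNReal.ofReal ((k : ℝ) + 1) * ‖t‖ₑ = 1 := by
      rw [← ofReal_norm, Real.norm_of_nonneg ht0.le, ← ENNReal.ofReal_mul (by positivity), ht,
        mul_inv_cancel₀ (by positivity), ENNReal.ofReal_one]
    calc _ ≤ ENNReal.ofReal ((k : ℝ) + 1) ^ (2 * N) *
          (‖t‖ₑ ^ N * eLpNorm (iteratedFDeriv ℝ N g) 2 volume) ^ 2 := by gcongr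
      _ = (ENNReal.ofReal ((k : ℝ) + 1) * ‖t‖ₑ) ^ (2 * N) *
          eLpNorm (iteratedFDeriv ℝ N g) 2 volume ^ 2 := by
          rw [mul_pow, mul_pow, ← pow_mul, mul_comm N 2]; ring
      _ = _ := by rw [e1, one_pow, one_mul]

/-- Where `1 - cutoff r` does not vanish, some coordinate of `ξ` is at least `r / √n`. -/
lemma one_sub_cutoff_sq_le {r : ℝ} (hr : 0 < r) (N : ℕ) (ξ : E) :
    (1 - cutoff r ξ) ^ 2 ≤ (Module.finrank ℝ E : ℝ) ^ N * r⁻¹ ^ (2 * N) *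
      ∑ j, |2 * Real.pi * ⟪stdOrthonormalBasis ℝ E j, ξ⟫| ^ (2 * N) := by
  have hnn : ∀ j, 0 ≤ |2 * Real.pi * ⟪stdOrthonormalBasis ℝ E j, ξ⟫| ^ (2 * N) :=
    fun j => by positivity
  by_cases h : ‖ξ‖ ≤ r
  · rw [cutoff_eq_one hr h, sub_self, zero_pow two_ne_zero]
    have := Finset.sum_nonneg fun j (_ : j ∈ Finset.univ) => hnn j
    positivity
  push Not at h
  have h1 : (1 - cutoff r ξ) ^ 2 ≤ 1 := by
    have := cutoff_nonneg r ξ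
    have := cutoff_le_one r ξ
    nlinarith
  refine h1.trans ?_
  have hs := (stdOrthonormalBasis ℝ E).sum_sq_norm_inner_right ξ
  obtain ⟨j, hj⟩ : ∃ j, r ^ 2 ≤ Module.finrank ℝ E * ⟪stdOrthonormalBasis ℝ E j, ξ⟫ ^ 2 := by
    by_contra! hlt
    rcases Nat.eq_zero_or_pos (Module.finrank ℝ E) with h0 | h0
    · have : IsEmpty (Fin (Module.finrank ℝ E)) := by rw [h0]; infer_instance
      rw [Finset.univ_eq_empty, Finset.sum_empty] at hs
      nlinarith [norm_nonneg ξ]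
    · have hd : (0 : ℝ) < Module.finrank ℝ E := by exact_mod_cast h0
      have : Module.finrank ℝ E * ‖ξ‖ ^ 2 ≤ Module.finrank ℝ E * r ^ 2 := by
        rw [← hs, Finset.mul_sum]
        calc _ ≤ ∑ _j : Fin (Module.finrank ℝ E), r ^ 2 := by
              refine Finset.sum_le_sum fun j _ => ?_
              rw [Real.norm_eq_abs, sq_abs]
              exact (hlt j).le
          _ = _ := by simp
      have := le_of_mul_le_mul_left this hd
      nlinarith
  have h2 : 1 ≤ (Module.finrank ℝ E : ℝ) ^ N * r⁻¹ ^ (2 * N) *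
      |2 * Real.pi * ⟪stdOrthonormalBasis ℝ E j, ξ⟫| ^ (2 * N) := by
    have e : (Module.finrank ℝ E : ℝ) ^ N * r⁻¹ ^ (2 * N) *
      |2 * Real.pi * ⟪stdOrthonormalBasis ℝ E j, ξ⟫| ^ (2 * N) =
      ((2 * Real.pi) ^ 2 * (r⁻¹ ^ 2 * (Module.finrank ℝ E *
        ⟪stdOrthonormalBasis ℝ E j, ξ⟫ ^ 2))) ^ N := by
      rw [pow_mul, pow_mul, sq_abs, ← mul_pow, ← mul_pow]
      congr 1
      ring
    rw [e]
    apply one_le_pow₀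
    have h3 : 1 ≤ r⁻¹ ^ 2 * (Module.finrank ℝ E * ⟪stdOrthonormalBasis ℝ E j, ξ⟫ ^ 2) := by
      rw [inv_pow, le_inv_mul_iff₀ (by positivity), mul_one]; exact hj
    have h4 : 1 ≤ (2 * Real.pi) ^ 2 := by nlinarith [Real.pi_gt_three]
    nlinarith
  refine h2.trans ?_
  have := Finset.single_le_sum (fun j _ => hnn j) (Finset.mem_univ j)
  gcongr

/-- The high-frequency part of a smooth function is controlled by its derivatives. -/
lemma eLpNorm_highPass_le_iteratedFDeriv {r : ℝ} (hr : 0 < r) {g : E → F}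
    (hg : MemLp g 2 volume) {M : ℝ} (hM : ∀ x, ‖g x‖ ≤ M) {N : ℕ} (hgN : ContDiff ℝ N g) :
    eLpNorm (highPass r g) 2 volume ≤ ENNReal.ofReal ((Module.finrank ℝ E : ℝ) ^ (N + 1) *
      r⁻¹ ^ N) * eLpNorm (iteratedFDeriv ℝ N g) 2 volume := by
  set d : ℝ := (Module.finrank ℝ E : ℝ) with hd
  have hd0 : 0 ≤ d := by positivity
  have hsq : eLpNorm (highPass r g) 2 volume ^ 2 ≤ (ENNReal.ofReal (d ^ (N + 1) *
      r⁻¹ ^ N) * eLpNorm (iteratedFDeriv ℝ N g) 2 volume) ^ 2 := by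
    rw [eLpNorm_highPass_sq hr hg hM]
    calc _ ≤ ∫⁻ ξ, ENNReal.ofReal (d ^ N * r⁻¹ ^ (2 * N)) * ∑ j,
          (ENNReal.ofReal |2 * Real.pi * ⟪stdOrthonormalBasis ℝ E j, ξ⟫| ^ (2 * N) *
            ‖l2Fourier hg ξ‖ₑ ^ 2) := by
          refine lintegral_mono fun ξ => ?_
          rw [← Finset.sum_mul, ← mul_assoc]
          gcongr
          refine (ENNReal.ofReal_le_ofReal (one_sub_cutoff_sq_le hr N ξ)).trans ?_
          rw [ENNReal.ofReal_mul (by positivity),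
            ENNReal.ofReal_sum_of_nonneg (fun j _ => by positivity)]
          gcongr with j
          rw [ENNReal.ofReal_pow (abs_nonneg _)]
      _ = ENNReal.ofReal (d ^ N * r⁻¹ ^ (2 * N)) * ∑ j, ∫⁻ ξ,
          (ENNReal.ofReal |2 * Real.pi * ⟪stdOrthonormalBasis ℝ E j, ξ⟫| ^ (2 * N) *
            ‖l2Fourier hg ξ‖ₑ ^ 2) := by
          rw [lintegral_const_mul' _ _ ENNReal.ofReal_ne_top, lintegral_finsetSum']
          intro j _
          refine AEMeasurable.mul (Measurable.aemeasurable ?_)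
            ((aestronglyMeasurable_l2Fourier hg).enorm.pow_const 2)
          have : Continuous fun ξ : E => |2 * Real.pi * ⟪stdOrthonormalBasis ℝ E j, ξ⟫| := by
            fun_prop
          exact this.measurable.ennreal_ofReal.pow_const _
      _ ≤ ENNReal.ofReal (d ^ N * r⁻¹ ^ (2 * N)) * ∑ _j : Fin (Module.finrank ℝ E),
            eLpNorm (iteratedFDeriv ℝ N g) 2 volume ^ 2 := by
          gcongr with j
          exact lintegral_inner_pow_l2Fourier_le hg hgN ((stdOrthonormalBasis ℝ E).norm_eq_one j)
      _ = ENNReal.ofReal (d ^ (N + 1) * r⁻¹ ^ (2 * N)) *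
            eLpNorm (iteratedFDeriv ℝ N g) 2 volume ^ 2 := by
          rw [Finset.sum_const, Finset.card_univ, Fintype.card_fin, nsmul_eq_mul, ← mul_assoc]
          congr 1
          rw [← ENNReal.ofReal_natCast, ← hd, ← ENNReal.ofReal_mul (by positivity)]
          congr 1; ring
      _ ≤ _ := by
          rw [mul_pow, ← ENNReal.ofReal_pow (by positivity)]
          gcongr
          rw [mul_pow, ← pow_mul r⁻¹, mul_comm N 2]
          gcongr
          rcases Nat.eq_zero_or_pos (Module.finrank ℝ E) with h0 | h0
          · rw [hd, h0]; simp
          · have : 1 ≤ d := by rw [hd]; exact_mod_cast h0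
            exact le_self_pow₀ (one_le_pow₀ this) two_ne_zero
  exact (ENNReal.pow_le_pow_left_iff two_ne_zero).1 hsq

end HighFrequency

/-! ### High frequencies of smooth functions of a bounded function -/

section Composition

variable {E : Type} [NormedAddCommGroup E] [InnerProductSpace ℝ E] [FiniteDimensional ℝ E]
  [MeasurableSpace E] [BorelSpace E]
  {V : Type} [NormedAddCommGroup V] [NormedSpace ℝ V] [FiniteDimensional ℝ V]

lemma highPass_sub {Y : Type} [NormedAddCommGroup Y] [NormedSpace ℝ Y] {r : ℝ} (hr : 0 < r)
    {f g : E → Y} (hf : AEStronglyMeasurable f volume) {M N : ℝ} (hM : ∀ x, ‖f x‖ ≤ M)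
    (hg : AEStronglyMeasurable g volume) (hN : ∀ x, ‖g x‖ ≤ N) (x : E) :
    highPass r (fun y => f y - g y) x = highPass r f x - highPass r g x := by
  simp only [highPass]
  rw [lowPass_sub hr hf hM hg hN x]
  abel

lemma highPass_const {Y : Type} [NormedAddCommGroup Y] [NormedSpace ℝ Y] [CompleteSpace Y] {r : ℝ}
    (hr : 0 < r) (c : Y) (x : E) : highPass r (fun _ => c) x = 0 := by
  rw [highPass, lowPass_const hr, sub_self]

lemma exists_iteratedFDeriv_le_of_norm_le {G : Type} [NormedAddCommGroup G] [NormedSpace ℝ G]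
    {F : V → G} (hF : ContDiff ℝ ∞ F) (N : ℕ) (R : ℝ) :
    ∃ C : ℝ, 0 ≤ C ∧ ∀ i ≤ N, ∀ v, ‖v‖ ≤ R → ‖iteratedFDeriv ℝ i F v‖ ≤ C := by
  have h : ∀ i : ℕ, ∃ C : ℝ, ∀ v ∈ Metric.closedBall (0 : V) R, ‖iteratedFDeriv ℝ i F v‖ ≤ C :=
    fun i => (isCompact_closedBall (0 : V) R).exists_bound_of_continuousOn
      (hF.continuous_iteratedFDeriv (by exact_mod_cast le_top)).continuousOn
  choose C hC using h
  refine ⟨∑ i ∈ Finset.range (N + 1), |C i|, Finset.sum_nonneg fun i _ => abs_nonneg _,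
    fun i hi v hv => ?_⟩
  refine (hC i v (by simpa using hv)).trans ((le_abs_self _).trans ?_)
  exact Finset.single_le_sum (f := fun i => |C i|) (fun i _ => abs_nonneg _)
    (Finset.mem_range.2 (by omega))

lemma exists_norm_sub_le_of_norm_le {G : Type} [NormedAddCommGroup G] [NormedSpace ℝ G]
    {F : V → G} (hF : ContDiff ℝ ∞ F) (R : ℝ) :
    ∃ C : ℝ, 0 ≤ C ∧ ∀ v w, ‖v‖ ≤ R → ‖w‖ ≤ R → ‖F w - F v‖ ≤ C * ‖w - v‖ := by
  obtain ⟨C, hC0, hC⟩ := exists_iteratedFDeriv_le_of_norm_le hF 1 R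
  refine ⟨C, hC0, fun v w hv hw => ?_⟩
  refine (convex_closedBall (0 : V) R).norm_image_sub_le_of_norm_fderiv_le (𝕜 := ℝ)
    (fun x _ => (hF.differentiable (by simp)).differentiableAt) (fun x hx => ?_)
    (by simpa using hv) (by simpa using hw)
  rw [← norm_iteratedFDeriv_one]
  exact hC 1 le_rfl x (by simpa using hx)

lemma norm_iteratedFDeriv_compL_le {X Y Z : Type} [NormedAddCommGroup X] [NormedSpace ℝ X]
    [NormedAddCommGroup Y] [NormedSpace ℝ Y] [NormedAddCommGroup Z] [NormedSpace ℝ Z]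
    {f : E → Y →L[ℝ] Z} {g : E → X →L[ℝ] Y} (hf : ContDiff ℝ ∞ f) (hg : ContDiff ℝ ∞ g) {x : E}
    {n : ℕ} {ρ a b : ℝ} (ha : ∀ i ≤ n, ‖iteratedFDeriv ℝ i f x‖ ≤ a * ρ ^ i)
    (hb : ∀ i ≤ n, ‖iteratedFDeriv ℝ i g x‖ ≤ b * ρ ^ i) (ha0 : 0 ≤ a) (hρ : 0 ≤ ρ) :
    ‖iteratedFDeriv ℝ n (fun y => (f y).comp (g y)) x‖ ≤ 2 ^ n * a * b * ρ ^ n := by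
  refine ((ContinuousLinearMap.compL ℝ X Y Z).norm_iteratedFDeriv_le_of_bilinear_of_le_one hf hg x
    (n := n) (by exact_mod_cast le_top) (ContinuousLinearMap.norm_compL_le ℝ X Y Z)).trans ?_
  calc _ ≤ ∑ i ∈ Finset.range (n + 1), (n.choose i : ℝ) * (a * b * ρ ^ n) := by
        refine Finset.sum_le_sum fun i hi => ?_
        have hi' : i ≤ n := by simpa [Nat.lt_succ_iff] using hi
        have h1 := ha i hi'
        have h2 := hb (n - i) (by omega)
        have h3 : (0 : ℝ) ≤ a * ρ ^ i := by positivity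
        have e : ρ ^ n = ρ ^ i * ρ ^ (n - i) := by rw [← pow_add]; congr 1; omega
        calc _ ≤ (n.choose i : ℝ) * (a * ρ ^ i) * (b * ρ ^ (n - i)) := by gcongr
          _ = _ := by rw [e]; ring
    _ = _ := by
        rw [← Finset.sum_mul]
        have : (∑ i ∈ Finset.range (n + 1), (n.choose i : ℝ)) = 2 ^ n := by
          exact_mod_cast Nat.sum_range_choose n
        rw [this]; ring

/-- If `v` and `v + d` vary at frequency `ρ`, then the derivatives of `F (v + d) - F v` are bounded
linearly in the size `η` of the increment `d`. -/
lemma exists_norm_iteratedFDeriv_comp_sub_le (N : ℕ) (R K : ℝ) (hK : 1 ≤ K) :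
    ∀ {G : Type} [NormedAddCommGroup G] [NormedSpace ℝ G] {F : V → G} (_ : ContDiff ℝ ∞ F),
    ∃ C : ℝ, 0 ≤ C ∧ ∀ (v d : E → V), ContDiff ℝ ∞ v → ContDiff ℝ ∞ d →
      ∀ (x : E) (ρ η : ℝ), 0 < ρ → 0 ≤ η → ‖v x‖ ≤ R → ‖v x + d x‖ ≤ R →
      (∀ i ≤ N, ‖iteratedFDeriv ℝ i v x‖ ≤ K * ρ ^ i) →
      (∀ i ≤ N, ‖iteratedFDeriv ℝ i (fun y => v y + d y) x‖ ≤ K * ρ ^ i) →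
      (∀ i ≤ N, ‖iteratedFDeriv ℝ i d x‖ ≤ η * ρ ^ i) →
      ∀ i ≤ N, ‖iteratedFDeriv ℝ i (fun y => F (v y + d y) - F (v y)) x‖ ≤ C * η * ρ ^ i := by
  induction N with
  | zero =>
    intro G _ _ F hF
    obtain ⟨C, hC0, hC⟩ := exists_norm_sub_le_of_norm_le hF R
    refine ⟨C, hC0, fun v d _ _ x ρ η _ _ hv hvd _ _ hd i hi => ?_⟩
    obtain rfl : i = 0 := by omega
    have := hd 0 le_rfl
    rw [norm_iteratedFDeriv_zero, pow_zero, mul_one] at *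
    refine (hC _ _ hv hvd).trans ?_
    rw [add_sub_cancel_left]
    gcongr
  | succ N ih =>
    intro G _ _ F hF
    obtain ⟨C₀, hC₀, hC₀'⟩ := exists_norm_sub_le_of_norm_le hF R
    have hF' : ContDiff ℝ ∞ (fderiv ℝ F) := hF.fderiv_right (by simp)
    obtain ⟨C₁, hC₁, hC₁'⟩ := ih hF'
    obtain ⟨C₂, hC₂, hC₂'⟩ := exists_iteratedFDeriv_le_of_norm_le hF' N R
    set C₃ : ℝ := N.factorial * C₂ * K ^ N
    have hK0 : 0 ≤ K := by linarith
    have hC₃ : 0 ≤ C₃ := by positivity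
    refine ⟨C₀ + (2 ^ N * C₃ + 2 ^ N * C₁ * K), by positivity,
      fun v d hv hd x ρ η hρ hη hvx hvdx hvN hvdN hdN i hi => ?_⟩
    rcases i with _ | i
    · have := hdN 0 (by omega)
      rw [norm_iteratedFDeriv_zero, pow_zero, mul_one] at *
      refine (hC₀' _ _ hvx hvdx).trans ?_
      rw [add_sub_cancel_left]
      have : 0 ≤ (2 ^ N * C₃ + 2 ^ N * C₁ * K) * η := by positivity
      have : C₀ * ‖d x‖ ≤ C₀ * η := by gcongr
      linarith
    have hiN : i ≤ N := by omega
    have hvd : ContDiff ℝ ∞ fun y => v y + d y := hv.add hd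
    have hvdiff : Differentiable ℝ v := hv.differentiable (by simp)
    have hddiff : Differentiable ℝ d := hd.differentiable (by simp)
    have hFdiff : Differentiable ℝ F := hF.differentiable (by simp)
    -- The derivative of `F (v + d) - F v` is a sum of two terms: one has the factor `fderiv d` of size
    -- `η * ρ`, and the other an increment of `fderiv F`, to which the induction hypothesis applies.
    rw [← norm_iteratedFDeriv_fderiv]
    have e : fderiv ℝ (fun y => F (v y + d y) - F (v y)) = fun y =>
        (fderiv ℝ F (v y + d y)).comp (fderiv ℝ d y) +
          (fderiv ℝ F (v y + d y) - fderiv ℝ F (v y)).comp (fderiv ℝ v y) := by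
      ext1 y
      have h1 : HasFDerivAt (fun y => F (v y + d y))
          ((fderiv ℝ F (v y + d y)).comp (fderiv ℝ v y + fderiv ℝ d y)) y :=
        HasFDerivAt.comp y (hFdiff _).hasFDerivAt ((hvdiff y).hasFDerivAt.add (hddiff y).hasFDerivAt)
      have h2 : HasFDerivAt (fun y => F (v y)) ((fderiv ℝ F (v y)).comp (fderiv ℝ v y)) y :=
        HasFDerivAt.comp y (hFdiff _).hasFDerivAt (hvdiff y).hasFDerivAt
      rw [(h1.fun_sub h2).fderiv, ContinuousLinearMap.comp_add, ContinuousLinearMap.sub_comp]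
      abel
    have hd' : ContDiff ℝ ∞ (fderiv ℝ d) := hd.fderiv_right (by simp)
    have hv' : ContDiff ℝ ∞ (fderiv ℝ v) := hv.fderiv_right (by simp)
    have b1 : ‖iteratedFDeriv ℝ i (fun y => (fderiv ℝ F (v y + d y)).comp (fderiv ℝ d y)) x‖ ≤
        2 ^ i * C₃ * (η * ρ) * ρ ^ i := by
      refine norm_iteratedFDeriv_compL_le (hF'.comp hvd) hd' (fun j hj => ?_) (fun j hj => ?_) hC₃
        hρ.le
      · refine (norm_iteratedFDeriv_comp_le hF' hvd (by exact_mod_cast le_top) x (C := C₂)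
          (D := K * ρ) (fun l hl => hC₂' l (by omega) _ hvdx) (fun l hl1 hl => ?_)).trans ?_
        · refine (hvdN l (by omega)).trans ?_
          rw [mul_pow]
          gcongr
          exact le_self_pow₀ hK (by omega)
        · rw [mul_pow, ← mul_assoc]
          have h1 : (j.factorial : ℝ) ≤ N.factorial :=
            by exact_mod_cast Nat.factorial_le (show j ≤ N by omega)
          have h2 : K ^ j ≤ K ^ N := pow_le_pow_right₀ hK (by omega)
          change _ ≤ N.factorial * C₂ * K ^ N * ρ ^ j
          gcongr
      · rw [norm_iteratedFDeriv_fderiv]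
        refine (hdN (j + 1) (by omega)).trans (le_of_eq ?_)
        ring
    have b2 : ‖iteratedFDeriv ℝ i (fun y => (fderiv ℝ F (v y + d y) - fderiv ℝ F (v y)).comp
        (fderiv ℝ v y)) x‖ ≤ 2 ^ i * (C₁ * η) * (K * ρ) * ρ ^ i := by
      refine norm_iteratedFDeriv_compL_le ((hF'.comp hvd).sub (hF'.comp hv)) hv' (fun j hj => ?_)
        (fun j hj => ?_) (by positivity) hρ.le
      · exact hC₁' v d hv hd x ρ η hρ hη hvx hvdx (fun l hl => hvN l (by omega))
          (fun l hl => hvdN l (by omega)) (fun l hl => hdN l (by omega)) j (by omega)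
      · rw [norm_iteratedFDeriv_fderiv]
        refine (hvN (j + 1) (by omega)).trans (le_of_eq ?_)
        ring
    have c1 : ContDiff ℝ ∞ fun y => (fderiv ℝ F (v y + d y)).comp (fderiv ℝ d y) :=
      (hF'.comp hvd).clm_comp hd'
    have c2 : ContDiff ℝ ∞ fun y => (fderiv ℝ F (v y + d y) - fderiv ℝ F (v y)).comp
        (fderiv ℝ v y) := ((hF'.comp hvd).sub (hF'.comp hv)).clm_comp hv'
    rw [e]
    have hadd := iteratedFDeriv_add_apply (𝕜 := ℝ) (i := i) (x := x)
      (c1.contDiffAt.of_le (by exact_mod_cast le_top)) (c2.contDiffAt.of_le (by exact_mod_cast le_top))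
    have h2i : (2 : ℝ) ^ i ≤ 2 ^ N := pow_le_pow_right₀ (by norm_num) hiN
    calc _ ≤ 2 ^ i * C₃ * (η * ρ) * ρ ^ i + 2 ^ i * (C₁ * η) * (K * ρ) * ρ ^ i := by
          refine (le_of_eq (congrArg norm hadd)).trans ((norm_add_le _ _).trans ?_)
          exact add_le_add b1 b2
      _ = 2 ^ i * ((C₃ + C₁ * K) * η * ρ ^ (i + 1)) := by ring
      _ ≤ 2 ^ N * ((C₃ + C₁ * K) * η * ρ ^ (i + 1)) := by gcongr
      _ ≤ C₀ * η * ρ ^ (i + 1) + 2 ^ N * ((C₃ + C₁ * K) * η * ρ ^ (i + 1)) := by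
          have : 0 ≤ C₀ * η * ρ ^ (i + 1) := by positivity
          linarith
      _ = _ := by ring

variable {W : Type} [NormedAddCommGroup W] [InnerProductSpace ℂ W] [CompleteSpace W]

/-- High frequencies, at scale `r`, of the increment `F (v + d) - F v` when `v` and `d` have frequencies
of size `ρ`: they gain any power of `ρ / r`. -/
lemma exists_eLpNorm_highPass_comp_sub_le (N : ℕ) (R K : ℝ) (hK : 1 ≤ K) {F : V → W}
    (hF : ContDiff ℝ ∞ F) :
    ∃ C : ℝ, 0 ≤ C ∧ ∀ (v d : E → V), ContDiff ℝ ∞ v → MemLp d 2 volume →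
      ∀ (D ρ : ℝ), 0 < ρ → (∀ x, ‖d x‖ ≤ D) → (∀ x, ‖v x‖ ≤ R) → (∀ x, ‖v x + d x‖ ≤ R) →
      (∀ i ≤ N, ∀ x, ‖iteratedFDeriv ℝ i v x‖ ≤ K * ρ ^ i) →
      (∀ i ≤ N, ∀ x, ‖iteratedFDeriv ℝ i (fun y => v y + d y) x‖ ≤ K * ρ ^ i) →
      lowPass (4 * ρ) d = d → ∀ r : ℝ, 0 < r →
      eLpNorm (highPass r fun y => F (v y + d y) - F (v y)) 2 volume ≤
        ENNReal.ofReal (C * (ρ / r) ^ N) * eLpNorm d 2 volume := by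
  obtain ⟨C, hC0, hC⟩ := exists_norm_iteratedFDeriv_comp_sub_le (E := E) N R K hK hF
  obtain ⟨C₁, hC₁0, hC₁⟩ := exists_norm_sub_le_of_norm_le hF R
  set S : ℝ := ∑ i ∈ Finset.range (N + 1), 4 ^ i * kernelMass E i with hS
  have hS0 : 0 ≤ S := Finset.sum_nonneg fun i _ => mul_nonneg (by positivity) (kernelMass_nonneg i)
  set n : ℝ := (Module.finrank ℝ E : ℝ) ^ (N + 1) with hn
  have hn0 : 0 ≤ n := by positivity
  refine ⟨n * C * S, by positivity, fun v d hv hd D ρ hρ hD hvR hvdR hvN hvdN hlow r hr => ?_⟩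
  have hdm := hd.aestronglyMeasurable
  have hds : ContDiff ℝ ∞ d := by rw [← hlow]; exact contDiff_lowPass (by positivity) hdm hD
  have hh : ContDiff ℝ ∞ fun y => F (v y + d y) - F (v y) :=
    (hF.comp (hv.add hds)).sub (hF.comp hv)
  have hle : ∀ x, ‖F (v x + d x) - F (v x)‖ ≤ C₁ * ‖d x‖ := fun x => by
    have := hC₁ _ _ (hvR x) (hvdR x)
    rwa [add_sub_cancel_left] at this
  have hmem : MemLp (fun y => F (v y + d y) - F (v y)) 2 volume :=
    hd.of_le_mul hh.continuous.aestronglyMeasurable (Filter.Eventually.of_forall hle)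
  -- a square integrable majorant of the increment `d` and its derivatives, in units of `ρ`
  set η : E → ℝ := ∑ i ∈ Finset.range (N + 1), fun x => ρ⁻¹ ^ i * ‖iteratedFDeriv ℝ i d x‖ with hη
  have hηx : ∀ x, η x = ∑ i ∈ Finset.range (N + 1), ρ⁻¹ ^ i * ‖iteratedFDeriv ℝ i d x‖ :=
    fun x => by rw [hη, Finset.sum_apply]
  have hη0 : ∀ x, 0 ≤ η x := fun x => by
    rw [hηx]; exact Finset.sum_nonneg fun i _ => by positivity
  have hηL : eLpNorm η 2 volume ≤ ENNReal.ofReal S * eLpNorm d 2 volume := by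
    have hcont : ∀ i : ℕ, Continuous (iteratedFDeriv ℝ i d) :=
      fun i => hds.continuous_iteratedFDeriv (by exact_mod_cast le_top)
    refine (eLpNorm_sum_le (fun i _ =>
      (continuous_const.mul (hcont i).norm).aestronglyMeasurable) (by norm_num)).trans ?_
    rw [hS, ENNReal.ofReal_sum_of_nonneg
      (fun i _ => mul_nonneg (by positivity) (kernelMass_nonneg i)), Finset.sum_mul]
    refine Finset.sum_le_sum fun i _ => ?_
    have h1 : eLpNorm (fun x => ρ⁻¹ ^ i * ‖iteratedFDeriv ℝ i d x‖) 2 volume ≤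
        ENNReal.ofReal (ρ⁻¹ ^ i) * eLpNorm (iteratedFDeriv ℝ i d) 2 volume := by
      refine eLpNorm_le_mul_eLpNorm_of_ae_le_mul (Filter.Eventually.of_forall fun x => ?_) 2
      rw [Real.norm_of_nonneg (by positivity)]
    refine h1.trans ?_
    have h2 := eLpNorm_iteratedFDeriv_lowPass_le (r := 4 * ρ) (by positivity) hdm hD i
    rw [hlow] at h2
    calc _ ≤ ENNReal.ofReal (ρ⁻¹ ^ i) *
          (ENNReal.ofReal ((4 * ρ) ^ i * kernelMass E i) * eLpNorm d 2 volume) := by gcongr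
      _ = _ := by
          rw [← mul_assoc, ← ENNReal.ofReal_mul (by positivity)]
          congr 2
          rw [mul_pow, inv_pow]
          field_simp
  have hDN : eLpNorm (iteratedFDeriv ℝ N fun y => F (v y + d y) - F (v y)) 2 volume ≤
      ENNReal.ofReal (C * ρ ^ N) * eLpNorm η 2 volume := by
    refine eLpNorm_le_mul_eLpNorm_of_ae_le_mul (Filter.Eventually.of_forall fun x => ?_) 2
    rw [Real.norm_of_nonneg (hη0 x)]
    refine (hC v d hv hds x ρ (η x) hρ (hη0 x) (hvR x) (hvdR x) (fun i hi => hvN i hi x)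
      (fun i hi => hvdN i hi x) (fun i hi => ?_) N le_rfl).trans (le_of_eq (by ring))
    have h1 : ρ⁻¹ ^ i * ‖iteratedFDeriv ℝ i d x‖ ≤ η x := by
      rw [hηx]
      exact Finset.single_le_sum (f := fun i => ρ⁻¹ ^ i * ‖iteratedFDeriv ℝ i d x‖)
        (fun i _ => by positivity) (Finset.mem_range.2 (by omega))
    calc ‖iteratedFDeriv ℝ i d x‖ = ρ⁻¹ ^ i * ‖iteratedFDeriv ℝ i d x‖ * ρ ^ i := by
          rw [inv_pow]; field_simp
      _ ≤ _ := by gcongr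
  have hD0 : ∀ x, ‖F (v x + d x) - F (v x)‖ ≤ C₁ * D := fun x => (hle x).trans (by gcongr; exact hD x)
  calc _ ≤ ENNReal.ofReal (n * r⁻¹ ^ N) *
        eLpNorm (iteratedFDeriv ℝ N fun y => F (v y + d y) - F (v y)) 2 volume :=
        eLpNorm_highPass_le_iteratedFDeriv hr hmem hD0 (hh.of_le (by exact_mod_cast le_top))
    _ ≤ ENNReal.ofReal (n * r⁻¹ ^ N) * (ENNReal.ofReal (C * ρ ^ N) *
        (ENNReal.ofReal S * eLpNorm d 2 volume)) := by
        gcongr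
        exact hDN.trans (by gcongr)
    _ = _ := by
        rw [← mul_assoc, ← mul_assoc, ← ENNReal.ofReal_mul (by positivity),
          ← ENNReal.ofReal_mul (by positivity)]
        congr 2
        rw [div_eq_mul_inv, mul_pow]; ring

/-- The high-frequency part of `F ∘ u` is controlled by that of `u` at all lower dyadic scales, with
a gain of an arbitrary power of the ratio of the scales. The proof telescopes
`F u = F (u) - F (S_k u) + ∑ (F (S_{l+1} u) - F (S_l u)) + F (S_0 u)`. -/
lemma exists_eLpNorm_highPass_comp_le (N : ℕ) (R : ℝ) {F : V → W} (hF : ContDiff ℝ ∞ F) :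
    ∃ C : ℝ, 0 ≤ C ∧ ∀ u : E → V, MemLp u 2 volume → (∀ x, ‖u x‖ ≤ R) → ∀ k : ℕ,
      eLpNorm (highPass (2 ^ k) fun y => F (u y)) 2 volume ≤ ENNReal.ofReal C *
        (eLpNorm (highPass (2 ^ k) u) 2 volume +
          ∑ l ∈ Finset.range k, ENNReal.ofReal (((2 : ℝ) ^ l / 2 ^ k) ^ N) *
            eLpNorm (highPass (2 ^ l) u) 2 volume +
          ENNReal.ofReal (((2 : ℝ) ^ k)⁻¹ ^ N) * eLpNorm u 2 volume) := by
  rcases lt_or_ge R 0 with hR | hR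
  · refine ⟨0, le_rfl, fun u _ hu => ?_⟩
    exact absurd ((norm_nonneg _).trans (hu 0)) (not_le.2 hR)
  set κ := kernelMass E 0
  have hκ : 1 ≤ κ := one_le_kernelMass_zero
  set R₁ := κ * R
  have hRR₁ : R ≤ R₁ := le_mul_of_one_le_left hR hκ
  have hR₁ : 0 ≤ R₁ := hR.trans hRR₁
  -- `K` bounds the derivatives of both `S_{2ˡ} u` and `S_{2ˡ⁺¹} u` at the scale `2ˡ`.
  -- The larger of the two scales accounts for the factor `2 ^ i`.
  set K : ℝ := 1 + ∑ i ∈ Finset.range (N + 1), 2 ^ i * kernelMass E i * R with hKdef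
  have hKi : ∀ i, 0 ≤ 2 ^ i * kernelMass E i * R := fun i =>
    mul_nonneg (mul_nonneg (by positivity) (kernelMass_nonneg i)) hR
  have hK : 1 ≤ K := by
    have := Finset.sum_nonneg fun i (_ : i ∈ Finset.range (N + 1)) => hKi i
    linarith
  have hKle : ∀ i ≤ N, 2 ^ i * kernelMass E i * R ≤ K := fun i hi => by
    have := Finset.single_le_sum (f := fun i => 2 ^ i * kernelMass E i * R) (fun i _ => hKi i)
      (Finset.mem_range.2 (show i < N + 1 by omega))
    linarith
  obtain ⟨C, hC0, hC⟩ := exists_eLpNorm_highPass_comp_sub_le (E := E) N R₁ K hK hF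
  obtain ⟨C₁, hC₁0, hC₁⟩ := exists_norm_sub_le_of_norm_le hF R₁
  obtain ⟨C₂, hC₂0, hC₂⟩ := exists_iteratedFDeriv_le_of_norm_le hF 0 R₁
  have hFb : ∀ v, ‖v‖ ≤ R₁ → ‖F v‖ ≤ C₂ := fun v hv => by
    simpa [norm_iteratedFDeriv_zero] using hC₂ 0 le_rfl v hv
  set C' := C * κ + (1 + κ) * C₁
  have hκ0 : 0 ≤ κ := by linarith
  refine ⟨C', by positivity, fun u hu huR k => ?_⟩
  have hum := hu.aestronglyMeasurable
  have h2k : (0 : ℝ) < 2 ^ k := by positivity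
  set v : ℕ → E → V := fun l => lowPass (2 ^ l) u with hv
  have hvs : ∀ l, ContDiff ℝ ∞ (v l) := fun l => contDiff_lowPass (by positivity) hum huR
  have hvR : ∀ l x, ‖v l x‖ ≤ R₁ := fun l x => norm_lowPass_le (by positivity) huR x
  have hvm : ∀ l, MemLp (v l) 2 volume := fun l => memLp_lowPass (by positivity) hu
  have hvd : ∀ l, ∀ i ≤ N, ∀ x, ‖iteratedFDeriv ℝ i (v l) x‖ ≤ K * (2 ^ l) ^ i := by
    intro l i hi x
    refine (norm_iteratedFDeriv_lowPass_le_of_bound (by positivity) hum huR i x).trans ?_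
    rw [mul_assoc, mul_comm]
    gcongr
    refine le_trans ?_ (hKle i hi)
    rw [mul_assoc]
    exact le_mul_of_one_le_left (mul_nonneg (kernelMass_nonneg i) hR) (one_le_pow₀ (by norm_num))
  have hvd' : ∀ l, ∀ i ≤ N, ∀ x, ‖iteratedFDeriv ℝ i (v (l + 1)) x‖ ≤ K * (2 ^ l) ^ i := by
    intro l i hi x
    refine (norm_iteratedFDeriv_lowPass_le_of_bound (by positivity) hum huR i x).trans ?_
    calc _ = (2 ^ i * kernelMass E i * R) * (2 ^ l) ^ i := by rw [pow_succ, mul_pow]; ring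
      _ ≤ _ := by gcongr; exact hKle i hi
  have hFvm : ∀ l, AEStronglyMeasurable (fun y => F (v l y)) volume := fun l =>
    (hF.continuous.comp (hvs l).continuous).aestronglyMeasurable
  have hFvb : ∀ l x, ‖F (v l x)‖ ≤ C₂ := fun l x => hFb _ (hvR l x)
  have hFum : AEStronglyMeasurable (fun y => F (u y)) volume :=
    hF.continuous.comp_aestronglyMeasurable hum
  have hFub : ∀ x, ‖F (u x)‖ ≤ C₂ := fun x => hFb _ ((huR x).trans hRR₁)
  -- the low-frequency end `F (S_1 u)` of the telescoping sum, as the increment from the constant `F 0`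
  have hbase : eLpNorm (highPass (2 ^ k) fun y => F (v 0 y)) 2 volume ≤
      ENNReal.ofReal C' * (ENNReal.ofReal (((2 : ℝ) ^ k)⁻¹ ^ N) * eLpNorm u 2 volume) := by
    have h1 := hC (fun _ => 0) (v 0) contDiff_const (hvm 0) R₁ 1 one_pos (hvR 0)
      (fun x => by simpa using hR₁) (fun x => by simpa using hvR 0 x)
      (fun i hi x => ?_) (fun i hi x => ?_) ?_ (2 ^ k) h2k
    · have e : highPass (2 ^ k) (fun y => F (v 0 y)) =
          highPass (2 ^ k) fun y => F (0 + v 0 y) - F 0 := by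
        ext1 x
        simp only [zero_add]
        rw [highPass_sub h2k (hFvm 0) (hFvb 0) aestronglyMeasurable_const
          (fun _ => le_rfl) x, highPass_const h2k, sub_zero]
      rw [e]
      refine h1.trans ?_
      have h2 : eLpNorm (v 0) 2 volume ≤ ENNReal.ofReal κ * eLpNorm u 2 volume :=
        eLpNorm_lowPass_le (by positivity) hum
      calc _ ≤ ENNReal.ofReal (C * (1 / 2 ^ k) ^ N) * (ENNReal.ofReal κ * eLpNorm u 2 volume) := by
            gcongr
        _ = ENNReal.ofReal (C * κ) * (ENNReal.ofReal (((2 : ℝ) ^ k)⁻¹ ^ N) * eLpNorm u 2 volume) := by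
            rw [← mul_assoc, ← mul_assoc, ← ENNReal.ofReal_mul (by positivity),
              ← ENNReal.ofReal_mul (by positivity)]
            congr 2
            rw [one_div]; ring
        _ ≤ _ := by
            gcongr
            exact le_add_of_nonneg_right (by positivity)
    · rw [one_pow, mul_one]
      rcases i with _ | i
      · simp; linarith
      · rw [iteratedFDeriv_const_of_ne (by omega)]; simp; linarith
    · simp only [zero_add]
      simpa using hvd 0 i hi x
    · ext1 x
      exact lowPass_lowPass (by positivity) (by norm_num) hum huR x
  -- one increment `F (S_{2ˡ⁺¹} u) - F (S_{2ˡ} u)`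
  have hstep : ∀ l, eLpNorm (highPass (2 ^ k) fun y => F (v (l + 1) y) - F (v l y)) 2 volume ≤
      ENNReal.ofReal C' * (ENNReal.ofReal (((2 : ℝ) ^ l / 2 ^ k) ^ N) *
        eLpNorm (highPass (2 ^ l) u) 2 volume) := by
    intro l
    have h2l : (0 : ℝ) < 2 ^ l := by positivity
    have he : ∀ y, v l y + (v (l + 1) y - v l y) = v (l + 1) y := fun y => by abel
    have h1 := hC (v l) (fun y => v (l + 1) y - v l y) (hvs l) ((hvm (l + 1)).sub (hvm l))
      (R₁ + R₁) (2 ^ l) h2l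
      (fun x => (norm_sub_le _ _).trans (add_le_add (hvR _ x) (hvR _ x))) (hvR l)
      (fun x => by rw [he]; exact hvR _ x) (hvd l)
      (by simp only [he]; exact hvd' l) ?_ (2 ^ k) h2k
    · simp only [he] at h1
      refine h1.trans ?_
      have h2 : eLpNorm (fun y => v (l + 1) y - v l y) 2 volume ≤
          ENNReal.ofReal κ * eLpNorm (highPass (2 ^ l) u) 2 volume :=
        eLpNorm_lowPass_sub_lowPass_le h2l (by rw [pow_succ, mul_comm]) hum huR
      calc _ ≤ ENNReal.ofReal (C * (2 ^ l / 2 ^ k) ^ N) *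
            (ENNReal.ofReal κ * eLpNorm (highPass (2 ^ l) u) 2 volume) := by gcongr
        _ = ENNReal.ofReal (C * κ) * (ENNReal.ofReal (((2 : ℝ) ^ l / 2 ^ k) ^ N) *
            eLpNorm (highPass (2 ^ l) u) 2 volume) := by
            rw [← mul_assoc, ← mul_assoc, ← ENNReal.ofReal_mul (by positivity),
              ← ENNReal.ofReal_mul (by positivity)]
            congr 2
            ring
        _ ≤ _ := by
            gcongr
            exact le_add_of_nonneg_right (by positivity)
    · ext1 x
      rw [lowPass_sub (by positivity) (hvm _).aestronglyMeasurable (hvR _)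
        (hvm _).aestronglyMeasurable (hvR _)]
      rw [lowPass_lowPass (by positivity) (by rw [pow_succ]; linarith) hum huR,
        lowPass_lowPass (by positivity) (by linarith) hum huR]
  have hsum : ∀ j, eLpNorm (highPass (2 ^ k) fun y => F (v j y)) 2 volume ≤
      ENNReal.ofReal C' * (∑ l ∈ Finset.range j, ENNReal.ofReal (((2 : ℝ) ^ l / 2 ^ k) ^ N) *
        eLpNorm (highPass (2 ^ l) u) 2 volume +
          ENNReal.ofReal (((2 : ℝ) ^ k)⁻¹ ^ N) * eLpNorm u 2 volume) := by
    intro j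
    induction j with
    | zero => simpa using hbase
    | succ j ih =>
      have e : highPass (2 ^ k) (fun y => F (v (j + 1) y)) =
          highPass (2 ^ k) (fun y => F (v (j + 1) y) - F (v j y)) +
            highPass (2 ^ k) (fun y => F (v j y)) := by
        ext1 x
        rw [Pi.add_apply, highPass_sub h2k (hFvm _) (hFvb _) (hFvm _) (hFvb _) x, sub_add_cancel]
      rw [e]
      refine (eLpNorm_add_le (aestronglyMeasurable_highPass ((hFvm _).sub (hFvm _)))
        (aestronglyMeasurable_highPass (hFvm _)) (by norm_num)).trans ?_
      refine (add_le_add (hstep j) ih).trans (le_of_eq ?_)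
      rw [Finset.sum_range_succ, ← mul_add]
      congr 1
      ring
  -- the remainder `F u - F (S_{2ᵏ} u)`, for which the Lipschitz bound of `F` is enough
  have hlast : eLpNorm (highPass (2 ^ k) fun y => F (u y) - F (v k y)) 2 volume ≤
      ENNReal.ofReal C' * eLpNorm (highPass (2 ^ k) u) 2 volume := by
    refine (eLpNorm_highPass_le h2k (hFum.sub (hFvm k))).trans ?_
    have h1 : eLpNorm (fun y => F (u y) - F (v k y)) 2 volume ≤
        ENNReal.ofReal C₁ * eLpNorm (highPass (2 ^ k) u) 2 volume :=
      eLpNorm_le_mul_eLpNorm_of_ae_le_mul (Filter.Eventually.of_forall fun x =>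
        hC₁ _ _ (hvR k x) ((huR x).trans hRR₁)) 2
    calc _ ≤ ENNReal.ofReal (1 + κ) * (ENNReal.ofReal C₁ *
          eLpNorm (highPass (2 ^ k) u) 2 volume) := by
          gcongr
          exact h1
      _ = ENNReal.ofReal ((1 + κ) * C₁) * eLpNorm (highPass (2 ^ k) u) 2 volume := by
          rw [← mul_assoc, ← ENNReal.ofReal_mul (by positivity)]
      _ ≤ _ := by
          gcongr
          exact le_add_of_nonneg_left (by positivity)
  have e : highPass (2 ^ k) (fun y => F (u y)) =
      highPass (2 ^ k) (fun y => F (u y) - F (v k y)) + highPass (2 ^ k) (fun y => F (v k y)) := by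
    ext1 x
    rw [Pi.add_apply, highPass_sub h2k hFum hFub (hFvm _) (hFvb _) x, sub_add_cancel]
  rw [e]
  refine (eLpNorm_add_le (aestronglyMeasurable_highPass (hFum.sub (hFvm _)))
    (aestronglyMeasurable_highPass (hFvm _)) (by norm_num)).trans ?_
  refine (add_le_add hlast (hsum k)).trans (le_of_eq ?_)
  rw [← mul_add, add_assoc]

end Composition

/-! ### The paraproduct estimate -/

section BandPass

variable {E : Type} [NormedAddCommGroup E] [InnerProductSpace ℝ E] [FiniteDimensional ℝ E]
  [MeasurableSpace E] [BorelSpace E]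

/-- The part of `f` at frequencies between `ρ` and `σ`. -/
def bandPass {V : Type} [NormedAddCommGroup V] [NormedSpace ℝ V] (ρ σ : ℝ) (f : E → V) (x : E) : V :=
  lowPass σ f x - lowPass ρ f x

lemma contDiff_bandPass {ρ σ : ℝ} (hρ : 0 < ρ) (hσ : 0 < σ) {f : E → ℝ}
    (hf : AEStronglyMeasurable f volume) {M : ℝ} (hM : ∀ x, ‖f x‖ ≤ M) :
    ContDiff ℝ ∞ (bandPass ρ σ f) :=
  (contDiff_lowPass hσ hf hM).sub (contDiff_lowPass hρ hf hM)

lemma memLp_bandPass {ρ σ : ℝ} (hρ : 0 < ρ) (hσ : 0 < σ) {f : E → ℝ} (hf : MemLp f 2 volume) :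
    MemLp (bandPass ρ σ f) 2 volume := (memLp_lowPass hσ hf).sub (memLp_lowPass hρ hf)

lemma aestronglyMeasurable_bandPass {ρ σ : ℝ} {f : E → ℝ} (hf : AEStronglyMeasurable f volume) :
    AEStronglyMeasurable (bandPass ρ σ f) volume :=
  (aestronglyMeasurable_lowPass hf).sub (aestronglyMeasurable_lowPass hf)

lemma eLpNorm_bandPass_le {ρ σ : ℝ} (hρ : 0 < ρ) (hσ : 0 < σ) {f : E → ℝ}
    (hf : AEStronglyMeasurable f volume) :
    eLpNorm (bandPass ρ σ f) 2 volume ≤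
      ENNReal.ofReal (2 * kernelMass E 0) * eLpNorm f 2 volume := by
  refine (eLpNorm_sub_le (aestronglyMeasurable_lowPass hf) (aestronglyMeasurable_lowPass hf)
    (by norm_num)).trans ?_
  refine (add_le_add (eLpNorm_lowPass_le hσ hf) (eLpNorm_lowPass_le hρ hf)).trans (le_of_eq ?_)
  have := kernelMass_nonneg (E := E) 0
  rw [← add_mul, ← ENNReal.ofReal_add this this, two_mul]

lemma fderiv_bandPass_apply {ρ σ : ℝ} (hρ : 0 < ρ) (hσ : 0 < σ) {f : E → ℝ} {L : ℝ≥0}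
    (hL : LipschitzWith L f) {M : ℝ} (hM : ∀ x, ‖f x‖ ≤ M) (x e : E) :
    fderiv ℝ (bandPass ρ σ f) x e = bandPass ρ σ (fun y => fderiv ℝ f y e) x := by
  have hm := hL.continuous.aestronglyMeasurable (μ := volume)
  have h1 := (contDiff_lowPass hσ hm hM).differentiable (by simp) x
  have h2 := (contDiff_lowPass hρ hm hM).differentiable (by simp) x
  have e1 : fderiv ℝ (bandPass ρ σ f) x = fderiv ℝ (lowPass σ f) x - fderiv ℝ (lowPass ρ f) x :=
    fderiv_fun_sub h1 h2
  rw [e1, sub_apply, fderiv_lowPass_apply hσ hL hM, fderiv_lowPass_apply hρ hL hM]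
  rfl

/-- **Bernstein's inequality**. It is used only for qualitative integrability, as it loses a factor `σ`. -/
lemma eLpNorm_fderiv_bandPass_le {ρ σ : ℝ} (hρ : 0 < ρ) (hρσ : ρ ≤ σ) {f : E → ℝ}
    (hf : AEStronglyMeasurable f volume) {M : ℝ} (hM : ∀ x, ‖f x‖ ≤ M) {e : E} (he : ‖e‖ ≤ 1) :
    eLpNorm (fun x => fderiv ℝ (bandPass ρ σ f) x e) 2 volume ≤
      ENNReal.ofReal (2 * σ * kernelMass E 1) * eLpNorm f 2 volume := by
  have hσ : 0 < σ := hρ.trans_le hρσ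
  have hd : ∀ {r : ℝ}, 0 < r → r ≤ σ → eLpNorm (fun x => fderiv ℝ (lowPass r f) x) 2 volume ≤
      ENNReal.ofReal (σ * kernelMass E 1) * eLpNorm f 2 volume := by
    intro r hr hrσ
    have h1 := eLpNorm_iteratedFDeriv_lowPass_le hr hf hM 1
    have h2 : eLpNorm (fun x => fderiv ℝ (lowPass r f) x) 2 volume =
        eLpNorm (iteratedFDeriv ℝ 1 (lowPass r f)) 2 volume :=
      eLpNorm_congr_norm_ae (Filter.Eventually.of_forall fun x => by
        rw [norm_iteratedFDeriv_one])
    rw [h2]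
    refine h1.trans ?_
    rw [pow_one]
    have := kernelMass_nonneg (E := E) 1
    gcongr
  have hc : ∀ {r : ℝ}, 0 < r → Continuous fun x => fderiv ℝ (lowPass r f) x := fun hr =>
    (contDiff_lowPass hr hf hM).continuous_fderiv (by simp)
  calc _ ≤ eLpNorm (fun x => fderiv ℝ (bandPass ρ σ f) x) 2 volume := by
        refine eLpNorm_mono fun x => ?_
        exact ((fderiv ℝ (bandPass ρ σ f) x).le_opNorm e).trans
          (mul_le_of_le_one_right (norm_nonneg _) he)
    _ = eLpNorm ((fun x => fderiv ℝ (lowPass σ f) x) - fun x => fderiv ℝ (lowPass ρ f) x) 2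
          volume := by
        congr 1
        ext1 x
        exact fderiv_fun_sub ((contDiff_lowPass hσ hf hM).differentiable (by simp) x)
          ((contDiff_lowPass hρ hf hM).differentiable (by simp) x)
    _ ≤ _ := by
        refine (eLpNorm_sub_le (hc hσ).aestronglyMeasurable (hc hρ).aestronglyMeasurable
          (by norm_num)).trans ?_
        refine (add_le_add (hd hσ le_rfl) (hd hρ hρσ)).trans (le_of_eq ?_)
        have := kernelMass_nonneg (E := E) 1
        rw [← add_mul, ← ENNReal.ofReal_add (by positivity) (by positivity)]
        congr 2
        ring

/-- Paraproduct estimate: up to an error controlled in `L²` by the high frequencies of `f` and `a`,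
the band-pass filter commutes with the product by `a`, provided that `a` is replaced by its low
frequencies. -/
lemma exists_eLpNorm_bandPass_mul_fderiv_sub_le (E : Type) [NormedAddCommGroup E]
    [InnerProductSpace ℝ E] [FiniteDimensional ℝ E] [MeasurableSpace E] [BorelSpace E] :
    ∃ C : ℝ, 0 ≤ C ∧ ∀ (ρ σ : ℝ), 0 < ρ → 2 * ρ ≤ σ → ∀ (L : ℝ≥0) (a f : E → ℝ),
      LipschitzWith L a → LipschitzWith L f → ∀ A M : ℝ, (∀ x, ‖a x‖ ≤ A) → (∀ x, ‖f x‖ ≤ M) →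
      ∀ e : E, ‖e‖ ≤ 1 →
      eLpNorm (fun x => bandPass ρ σ (fun y => a y * fderiv ℝ f y e) x -
        lowPass (ρ / 8) a x * fderiv ℝ (bandPass ρ σ f) x e) 2 volume ≤
        ENNReal.ofReal (C * L) * (eLpNorm (highPass (ρ / 4) f) 2 volume +
          eLpNorm (highPass (ρ / 8) a) 2 volume) := by
  set κ := kernelMass E 0
  have hκ : 0 ≤ κ := kernelMass_nonneg 0
  have hc0 := commutatorConst_nonneg (E := E)
  set c := commutatorConst E
  refine ⟨c * (2 + κ) + 2 * κ, by positivity, fun ρ σ hρ hσρ L a f ha hf A M hA hM e he => ?_⟩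
  have hσ : 0 < σ := by linarith
  have hρ8 : 0 < ρ / 8 := by linarith
  have ham := ha.continuous.aestronglyMeasurable (μ := volume)
  have hfm := hf.continuous.aestronglyMeasurable (μ := volume)
  have hA0 : 0 ≤ A := (norm_nonneg _).trans (hA 0)
  set g : E → ℝ := fun y => fderiv ℝ f y e with hg
  have hgm : AEStronglyMeasurable g volume :=
    (measurable_fderiv_apply_const ℝ f e).aestronglyMeasurable
  have hgb : ∀ x, ‖g x‖ ≤ L := fun x =>
    ((fderiv ℝ f x).le_opNorm e).trans ((mul_le_of_le_one_right (norm_nonneg _) he).trans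
      (norm_fderiv_le_of_lipschitz ℝ hf))
  -- The low frequencies `b` of `a` give the commutators, and the high frequencies `h` are multiplied by
  -- the bounded function `g`.
  set b : E → ℝ := lowPass (ρ / 8) a with hb
  have hbm : AEStronglyMeasurable b volume := aestronglyMeasurable_lowPass ham
  have hbb : ∀ x, ‖b x‖ ≤ κ * A := fun x => norm_lowPass_le hρ8 hA x
  set h : E → ℝ := highPass (ρ / 8) a with hh
  have hhm : AEStronglyMeasurable h volume := aestronglyMeasurable_highPass ham
  have hhb : ∀ x, ‖h x‖ ≤ (1 + κ) * A := fun x => norm_highPass_le hρ8 hA x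
  have hhg : ∀ x, ‖h x * g x‖ ≤ (1 + κ) * A * L := fun x => by
    rw [norm_mul]; exact mul_le_mul (hhb x) (hgb x) (norm_nonneg _) (by positivity)
  have hbg : ∀ x, ‖b x * g x‖ ≤ κ * A * L := fun x => by
    rw [norm_mul]; exact mul_le_mul (hbb x) (hgb x) (norm_nonneg _) (by positivity)
  have hmul : ∀ x, a x * g x = h x * g x + b x * g x := fun x => by
    rw [hh, hb, highPass]; ring
  have hsplit : ∀ {r : ℝ}, 0 < r → ∀ x, lowPass r (fun y => a y * g y) x =
      lowPass r (fun y => h y * g y) x + lowPass r (fun y => b y * g y) x := fun hr x => by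
    simp only [hmul]
    exact lowPass_add hr (hhm.mul hgm) hhg (hbm.mul hgm) hbg x
  have e1 : (fun x => bandPass ρ σ (fun y => a y * g y) x -
      b x * fderiv ℝ (bandPass ρ σ f) x e) =
      bandPass ρ σ (fun y => h y * g y) + (lpCommutator σ b g - lpCommutator ρ b g) := by
    ext1 x
    rw [fderiv_bandPass_apply hρ hσ hf hM, Pi.add_apply, Pi.sub_apply]
    simp only [bandPass, lpCommutator]
    rw [hsplit hσ, hsplit hρ]
    ring
  have hcm : ∀ r : ℝ, AEStronglyMeasurable (lpCommutator r b g) volume := fun r =>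
    (aestronglyMeasurable_lowPass (hbm.mul hgm)).sub (hbm.mul (aestronglyMeasurable_lowPass hgm))
  rw [e1]
  have n1 : eLpNorm (bandPass ρ σ (fun y => h y * g y)) 2 volume ≤
      ENNReal.ofReal (2 * κ * L) * eLpNorm h 2 volume := by
    refine (eLpNorm_bandPass_le hρ hσ (hhm.mul hgm)).trans ?_
    rw [ENNReal.ofReal_mul (q := (L : ℝ)) (by positivity), mul_assoc]
    refine mul_le_mul' le_rfl ?_
    refine eLpNorm_le_mul_eLpNorm_of_ae_le_mul (Filter.Eventually.of_forall fun x => ?_) 2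
    rw [Pi.mul_apply, norm_mul, mul_comm]
    gcongr
    exact hgb x
  have n2 : eLpNorm (lpCommutator σ b g) 2 volume ≤
      ENNReal.ofReal (c * L * (1 + κ)) * eLpNorm (highPass (ρ / 4) f) 2 volume := by
    refine (eLpNorm_lpCommutator_fderiv_le hρ8 (by linarith) ha hA hf hM he).trans ?_
    rw [ENNReal.ofReal_mul (q := 1 + κ) (by positivity), mul_assoc]
    refine mul_le_mul' le_rfl ?_
    exact eLpNorm_highPass_le_highPass (r₁ := ρ / 4) (by linarith) (by linarith) hfm hM
  have n3 : eLpNorm (lpCommutator ρ b g) 2 volume ≤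
      ENNReal.ofReal (c * L) * eLpNorm (highPass (ρ / 4) f) 2 volume :=
    eLpNorm_lpCommutator_fderiv_le hρ8 (by linarith) ha hA hf hM he
  refine (eLpNorm_add_le (aestronglyMeasurable_bandPass (hhm.mul hgm)) ((hcm σ).sub (hcm ρ))
    (by norm_num)).trans ?_
  refine (add_le_add n1 ((eLpNorm_sub_le (hcm σ) (hcm ρ) (by norm_num)).trans
    (add_le_add n2 n3))).trans ?_
  rw [← add_mul, ← ENNReal.ofReal_add (by positivity) (by positivity), add_comm,
    mul_add (ENNReal.ofReal _)]
  have hL0 : (0 : ℝ) ≤ L := L.2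
  refine add_le_add ?_ ?_
  · gcongr
    nlinarith [mul_nonneg hκ hL0]
  · gcongr
    nlinarith [mul_nonneg hc0 hL0, mul_nonneg (mul_nonneg hc0 hL0) hκ]

end BandPass

/-! ### Integration by parts in a symmetric form -/

section SymmetricForm

variable {E : Type} [NormedAddCommGroup E] [InnerProductSpace ℝ E] [FiniteDimensional ℝ E]
  [MeasurableSpace E] [BorelSpace E]

lemma lintegral_enorm_mul_le {f g : E → ℝ} (hf : AEStronglyMeasurable f volume)
    (hg : AEStronglyMeasurable g volume) :
    ∫⁻ x, ‖f x * g x‖ₑ ≤ eLpNorm f 2 volume * eLpNorm g 2 volume := by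
  have h := ENNReal.lintegral_mul_le_Lp_mul_Lq volume Real.HolderConjugate.two_two hf.enorm hg.enorm
  have e : ∀ u : E → ℝ, eLpNorm u 2 volume = (∫⁻ x, ‖u x‖ₑ ^ (2 : ℝ)) ^ (1 / (2 : ℝ)) := fun u => by
    rw [eLpNorm_eq_lintegral_rpow_enorm_toReal (by norm_num) (by norm_num)]; norm_num
  rw [e, e]
  simpa [enorm_mul] using h

lemma integrable_mul_of_memLp {f g : E → ℝ} (hf : MemLp f 2 volume) (hg : MemLp g 2 volume) :
    Integrable (fun x => f x * g x) volume :=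
  MemLp.integrable_mul hf hg

/-- Integration by parts in the principal part: a symmetric first-order form loses its derivative
to the coefficients. -/
lemma integral_symmetric_form {I : Type} [Fintype I] {w : I → E → ℝ}
    (hw : ∀ c, Differentiable ℝ (w c)) (hw2 : ∀ c, MemLp (w c) 2 volume) {e : E}
    (hdw : ∀ c, MemLp (fun x => fderiv ℝ (w c) x e) 2 volume) {b : I → I → E → ℝ}
    (hb : ∀ c d, Differentiable ℝ (b c d)) (hsymm : ∀ c d, b c d = b d c) {A L : ℝ}
    (hA : ∀ c d x, ‖b c d x‖ ≤ A) (hL : ∀ c d x, ‖fderiv ℝ (b c d) x e‖ ≤ L) :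
    2 * ∑ c, ∑ d, ∫ x, w c x * (b c d x * fderiv ℝ (w d) x e) =
      -∑ c, ∑ d, ∫ x, w c x * (fderiv ℝ (b c d) x e * w d x) := by
  have hbm : ∀ c d, AEStronglyMeasurable (b c d) volume := fun c d =>
    (hb c d).continuous.aestronglyMeasurable
  have hdbm : ∀ c d, AEStronglyMeasurable (fun x => fderiv ℝ (b c d) x e) volume := fun c d =>
    (measurable_fderiv_apply_const ℝ (b c d) e).aestronglyMeasurable
  have mul1 : ∀ c d {g : E → ℝ}, MemLp g 2 volume → MemLp (fun x => b c d x * g x) 2 volume :=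
    fun c d g hg => hg.of_le_mul (c := A) ((hbm c d).mul hg.aestronglyMeasurable)
      (Filter.Eventually.of_forall fun x => by
        rw [norm_mul]; gcongr; exact hA c d x)
  have mul2 : ∀ c d {g : E → ℝ}, MemLp g 2 volume →
      MemLp (fun x => fderiv ℝ (b c d) x e * g x) 2 volume :=
    fun c d g hg => hg.of_le_mul (c := L) ((hdbm c d).mul hg.aestronglyMeasurable)
      (Filter.Eventually.of_forall fun x => by
        rw [norm_mul]; gcongr; exact hL c d x)
  -- integration by parts for one pair of components
  have hpart : ∀ c d, ∫ x, w c x * (b c d x * fderiv ℝ (w d) x e) =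
      -(∫ x, w d x * (b d c x * fderiv ℝ (w c) x e)) -
        ∫ x, w c x * (fderiv ℝ (b c d) x e * w d x) := by
    intro c d
    have hder : ∀ x, fderiv ℝ (fun y => w c y * b c d y) x e =
        w c x * fderiv ℝ (b c d) x e + b c d x * fderiv ℝ (w c) x e := by
      intro x
      rw [fderiv_fun_mul (hw c x) (hb c d x)]
      simp
    have i1 : Integrable fun x => w d x * (b c d x * fderiv ℝ (w c) x e) :=
      integrable_mul_of_memLp (hw2 d) (mul1 c d (hdw c))
    have i2 : Integrable fun x => w c x * (fderiv ℝ (b c d) x e * w d x) :=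
      integrable_mul_of_memLp (hw2 c) (mul2 c d (hw2 d))
    have h := integral_mul_fderiv_eq_neg_fderiv_mul_of_integrable (μ := (volume : Measure E))
      (f := fun y => w c y * b c d y) (g := w d) (v := e) ?_ ?_ ?_
      (fun x _ => (hw c x).mul (hb c d x)) (fun x _ => hw d x)
    · simp only [hder] at h
      have e1 : ∀ x, (w c x * fderiv ℝ (b c d) x e + b c d x * fderiv ℝ (w c) x e) * w d x =
          w d x * (b c d x * fderiv ℝ (w c) x e) + w c x * (fderiv ℝ (b c d) x e * w d x) :=
        fun x => by ring
      simp only [e1, mul_assoc] at h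
      rw [integral_add i1 i2] at h
      rw [h, hsymm d c]
      ring
    · simp only [hder]
      refine (i1.add i2).congr (Filter.Eventually.of_forall fun x => ?_)
      simp only [Pi.add_apply]; ring
    · refine (integrable_mul_of_memLp (hw2 c) (mul1 c d (hdw d))).congr
        (Filter.Eventually.of_forall fun x => ?_)
      simp only; ring
    · refine (integrable_mul_of_memLp (hw2 c) (mul1 c d (hw2 d))).congr
        (Filter.Eventually.of_forall fun x => ?_)
      simp only; ring
  have hs : ∑ c, ∑ d, ∫ x, w c x * (b c d x * fderiv ℝ (w d) x e) =
      -(∑ c, ∑ d, ∫ x, w c x * (b c d x * fderiv ℝ (w d) x e)) -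
        ∑ c, ∑ d, ∫ x, w c x * (fderiv ℝ (b c d) x e * w d x) := by
    refine (Finset.sum_congr rfl fun c _ => Finset.sum_congr rfl fun d _ => hpart c d).trans ?_
    simp only [Finset.sum_sub_distrib, Finset.sum_neg_distrib]
    rw [Finset.sum_comm]
  linarith

end SymmetricForm

/-! ### The energy estimate for band-pass filtered systems -/

section StaticEnergy

variable {E : Type} [NormedAddCommGroup E] [InnerProductSpace ℝ E] [FiniteDimensional ℝ E]
  [MeasurableSpace E] [BorelSpace E]

lemma abs_integral_mul_le {f g : E → ℝ} (hf : MemLp f 2 volume) (hg : MemLp g 2 volume) :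
    |∫ x, f x * g x| ≤ (eLpNorm f 2 volume).toReal * (eLpNorm g 2 volume).toReal := by
  have h1 : ‖∫ x, f x * g x‖ₑ ≤ eLpNorm f 2 volume * eLpNorm g 2 volume :=
    (enorm_integral_le_lintegral_enorm _).trans
      (lintegral_enorm_mul_le hf.aestronglyMeasurable hg.aestronglyMeasurable)
  have h2 := ENNReal.toReal_mono (ENNReal.mul_ne_top hf.eLpNorm_ne_top hg.eLpNorm_ne_top) h1
  rwa [ENNReal.toReal_mul, toReal_enorm, Real.norm_eq_abs] at h2

lemma bandPass_sum {ρ σ : ℝ} (hρ : 0 < ρ) (hσ : 0 < σ) {ι : Type*} (s : Finset ι)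
    {f : ι → E → ℝ} (hf : ∀ i, AEStronglyMeasurable (f i) volume) {M : ι → ℝ}
    (hM : ∀ i x, ‖f i x‖ ≤ M i) (x : E) :
    bandPass ρ σ (fun y => ∑ i ∈ s, f i y) x = ∑ i ∈ s, bandPass ρ σ (f i) x := by
  simp only [bandPass]
  rw [lowPass_sum hσ s hf hM, lowPass_sum hρ s hf hM, Finset.sum_sub_distrib]

lemma eLpNorm_bandPass_le_highPass {ρ σ : ℝ} (hρ : 0 < ρ) (hρσ : 2 * ρ ≤ σ) {f : E → ℝ}
    (hf : AEStronglyMeasurable f volume) {M : ℝ} (hM : ∀ x, ‖f x‖ ≤ M) :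
    eLpNorm (bandPass ρ σ f) 2 volume ≤ ENNReal.ofReal (kernelMass E 0 * (1 + kernelMass E 0)) *
      eLpNorm (highPass (ρ / 4) f) 2 volume := by
  have := kernelMass_nonneg (E := E) 0
  refine (eLpNorm_lowPass_sub_lowPass_le hρ hρσ hf hM).trans ?_
  rw [ENNReal.ofReal_mul this, mul_assoc]
  refine mul_le_mul' le_rfl ?_
  exact eLpNorm_highPass_le_highPass (by linarith) (by linarith) hf hM

/-- The data of a symmetric first-order operator `∑ⱼ aⱼ ∂_{eⱼ}` acting on a bounded Lipschitz
function `f`, in components. The bound `L` controls the Lipschitz constants of both. -/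
structure SymmetricSystem {I J : Type} [Fintype I] [Fintype J] (L : ℝ≥0) (A M : ℝ)
    (e : J → E) (a : J → I → I → E → ℝ) (f : I → E → ℝ) : Prop where
  norm_dir : ∀ j, ‖e j‖ ≤ 1
  lip_coeff : ∀ j c d, LipschitzWith L (a j c d)
  lip : ∀ c, LipschitzWith L (f c)
  bound_coeff : ∀ j c d x, ‖a j c d x‖ ≤ A
  bound : ∀ c x, ‖f c x‖ ≤ M
  symm : ∀ j c d, a j c d = a j d c

/-- The component `∑ⱼ ∑_d a_{jcd} ∂_{eⱼ} f_d` of a first-order operator. -/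
def systemTerm {I J : Type} [Fintype I] [Fintype J] (e : J → E) (a : J → I → I → E → ℝ)
    (f : I → E → ℝ) (c : I) (x : E) : ℝ :=
  ∑ p : J × I, a p.1 c p.2 x * fderiv ℝ (f p.2) x (e p.1)

/-- The size of the high frequencies of a function and of the coefficients of a system. The thresholds
`ρ / 4` and `ρ / 8` are those of the paraproduct estimate at the scale `ρ`. -/
def highSize {I J : Type} [Fintype I] [Fintype J] (ρ : ℝ) (a : J → I → I → E → ℝ)
    (f : I → E → ℝ) : ℝ≥0∞ :=
  ∑ c, eLpNorm (highPass (ρ / 4) (f c)) 2 volume +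
    ∑ j, ∑ c, ∑ d, eLpNorm (highPass (ρ / 8) (a j c d)) 2 volume

variable {I J : Type} [Fintype I] [Fintype J] {L : ℝ≥0} {A M : ℝ}
  {e : J → E} {a : J → I → I → E → ℝ} {f : I → E → ℝ}

namespace SymmetricSystem

lemma norm_fderiv_le (h : SymmetricSystem L A M e a f) (j : J) (c : I) (x : E) :
    ‖fderiv ℝ (f c) x (e j)‖ ≤ L :=
  ((fderiv ℝ (f c) x).le_opNorm (e j)).trans ((mul_le_of_le_one_right (norm_nonneg _)
    (h.norm_dir j)).trans (norm_fderiv_le_of_lipschitz ℝ (h.lip c)))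

lemma bandPass_systemTerm (h : SymmetricSystem L A M e a f) {ρ σ : ℝ} (hρ : 0 < ρ) (hσ : 0 < σ)
    (c : I) (x : E) :
    bandPass ρ σ (systemTerm e a f c) x =
      ∑ p : J × I, bandPass ρ σ (fun y => a p.1 c p.2 y * fderiv ℝ (f p.2) y (e p.1)) x := by
  refine bandPass_sum hρ hσ Finset.univ (M := fun _ => A * L) (fun p => ?_) (fun p y => ?_) x
  · exact ((h.lip_coeff _ _ _).continuous.aestronglyMeasurable).mul
      (measurable_fderiv_apply_const ℝ _ _).aestronglyMeasurable
  · rw [norm_mul]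
    exact mul_le_mul (h.bound_coeff _ _ _ _) (h.norm_fderiv_le _ _ _) (norm_nonneg _)
      ((norm_nonneg _).trans (h.bound_coeff p.1 c p.2 y))

end SymmetricSystem

lemma eLpNorm_le_highSize (ρ : ℝ) (c : I) :
    eLpNorm (highPass (ρ / 4) (f c)) 2 volume ≤ highSize ρ a f :=
  (Finset.single_le_sum (f := fun c => eLpNorm (highPass (ρ / 4) (f c)) 2 volume)
    (fun _ _ => zero_le) (Finset.mem_univ c)).trans le_self_add

lemma eLpNorm_add_le_highSize (ρ : ℝ) (j : J) (c d : I) :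
    eLpNorm (highPass (ρ / 4) (f d)) 2 volume + eLpNorm (highPass (ρ / 8) (a j c d)) 2 volume ≤
      highSize ρ a f := by
  refine add_le_add (Finset.single_le_sum (f := fun c => eLpNorm (highPass (ρ / 4) (f c)) 2 volume)
    (fun _ _ => zero_le) (Finset.mem_univ d)) ?_
  refine le_trans ?_ (Finset.single_le_sum (f := fun j => ∑ c, ∑ d, eLpNorm
    (highPass (ρ / 8) (a j c d)) 2 volume) (fun _ _ => zero_le) (Finset.mem_univ j))
  refine le_trans ?_ (Finset.single_le_sum (f := fun c => ∑ d, eLpNorm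
    (highPass (ρ / 8) (a j c d)) 2 volume) (fun _ _ => zero_le) (Finset.mem_univ c))
  exact Finset.single_le_sum (f := fun d => eLpNorm
    (highPass (ρ / 8) (a j c d)) 2 volume) (fun _ _ => zero_le) (Finset.mem_univ d)

/-- The band-pass filtered first-order term is square integrable, with a (lossy) bound. -/
lemma exists_eLpNorm_bandPass_systemTerm_le (E : Type) [NormedAddCommGroup E]
    [InnerProductSpace ℝ E] [FiniteDimensional ℝ E] [MeasurableSpace E] [BorelSpace E]
    (I J : Type) [Fintype I] [Fintype J] :
    ∃ C : ℝ, 0 ≤ C ∧ ∀ (ρ σ : ℝ), 0 < ρ → 2 * ρ ≤ σ → ∀ (L : ℝ≥0) (A M : ℝ) (e : J → E)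
      (a : J → I → I → E → ℝ) (f : I → E → ℝ), SymmetricSystem L A M e a f →
      (∀ c, MemLp (f c) 2 volume) → ∀ c,
      eLpNorm (bandPass ρ σ (systemTerm e a f c)) 2 volume ≤
        ENNReal.ofReal (C * L) * highSize ρ a f +
          ENNReal.ofReal (C * A * σ) * ∑ d, eLpNorm (f d) 2 volume := by
  obtain ⟨C₁, hC₁0, hC₁⟩ := exists_eLpNorm_bandPass_mul_fderiv_sub_le E
  set κ := kernelMass E 0
  have hκ : 0 ≤ κ := kernelMass_nonneg 0
  set κ₁ := kernelMass E 1
  have hκ₁ : 0 ≤ κ₁ := kernelMass_nonneg 1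
  set P : ℝ := (Fintype.card (J × I) : ℝ)
  have hP : 0 ≤ P := by positivity
  refine ⟨P * C₁ + P * (2 * κ * κ₁), by positivity, fun ρ σ hρ hσρ L A M e a f h hf2 c => ?_⟩
  have hσ : 0 < σ := by linarith
  have hL : (0 : ℝ) ≤ L := L.2
  have hterm : ∀ p : J × I, eLpNorm (bandPass ρ σ
      (fun y => a p.1 c p.2 y * fderiv ℝ (f p.2) y (e p.1))) 2 volume ≤
      ENNReal.ofReal (C₁ * L) * highSize ρ a f +
        ENNReal.ofReal (2 * κ * κ₁ * A * σ) * ∑ d, eLpNorm (f d) 2 volume := by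
    intro p
    have hA : 0 ≤ A := (norm_nonneg _).trans (h.bound_coeff p.1 c p.2 0)
    have hfm := (hf2 p.2).aestronglyMeasurable
    have ham := (h.lip_coeff p.1 c p.2).continuous.aestronglyMeasurable (μ := volume)
    have hwm : AEStronglyMeasurable (fun x => fderiv ℝ (bandPass ρ σ (f p.2)) x (e p.1)) volume :=
      (measurable_fderiv_apply_const ℝ _ _).aestronglyMeasurable
    have hbm : AEStronglyMeasurable (lowPass (ρ / 8) (a p.1 c p.2)) volume :=
      aestronglyMeasurable_lowPass ham
    have e1 : bandPass ρ σ (fun y => a p.1 c p.2 y * fderiv ℝ (f p.2) y (e p.1)) =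
        (fun x => bandPass ρ σ (fun y => a p.1 c p.2 y * fderiv ℝ (f p.2) y (e p.1)) x -
          lowPass (ρ / 8) (a p.1 c p.2) x * fderiv ℝ (bandPass ρ σ (f p.2)) x (e p.1)) +
        fun x => lowPass (ρ / 8) (a p.1 c p.2) x * fderiv ℝ (bandPass ρ σ (f p.2)) x (e p.1) := by
      ext1 x; rw [Pi.add_apply, sub_add_cancel]
    rw [e1]
    have hqm : AEStronglyMeasurable (fun y => a p.1 c p.2 y * fderiv ℝ (f p.2) y (e p.1)) volume :=
      ham.mul (measurable_fderiv_apply_const ℝ _ _).aestronglyMeasurable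
    refine (eLpNorm_add_le ((aestronglyMeasurable_bandPass hqm).sub (hbm.mul hwm)) (hbm.mul hwm)
      (by norm_num)).trans (add_le_add ?_ ?_)
    · refine (hC₁ ρ σ hρ hσρ L _ _ (h.lip_coeff _ _ _) (h.lip _) A M (h.bound_coeff _ _ _)
        (h.bound _) (e p.1) (h.norm_dir _)).trans ?_
      gcongr
      exact eLpNorm_add_le_highSize ρ p.1 c p.2
    · have h1 : eLpNorm (lowPass (ρ / 8) (a p.1 c p.2) *
          fun x => fderiv ℝ (bandPass ρ σ (f p.2)) x (e p.1)) 2 volume ≤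
          ENNReal.ofReal (κ * A) *
            eLpNorm (fun x => fderiv ℝ (bandPass ρ σ (f p.2)) x (e p.1)) 2 volume := by
        refine eLpNorm_le_mul_eLpNorm_of_ae_le_mul (Filter.Eventually.of_forall fun x => ?_) 2
        rw [Pi.mul_apply, norm_mul]
        gcongr
        exact norm_lowPass_le (by linarith) (h.bound_coeff _ _ _) x
      refine h1.trans ?_
      have h2 := eLpNorm_fderiv_bandPass_le hρ (by linarith : ρ ≤ σ) hfm (h.bound p.2)
        (h.norm_dir p.1)
      calc _ ≤ ENNReal.ofReal (κ * A) * (ENNReal.ofReal (2 * σ * κ₁) *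
            ∑ d, eLpNorm (f d) 2 volume) := by
            refine mul_le_mul' le_rfl (h2.trans (mul_le_mul' le_rfl ?_))
            exact Finset.single_le_sum (f := fun d => eLpNorm (f d) 2 volume)
              (fun _ _ => zero_le) (Finset.mem_univ p.2)
        _ = _ := by
            rw [← mul_assoc, ← ENNReal.ofReal_mul (by positivity)]
            congr 2; ring
  have e0 : bandPass ρ σ (systemTerm e a f c) =
      ∑ p : J × I, bandPass ρ σ (fun y => a p.1 c p.2 y * fderiv ℝ (f p.2) y (e p.1)) := by
    ext1 x
    rw [h.bandPass_systemTerm hρ hσ, Finset.sum_apply]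
  rw [e0]
  refine (eLpNorm_sum_le (fun p _ => aestronglyMeasurable_bandPass
    (((h.lip_coeff _ _ _).continuous.aestronglyMeasurable).mul
      (measurable_fderiv_apply_const ℝ _ _).aestronglyMeasurable)) (by norm_num)).trans ?_
  rcases isEmpty_or_nonempty (J × I) with hE | ⟨⟨p⟩⟩
  · simp
  have hA : 0 ≤ A := (norm_nonneg _).trans (h.bound_coeff p.1 c p.2 0)
  refine (Finset.sum_le_sum fun p _ => hterm p).trans ?_
  rw [Finset.sum_const, Finset.card_univ, nsmul_eq_mul, ← ENNReal.ofReal_natCast, mul_add,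
    ← mul_assoc, ← mul_assoc, ← ENNReal.ofReal_mul hP, ← ENNReal.ofReal_mul hP]
  have t1 : 0 ≤ P * (2 * κ * κ₁) * L := by positivity
  have t2 : 0 ≤ P * C₁ * A * σ := by positivity
  exact add_le_add (mul_le_mul' (ENNReal.ofReal_le_ofReal (by linarith)) le_rfl)
    (mul_le_mul' (ENNReal.ofReal_le_ofReal (by linarith)) le_rfl)

/-- Energy estimate for the band-pass filtered system: no derivative of `f` is lost. -/
lemma exists_integral_bandPass_mul_systemTerm_le (E : Type) [NormedAddCommGroup E]
    [InnerProductSpace ℝ E] [FiniteDimensional ℝ E] [MeasurableSpace E] [BorelSpace E]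
    (I J : Type) [Fintype I] [Fintype J] :
    ∃ C : ℝ, 0 ≤ C ∧ ∀ (ρ σ : ℝ), 0 < ρ → 2 * ρ ≤ σ → ∀ (L : ℝ≥0) (A M : ℝ) (e : J → E)
      (a : J → I → I → E → ℝ) (f : I → E → ℝ), SymmetricSystem L A M e a f →
      (∀ c, MemLp (f c) 2 volume) → highSize ρ a f ≠ ⊤ →
      ENNReal.ofReal (∫ x, ∑ c, bandPass ρ σ (f c) x * bandPass ρ σ (systemTerm e a f c) x) ≤
        ENNReal.ofReal (C * L) * highSize ρ a f ^ 2 := by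
  obtain ⟨C₁, hC₁0, hC₁⟩ := exists_eLpNorm_bandPass_mul_fderiv_sub_le E
  set κ := kernelMass E 0
  have hκ : 0 ≤ κ := kernelMass_nonneg 0
  set P : ℝ := (Fintype.card J : ℝ) * (Fintype.card I : ℝ) * (Fintype.card I : ℝ) with hP
  have hP0 : 0 ≤ P := by positivity
  set κ' := κ * (1 + κ) with hκ'
  have hκ'0 : 0 ≤ κ' := by positivity
  refine ⟨P * (κ' * κ * κ' + κ' * C₁), by positivity, fun ρ σ hρ hσρ L A M e a f h hf2 hfin => ?_⟩
  have hσ : 0 < σ := by linarith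
  have hL : (0 : ℝ) ≤ L := L.2
  set z := (highSize ρ a f).toReal with hz
  have hz0 : 0 ≤ z := ENNReal.toReal_nonneg
  set w : I → E → ℝ := fun c => bandPass ρ σ (f c) with hw
  set b : J → I → I → E → ℝ := fun j c d => lowPass (ρ / 8) (a j c d) with hb
  have hfm := fun c => (hf2 c).aestronglyMeasurable
  have ham := fun j c d => (h.lip_coeff j c d).continuous.aestronglyMeasurable (μ := volume)
  have hw2 : ∀ c, MemLp (w c) 2 volume := fun c => memLp_bandPass hρ hσ (hf2 c)
  have hwz : ∀ c, (eLpNorm (w c) 2 volume).toReal ≤ κ' * z := by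
    intro c
    have h1 := (eLpNorm_bandPass_le_highPass hρ hσρ (hfm c) (h.bound c)).trans
      (mul_le_mul' le_rfl (eLpNorm_le_highSize (a := a) (f := f) ρ c))
    have h2 := ENNReal.toReal_mono (ENNReal.mul_ne_top ENNReal.ofReal_ne_top hfin) h1
    rwa [ENNReal.toReal_mul, ENNReal.toReal_ofReal hκ'0] at h2
  have hdw : ∀ c j, MemLp (fun x => fderiv ℝ (w c) x (e j)) 2 volume := fun c j =>
    ⟨(measurable_fderiv_apply_const ℝ _ _).aestronglyMeasurable,
      (eLpNorm_fderiv_bandPass_le hρ (by linarith : ρ ≤ σ) (hfm c) (h.bound c)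
        (h.norm_dir j)).trans_lt (ENNReal.mul_lt_top ENNReal.ofReal_lt_top (hf2 c).2)⟩
  have hbA : ∀ j c d x, ‖b j c d x‖ ≤ κ * A := fun j c d x =>
    norm_lowPass_le (by linarith) (h.bound_coeff j c d) x
  have hbL : ∀ j c d x, ‖fderiv ℝ (b j c d) x (e j)‖ ≤ κ * L := by
    intro j c d x
    refine ((fderiv ℝ (b j c d) x).le_opNorm (e j)).trans ((mul_le_of_le_one_right (norm_nonneg _)
      (h.norm_dir j)).trans ?_)
    have := norm_fderiv_le_of_lipschitz ℝ (x₀ := x) (lipschitzWith_lowPass (r := ρ / 8)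
      (by linarith) (h.lip_coeff j c d) (h.bound_coeff j c d))
    rwa [NNReal.coe_mul, Real.coe_toNNReal _ hκ] at this
  have hbd : ∀ j c d, Differentiable ℝ (b j c d) := fun j c d =>
    (contDiff_lowPass (by linarith) (ham j c d) (h.bound_coeff j c d)).differentiable (by simp)
  have hbdw : ∀ j c d, MemLp (fun x => b j c d x * fderiv ℝ (w d) x (e j)) 2 volume :=
    fun j c d => (hdw d j).of_le_mul (c := κ * A)
      ((hbd j c d).continuous.aestronglyMeasurable.mul (hdw d j).aestronglyMeasurable)
      (Filter.Eventually.of_forall fun x => by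
        rw [norm_mul]; gcongr; exact hbA j c d x)
  -- the error of the paraproduct estimate
  set err : J → I → I → E → ℝ := fun j c d x =>
    bandPass ρ σ (fun y => a j c d y * fderiv ℝ (f d) y (e j)) x -
      b j c d x * fderiv ℝ (w d) x (e j) with herr
  have herr1 : ∀ j c d, eLpNorm (err j c d) 2 volume ≤
      ENNReal.ofReal (C₁ * L) * highSize ρ a f := fun j c d =>
    (hC₁ ρ σ hρ hσρ L _ _ (h.lip_coeff j c d) (h.lip d) A M (h.bound_coeff j c d) (h.bound d)
      (e j) (h.norm_dir j)).trans (mul_le_mul' le_rfl (eLpNorm_add_le_highSize ρ j c d))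
  have hfin' : ENNReal.ofReal (C₁ * L) * highSize ρ a f ≠ ⊤ :=
    ENNReal.mul_ne_top ENNReal.ofReal_ne_top hfin
  have herrm : ∀ j c d, MemLp (err j c d) 2 volume := fun j c d =>
    ⟨(aestronglyMeasurable_bandPass ((ham j c d).mul
      (measurable_fderiv_apply_const ℝ _ _).aestronglyMeasurable)).sub
        (hbdw j c d).aestronglyMeasurable, (herr1 j c d).trans_lt hfin'.lt_top⟩
  have herr2 : ∀ j c d, (eLpNorm (err j c d) 2 volume).toReal ≤ C₁ * L * z := by
    intro j c d
    have h2 := ENNReal.toReal_mono hfin' (herr1 j c d)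
    rwa [ENNReal.toReal_mul, ENNReal.toReal_ofReal (by positivity)] at h2
  have hdbw : ∀ j c d, MemLp (fun x => fderiv ℝ (b j c d) x (e j) * w d x) 2 volume :=
    fun j c d => (hw2 d).of_le_mul (c := κ * L)
      ((measurable_fderiv_apply_const ℝ _ _).aestronglyMeasurable.mul
        (hw2 d).aestronglyMeasurable)
      (Filter.Eventually.of_forall fun x => by
        rw [norm_mul]; gcongr; exact hbL j c d x)
  have hdbw' : ∀ j c d, (eLpNorm (fun x => fderiv ℝ (b j c d) x (e j) * w d x) 2 volume).toReal ≤
      κ * L * (κ' * z) := by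
    intro j c d
    have h1 : eLpNorm (fun x => fderiv ℝ (b j c d) x (e j) * w d x) 2 volume ≤
        ENNReal.ofReal (κ * L) * eLpNorm (w d) 2 volume :=
      eLpNorm_le_mul_eLpNorm_of_ae_le_mul (Filter.Eventually.of_forall fun x => by
        rw [norm_mul]; gcongr; exact hbL j c d x) 2
    have h2 := ENNReal.toReal_mono (ENNReal.mul_ne_top ENNReal.ofReal_ne_top
      (hw2 d).eLpNorm_ne_top) h1
    rw [ENNReal.toReal_mul, ENNReal.toReal_ofReal (by positivity)] at h2
    refine h2.trans ?_
    gcongr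
    exact hwz d
  -- the integral splits into the principal part and the errors
  have hsplit : ∫ x, ∑ c, w c x * bandPass ρ σ (systemTerm e a f c) x =
      (∑ j, ∑ c, ∑ d, ∫ x, w c x * (b j c d x * fderiv ℝ (w d) x (e j))) +
        ∑ j, ∑ c, ∑ d, ∫ x, w c x * err j c d x := by
    have e1 : ∀ x, ∑ c, w c x * bandPass ρ σ (systemTerm e a f c) x =
        ∑ j, ∑ c, ∑ d, (w c x * (b j c d x * fderiv ℝ (w d) x (e j)) + w c x * err j c d x) := by
      intro x
      rw [Finset.sum_comm]
      refine Finset.sum_congr rfl fun c _ => ?_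
      rw [h.bandPass_systemTerm hρ hσ, Fintype.sum_prod_type, Finset.mul_sum]
      refine Finset.sum_congr rfl fun j _ => ?_
      rw [Finset.mul_sum]
      refine Finset.sum_congr rfl fun d _ => ?_
      rw [herr]
      ring
    simp only [e1]
    have i1 : ∀ j c d, Integrable (fun x => w c x * (b j c d x * fderiv ℝ (w d) x (e j))) volume :=
      fun j c d => integrable_mul_of_memLp (hw2 c) (hbdw j c d)
    have i2 : ∀ j c d, Integrable (fun x => w c x * err j c d x) volume :=
      fun j c d => integrable_mul_of_memLp (hw2 c) (herrm j c d)
    have i3 : ∀ j c d, Integrable (fun x => w c x * (b j c d x * fderiv ℝ (w d) x (e j)) +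
        w c x * err j c d x) volume := fun j c d => (i1 j c d).add (i2 j c d)
    rw [integral_finsetSum _ fun j _ => integrable_finsetSum _ fun c _ =>
      integrable_finsetSum _ fun d _ => i3 j c d, ← Finset.sum_add_distrib]
    refine Finset.sum_congr rfl fun j _ => ?_
    rw [integral_finsetSum _ fun c _ =>
      integrable_finsetSum _ fun d _ => i3 j c d, ← Finset.sum_add_distrib]
    refine Finset.sum_congr rfl fun c _ => ?_
    rw [integral_finsetSum _ fun d _ => i3 j c d, ← Finset.sum_add_distrib]
    exact Finset.sum_congr rfl fun d _ => integral_add (i1 j c d) (i2 j c d)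
  -- The principal part loses its derivative to the low-pass filtered coefficients.
  have hmain : ∑ j, ∑ c, ∑ d, ∫ x, w c x * (b j c d x * fderiv ℝ (w d) x (e j)) ≤
      ∑ _j : J, ∑ _c : I, ∑ _d : I, κ' * κ * κ' * L * z ^ 2 := by
    refine Finset.sum_le_sum fun j _ => ?_
    have h1 := integral_symmetric_form (fun c => (contDiff_bandPass hρ hσ (hfm c)
      (h.bound c)).differentiable (by simp)) hw2 (hdw · j) (hbd j)
      (fun c d => by rw [hb]; simp only [h.symm j c d]) (hbA j) (hbL j)
    have h2 : -∑ c, ∑ d, ∫ x, w c x * (fderiv ℝ (b j c d) x (e j) * w d x) ≤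
        ∑ _c : I, ∑ _d : I, κ' * κ * κ' * L * z ^ 2 := by
      simp only [← Finset.sum_neg_distrib]
      refine Finset.sum_le_sum fun c _ => Finset.sum_le_sum fun d _ => ?_
      refine (neg_le_abs _).trans ((abs_integral_mul_le (hw2 c) (hdbw j c d)).trans ?_)
      calc _ ≤ κ' * z * (κ * L * (κ' * z)) :=
            mul_le_mul (hwz c) (hdbw' j c d) ENNReal.toReal_nonneg (by positivity)
        _ = _ := by ring
    have h3 : 0 ≤ ∑ _c : I, ∑ _d : I, κ' * κ * κ' * L * z ^ 2 := by positivity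
    linarith
  have herror : ∑ j, ∑ c, ∑ d, ∫ x, w c x * err j c d x ≤
      ∑ _j : J, ∑ _c : I, ∑ _d : I, κ' * C₁ * L * z ^ 2 := by
    refine Finset.sum_le_sum fun j _ => Finset.sum_le_sum fun c _ => Finset.sum_le_sum fun d _ => ?_
    refine (le_abs_self _).trans ((abs_integral_mul_le (hw2 c) (herrm j c d)).trans ?_)
    calc _ ≤ κ' * z * (C₁ * L * z) :=
          mul_le_mul (hwz c) (herr2 j c d) ENNReal.toReal_nonneg (by positivity)
      _ = _ := by ring
  have hfinal : ∫ x, ∑ c, w c x * bandPass ρ σ (systemTerm e a f c) x ≤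
      P * (κ' * κ * κ' + κ' * C₁) * L * z ^ 2 := by
    rw [hsplit]
    refine (add_le_add hmain herror).trans (le_of_eq ?_)
    simp only [Finset.sum_const, Finset.card_univ, nsmul_eq_mul]
    rw [hP]; ring
  refine (ENNReal.ofReal_le_ofReal hfinal).trans (le_of_eq ?_)
  rw [ENNReal.ofReal_mul (by positivity), ENNReal.ofReal_pow hz0, hz, ENNReal.ofReal_toReal hfin]

end StaticEnergy

/-! ### The weighted energy estimate -/

section WeightedEnergy

variable {E : Type} [NormedAddCommGroup E] [InnerProductSpace ℝ E] [FiniteDimensional ℝ E]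
  [MeasurableSpace E] [BorelSpace E]

/-- A positive integrable weight whose logarithmic derivative is of size `ε`. It is Lipschitz but not
differentiable at the origin, so its increments are estimated instead of its derivative. -/
def decayWeight (ε : ℝ) (x : E) : ℝ := ((1 + ε * ‖x‖) ^ (Module.finrank ℝ E + 1))⁻¹

lemma one_le_one_add_mul_norm {ε : ℝ} (hε : 0 ≤ ε) (x : E) : 1 ≤ 1 + ε * ‖x‖ :=
  le_add_of_nonneg_right (by positivity)

lemma decayWeight_pos {ε : ℝ} (hε : 0 ≤ ε) (x : E) : 0 < decayWeight ε x := by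
  have := one_le_one_add_mul_norm hε x
  exact inv_pos.2 (pow_pos (by linarith) _)

lemma decayWeight_le_one {ε : ℝ} (hε : 0 ≤ ε) (x : E) : decayWeight ε x ≤ 1 :=
  inv_le_one_of_one_le₀ (one_le_pow₀ (one_le_one_add_mul_norm hε x))

lemma continuous_decayWeight {ε : ℝ} (hε : 0 ≤ ε) : Continuous (decayWeight (E := E) ε) := by
  refine Continuous.inv₀ (by fun_prop) fun x => ?_
  have := one_le_one_add_mul_norm hε x
  exact (pow_pos (by linarith) _).ne'

lemma integrable_decayWeight {ε : ℝ} (hε : 0 < ε) :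
    Integrable (decayWeight (E := E) ε) volume := by
  have h1 := integrable_one_add_norm (E := E) (μ := volume) (r := (Module.finrank ℝ E + 1 : ℕ))
    (by push_cast; linarith)
  refine (h1.comp_smul hε.ne').congr (Filter.Eventually.of_forall fun x => ?_)
  have := one_le_one_add_mul_norm hε.le x
  simp only [norm_smul, Real.norm_of_nonneg hε.le, decayWeight]
  rw [Real.rpow_neg (by linarith), Real.rpow_natCast]

lemma decayWeight_add_le {ε : ℝ} (hε : 0 ≤ ε) (x h : E) :
    decayWeight ε (x + h) ≤ (1 + ε * ‖h‖) ^ (Module.finrank ℝ E + 1) * decayWeight ε x := by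
  have h1 := one_le_one_add_mul_norm hε x
  have h2 := one_le_one_add_mul_norm hε (x + h)
  have h3 := one_le_one_add_mul_norm hε h
  unfold decayWeight
  rw [← div_eq_mul_inv, le_div_iff₀ (pow_pos (by linarith) _),
    inv_mul_le_iff₀ (pow_pos (by linarith) _), ← mul_pow]
  refine pow_le_pow_left₀ (by linarith) ?_ _
  have h4 : ‖x‖ ≤ ‖x + h‖ + ‖h‖ := by
    calc ‖x‖ = ‖(x + h) - h‖ := by rw [add_sub_cancel_right]
      _ ≤ _ := norm_sub_le _ _
  have h5 : 0 ≤ ε * ‖x + h‖ * (ε * ‖h‖) := by positivity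
  nlinarith [mul_le_mul_of_nonneg_left h4 hε]

lemma abs_decayWeight_add_sub_le {ε : ℝ} (hε : 0 ≤ ε) (x h : E) :
    |decayWeight ε (x + h) - decayWeight ε x| ≤
      ((1 + ε * ‖h‖) ^ (Module.finrank ℝ E + 1) - 1) * decayWeight ε x := by
  have h1 := decayWeight_add_le hε x h
  have h2 := decayWeight_add_le hε (x + h) (-h)
  rw [add_neg_cancel_right, norm_neg] at h2
  set s := (1 + ε * ‖h‖) ^ (Module.finrank ℝ E + 1)
  have hs : 1 ≤ s := one_le_pow₀ (one_le_one_add_mul_norm hε h)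
  have h3 := decayWeight_pos hε x
  have h4 := decayWeight_pos hε (x + h)
  rw [abs_le]
  constructor
  · -- `φ (x + h) ≥ s⁻¹ φ x ≥ (2 - s) φ x`
    rcases le_or_gt 2 s with h5 | h5
    · nlinarith
    · nlinarith [mul_le_mul_of_nonneg_left h2 (by linarith : 0 ≤ 2 - s), sq_nonneg (s - 1)]
  · linarith

/-- Integration by parts against the weight. There are no boundary terms because the weight is integrable
and `p` is bounded, and the derivative of the weight costs only a factor of size `ε`. -/
lemma abs_integral_lineDeriv_mul_decayWeight_le {ε : ℝ} (hε : 0 < ε) {p : E → ℝ} {L : ℝ≥0}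
    (hp : LipschitzWith L p) {M : ℝ} (hM : ∀ x, |p x| ≤ M) {v : E} (hv : ‖v‖ ≤ 1) :
    |∫ x, lineDeriv ℝ p x v * decayWeight ε x| ≤
      (Module.finrank ℝ E + 1) * ε * ∫ x, |p x| * decayWeight ε x := by
  set N := Module.finrank ℝ E + 1 with hN
  have hφ := integrable_decayWeight (E := E) hε
  have hpφ : ∀ {g : E → ℝ}, Integrable g volume → Integrable (fun x => p x * g x) volume :=
    fun hg => hg.bdd_mul (c := M) hp.continuous.aestronglyMeasurable
      (Filter.Eventually.of_forall hM)
  have habs : Integrable (fun x => |p x| * decayWeight ε x) volume := by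
    refine (hpφ hφ).norm.congr (Filter.Eventually.of_forall fun x => ?_)
    simp only [norm_mul, Real.norm_eq_abs, abs_of_pos (decayWeight_pos hε.le x)]
  have hI0 : 0 ≤ ∫ x, |p x| * decayWeight ε x :=
    integral_nonneg fun x => mul_nonneg (abs_nonneg _) (decayWeight_pos hε.le x).le
  have h1 := (hp.integral_inv_smul_sub_mul_tendsto_integral_lineDeriv_mul hφ v).abs
  have h2 : Filter.Tendsto (fun t : ℝ => t⁻¹ * ((1 + ε * t) ^ N - 1) *
      ∫ x, |p x| * decayWeight ε x) (nhdsWithin 0 (Ioi 0))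
      (nhds (N * ε * ∫ x, |p x| * decayWeight ε x)) := by
    refine Filter.Tendsto.mul_const _ ?_
    have hd : HasDerivAt (fun t : ℝ => (1 + ε * t) ^ N) (N * ε) 0 := by
      have := (((hasDerivAt_id (0 : ℝ)).const_mul ε).const_add 1).fun_pow N
      simpa using this
    have := hd.tendsto_slope_zero_right
    simpa using this
  have hcast : ((N : ℕ) : ℝ) = Module.finrank ℝ E + 1 := by rw [hN]; push_cast; rfl
  rw [← hcast]
  refine le_of_tendsto_of_tendsto h1 h2 ?_
  filter_upwards [self_mem_nhdsWithin] with t ht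
  have ht' : 0 < t := ht
  have hφt : Integrable (fun x => decayWeight ε (x + -(t • v))) volume :=
    hφ.comp_add_right (-(t • v))
  have e1 : ∫ x, t⁻¹ • (p (x + t • v) - p x) * decayWeight ε x =
      t⁻¹ * ∫ x, p x * (decayWeight ε (x + -(t • v)) - decayWeight ε x) := by
    have i1 : Integrable (fun x => p (x + t • v) * decayWeight ε x) volume := by
      refine ((hpφ hφt).comp_add_right (t • v)).congr (Filter.Eventually.of_forall fun x => ?_)
      simp only [add_neg_cancel_right]
    have i2 := hpφ hφ
    have e2 : ∫ x, p (x + t • v) * decayWeight ε x =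
        ∫ x, p x * decayWeight ε (x + -(t • v)) := by
      rw [← integral_add_right_eq_self (fun x => p x * decayWeight ε (x + -(t • v))) (t • v)]
      simp only [add_neg_cancel_right]
    simp only [smul_eq_mul, mul_assoc, sub_mul, mul_sub]
    rw [integral_sub (i1.const_mul _) (i2.const_mul _), integral_const_mul, integral_const_mul,
      e2, integral_sub (hpφ hφt) i2, mul_sub]
  rw [e1, abs_mul, abs_of_pos (inv_pos.2 ht'), mul_assoc]
  refine mul_le_mul_of_nonneg_left ?_ (inv_pos.2 ht').le
  rw [← integral_const_mul]
  refine (abs_integral_le_integral_abs).trans (integral_mono_of_nonneg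
    (Filter.Eventually.of_forall fun x => abs_nonneg _) (habs.const_mul _)
    (Filter.Eventually.of_forall fun x => ?_))
  simp only [abs_mul]
  have h3 := abs_decayWeight_add_sub_le hε.le x (-(t • v))
  have h4 : ‖-(t • v)‖ ≤ t := by
    rw [norm_neg, norm_smul, Real.norm_of_nonneg ht'.le]
    exact mul_le_of_le_one_right ht'.le hv
  have h5 : (1 + ε * ‖-(t • v)‖) ^ N ≤ (1 + ε * t) ^ N := by gcongr
  have h6 := decayWeight_pos hε.le x
  calc _ ≤ |p x| * (((1 + ε * ‖-(t • v)‖) ^ N - 1) * decayWeight ε x) := by gcongr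
    _ ≤ |p x| * (((1 + ε * t) ^ N - 1) * decayWeight ε x) := by gcongr
    _ = _ := by ring

lemma exists_lipschitzWith_mul {p q : E → ℝ} {K L : ℝ≥0} (hp : LipschitzWith K p)
    (hq : LipschitzWith L q) {M N : ℝ} (hM : ∀ x, |p x| ≤ M) (hN : ∀ x, |q x| ≤ N) :
    ∃ C, LipschitzWith C fun x => p x * q x := by
  have hM0 : 0 ≤ M := (abs_nonneg _).trans (hM 0)
  have hN0 : 0 ≤ N := (abs_nonneg _).trans (hN 0)
  refine ⟨(M * L + N * K).toNNReal, LipschitzWith.of_dist_le_mul fun x y => ?_⟩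
  have hK := hp.dist_le_mul x y
  have hL := hq.dist_le_mul x y
  rw [Real.coe_toNNReal _ (by positivity)]
  rw [Real.dist_eq] at *
  calc |p x * q x - p y * q y| = |p x * (q x - q y) + q y * (p x - p y)| := by congr 1; ring
    _ ≤ |p x| * |q x - q y| + |q y| * |p x - p y| := by
        refine (abs_add_le _ _).trans ?_; rw [abs_mul, abs_mul]
    _ ≤ M * (L * dist x y) + N * (K * dist x y) := by
        gcongr
        · exact hM x
        · exact hN y
    _ = _ := by ring

variable {I J : Type} [Fintype I] [Fintype J] {L : ℝ≥0} {A M : ℝ}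
  {e : J → E} {a : J → I → I → E → ℝ} {f : I → E → ℝ}

/-- Weighted energy estimate for a symmetric system; square integrability is not required. -/
lemma SymmetricSystem.abs_integral_decayWeight_le (h : SymmetricSystem L A M e a f) {ε : ℝ}
    (hε : 0 < ε) (hA : 0 ≤ A) :
    |∫ x, decayWeight ε x * ∑ c, f c x * systemTerm e a f c x| ≤
      (Fintype.card J * Fintype.card I) * ((Module.finrank ℝ E + 1) * ε * A + L) *
        ∫ x, decayWeight ε x * ∑ c, f c x ^ 2 := by
  have hφ := integrable_decayWeight (E := E) hε
  have hφ0 := decayWeight_pos (E := E) hε.le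
  have hL : (0 : ℝ) ≤ L := L.2
  -- products of bounded measurable functions with the weight are integrable
  have hint : ∀ {g : E → ℝ} {K : ℝ}, AEStronglyMeasurable g volume → (∀ x, |g x| ≤ K) →
      Integrable (fun x => decayWeight ε x * g x) volume := fun hg hK =>
    hφ.mul_bdd hg (Filter.Eventually.of_forall hK)
  have hfm := fun c => (h.lip c).continuous.aestronglyMeasurable (μ := volume)
  have ham := fun j c d => (h.lip_coeff j c d).continuous.aestronglyMeasurable (μ := volume)
  have hdfm : ∀ c j, AEStronglyMeasurable (fun x => fderiv ℝ (f c) x (e j)) volume :=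
    fun c j => (measurable_fderiv_apply_const ℝ _ _).aestronglyMeasurable
  have hdam : ∀ j c d, AEStronglyMeasurable (fun x => fderiv ℝ (a j c d) x (e j)) volume :=
    fun j c d => (measurable_fderiv_apply_const ℝ _ _).aestronglyMeasurable
  have hdaL : ∀ j c d x, |fderiv ℝ (a j c d) x (e j)| ≤ L := fun j c d x =>
    ((fderiv ℝ (a j c d) x).le_opNorm (e j)).trans ((mul_le_of_le_one_right (norm_nonneg _)
      (h.norm_dir j)).trans (norm_fderiv_le_of_lipschitz ℝ (h.lip_coeff j c d)))
  have hM0 : ∀ c : I, 0 ≤ M := fun c => (norm_nonneg _).trans (h.bound c 0)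
  have b3 : ∀ {x y z X Y Z : ℝ}, |x| ≤ X → |y| ≤ Y → |z| ≤ Z → |x * (y * z)| ≤ X * (Y * Z) := by
    intro x y z X Y Z hx hy hz
    rw [abs_mul, abs_mul]
    have := (abs_nonneg _).trans hx
    have := (abs_nonneg _).trans hy
    gcongr
  -- the three types of terms in the derivative of `f_c a_{jcd} f_d`
  set P : J → I → I → ℝ := fun j c d =>
    ∫ x, decayWeight ε x * (f c x * (a j c d x * fderiv ℝ (f d) x (e j))) with hP
  set Q : J → I → I → ℝ := fun j c d =>
    ∫ x, decayWeight ε x * (f c x * (fderiv ℝ (a j c d) x (e j) * f d x)) with hQ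
  set S : I → I → ℝ := fun c d => ∫ x, decayWeight ε x * (|f c x| * |f d x|) with hS
  have iS : ∀ c d, Integrable (fun x => decayWeight ε x * (|f c x| * |f d x|)) volume := fun c d =>
    hint (K := M * M) ((hfm c).norm.mul (hfm d).norm) fun x => by
      rw [abs_mul, abs_abs, abs_abs]
      exact mul_le_mul (h.bound c x) (h.bound d x) (abs_nonneg _) (hM0 c)
  have iP : ∀ j c d, Integrable (fun x => decayWeight ε x *
      (f c x * (a j c d x * fderiv ℝ (f d) x (e j)))) volume := fun j c d =>
    hint ((hfm c).mul ((ham j c d).mul (hdfm d j))) fun x =>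
      b3 (h.bound c x) (h.bound_coeff j c d x) (h.norm_fderiv_le j d x)
  have iQ : ∀ j c d, Integrable (fun x => decayWeight ε x *
      (f c x * (fderiv ℝ (a j c d) x (e j) * f d x))) volume := fun j c d =>
    hint ((hfm c).mul ((hdam j c d).mul (hfm d))) fun x =>
      b3 (h.bound c x) (hdaL j c d x) (h.bound d x)
  have hQS : ∀ j c d, |Q j c d| ≤ L * S c d := by
    intro j c d
    rw [hQ, hS, ← integral_const_mul]
    refine abs_integral_le_integral_abs.trans (integral_mono (iQ j c d).abs
      ((iS c d).const_mul _) fun x => ?_)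
    simp only [abs_mul, abs_of_pos (hφ0 x)]
    have := hdaL j c d x
    calc _ ≤ decayWeight ε x * (|f c x| * (L * |f d x|)) := by
          have := (hφ0 x).le
          gcongr
      _ = _ := by ring
  -- the integral of the derivative of `f_c a_{jcd} f_d` against the weight
  have hPPQ : ∀ j c d, |P j c d + P j d c + Q j c d| ≤
      (Module.finrank ℝ E + 1) * ε * A * S c d := by
    intro j c d
    obtain ⟨K₁, hK₁⟩ := exists_lipschitzWith_mul (h.lip_coeff j c d) (h.lip d)
      (h.bound_coeff j c d) (h.bound d)
    have hb1 : ∀ x, |a j c d x * f d x| ≤ A * M := fun x => by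
      rw [abs_mul]
      exact mul_le_mul (h.bound_coeff j c d x) (h.bound d x) (abs_nonneg _) hA
    obtain ⟨K₂, hK₂⟩ := exists_lipschitzWith_mul (h.lip c) hK₁ (h.bound c) hb1
    have h1 := abs_integral_lineDeriv_mul_decayWeight_le hε hK₂ (M := M * (A * M))
      (fun x => b3 (h.bound c x) (h.bound_coeff j c d x) (h.bound d x)) (h.norm_dir j)
    have e1 : ∫ x, lineDeriv ℝ (fun x => f c x * (a j c d x * f d x)) x (e j) * decayWeight ε x =
        P j c d + P j d c + Q j c d := by
      rw [hP, hQ]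
      have iPP : Integrable (fun x => decayWeight ε x *
          (f c x * (a j c d x * fderiv ℝ (f d) x (e j))) + decayWeight ε x *
          (f d x * (a j d c x * fderiv ℝ (f c) x (e j)))) volume := (iP j c d).add (iP j d c)
      beta_reduce
      rw [← integral_add (iP j c d) (iP j d c), ← integral_add iPP (iQ j c d)]
      refine integral_congr_ae ?_
      filter_upwards [(h.lip c).ae_differentiableAt (μ := volume),
        (h.lip d).ae_differentiableAt (μ := volume),
        (h.lip_coeff j c d).ae_differentiableAt (μ := volume)] with x h1 h2 h3
      have h4 : DifferentiableAt ℝ (fun x => f c x * (a j c d x * f d x)) x := h1.mul (h3.mul h2)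
      rw [h4.lineDeriv_eq_fderiv, fderiv_fun_mul h1 (h3.fun_mul h2), fderiv_fun_mul h3 h2, h.symm j d c]
      simp only [add_apply, smul_apply, smul_eq_mul]
      ring
    rw [e1] at h1
    refine h1.trans ?_
    rw [mul_assoc _ A, hS, ← integral_const_mul A]
    refine mul_le_mul_of_nonneg_left ?_ (by positivity)
    refine integral_mono_of_nonneg (Filter.Eventually.of_forall fun x =>
      mul_nonneg (abs_nonneg _) (hφ0 x).le) ((iS c d).const_mul A)
      (Filter.Eventually.of_forall fun x => ?_)
    simp only [abs_mul]
    have := h.bound_coeff j c d x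
    rw [Real.norm_eq_abs] at this
    calc _ ≤ |f c x| * (A * |f d x|) * decayWeight ε x := by
          have := (hφ0 x).le
          gcongr
      _ = _ := by ring
  have hsum : ∫ x, decayWeight ε x * ∑ c, f c x * systemTerm e a f c x =
      ∑ j, ∑ c, ∑ d, P j c d := by
    have e1 : ∀ x, decayWeight ε x * ∑ c, f c x * systemTerm e a f c x = ∑ j, ∑ c, ∑ d,
        decayWeight ε x * (f c x * (a j c d x * fderiv ℝ (f d) x (e j))) := by
      intro x
      simp only [systemTerm, Fintype.sum_prod_type, Finset.mul_sum]
      rw [Finset.sum_comm]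
    simp only [e1]
    rw [integral_finsetSum _ fun j _ => integrable_finsetSum _ fun c _ =>
      integrable_finsetSum _ fun d _ => iP j c d]
    refine Finset.sum_congr rfl fun j _ => ?_
    rw [integral_finsetSum _ fun c _ => integrable_finsetSum _ fun d _ => iP j c d]
    refine Finset.sum_congr rfl fun c _ => ?_
    rw [integral_finsetSum _ fun d _ => iP j c d]
  have hSsum : ∑ c, ∑ d, S c d ≤ Fintype.card I * ∫ x, decayWeight ε x * ∑ c, f c x ^ 2 := by
    have i2 : Integrable (fun x => decayWeight ε x * ∑ c, f c x ^ 2) volume := by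
      simp only [Finset.mul_sum]
      refine integrable_finsetSum _ fun c _ => (iS c c).congr (Filter.Eventually.of_forall fun x => ?_)
      simp only [abs_mul_abs_self, sq]
    rw [← integral_const_mul]
    calc _ = ∫ x, ∑ c, ∑ d, decayWeight ε x * (|f c x| * |f d x|) := by
          rw [integral_finsetSum _ fun c _ => integrable_finsetSum _ fun d _ => iS c d]
          refine Finset.sum_congr rfl fun c _ => ?_
          rw [integral_finsetSum _ fun d _ => iS c d]
      _ ≤ _ := by
          refine integral_mono (integrable_finsetSum _ fun c _ => integrable_finsetSum _ fun d _ =>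
            iS c d) (i2.const_mul _) fun x => ?_
          simp only [← Finset.mul_sum, ← Finset.sum_mul]
          have h2 : (∑ c, |f c x|) * ∑ c, |f c x| ≤ Fintype.card I * ∑ c, f c x ^ 2 := by
            have := sq_sum_le_card_mul_sum_sq (s := Finset.univ) (f := fun c : I => |f c x|)
            simpa [sq, Finset.card_univ] using this
          calc _ ≤ decayWeight ε x * (Fintype.card I * ∑ c, f c x ^ 2) :=
                mul_le_mul_of_nonneg_left h2 (hφ0 x).le
            _ = _ := by ring
  have hswap : ∀ j, ∑ c, ∑ d, P j d c = ∑ c, ∑ d, P j c d := fun j => Finset.sum_comm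
  have hS0 : ∀ c d, 0 ≤ S c d := fun c d => integral_nonneg fun x =>
    mul_nonneg (hφ0 x).le (by positivity)
  set k : ℝ := (Module.finrank ℝ E + 1) * ε * A + L
  have hj : ∀ j, |∑ c, ∑ d, P j c d| ≤ k * ∑ c, ∑ d, S c d := by
    intro j
    have e2 : 2 * ∑ c, ∑ d, P j c d =
        ∑ c, ∑ d, ((P j c d + P j d c + Q j c d) - Q j c d) := by
      simp only [add_sub_cancel_right, Finset.sum_add_distrib]
      rw [hswap j]; ring
    have h1 : |2 * ∑ c, ∑ d, P j c d| ≤ k * ∑ c, ∑ d, S c d := by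
      rw [e2, Finset.mul_sum]
      refine (Finset.abs_sum_le_sum_abs _ _).trans (Finset.sum_le_sum fun c _ => ?_)
      rw [Finset.mul_sum]
      refine (Finset.abs_sum_le_sum_abs _ _).trans (Finset.sum_le_sum fun d _ => ?_)
      refine (abs_sub _ _).trans ((add_le_add (hPPQ j c d) (hQS j c d)).trans (le_of_eq ?_))
      ring
    rw [abs_mul, abs_two] at h1
    have := abs_nonneg (∑ c, ∑ d, P j c d)
    linarith
  rw [hsum]
  have hk : 0 ≤ k := by positivity
  calc _ ≤ ∑ j : J, |∑ c, ∑ d, P j c d| := Finset.abs_sum_le_sum_abs _ _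
    _ ≤ ∑ _j : J, k * (Fintype.card I * ∫ x, decayWeight ε x * ∑ c, f c x ^ 2) :=
        Finset.sum_le_sum fun j _ => (hj j).trans (mul_le_mul_of_nonneg_left hSsum hk)
    _ = _ := by
        rw [Finset.sum_const, Finset.card_univ, nsmul_eq_mul]; ring

end WeightedEnergy

/-! ### Grönwall's inequality -/

section Gronwall

/-- The function `e^{2 ∫ b}` has the derivative `2 b e^{2 ∫ b}` almost everywhere, and the integral of the
derivative of a monotone function is at most its increment. -/
lemma lintegral_mul_exp_integral_le {t : ℝ} (ht : 0 ≤ t) {b : ℝ → ℝ}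
    (hb : IntervalIntegrable b volume 0 t) (hb0 : ∀ τ, 0 ≤ b τ) :
    ∫⁻ τ in Icc 0 t, ENNReal.ofReal (b τ) * ENNReal.ofReal (Real.exp (2 * ∫ r in (0 : ℝ)..τ, b r)) ≤
      ENNReal.ofReal (Real.exp (2 * ∫ r in (0 : ℝ)..t, b r) / 2) := by
  set h : ℝ → ℝ := fun τ => Real.exp (2 * ∫ r in (0 : ℝ)..τ, b r) with hh
  have hsub : ∀ τ ∈ Icc 0 t, IntervalIntegrable b volume 0 τ := fun τ hτ =>
    hb.mono_set (by rw [uIcc_of_le hτ.1, uIcc_of_le ht]; exact Icc_subset_Icc_right hτ.2)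
  have hmono : MonotoneOn h (uIcc 0 t) := by
    rw [uIcc_of_le ht]
    intro x hx y hy hxy
    refine Real.exp_le_exp.2 (mul_le_mul_of_nonneg_left ?_ zero_le_two)
    have h1 : IntervalIntegrable b volume x y := (hsub x hx).symm.trans (hsub y hy)
    rw [← intervalIntegral.integral_add_adjacent_intervals (hsub x hx) h1]
    exact le_add_of_nonneg_right (intervalIntegral.integral_nonneg_of_forall hxy hb0)
  have hderiv : ∀ᵐ τ, τ ∈ uIcc 0 t → deriv h τ = 2 * (b τ * h τ) := by
    filter_upwards [hb.ae_hasDerivAt_integral] with τ hτ hmem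
    have h1 := ((hτ hmem 0 left_mem_uIcc).const_mul 2).exp
    rw [h1.deriv, hh]; ring
  have hle : ∫ τ in (0 : ℝ)..t, deriv h τ ≤ h t := by
    have h1 := hmono.intervalIntegral_deriv_mem_uIcc
    have h2 : h 0 ≤ h t := hmono left_mem_uIcc right_mem_uIcc ht
    rw [uIcc_of_le (by linarith)] at h1
    have : 0 < h 0 := Real.exp_pos _
    linarith [h1.2]
  have hint := hmono.intervalIntegrable_deriv
  have hint' : IntegrableOn (fun τ => b τ * h τ) (Icc 0 t) volume := by
    rw [integrableOn_Icc_iff_integrableOn_Ioc]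
    have h1 := (intervalIntegrable_iff_integrableOn_Ioc_of_le ht).1 hint
    refine (h1.const_mul 2⁻¹).congr ?_
    filter_upwards [ae_restrict_of_ae hderiv, ae_restrict_mem measurableSet_Ioc] with τ h2 h3
    rw [h2 (by rw [uIcc_of_le ht]; exact Ioc_subset_Icc_self h3)]
    ring
  calc _ = ∫⁻ τ in Icc 0 t, ENNReal.ofReal (b τ * h τ) :=
        lintegral_congr fun τ => (ENNReal.ofReal_mul (hb0 τ)).symm
    _ = ENNReal.ofReal (∫ τ in Icc 0 t, b τ * h τ) :=
        (ofReal_integral_eq_lintegral_ofReal hint' (Filter.Eventually.of_forall fun τ =>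
          mul_nonneg (hb0 τ) (Real.exp_pos _).le)).symm
    _ ≤ _ := by
        refine ENNReal.ofReal_le_ofReal ?_
        have e1 : ∫ τ in (0 : ℝ)..t, deriv h τ = 2 * ∫ τ in Icc 0 t, b τ * h τ := by
          rw [integral_Icc_eq_integral_Ioc, ← intervalIntegral.integral_of_le ht,
            ← intervalIntegral.integral_const_mul]
          refine intervalIntegral.integral_congr_ae ?_
          filter_upwards [hderiv] with τ h2 h3
          exact h2 (uIoc_subset_uIcc h3)
        change _ ≤ h t / 2
        linarith

/-- Grönwall's inequality in integrated form, for bounded functions without regularity. -/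
lemma gronwall_lintegral {T : ℝ} {b f : ℝ → ℝ≥0∞}
    (hb : AEMeasurable b (volume.restrict (Icc 0 T))) (hbT : ∫⁻ τ in Icc 0 T, b τ ≠ ⊤)
    {c F₀ : ℝ≥0∞} (hF₀ : F₀ ≠ ⊤) (hf : ∀ t ∈ Icc 0 T, f t ≤ F₀)
    (h : ∀ t ∈ Icc 0 T, f t ≤ c + ∫⁻ τ in Icc 0 t, b τ * f τ) {t : ℝ} (ht : t ∈ Icc 0 T) :
    f t ≤ 2 * c * ENNReal.ofReal (Real.exp (2 * (∫⁻ τ in Icc 0 t, b τ).toReal)) := by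
  set b' : ℝ → ℝ := fun τ => (b τ).toReal with hb'
  have hb'0 : ∀ τ, 0 ≤ b' τ := fun τ => ENNReal.toReal_nonneg
  have hT : 0 ≤ T := ht.1.trans ht.2
  have hfin := ae_lt_top' hb hbT
  have hint : IntegrableOn b' (Icc 0 T) volume := integrable_toReal_of_lintegral_ne_top hb hbT
  have hsub : ∀ τ ∈ Icc 0 T, IntervalIntegrable b' volume 0 τ := fun τ hτ =>
    (intervalIntegrable_iff_integrableOn_Icc_of_le hτ.1).2
      (hint.mono_set (Icc_subset_Icc_right hτ.2))
  have hfin' : ∀ τ ∈ Icc 0 T, ∀ᵐ r ∂(volume.restrict (Icc 0 τ)), b r < ⊤ := fun τ hτ =>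
    ae_restrict_of_ae_restrict_of_subset (Icc_subset_Icc_right hτ.2) hfin
  have hβ : ∀ τ ∈ Icc 0 T, ∫ r in (0 : ℝ)..τ, b' r = (∫⁻ r in Icc 0 τ, b r).toReal := by
    intro τ hτ
    rw [intervalIntegral.integral_of_le hτ.1, ← integral_Icc_eq_integral_Ioc]
    exact integral_toReal (hb.mono_measure (Measure.restrict_mono_set _
      (Icc_subset_Icc_right hτ.2))) (hfin' τ hτ)
  set β : ℝ → ℝ := fun τ => ∫ r in (0 : ℝ)..τ, b' r with hβdef
  have hβ0 : ∀ τ ∈ Icc 0 T, 0 ≤ β τ := fun τ hτ =>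
    intervalIntegral.integral_nonneg_of_forall hτ.1 hb'0
  -- The weighted supremum `F` of `f e^{-2β}` is finite and satisfies `F ≤ c + F / 2`.
  set F : ℝ≥0∞ := ⨆ τ ∈ Icc 0 T, f τ * ENNReal.ofReal (Real.exp (-(2 * β τ))) with hF
  have hexp1 : ∀ τ ∈ Icc 0 T, ENNReal.ofReal (Real.exp (-(2 * β τ))) ≤ 1 := fun τ hτ => by
    rw [ENNReal.ofReal_le_one, Real.exp_le_one_iff]
    linarith [hβ0 τ hτ]
  have hFtop : F ≠ ⊤ := by
    refine ne_top_of_le_ne_top hF₀ (iSup₂_le fun τ hτ => ?_)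
    exact (mul_le_mul' (hf τ hτ) (hexp1 τ hτ)).trans (mul_one _).le
  have hfF : ∀ τ ∈ Icc 0 T, f τ ≤ F * ENNReal.ofReal (Real.exp (2 * β τ)) := by
    intro τ hτ
    have h1 : f τ * ENNReal.ofReal (Real.exp (-(2 * β τ))) ≤ F :=
      le_iSup₂ (f := fun τ _ => f τ * ENNReal.ofReal (Real.exp (-(2 * β τ)))) τ hτ
    calc f τ = f τ * ENNReal.ofReal (Real.exp (-(2 * β τ))) *
          ENNReal.ofReal (Real.exp (2 * β τ)) := by
          rw [mul_assoc, ← ENNReal.ofReal_mul (Real.exp_pos _).le, ← Real.exp_add,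
            neg_add_cancel, Real.exp_zero, ENNReal.ofReal_one, mul_one]
      _ ≤ _ := by gcongr
  have hstep : ∀ τ ∈ Icc 0 T, f τ * ENNReal.ofReal (Real.exp (-(2 * β τ))) ≤ c + F / 2 := by
    intro τ hτ
    have h1 : ∫⁻ r in Icc 0 τ, b r * f r ≤ F * ENNReal.ofReal (Real.exp (2 * β τ) / 2) := by
      calc _ ≤ ∫⁻ r in Icc 0 τ, F * (ENNReal.ofReal (b' r) *
            ENNReal.ofReal (Real.exp (2 * β r))) := by
            refine lintegral_mono_ae ?_
            filter_upwards [hfin' τ hτ, ae_restrict_mem measurableSet_Icc] with r hr hr'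
            rw [hb', ENNReal.ofReal_toReal hr.ne, mul_left_comm]
            gcongr
            exact hfF r ⟨hr'.1, hr'.2.trans hτ.2⟩
        _ = F * _ := lintegral_const_mul' _ _ hFtop
        _ ≤ _ := by
            gcongr
            exact lintegral_mul_exp_integral_le hτ.1 (hsub τ hτ) hb'0
    calc _ ≤ (c + F * ENNReal.ofReal (Real.exp (2 * β τ) / 2)) *
          ENNReal.ofReal (Real.exp (-(2 * β τ))) := by
          gcongr
          exact (h τ hτ).trans (by gcongr)
      _ = c * ENNReal.ofReal (Real.exp (-(2 * β τ))) + F * (ENNReal.ofReal (Real.exp (2 * β τ) / 2) *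
          ENNReal.ofReal (Real.exp (-(2 * β τ)))) := by ring
      _ ≤ c * 1 + F * 2⁻¹ := by
          gcongr
          · exact hexp1 τ hτ
          · rw [← ENNReal.ofReal_mul (by positivity), div_mul_eq_mul_div, ← Real.exp_add,
              add_neg_cancel, Real.exp_zero, one_div, ENNReal.ofReal_inv_of_pos (by norm_num)]
            simp
      _ = _ := by rw [mul_one, div_eq_mul_inv]
  have hF2 : F ≤ c + F / 2 := iSup₂_le hstep
  have hF3 : F ≤ 2 * c := by
    have h1 : F / 2 ≠ ⊤ := ENNReal.div_ne_top hFtop (by norm_num)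
    have h2 : F / 2 + F / 2 ≤ c + F / 2 := by rwa [ENNReal.add_halves]
    have h3 := (ENNReal.add_le_add_iff_right h1).1 h2
    calc F = F / 2 + F / 2 := (ENNReal.add_halves F).symm
      _ ≤ c + c := add_le_add h3 h3
      _ = _ := (two_mul c).symm
  rw [← hβ t ht]
  exact (hfF t ht).trans (mul_le_mul' hF3 le_rfl)

end Gronwall

/-! ### The energy identity -/

section EnergyIdentity

/-- The chain rule for the square of an absolutely continuous function. -/
lemma sq_eq_add_two_mul_integral {w g : ℝ → ℝ} {t : ℝ} (ht : 0 ≤ t)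
    (hg : IntervalIntegrable g volume 0 t)
    (hw : ∀ r ∈ Icc 0 t, w r = w 0 + ∫ τ in (0 : ℝ)..r, g τ) :
    w t ^ 2 = w 0 ^ 2 + 2 * ∫ τ in (0 : ℝ)..t, w τ * g τ := by
  set G : ℝ → ℝ := fun r => ∫ τ in (0 : ℝ)..r, g τ with hG
  have hac : AbsolutelyContinuousOnInterval G 0 t :=
    hg.absolutelyContinuousOnInterval_intervalIntegral left_mem_uIcc
  have h1 := hac.integral_deriv_mul_eq_sub hac
  have hGc : ContinuousOn G (uIcc 0 t) := hac.continuousOn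
  have hGg : IntervalIntegrable (fun τ => G τ * g τ) volume 0 t := hg.continuousOn_mul hGc
  have h2 : ∫ τ in (0 : ℝ)..t, deriv G τ * G τ + G τ * deriv G τ =
      2 * ∫ τ in (0 : ℝ)..t, G τ * g τ := by
    rw [← intervalIntegral.integral_const_mul]
    refine intervalIntegral.integral_congr_ae ?_
    filter_upwards [hg.ae_hasDerivAt_integral] with τ hτ hmem
    rw [(hτ (uIoc_subset_uIcc hmem) 0 left_mem_uIcc).deriv]
    ring
  have h3 : ∫ τ in (0 : ℝ)..t, w τ * g τ = w 0 * G t + ∫ τ in (0 : ℝ)..t, G τ * g τ := by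
    rw [hG, ← intervalIntegral.integral_const_mul,
      ← intervalIntegral.integral_add (hg.const_mul _) hGg]
    refine intervalIntegral.integral_congr fun τ hτ => ?_
    rw [uIcc_of_le ht] at hτ
    rw [hw τ hτ]
    ring
  have hG0 : G 0 = 0 := intervalIntegral.integral_same
  rw [h2, hG0] at h1
  rw [h3, hw t ⟨ht, le_rfl⟩]
  change (w 0 + G t) ^ 2 = _
  nlinarith

lemma ofReal_integral_le_lintegral_ofReal {α : Type*} [MeasurableSpace α] {μ : Measure α}
    {f : α → ℝ} (hf : Integrable f μ) :
    ENNReal.ofReal (∫ x, f x ∂μ) ≤ ∫⁻ x, ENNReal.ofReal (f x) ∂μ := by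
  calc _ ≤ ENNReal.ofReal (∫ x, max (f x) 0 ∂μ) :=
        ENNReal.ofReal_le_ofReal (integral_mono hf hf.pos_part fun x => le_max_left _ _)
    _ = ∫⁻ x, ENNReal.ofReal (max (f x) 0) ∂μ :=
        ofReal_integral_eq_lintegral_ofReal hf.pos_part
          (Filter.Eventually.of_forall fun x => le_max_right _ _)
    _ = _ := by simp

/-- The energy inequality `‖w(t)‖² ≤ ‖w(0)‖² + 2 ∫ ⟨w, ∂ₜw⟩₊` for a function that is absolutely
continuous in time, pointwise in space. -/
lemma lintegral_energy_le {S I : Type} [MeasurableSpace S] [Fintype I] {μ : Measure S} [SFinite μ]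
    {w g : I → ℝ → S → ℝ} {t : ℝ} (ht : 0 ≤ t)
    (hw : ∀ᵐ x ∂μ, ∀ c, IntervalIntegrable (fun τ => g c τ x) volume 0 t ∧
      ∀ r ∈ Icc 0 t, w c r x = w c 0 x + ∫ τ in (0 : ℝ)..r, g c τ x)
    (hw0 : ∀ c, Integrable (fun x => w c 0 x ^ 2) μ)
    (hint : ∀ c, Integrable (fun p : ℝ × S => w c p.1 p.2 * g c p.1 p.2)
      ((volume.restrict (Icc 0 t)).prod μ)) :
    ∫⁻ x, ENNReal.ofReal (∑ c, w c t x ^ 2) ∂μ ≤ ∫⁻ x, ENNReal.ofReal (∑ c, w c 0 x ^ 2) ∂μ +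
      ∫⁻ τ in Icc 0 t, ENNReal.ofReal (2 * ∫ x, ∑ c, w c τ x * g c τ x ∂μ) := by
  have hint' : Integrable (fun p : ℝ × S => ∑ c, w c p.1 p.2 * g c p.1 p.2)
      ((volume.restrict (Icc 0 t)).prod μ) := integrable_finsetSum _ fun c _ => hint c
  have hw0' : Integrable (fun x => ∑ c, w c 0 x ^ 2) μ := integrable_finsetSum _ fun c _ => hw0 c
  have hI : Integrable (fun x => ∫ τ in Icc 0 t, ∑ c, w c τ x * g c τ x) μ :=
    hint'.integral_prod_right
  have hpt : ∀ᵐ x ∂μ, ∑ c, w c t x ^ 2 =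
      ∑ c, w c 0 x ^ 2 + 2 * ∫ τ in Icc 0 t, ∑ c, w c τ x * g c τ x := by
    filter_upwards [hw, ae_all_iff.2 fun c => (hint c).prod_left_ae] with x hx hx2
    rw [integral_finsetSum _ fun c _ => hx2 c, Finset.mul_sum, ← Finset.sum_add_distrib]
    refine Finset.sum_congr rfl fun c _ => ?_
    rw [sq_eq_add_two_mul_integral (w := fun τ => w c τ x) (g := fun τ => g c τ x) ht (hx c).1
      (hx c).2, integral_Icc_eq_integral_Ioc, intervalIntegral.integral_of_le ht]
  have hJ : Integrable (fun x => ∑ c, w c 0 x ^ 2 +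
      2 * ∫ τ in Icc 0 t, ∑ c, w c τ x * g c τ x) μ := hw0'.add (hI.const_mul 2)
  have hnn : ∀ s x, 0 ≤ ∑ c, w c s x ^ 2 := fun s x => Finset.sum_nonneg fun c _ => sq_nonneg _
  calc _ = ∫⁻ x, ENNReal.ofReal (∑ c, w c 0 x ^ 2 +
        2 * ∫ τ in Icc 0 t, ∑ c, w c τ x * g c τ x) ∂μ := by
        refine lintegral_congr_ae ?_
        filter_upwards [hpt] with x hx
        rw [hx]
    _ = ENNReal.ofReal (∫ x, (∑ c, w c 0 x ^ 2 +
        2 * ∫ τ in Icc 0 t, ∑ c, w c τ x * g c τ x) ∂μ) := by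
        refine (ofReal_integral_eq_lintegral_ofReal hJ ?_).symm
        filter_upwards [hpt] with x hx
        rw [← hx]
        exact hnn t x
    _ = ENNReal.ofReal (∫ x, ∑ c, w c 0 x ^ 2 ∂μ +
        ∫ τ in Icc 0 t, 2 * ∫ x, ∑ c, w c τ x * g c τ x ∂μ) := by
        rw [integral_add hw0' (hI.const_mul 2), integral_const_mul, integral_const_mul,
          integral_integral_swap (f := fun x τ => ∑ c, w c τ x * g c τ x) hint'.swap]
    _ ≤ ENNReal.ofReal (∫ x, ∑ c, w c 0 x ^ 2 ∂μ) +
        ENNReal.ofReal (∫ τ in Icc 0 t, 2 * ∫ x, ∑ c, w c τ x * g c τ x ∂μ) :=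
        ENNReal.ofReal_add_le
    _ ≤ _ := by
        refine add_le_add ?_ ?_
        · exact (ofReal_integral_eq_lintegral_ofReal hw0'
            (Filter.Eventually.of_forall fun x => hnn 0 x)).le
        · exact ofReal_integral_le_lintegral_ofReal (hint'.integral_prod_left.const_mul 2)

end EnergyIdentity

/-! ### Solutions of symmetric systems -/

section TimeDependence

variable {E : Type} [NormedAddCommGroup E] [InnerProductSpace ℝ E] [FiniteDimensional ℝ E]
  [MeasurableSpace E] [BorelSpace E]

lemma measurable_lowPass_with_param {q : ℝ → E → ℝ} (hq : Measurable (Function.uncurry q)) (r : ℝ) :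
    Measurable fun p : ℝ × E => lowPass r (q p.1) p.2 := by
  have h1 : StronglyMeasurable fun z : (ℝ × E) × E => lpKernel r z.2 • q z.1.1 (z.1.2 - z.2) := by
    refine Measurable.stronglyMeasurable ?_
    refine ((continuous_lpKernel (E := E) r).measurable.comp measurable_snd).smul ?_
    exact hq.comp ((measurable_fst.comp measurable_fst).prodMk
      ((measurable_snd.comp measurable_fst).sub measurable_snd))
  exact h1.integral_prod_right.measurable

lemma integrable_lowPass_prod {q : ℝ → E → ℝ} (hq : Measurable (Function.uncurry q)) {r : ℝ}
    (hr : 0 < r) {t : ℝ} {b : ℝ → ℝ} (hb : IntegrableOn b (Icc 0 t))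
    (hqb : ∀ᵐ τ ∂(volume.restrict (Icc 0 t)), ∀ y, |q τ y| ≤ b τ) (x : E) :
    Integrable (fun p : ℝ × E => lpKernel r p.2 * q p.1 (x - p.2))
      ((volume.restrict (Icc 0 t)).prod volume) := by
  have hK := integrable_lpKernel (E := E) hr
  have hbK : Integrable (fun p : ℝ × E => b p.1 * lpKernel r p.2)
      ((volume.restrict (Icc 0 t)).prod volume) := Integrable.mul_prod hb hK
  have hm : AEStronglyMeasurable (fun p : ℝ × E => lpKernel r p.2 * q p.1 (x - p.2))
      ((volume.restrict (Icc 0 t)).prod volume) := by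
    refine Measurable.aestronglyMeasurable ?_
    exact ((continuous_lpKernel (E := E) r).measurable.comp measurable_snd).mul
      (hq.comp (measurable_fst.prodMk (measurable_const.sub measurable_snd)))
  refine hbK.mono hm ?_
  have hqb' : ∀ᵐ p ∂((volume.restrict (Icc 0 t)).prod (volume : Measure E)), ∀ y, |q p.1 y| ≤ b p.1 :=
    Measure.quasiMeasurePreserving_fst.ae hqb
  filter_upwards [hqb'] with p hp
  rw [norm_mul, norm_mul, mul_comm]
  gcongr
  exact (hp _).trans (le_abs_self _)

/-- Low-pass filtering commutes with time integration. -/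
lemma lowPass_eq_add_integral {v q : ℝ → E → ℝ} (hq : Measurable (Function.uncurry q)) {r : ℝ}
    (hr : 0 < r) {t : ℝ} {b : ℝ → ℝ} (hb : IntegrableOn b (Icc 0 t))
    (hqb : ∀ᵐ τ ∂(volume.restrict (Icc 0 t)), ∀ y, |q τ y| ≤ b τ) {M : ℝ} (hM : ∀ s y, |v s y| ≤ M)
    (hvm : ∀ s, AEStronglyMeasurable (v s) volume)
    (hv : ∀ᵐ y, ∀ s ∈ Icc 0 t, v s y = v 0 y + ∫ τ in (0 : ℝ)..s, q τ y) (x : E) :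
    (0 ≤ t → IntervalIntegrable (fun τ => lowPass r (q τ) x) volume 0 t) ∧
      ∀ s ∈ Icc 0 t, lowPass r (v s) x = lowPass r (v 0) x +
        ∫ τ in (0 : ℝ)..s, lowPass r (q τ) x := by
  constructor
  · intro ht
    rw [intervalIntegrable_iff_integrableOn_Icc_of_le ht]
    exact (integrable_lowPass_prod hq hr hb hqb x).integral_prod_left
  intro s hs
  have hint := integrable_lowPass_prod (t := s) hq hr (hb.mono_set (Icc_subset_Icc_right hs.2))
    (ae_restrict_of_ae_restrict_of_subset (Icc_subset_Icc_right hs.2) hqb) x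
  have h1 : lowPass r (v s) x - lowPass r (v 0) x =
      ∫ y, lpKernel r y • ∫ τ in (0 : ℝ)..s, q τ (x - y) := by
    rw [← lowPass_sub hr (hvm s) (hM s) (hvm 0) (hM 0)]
    have hv' : ∀ᵐ y, ∀ s ∈ Icc 0 t, v s (x - y) = v 0 (x - y) + ∫ τ in (0 : ℝ)..s, q τ (x - y) :=
      (quasiMeasurePreserving_sub_left volume x).ae hv
    refine integral_congr_ae ?_
    filter_upwards [hv'] with y hy
    rw [hy s hs, add_sub_cancel_left]
  have h2 : ∫ y, lpKernel r y • ∫ τ in (0 : ℝ)..s, q τ (x - y) =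
      ∫ τ in (0 : ℝ)..s, lowPass r (q τ) x := by
    rw [intervalIntegral.integral_of_le hs.1, ← integral_Icc_eq_integral_Ioc]
    have h3 := integral_integral_swap (f := fun (τ : ℝ) (y : E) => lpKernel r y * q τ (x - y)) hint
    unfold lowPass
    simp only [smul_eq_mul]
    rw [h3]
    refine integral_congr_ae (Filter.Eventually.of_forall fun y => ?_)
    beta_reduce
    rw [intervalIntegral.integral_of_le hs.1, ← integral_Icc_eq_integral_Ioc, integral_const_mul]
  rw [← h2, ← h1]
  ring

lemma measurable_bandPass_with_param {q : ℝ → E → ℝ} (hq : Measurable (Function.uncurry q))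
    (ρ σ : ℝ) : Measurable fun p : ℝ × E => bandPass ρ σ (q p.1) p.2 :=
  (measurable_lowPass_with_param hq σ).sub (measurable_lowPass_with_param hq ρ)

lemma bandPass_eq_add_integral {v q : ℝ → E → ℝ} (hq : Measurable (Function.uncurry q)) {ρ σ : ℝ}
    (hρ : 0 < ρ) (hσ : 0 < σ) {t : ℝ} (ht : 0 ≤ t) {b : ℝ → ℝ} (hb : IntegrableOn b (Icc 0 t))
    (hqb : ∀ᵐ τ ∂(volume.restrict (Icc 0 t)), ∀ y, |q τ y| ≤ b τ) {M : ℝ} (hM : ∀ s y, |v s y| ≤ M)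
    (hvm : ∀ s, AEStronglyMeasurable (v s) volume)
    (hv : ∀ᵐ y, ∀ s ∈ Icc 0 t, v s y = v 0 y + ∫ τ in (0 : ℝ)..s, q τ y) (x : E) :
    IntervalIntegrable (fun τ => bandPass ρ σ (q τ) x) volume 0 t ∧
      ∀ s ∈ Icc 0 t, bandPass ρ σ (v s) x = bandPass ρ σ (v 0) x +
        ∫ τ in (0 : ℝ)..s, bandPass ρ σ (q τ) x := by
  obtain ⟨i1, e1⟩ := lowPass_eq_add_integral hq hσ hb hqb hM hvm hv x
  obtain ⟨i2, e2⟩ := lowPass_eq_add_integral hq hρ hb hqb hM hvm hv x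
  refine ⟨(i1 ht).sub (i2 ht), fun s hs => ?_⟩
  have hsub : uIcc 0 s ⊆ uIcc 0 t := by
    rw [uIcc_of_le hs.1, uIcc_of_le ht]; exact Icc_subset_Icc_right hs.2
  simp only [bandPass]
  rw [e1 s hs, e2 s hs, intervalIntegral.integral_sub ((i1 ht).mono_set hsub)
    ((i2 ht).mono_set hsub)]
  ring

/-- A bounded solution `f` of a symmetric first-order system on `[0, T]`, in components, where the
function `B`, integrable in time, controls the Lipschitz constants of `f` and of the coefficients. -/
structure SystemSolution {I J : Type} [Fintype I] [Fintype J] (T A M : ℝ) (K : ℝ≥0) (B : ℝ → ℝ≥0∞)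
    (e : J → E) (a : ℝ → J → I → I → E → ℝ) (f : ℝ → I → E → ℝ) : Prop where
  measurable_control : Measurable B
  control_ne_top : ∫⁻ τ in Icc 0 T, B τ ≠ ⊤
  continuous_fun : ∀ c, Continuous (Function.uncurry fun τ => f τ c)
  bound : ∀ τ c x, |f τ c x| ≤ M
  bound_nonneg : 0 ≤ A
  symmetric : ∀ᵐ τ ∂(volume.restrict (Icc 0 T)),
    SymmetricSystem (K * (B τ).toNNReal) A M e (a τ) (f τ)
  measurable_term : ∀ c, Measurable (Function.uncurry fun τ => systemTerm e (a τ) (f τ) c)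
  equation : ∀ᵐ x, ∀ c, IntervalIntegrable (fun τ => systemTerm e (a τ) (f τ) c x) volume 0 T ∧
    ∀ r ∈ Icc 0 T, f r c x = f 0 c x + ∫ τ in (0 : ℝ)..r, systemTerm e (a τ) (f τ) c x

variable {I J : Type} [Fintype I] [Fintype J] {T A M : ℝ} {K : ℝ≥0} {B : ℝ → ℝ≥0∞}
  {e : J → E} {a : ℝ → J → I → I → E → ℝ} {f : ℝ → I → E → ℝ}

lemma SymmetricSystem.abs_systemTerm_le {L : ℝ≥0} {a : J → I → I → E → ℝ} {f : I → E → ℝ}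
    (h : SymmetricSystem L A M e a f) (c : I) (x : E) :
    |systemTerm e a f c x| ≤ Fintype.card (J × I) * (A * L) := by
  unfold systemTerm
  refine (Finset.abs_sum_le_sum_abs _ _).trans ?_
  rw [← nsmul_eq_mul, ← Finset.card_univ, ← Finset.sum_const]
  refine Finset.sum_le_sum fun p _ => ?_
  rw [abs_mul]
  exact mul_le_mul (h.bound_coeff _ _ _ _) (h.norm_fderiv_le _ _ _) (abs_nonneg _)
    ((norm_nonneg _).trans (h.bound_coeff p.1 c p.2 x))

namespace SystemSolution

lemma integrableOn_control (h : SystemSolution T A M K B e a f) {t : ℝ} (ht : t ≤ T) :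
    IntegrableOn (fun τ => (B τ).toReal) (Icc 0 t) :=
  (integrable_toReal_of_lintegral_ne_top h.measurable_control.aemeasurable
    h.control_ne_top).mono_measure (Measure.restrict_mono_set _ (Icc_subset_Icc_right ht))

lemma lintegral_control_ne_top (h : SystemSolution T A M K B e a f) {t : ℝ} (ht : t ≤ T) :
    ∫⁻ τ in Icc 0 t, B τ ≠ ⊤ :=
  ne_top_of_le_ne_top h.control_ne_top
    (lintegral_mono' (Measure.restrict_mono_set _ (Icc_subset_Icc_right ht)) le_rfl)

lemma ae_control_ne_top (h : SystemSolution T A M K B e a f) {t : ℝ} (ht : t ≤ T) :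
    ∀ᵐ τ ∂(volume.restrict (Icc 0 t)), B τ ≠ ⊤ := by
  filter_upwards [ae_lt_top h.measurable_control (h.lintegral_control_ne_top ht)] with τ hτ
  exact hτ.ne

lemma ae_symmetric (h : SystemSolution T A M K B e a f) {t : ℝ} (ht : t ≤ T) :
    ∀ᵐ τ ∂(volume.restrict (Icc 0 t)), SymmetricSystem (K * (B τ).toNNReal) A M e (a τ) (f τ) :=
  ae_restrict_of_ae_restrict_of_subset (Icc_subset_Icc_right ht) h.symmetric

lemma ae_abs_term_le (h : SystemSolution T A M K B e a f) {t : ℝ} (ht : t ≤ T) (c : I) :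
    ∀ᵐ τ ∂(volume.restrict (Icc 0 t)), ∀ y, |systemTerm e (a τ) (f τ) c y| ≤
      Fintype.card (J × I) * (A * K) * (B τ).toReal := by
  filter_upwards [h.ae_symmetric ht] with τ hτ y
  refine (hτ.abs_systemTerm_le c y).trans (le_of_eq ?_)
  rw [NNReal.coe_mul, ENNReal.coe_toNNReal_eq_toReal]
  ring

lemma continuous_apply (h : SystemSolution T A M K B e a f) (τ : ℝ) (c : I) :
    Continuous (f τ c) := (h.continuous_fun c).comp (Continuous.prodMk_right τ)

lemma integrableOn_term_bound (h : SystemSolution T A M K B e a f) {t : ℝ} (ht : t ≤ T) :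
    IntegrableOn (fun τ => Fintype.card (J × I) * (A * K) * (B τ).toReal) (Icc 0 t) :=
  (h.integrableOn_control ht).const_mul _

lemma intervalIntegrable_term (h : SystemSolution T A M K B e a f) {t : ℝ} (ht : t ∈ Icc 0 T) :
    ∀ᵐ x, ∀ c, IntervalIntegrable (fun τ => systemTerm e (a τ) (f τ) c x) volume 0 t ∧
      ∀ r ∈ Icc 0 t, f r c x = f 0 c x + ∫ τ in (0 : ℝ)..r, systemTerm e (a τ) (f τ) c x := by
  filter_upwards [h.equation] with x hx c
  refine ⟨(hx c).1.mono_set ?_, fun r hr => (hx c).2 r ⟨hr.1, hr.2.trans ht.2⟩⟩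
  rw [uIcc_of_le ht.1, uIcc_of_le (ht.1.trans ht.2)]
  exact Icc_subset_Icc_right ht.2

/-- The equation satisfied by the band-pass filtered solution. -/
lemma bandPass_eq (h : SystemSolution T A M K B e a f) {ρ σ : ℝ} (hρ : 0 < ρ) (hσ : 0 < σ) {t : ℝ}
    (ht : t ∈ Icc 0 T) (c : I) (x : E) :
    IntervalIntegrable (fun τ => bandPass ρ σ (systemTerm e (a τ) (f τ) c) x) volume 0 t ∧
      ∀ s ∈ Icc 0 t, bandPass ρ σ (f s c) x = bandPass ρ σ (f 0 c) x +
        ∫ τ in (0 : ℝ)..s, bandPass ρ σ (systemTerm e (a τ) (f τ) c) x := by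
  refine bandPass_eq_add_integral (v := fun s => f s c) (h.measurable_term c) hρ hσ ht.1
    (h.integrableOn_term_bound ht.2) (h.ae_abs_term_le ht.2 c) (fun s y => h.bound s c y)
    (fun s => (h.continuous_apply s c).aestronglyMeasurable) ?_ x
  filter_upwards [h.intervalIntegrable_term ht] with y hy
  exact (hy c).2

/-- Weighted energy inequality, before the use of Grönwall's inequality. -/
lemma weighted_energy_le (h : SystemSolution T A M K B e a f) {ε : ℝ} (hε : 0 < ε) {t : ℝ}
    (ht : t ∈ Icc 0 T) :
    ∫⁻ x, ENNReal.ofReal (decayWeight ε x * ∑ c, f t c x ^ 2) ≤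
      (∫⁻ x, ENNReal.ofReal (decayWeight ε x * ∑ c, f 0 c x ^ 2)) +
      ∫⁻ τ in Icc 0 t, ENNReal.ofReal (2 * (Fintype.card J * Fintype.card I) *
        ((Module.finrank ℝ E + 1) * ε * A + K * (B τ).toReal)) *
          ∫⁻ x, ENNReal.ofReal (decayWeight ε x * ∑ c, f τ c x ^ 2) := by
  have hφ := integrable_decayWeight (E := E) hε
  have hφ0 := decayWeight_pos (E := E) hε.le
  have hφc := continuous_decayWeight (E := E) hε.le
  have hfi : ∀ τ, Integrable (fun x => decayWeight ε x * ∑ c, f τ c x ^ 2) volume := by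
    intro τ
    refine hφ.mul_bdd (c := Fintype.card I * M ^ 2)
      (continuous_finsetSum _ fun c _ => (h.continuous_apply τ c).pow 2).aestronglyMeasurable
      (Filter.Eventually.of_forall fun x => ?_)
    rw [Real.norm_of_nonneg (Finset.sum_nonneg fun c _ => sq_nonneg _), ← nsmul_eq_mul,
      ← Finset.card_univ, ← Finset.sum_const]
    exact Finset.sum_le_sum fun c _ => sq_le_sq' (abs_le.1 (h.bound τ c x)).1
      (abs_le.1 (h.bound τ c x)).2
  have hsq : ∀ x, Real.sqrt (decayWeight ε x) * Real.sqrt (decayWeight ε x) = decayWeight ε x :=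
    fun x => Real.mul_self_sqrt (hφ0 x).le
  -- the energy inequality for `√φ f`, where `φ` is the weight
  have hen := lintegral_energy_le (μ := (volume : Measure E)) (I := I)
    (w := fun c τ x => Real.sqrt (decayWeight ε x) * f τ c x)
    (g := fun c τ x => Real.sqrt (decayWeight ε x) * systemTerm e (a τ) (f τ) c x) ht.1 ?_ ?_ ?_
  · have e1 : ∀ τ x, ∑ c, (Real.sqrt (decayWeight ε x) * f τ c x) ^ 2 =
        decayWeight ε x * ∑ c, f τ c x ^ 2 := fun τ x => by
      rw [Finset.mul_sum]
      refine Finset.sum_congr rfl fun c _ => ?_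
      rw [mul_pow, sq, hsq]
    have e2 : ∀ τ x, ∑ c, Real.sqrt (decayWeight ε x) * f τ c x *
        (Real.sqrt (decayWeight ε x) * systemTerm e (a τ) (f τ) c x) =
        decayWeight ε x * ∑ c, f τ c x * systemTerm e (a τ) (f τ) c x := fun τ x => by
      rw [Finset.mul_sum]
      refine Finset.sum_congr rfl fun c _ => ?_
      rw [mul_mul_mul_comm, hsq]
    simp only [e1, e2] at hen
    refine hen.trans (add_le_add le_rfl (lintegral_mono_ae ?_))
    filter_upwards [h.ae_symmetric ht.2] with τ hτ
    have h1 := (le_abs_self _).trans (hτ.abs_integral_decayWeight_le hε h.bound_nonneg)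
    rw [← ofReal_integral_eq_lintegral_ofReal (hfi τ) (Filter.Eventually.of_forall fun x =>
      mul_nonneg (hφ0 x).le (Finset.sum_nonneg fun c _ => sq_nonneg _)),
      ← ENNReal.ofReal_mul (by have := h.bound_nonneg; positivity)]
    refine ENNReal.ofReal_le_ofReal ?_
    rw [NNReal.coe_mul, ENNReal.coe_toNNReal_eq_toReal] at h1
    linarith
  · filter_upwards [h.intervalIntegrable_term ht] with x hx c
    refine ⟨(hx c).1.const_mul _, fun r hr => ?_⟩
    rw [intervalIntegral.integral_const_mul, (hx c).2 r hr]
    ring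
  · intro c
    refine ((hφ.mul_bdd (c := M ^ 2) ((h.continuous_apply 0 c).pow 2).aestronglyMeasurable
      (Filter.Eventually.of_forall fun x => ?_))).congr (Filter.Eventually.of_forall fun x => ?_)
    · rw [Pi.pow_apply, Real.norm_of_nonneg (sq_nonneg _)]
      exact sq_le_sq' (abs_le.1 (h.bound 0 c x)).1 (abs_le.1 (h.bound 0 c x)).2
    · simp only [mul_pow, Pi.pow_apply]
      rw [sq (Real.sqrt _), hsq]
  · intro c
    have hdom : Integrable (fun p : ℝ × E => M * (Fintype.card (J × I) * (A * K) * (B p.1).toReal) *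
        decayWeight ε p.2) ((volume.restrict (Icc 0 t)).prod volume) :=
      Integrable.mul_prod ((h.integrableOn_term_bound ht.2).const_mul M) hφ
    refine hdom.mono ?_ ?_
    · have m1 : Measurable fun p : ℝ × E => Real.sqrt (decayWeight ε p.2) :=
        (hφc.measurable.comp measurable_snd).sqrt
      exact ((m1.mul (h.continuous_fun c).measurable).mul
        (m1.mul (h.measurable_term c))).aestronglyMeasurable
    · have hqb : ∀ᵐ p ∂((volume.restrict (Icc 0 t)).prod (volume : Measure E)),
          ∀ y, |systemTerm e (a p.1) (f p.1) c y| ≤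
            Fintype.card (J × I) * (A * K) * (B p.1).toReal :=
        Measure.quasiMeasurePreserving_fst.ae (h.ae_abs_term_le ht.2 c)
      filter_upwards [hqb] with p hp
      have h1 := h.bound p.1 c p.2
      have h2 := hp p.2
      have h3 := (hφ0 p.2).le
      have h4 : 0 ≤ M := (abs_nonneg _).trans h1
      rw [mul_mul_mul_comm, hsq, norm_mul, norm_mul, norm_mul, mul_comm, Real.norm_of_nonneg h3]
      refine mul_le_mul_of_nonneg_right ?_ h3
      rw [norm_mul M]
      refine mul_le_mul ?_ (h2.trans (le_abs_self _)) (abs_nonneg _) (abs_nonneg _)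
      exact h1.trans (le_abs_self _)

end SystemSolution

end TimeDependence

/-! ### Propagation of the `L²` norm and of the high frequencies -/

section EnergyEstimates

variable {E : Type} [NormedAddCommGroup E] [InnerProductSpace ℝ E] [FiniteDimensional ℝ E]
  [MeasurableSpace E] [BorelSpace E]

/-- The high-pass filter commutes with the inclusion of `ℝ` in `ℂ`, where the Fourier transform lives. -/
lemma eLpNorm_highPass_ofReal {r : ℝ} (hr : 0 < r) {f : E → ℝ}
    (hf : AEStronglyMeasurable f volume) {M : ℝ} (hM : ∀ x, ‖f x‖ ≤ M) :
    eLpNorm (highPass r fun x => (f x : ℂ)) 2 volume = eLpNorm (highPass r f) 2 volume := by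
  refine eLpNorm_congr_norm_ae (Filter.Eventually.of_forall fun x => ?_)
  have h := lowPass_clm hr Complex.ofRealCLM hf hM x
  simp only [Complex.ofRealCLM_apply] at h
  rw [highPass, h, ← Complex.ofReal_sub, Complex.norm_real]
  rfl

/-- The high frequencies of an `L²` function tend to zero, by dominated convergence on the Fourier side. -/
lemma tendsto_eLpNorm_highPass {f : E → ℝ} (hf : MemLp f 2 volume) {M : ℝ} (hM : ∀ x, ‖f x‖ ≤ M) :
    Filter.Tendsto (fun k : ℕ => eLpNorm (highPass ((k : ℝ) + 1) f) 2 volume ^ 2) Filter.atTop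
      (nhds 0) := by
  have hg : MemLp (fun x => (f x : ℂ)) 2 volume := hf.ofReal
  have hgM : ∀ x, ‖(f x : ℂ)‖ ≤ M := fun x => by rw [Complex.norm_real]; exact hM x
  have e : ∀ k : ℕ, eLpNorm (highPass ((k : ℝ) + 1) f) 2 volume ^ 2 =
      ∫⁻ ξ, ENNReal.ofReal ((1 - cutoff ((k : ℝ) + 1) ξ) ^ 2) * ‖l2Fourier hg ξ‖ₑ ^ 2 := fun k => by
    rw [← eLpNorm_highPass_sq (by positivity) hg hgM,
      ← eLpNorm_highPass_ofReal (by positivity) hf.aestronglyMeasurable hM]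
  simp only [e]
  have h0 : (0 : ℝ≥0∞) = ∫⁻ _ξ : E, 0 := by simp
  rw [h0]
  refine tendsto_lintegral_of_dominated_convergence' (fun ξ => ‖l2Fourier hg ξ‖ₑ ^ 2)
    (fun k => ?_) (fun k => ?_) ?_ ?_
  · refine AEMeasurable.mul ?_ ((aestronglyMeasurable_l2Fourier hg).enorm.pow_const 2)
    have : Measurable fun ξ : E => (1 - cutoff ((k : ℝ) + 1) ξ) ^ 2 :=
      ((measurable_const.sub (continuous_cutoff _).measurable)).pow_const 2
    exact this.ennreal_ofReal.aemeasurable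
  · refine Filter.Eventually.of_forall fun ξ => ?_
    refine mul_le_of_le_one_left (zero_le) ?_
    rw [ENNReal.ofReal_le_one]
    have := cutoff_nonneg ((k : ℝ) + 1) ξ
    have := cutoff_le_one ((k : ℝ) + 1) ξ
    nlinarith
  · rw [lintegral_enorm_l2Fourier_sq, ← eLpNorm_two_sq]
    exact (ENNReal.pow_lt_top hg.2).ne
  · refine Filter.Eventually.of_forall fun ξ => tendsto_const_nhds.congr' ?_
    obtain ⟨K, hK⟩ := exists_nat_ge ‖ξ‖
    filter_upwards [Filter.eventually_ge_atTop K] with k hk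
    have h1 : (K : ℝ) ≤ k := by exact_mod_cast hk
    rw [cutoff_eq_one (by positivity) (by linarith)]
    simp

variable {I J : Type} [Fintype I] [Fintype J] {T A M : ℝ} {K : ℝ≥0} {B : ℝ → ℝ≥0∞}
  {e : J → E} {a : ℝ → J → I → I → E → ℝ} {f : ℝ → I → E → ℝ}

namespace SystemSolution

/-- Grönwall's inequality for the weighted energy, which is finite because the solution is bounded and
the weight is integrable. -/
lemma weighted_bound (h : SystemSolution T A M K B e a f) {ε : ℝ} (hε : 0 < ε) {t : ℝ}
    (ht : t ∈ Icc 0 T) :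
    ∫⁻ x, ENNReal.ofReal (decayWeight ε x * ∑ c, f t c x ^ 2) ≤
      2 * (∫⁻ x, ENNReal.ofReal (∑ c, f 0 c x ^ 2)) *
        ENNReal.ofReal (Real.exp (4 * (Fintype.card J * Fintype.card I) *
          ((Module.finrank ℝ E + 1) * ε * A * t + K * (∫⁻ τ in Icc 0 t, B τ).toReal))) := by
  have hφ := integrable_decayWeight (E := E) hε
  have hφ0 := decayWeight_pos (E := E) hε.le
  have hA := h.bound_nonneg
  set N : ℝ := Fintype.card J * Fintype.card I with hN
  have hN0 : 0 ≤ N := by positivity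
  set d : ℝ := Module.finrank ℝ E + 1
  have hd : 0 ≤ d := by positivity
  set b : ℝ → ℝ≥0∞ := fun τ => ENNReal.ofReal (2 * N * (d * ε * A + K * (B τ).toReal)) with hb
  have hbm : Measurable b :=
    (((h.measurable_control.ennreal_toReal.const_mul _).const_add _).const_mul _).ennreal_ofReal
  have hbi : IntegrableOn (fun τ => 2 * N * (d * ε * A + K * (B τ).toReal)) (Icc 0 t) :=
    ((integrableOn_const (by simp)).add ((h.integrableOn_control ht.2).const_mul _)).const_mul _
  have hbL : ∫⁻ τ in Icc 0 t, b τ =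
      ENNReal.ofReal (2 * N * (d * ε * A * t + K * (∫⁻ τ in Icc 0 t, B τ).toReal)) := by
    rw [hb, ← ofReal_integral_eq_lintegral_ofReal hbi
      (Filter.Eventually.of_forall fun τ => by positivity), integral_const_mul,
      integral_add (integrable_const _) ((h.integrableOn_control ht.2).const_mul _),
      integral_const_mul (K : ℝ), integral_toReal h.measurable_control.aemeasurable
        (ae_lt_top h.measurable_control (h.lintegral_control_ne_top ht.2))]
    congr 3
    simp [ht.1, mul_comm]
  have hF₀ : ∫⁻ x : E, ENNReal.ofReal (decayWeight ε x * (Fintype.card I * M ^ 2)) ≠ ⊤ := by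
    rw [← ofReal_integral_eq_lintegral_ofReal (hφ.mul_const _) (Filter.Eventually.of_forall fun x =>
      mul_nonneg (hφ0 x).le (by positivity))]
    exact ENNReal.ofReal_ne_top
  have hbd : ∀ τ ∈ Icc 0 t, ∫⁻ x, ENNReal.ofReal (decayWeight ε x * ∑ c, f τ c x ^ 2) ≤
      ∫⁻ x : E, ENNReal.ofReal (decayWeight ε x * (Fintype.card I * M ^ 2)) := by
    intro τ _
    refine lintegral_mono fun x => ENNReal.ofReal_le_ofReal
      (mul_le_mul_of_nonneg_left ?_ (hφ0 x).le)
    rw [← nsmul_eq_mul, ← Finset.card_univ, ← Finset.sum_const]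
    exact Finset.sum_le_sum fun c _ => sq_le_sq' (abs_le.1 (h.bound τ c x)).1
      (abs_le.1 (h.bound τ c x)).2
  have hg := gronwall_lintegral (T := t) (b := b)
    (f := fun τ => ∫⁻ x, ENNReal.ofReal (decayWeight ε x * ∑ c, f τ c x ^ 2)) hbm.aemeasurable
    (by rw [hbL]; exact ENNReal.ofReal_ne_top) hF₀ hbd
    (fun τ hτ => h.weighted_energy_le hε ⟨hτ.1, hτ.2.trans ht.2⟩) ⟨ht.1, le_rfl⟩
  have ht0 := ht.1
  rw [hbL, ENNReal.toReal_ofReal (by positivity)] at hg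
  refine hg.trans (mul_le_mul' (mul_le_mul' le_rfl (lintegral_mono fun x => ?_)) (le_of_eq ?_))
  · exact ENNReal.ofReal_le_ofReal (mul_le_of_le_one_left
      (Finset.sum_nonneg fun c _ => sq_nonneg _) (decayWeight_le_one hε.le x))
  · congr 2; ring

/-- Propagation of square integrability. The weight tends to `1` as `ε → 0`, its contribution to the
exponent tends to `0`, and the weighted energy passes to the limit by Fatou's lemma. -/
lemma lintegral_sq_le (h : SystemSolution T A M K B e a f) {t : ℝ} (ht : t ∈ Icc 0 T) :
    ∫⁻ x, ENNReal.ofReal (∑ c, f t c x ^ 2) ≤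
      2 * (∫⁻ x, ENNReal.ofReal (∑ c, f 0 c x ^ 2)) *
        ENNReal.ofReal (Real.exp (4 * (Fintype.card J * Fintype.card I) *
          (K * (∫⁻ τ in Icc 0 t, B τ).toReal))) := by
  set Y : ℝ≥0∞ := ∫⁻ x, ENNReal.ofReal (∑ c, f 0 c x ^ 2) with hY
  rcases eq_or_ne Y ⊤ with hT | hT
  · rw [hT, ENNReal.mul_top (by norm_num), ENNReal.top_mul
      (by rw [ENNReal.ofReal_ne_zero_iff]; exact Real.exp_pos _)]
    exact le_top
  have hε : ∀ k : ℕ, 0 < ((k : ℝ) + 1)⁻¹ := fun k => by positivity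
  have hε0 : Filter.Tendsto (fun k : ℕ => ((k : ℝ) + 1)⁻¹) Filter.atTop (nhds 0) := by
    simpa [one_div] using tendsto_one_div_add_atTop_nhds_zero_nat (𝕜 := ℝ)
  have hlim : ∀ x : E, Filter.liminf (fun k : ℕ => ENNReal.ofReal
      (decayWeight ((k : ℝ) + 1)⁻¹ x * ∑ c, f t c x ^ 2)) Filter.atTop =
      ENNReal.ofReal (∑ c, f t c x ^ 2) := by
    intro x
    refine Filter.Tendsto.liminf_eq (ENNReal.tendsto_ofReal ?_)
    have h1 : Filter.Tendsto (fun r : ℝ => decayWeight r x * ∑ c, f t c x ^ 2) (nhds 0)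
        (nhds (decayWeight 0 x * ∑ c, f t c x ^ 2)) := by
      refine Filter.Tendsto.mul_const _ (ContinuousAt.tendsto ?_)
      unfold decayWeight
      exact ContinuousAt.inv₀ (by fun_prop) (by simp)
    have h2 := h1.comp hε0
    have h3 : decayWeight 0 x = 1 := by simp [decayWeight]
    rwa [h3, one_mul] at h2
  have hmeas : ∀ k : ℕ, Measurable fun x => ENNReal.ofReal
      (decayWeight ((k : ℝ) + 1)⁻¹ x * ∑ c, f t c x ^ 2) := fun k =>
    ((continuous_decayWeight (hε k).le).mul (continuous_finsetSum _ fun c _ =>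
      (h.continuous_apply t c).pow 2)).measurable.ennreal_ofReal
  calc _ = ∫⁻ x, Filter.liminf (fun k : ℕ => ENNReal.ofReal
        (decayWeight ((k : ℝ) + 1)⁻¹ x * ∑ c, f t c x ^ 2)) Filter.atTop := by simp only [hlim]
    _ ≤ Filter.liminf (fun k : ℕ => ∫⁻ x, ENNReal.ofReal
        (decayWeight ((k : ℝ) + 1)⁻¹ x * ∑ c, f t c x ^ 2)) Filter.atTop := lintegral_liminf_le hmeas
    _ ≤ Filter.liminf (fun k : ℕ => 2 * Y *
        ENNReal.ofReal (Real.exp (4 * (Fintype.card J * Fintype.card I) *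
          ((Module.finrank ℝ E + 1) * ((k : ℝ) + 1)⁻¹ * A * t +
            K * (∫⁻ τ in Icc 0 t, B τ).toReal)))) Filter.atTop :=
        Filter.liminf_le_liminf (Filter.Eventually.of_forall fun k => h.weighted_bound (hε k) ht)
    _ = _ := by
        refine Filter.Tendsto.liminf_eq (ENNReal.Tendsto.const_mul (ENNReal.tendsto_ofReal ?_)
          (Or.inr (ENNReal.mul_ne_top (by norm_num) hT)))
        have h1 : Continuous fun r : ℝ => Real.exp (4 * (Fintype.card J * Fintype.card I) *
          ((Module.finrank ℝ E + 1) * r * A * t + K * (∫⁻ τ in Icc 0 t, B τ).toReal)) := by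
          fun_prop
        have h2 := (h1.tendsto 0).comp hε0
        rw [mul_zero, zero_mul, zero_mul, zero_add] at h2
        exact h2

end SystemSolution

lemma ofReal_sum_sq_eq {I : Type} [Fintype I] {g : I → E → ℝ} (x : E) :
    ENNReal.ofReal (∑ c, g c x ^ 2) = ∑ c, ‖g c x‖ₑ ^ 2 := by
  rw [ENNReal.ofReal_sum_of_nonneg fun c _ => sq_nonneg _]
  refine Finset.sum_congr rfl fun c _ => ?_
  rw [← ofReal_norm, ← ENNReal.ofReal_pow (norm_nonneg _), Real.norm_eq_abs, sq_abs]

lemma lintegral_ofReal_sum_sq {I : Type} [Fintype I] {g : I → E → ℝ}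
    (hg : ∀ c, AEStronglyMeasurable (g c) volume) :
    ∫⁻ x, ENNReal.ofReal (∑ c, g c x ^ 2) = ∑ c, eLpNorm (g c) 2 volume ^ 2 := by
  simp only [ofReal_sum_sq_eq, eLpNorm_two_sq]
  exact lintegral_finsetSum' _ fun c _ => (hg c).enorm.pow_const 2

/-- Band-pass filtered energy inequality. The constant depends only on the dimensions. -/
lemma exists_sum_eLpNorm_bandPass_sq_le (E : Type) [NormedAddCommGroup E]
    [InnerProductSpace ℝ E] [FiniteDimensional ℝ E] [MeasurableSpace E] [BorelSpace E]
    (I J : Type) [Fintype I] [Fintype J] :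
    ∃ C : ℝ, 0 ≤ C ∧ ∀ (T A M : ℝ) (K : ℝ≥0) (B : ℝ → ℝ≥0∞) (e : J → E)
      (a : ℝ → J → I → I → E → ℝ) (f : ℝ → I → E → ℝ), SystemSolution T A M K B e a f →
      ∀ N₂ : ℝ≥0∞, N₂ ≠ ⊤ → (∀ τ ∈ Icc 0 T, ∀ c, eLpNorm (f τ c) 2 volume ≤ N₂) →
      ∀ ρ σ : ℝ, 0 < ρ → 2 * ρ ≤ σ → ∀ Z : ℝ≥0∞, Z ≠ ⊤ →
      (∀ᵐ τ ∂(volume.restrict (Icc 0 T)), highSize ρ (a τ) (f τ) ≤ Z) → ∀ t ∈ Icc 0 T,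
      ∑ c, eLpNorm (bandPass ρ σ (f t c)) 2 volume ^ 2 ≤
        ∑ c, eLpNorm (bandPass ρ σ (f 0 c)) 2 volume ^ 2 +
          ∫⁻ τ in Icc 0 t, ENNReal.ofReal (C * K) * B τ * highSize ρ (a τ) (f τ) ^ 2 := by
  obtain ⟨C₁, hC₁0, hC₁⟩ := exists_integral_bandPass_mul_systemTerm_le E I J
  obtain ⟨C₂, hC₂0, hC₂⟩ := exists_eLpNorm_bandPass_systemTerm_le E I J
  refine ⟨2 * C₁, by positivity, fun T A M K B e a f h N₂ hN₂ hfN ρ σ hρ hσρ Z hZ hZb t ht => ?_⟩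
  have hσ : 0 < σ := by linarith
  have hfm : ∀ τ c, AEStronglyMeasurable (f τ c) volume := fun τ c =>
    (h.continuous_apply τ c).aestronglyMeasurable
  have hf2 : ∀ τ ∈ Icc 0 T, ∀ c, MemLp (f τ c) 2 volume := fun τ hτ c =>
    ⟨hfm τ c, (hfN τ hτ c).trans_lt hN₂.lt_top⟩
  have hZb' : ∀ᵐ τ ∂(volume.restrict (Icc 0 t)), highSize ρ (a τ) (f τ) ≤ Z :=
    ae_restrict_of_ae_restrict_of_subset (Icc_subset_Icc_right ht.2) hZb
  have hmem : ∀ᵐ τ ∂(volume.restrict (Icc 0 t)), τ ∈ Icc 0 T := by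
    filter_upwards [ae_restrict_mem measurableSet_Icc] with τ hτ
    exact ⟨hτ.1, hτ.2.trans ht.2⟩
  have h0T : (0 : ℝ) ∈ Icc 0 T := ⟨le_rfl, ht.1.trans ht.2⟩
  have hwm : ∀ τ c, AEStronglyMeasurable (bandPass ρ σ (f τ c)) volume := fun τ c =>
    aestronglyMeasurable_bandPass (hfm τ c)
  have hgm : ∀ τ c, AEStronglyMeasurable (bandPass ρ σ (systemTerm e (a τ) (f τ) c)) volume :=
    fun τ c => aestronglyMeasurable_bandPass
      ((h.measurable_term c).comp measurable_prodMk_left).aestronglyMeasurable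
  have hen := lintegral_energy_le (μ := (volume : Measure E)) (I := I)
    (w := fun c τ x => bandPass ρ σ (f τ c) x)
    (g := fun c τ x => bandPass ρ σ (systemTerm e (a τ) (f τ) c) x) ht.1
    (Filter.Eventually.of_forall fun x c => h.bandPass_eq hρ hσ ht c x) ?_ ?_
  · rw [lintegral_ofReal_sum_sq (hwm t), lintegral_ofReal_sum_sq (hwm 0)] at hen
    refine hen.trans (add_le_add le_rfl (lintegral_mono_ae ?_))
    filter_upwards [h.ae_symmetric ht.2, h.ae_control_ne_top ht.2, hZb', hmem] with τ h1 h2 h3 h4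
    rw [ENNReal.ofReal_mul zero_le_two]
    have h5 := hC₁ ρ σ hρ hσρ _ A M e (a τ) (f τ) h1 (hf2 τ h4) (ne_top_of_le_ne_top hZ h3)
    refine (mul_le_mul' le_rfl h5).trans (le_of_eq ?_)
    rw [← mul_assoc, ← ENNReal.ofReal_mul zero_le_two, NNReal.coe_mul,
      ENNReal.coe_toNNReal_eq_toReal, ← mul_assoc, ← mul_assoc,
      ENNReal.ofReal_mul (q := (B τ).toReal) (by positivity), ENNReal.ofReal_toReal h2]
  · intro c
    have := memLp_bandPass hρ hσ (hf2 0 h0T c)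
    refine (integrable_mul_of_memLp this this).congr (Filter.Eventually.of_forall fun x => ?_)
    simp only [sq]
  · intro c
    have hm : Measurable fun p : ℝ × E => bandPass ρ σ (f p.1 c) p.2 *
        bandPass ρ σ (systemTerm e (a p.1) (f p.1) c) p.2 :=
      (measurable_bandPass_with_param (q := fun τ => f τ c) (h.continuous_fun c).measurable ρ σ).mul
        (measurable_bandPass_with_param (h.measurable_term c) ρ σ)
    refine ⟨hm.aestronglyMeasurable, ?_⟩
    rw [HasFiniteIntegral, lintegral_prod _ hm.enorm.aemeasurable]
    set κ : ℝ := 2 * kernelMass E 0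
    have hbound : ∀ᵐ τ ∂(volume.restrict (Icc 0 t)),
        ∫⁻ x, ‖bandPass ρ σ (f τ c) x * bandPass ρ σ (systemTerm e (a τ) (f τ) c) x‖ₑ ≤
        (ENNReal.ofReal κ * N₂) * (ENNReal.ofReal (C₂ * K) * Z * B τ +
          ENNReal.ofReal (C₂ * A * σ) * (Fintype.card I * N₂)) := by
      filter_upwards [h.ae_symmetric ht.2, h.ae_control_ne_top ht.2, hZb', hmem] with τ h1 h2 h3 h4
      refine (lintegral_enorm_mul_le (hwm τ c) (hgm τ c)).trans (mul_le_mul' ?_ ?_)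
      · exact (eLpNorm_bandPass_le hρ hσ (hfm τ c)).trans (mul_le_mul' le_rfl (hfN τ h4 c))
      · refine (hC₂ ρ σ hρ hσρ _ A M e (a τ) (f τ) h1 (hf2 τ h4) c).trans (add_le_add ?_ ?_)
        · rw [NNReal.coe_mul, ENNReal.coe_toNNReal_eq_toReal, ← mul_assoc,
            ENNReal.ofReal_mul (q := (B τ).toReal) (by positivity), ENNReal.ofReal_toReal h2,
            mul_assoc, mul_assoc, mul_comm Z]
          gcongr
        · refine mul_le_mul' le_rfl ?_
          rw [← nsmul_eq_mul, ← Finset.card_univ, ← Finset.sum_const]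
          exact Finset.sum_le_sum fun d _ => hfN τ h4 d
    refine (lintegral_mono_ae hbound).trans_lt ?_
    have hκN : ENNReal.ofReal κ * N₂ ≠ ⊤ := ENNReal.mul_ne_top ENNReal.ofReal_ne_top hN₂
    have hCZ : ENNReal.ofReal (C₂ * K) * Z ≠ ⊤ := ENNReal.mul_ne_top ENNReal.ofReal_ne_top hZ
    rw [lintegral_const_mul' _ _ hκN, lintegral_add_right _ measurable_const,
      lintegral_const_mul' _ _ hCZ, setLIntegral_const]
    refine ENNReal.mul_lt_top hκN.lt_top (ENNReal.add_lt_top.2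
      ⟨ENNReal.mul_lt_top hCZ.lt_top (h.lintegral_control_ne_top ht.2).lt_top,
        ENNReal.mul_lt_top (ENNReal.mul_lt_top ENNReal.ofReal_lt_top
          (ENNReal.mul_lt_top (by simp) hN₂.lt_top)) (by simp)⟩)

/-- High-frequency energy inequality, from the band-pass inequality by letting the upper frequency
tend to infinity. -/
lemma exists_sum_eLpNorm_highPass_sq_le (E : Type) [NormedAddCommGroup E]
    [InnerProductSpace ℝ E] [FiniteDimensional ℝ E] [MeasurableSpace E] [BorelSpace E]
    (I J : Type) [Fintype I] [Fintype J] :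
    ∃ C : ℝ, 0 ≤ C ∧ ∀ (T A M : ℝ) (K : ℝ≥0) (B : ℝ → ℝ≥0∞) (e : J → E)
      (a : ℝ → J → I → I → E → ℝ) (f : ℝ → I → E → ℝ), SystemSolution T A M K B e a f →
      ∀ N₂ : ℝ≥0∞, N₂ ≠ ⊤ → (∀ τ ∈ Icc 0 T, ∀ c, eLpNorm (f τ c) 2 volume ≤ N₂) →
      ∀ ρ : ℝ, 0 < ρ → ∀ Z : ℝ≥0∞, Z ≠ ⊤ →
      (∀ᵐ τ ∂(volume.restrict (Icc 0 T)), highSize ρ (a τ) (f τ) ≤ Z) → ∀ t ∈ Icc 0 T,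
      ∑ c, eLpNorm (highPass ρ (f t c)) 2 volume ^ 2 ≤
        ENNReal.ofReal C * (∑ c, eLpNorm (highPass ρ (f 0 c)) 2 volume ^ 2 +
          ∫⁻ τ in Icc 0 t, K * B τ * highSize ρ (a τ) (f τ) ^ 2) := by
  obtain ⟨C₁, hC₁0, hC₁⟩ := exists_sum_eLpNorm_bandPass_sq_le E I J
  set κ := kernelMass E 0
  have hκ : 0 ≤ κ := kernelMass_nonneg 0
  refine ⟨2 * (κ ^ 2 + C₁), by positivity,
    fun T A M K B e a f h N₂ hN₂ hfN ρ hρ Z hZ hZb t ht => ?_⟩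
  have hfm : ∀ τ c, AEStronglyMeasurable (f τ c) volume := fun τ c =>
    (h.continuous_apply τ c).aestronglyMeasurable
  set Y₀ := ∑ c, eLpNorm (highPass ρ (f 0 c)) 2 volume ^ 2
  set Q := ∫⁻ τ in Icc 0 t, K * B τ * highSize ρ (a τ) (f τ) ^ 2 with hQ
  have hQ' : ∫⁻ τ in Icc 0 t, ENNReal.ofReal (C₁ * K) * B τ * highSize ρ (a τ) (f τ) ^ 2 =
      ENNReal.ofReal C₁ * Q := by
    rw [hQ, ← lintegral_const_mul' _ _ ENNReal.ofReal_ne_top]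
    refine lintegral_congr fun τ => ?_
    rw [ENNReal.ofReal_mul hC₁0, ENNReal.ofReal_coe_nnreal]
    ring
  -- The upper threshold is `k + 1`. The frequencies above it are added on the right and vanish in the
  -- limit `k → ∞`.
  have hle : ∀ k : ℕ, 2 * ρ ≤ (k : ℝ) + 1 → ∑ c, eLpNorm (highPass ρ (f t c)) 2 volume ^ 2 ≤
      ENNReal.ofReal (2 * (κ ^ 2 + C₁)) * (Y₀ + Q) +
        2 * ∑ c, eLpNorm (highPass ((k : ℝ) + 1) (f t c)) 2 volume ^ 2 := by
    intro k hk
    have hσ : (0 : ℝ) < (k : ℝ) + 1 := by positivity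
    have h1 := hC₁ T A M K B e a f h N₂ hN₂ hfN ρ ((k : ℝ) + 1) hρ hk Z hZ hZb t ht
    rw [hQ'] at h1
    have h2 : ∑ c, eLpNorm (bandPass ρ ((k : ℝ) + 1) (f 0 c)) 2 volume ^ 2 ≤
        ENNReal.ofReal (κ ^ 2) * Y₀ := by
      rw [Finset.mul_sum]
      refine Finset.sum_le_sum fun c _ => ?_
      rw [ENNReal.ofReal_pow hκ, ← mul_pow]
      gcongr
      exact eLpNorm_lowPass_sub_lowPass_le hρ hk (hfm 0 c) (h.bound 0 c)
    have h3 : ∀ c, eLpNorm (highPass ρ (f t c)) 2 volume ^ 2 ≤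
        2 * eLpNorm (bandPass ρ ((k : ℝ) + 1) (f t c)) 2 volume ^ 2 +
          2 * eLpNorm (highPass ((k : ℝ) + 1) (f t c)) 2 volume ^ 2 := by
      intro c
      have e1 : highPass ρ (f t c) =
          bandPass ρ ((k : ℝ) + 1) (f t c) + highPass ((k : ℝ) + 1) (f t c) := by
        ext1 x
        simp only [Pi.add_apply, highPass, bandPass]
        ring
      have h4 := eLpNorm_add_le (p := 2) (μ := volume)
        (aestronglyMeasurable_bandPass (ρ := ρ) (σ := (k : ℝ) + 1) (hfm t c))
        (aestronglyMeasurable_highPass (r := (k : ℝ) + 1) (hfm t c)) (by norm_num)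
      rw [e1]
      refine (pow_le_pow_left' h4 2).trans ?_
      rw [← mul_add]
      have := ENNReal.rpow_add_le_mul_rpow_add_rpow
        (eLpNorm (bandPass ρ ((k : ℝ) + 1) (f t c)) 2 volume)
        (eLpNorm (highPass ((k : ℝ) + 1) (f t c)) 2 volume) (p := 2) (by norm_num)
      norm_num at this
      exact this
    calc _ ≤ ∑ c, (2 * eLpNorm (bandPass ρ ((k : ℝ) + 1) (f t c)) 2 volume ^ 2 +
          2 * eLpNorm (highPass ((k : ℝ) + 1) (f t c)) 2 volume ^ 2) :=
          Finset.sum_le_sum fun c _ => h3 c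
      _ = 2 * ∑ c, eLpNorm (bandPass ρ ((k : ℝ) + 1) (f t c)) 2 volume ^ 2 +
          2 * ∑ c, eLpNorm (highPass ((k : ℝ) + 1) (f t c)) 2 volume ^ 2 := by
          rw [Finset.sum_add_distrib, Finset.mul_sum, Finset.mul_sum]
      _ ≤ _ := by
          refine add_le_add ?_ le_rfl
          refine (mul_le_mul' le_rfl (h1.trans (add_le_add h2 le_rfl))).trans ?_
          rw [ENNReal.ofReal_mul zero_le_two, mul_assoc, ENNReal.ofReal_ofNat,
            ENNReal.ofReal_add (by positivity) hC₁0, mul_add, mul_add, add_mul, add_mul]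
          rw [mul_add, mul_add, mul_add]
          refine add_le_add (le_self_add) le_add_self
  have hlim : Filter.Tendsto (fun k : ℕ => ENNReal.ofReal (2 * (κ ^ 2 + C₁)) * (Y₀ + Q) +
      2 * ∑ c, eLpNorm (highPass ((k : ℝ) + 1) (f t c)) 2 volume ^ 2) Filter.atTop
      (nhds (ENNReal.ofReal (2 * (κ ^ 2 + C₁)) * (Y₀ + Q) + 2 * ∑ _c : I, 0)) := by
    refine tendsto_const_nhds.add (ENNReal.Tendsto.const_mul (tendsto_finsetSum _ fun c _ => ?_)
      (Or.inr (by norm_num)))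
    exact tendsto_eLpNorm_highPass ⟨hfm t c, (hfN t ht c).trans_lt hN₂.lt_top⟩ (h.bound t c)
  rw [Finset.sum_const_zero, mul_zero, add_zero] at hlim
  refine ge_of_tendsto hlim ?_
  obtain ⟨k₀, hk₀⟩ := exists_nat_ge (2 * ρ)
  filter_upwards [Filter.eventually_ge_atTop k₀] with k hk
  have h1 : (k₀ : ℝ) ≤ k := by exact_mod_cast hk
  exact hle k (by linarith)

end EnergyEstimates

/-! ### Summation over dyadic scales -/

section Summation

lemma ennreal_add_sq_le (x y : ℝ≥0∞) : (x + y) ^ 2 ≤ 2 * x ^ 2 + 2 * y ^ 2 := by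
  have := ENNReal.rpow_add_le_mul_rpow_add_rpow x y (p := 2) (by norm_num)
  norm_num at this
  rwa [mul_add] at this

/-- Superadditivity of the lower integral, without measurability. -/
theorem sum_lintegral_le {ι α : Type*} [MeasurableSpace α] {μ : Measure α} (s : Finset ι)
    (g : ι → α → ℝ≥0∞) : ∑ i ∈ s, ∫⁻ x, g i x ∂μ ≤ ∫⁻ x, ∑ i ∈ s, g i x ∂μ := by
  classical
  induction s using Finset.induction_on with
  | empty => simp
  | insert i s his ih =>
    simp only [Finset.sum_insert his]
    exact (add_le_add le_rfl ih).trans (le_lintegral_add _ _)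

/-- A discrete convolution with a geometric kernel is bounded on `ℓ²`. -/
lemma sum_sq_le_of_geometric {S y : ℕ → ℝ≥0∞} {d : ℝ≥0∞} (h0 : S 0 ≤ y 0 + d)
    (hS : ∀ j, S (j + 1) ≤ S j / 2 + y (j + 1)) (n : ℕ) :
    ∑ j ∈ Finset.range n, S j ^ 2 ≤ 4 * (∑ j ∈ Finset.range n, y j ^ 2 + d ^ 2) := by
  -- the extra term `S n ^ 2` on the left makes the induction work
  have key : ∀ n, ∑ j ∈ Finset.range (n + 1), S j ^ 2 + S n ^ 2 ≤
      4 * (∑ j ∈ Finset.range (n + 1), y j ^ 2 + d ^ 2) := by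
    intro n
    induction n with
    | zero =>
      have h1 : S 0 ^ 2 ≤ 2 * y 0 ^ 2 + 2 * d ^ 2 :=
        (pow_le_pow_left' h0 2).trans (ennreal_add_sq_le _ _)
      simp only [zero_add, Finset.sum_range_one]
      calc _ ≤ (2 * y 0 ^ 2 + 2 * d ^ 2) + (2 * y 0 ^ 2 + 2 * d ^ 2) := add_le_add h1 h1
        _ = _ := by ring
    | succ n ih =>
      have h1 : S (n + 1) ^ 2 + S (n + 1) ^ 2 ≤ S n ^ 2 + 4 * y (n + 1) ^ 2 := by
        have h2 : S (n + 1) ^ 2 ≤ 2 * (S n / 2) ^ 2 + 2 * y (n + 1) ^ 2 :=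
          (pow_le_pow_left' (hS n) 2).trans (ennreal_add_sq_le _ _)
        have h3 : 2 * (S n / 2) ^ 2 + 2 * (S n / 2) ^ 2 = S n ^ 2 := by
          have h4 : S n = 2 * (S n / 2) := by
            rw [ENNReal.mul_div_cancel (by norm_num) (by norm_num)]
          conv_rhs => rw [h4]
          ring
        calc _ ≤ (2 * (S n / 2) ^ 2 + 2 * y (n + 1) ^ 2) +
              (2 * (S n / 2) ^ 2 + 2 * y (n + 1) ^ 2) := add_le_add h2 h2
          _ = (2 * (S n / 2) ^ 2 + 2 * (S n / 2) ^ 2) + 4 * y (n + 1) ^ 2 := by ring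
          _ = _ := by rw [h3]
      rw [Finset.sum_range_succ _ (n + 1), Finset.sum_range_succ _ (n + 1)]
      calc _ = ∑ j ∈ Finset.range (n + 1), S j ^ 2 + (S (n + 1) ^ 2 + S (n + 1) ^ 2) := by ring
        _ ≤ ∑ j ∈ Finset.range (n + 1), S j ^ 2 + (S n ^ 2 + 4 * y (n + 1) ^ 2) := by gcongr
        _ = (∑ j ∈ Finset.range (n + 1), S j ^ 2 + S n ^ 2) + 4 * y (n + 1) ^ 2 := by ring
        _ ≤ 4 * (∑ j ∈ Finset.range (n + 1), y j ^ 2 + d ^ 2) + 4 * y (n + 1) ^ 2 := by gcongr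
        _ = _ := by ring
  rcases n with _ | n
  · simp
  · exact le_self_add.trans (key n)

lemma sq_sum_le_card_mul {I : Type} [Fintype I] (x : I → ℝ≥0∞) :
    (∑ c, x c) ^ 2 ≤ Fintype.card I * ∑ c, x c ^ 2 := by
  have h := ENNReal.inner_le_Lp_mul_Lq Finset.univ (fun _ : I => 1) x Real.HolderConjugate.two_two
  simp only [one_mul, ENNReal.one_rpow, Finset.sum_const, Finset.card_univ, nsmul_eq_mul,
    mul_one] at h
  calc _ ≤ (((Fintype.card I : ℝ≥0∞)) ^ (1 / (2 : ℝ)) * (∑ c, x c ^ (2 : ℝ)) ^ (1 / (2 : ℝ))) ^ 2 :=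
        pow_le_pow_left' h 2
    _ = _ := by
        rw [mul_pow, ← ENNReal.rpow_natCast, ← ENNReal.rpow_mul, ← ENNReal.rpow_natCast,
          ← ENNReal.rpow_mul]
        norm_num

lemma sum_sq_le_sq_sum {I : Type} [Fintype I] (x : I → ℝ≥0∞) :
    ∑ c, x c ^ 2 ≤ (∑ c, x c) ^ 2 := by
  rw [sq, Finset.sum_mul]
  refine Finset.sum_le_sum fun c _ => ?_
  rw [sq]
  gcongr
  exact Finset.single_le_sum (f := x) (fun _ _ => zero_le) (Finset.mem_univ c)

end Summation

/-! ### The Littlewood-Paley energy -/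

section DyadicEnergy

variable {E : Type} [NormedAddCommGroup E] [InnerProductSpace ℝ E] [FiniteDimensional ℝ E]
  [MeasurableSpace E] [BorelSpace E]

/-- The sum of the `L²` norms of the components. -/
def lowSize {I : Type} [Fintype I] (g : I → E → ℝ) : ℝ≥0∞ := ∑ c, eLpNorm (g c) 2 volume

/-- The sum of the `L²` norms of the high-frequency parts of the components. -/
def dyadicSize {I : Type} [Fintype I] (k : ℕ) (g : I → E → ℝ) : ℝ≥0∞ :=
  ∑ c, eLpNorm (highPass (2 ^ k) (g c)) 2 volume

/-- The Littlewood-Paley energy `‖g‖² + ∑ₖ w²ᵏ ‖g_{≥ 2ᵏ}‖²`, comparable for `w = 2ˢ > 1` to the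
square of the norm of `Hˢ`. -/
def dyadicEnergy {I : Type} [Fintype I] (w : ℝ) (g : I → E → ℝ) : ℝ≥0∞ :=
  lowSize g ^ 2 + ∑' k : ℕ, (ENNReal.ofReal (w ^ k) * dyadicSize k g) ^ 2

/-- The Littlewood-Paley energy of the frequencies up to about `2ⁿ`. -/
def dyadicEnergyBelow {I : Type} [Fintype I] (n : ℕ) (w : ℝ) (g : I → E → ℝ) : ℝ≥0∞ :=
  lowSize g ^ 2 + ∑ k ∈ Finset.range n, (ENNReal.ofReal (w ^ k) * dyadicSize k g) ^ 2

lemma dyadicSize_le {I : Type} [Fintype I] (k : ℕ) {g : I → E → ℝ}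
    (hg : ∀ c, AEStronglyMeasurable (g c) volume) :
    dyadicSize k g ≤ ENNReal.ofReal (1 + kernelMass E 0) * lowSize g := by
  unfold dyadicSize lowSize
  rw [Finset.mul_sum]
  exact Finset.sum_le_sum fun c _ => eLpNorm_highPass_le (by positivity) (hg c)

/-- The frequency-localized bound of the coefficients by the solution: at the scale `2ʲ`, the frequencies
of `f` at a lower scale `2ˡ` contribute with the factor `(2ˡ / 2ʲ)ᴺ`. -/
def MoserBound {I J : Type} [Fintype I] [Fintype J] (N : ℕ) (C : ℝ)
    (a : J → I → I → E → ℝ) (f : I → E → ℝ) : Prop :=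
  ∀ j : ℕ, highSize (2 ^ (j + 3)) a f ≤ ENNReal.ofReal C *
    (∑ l ∈ Finset.range (j + 1), ENNReal.ofReal (((2 : ℝ) ^ l / 2 ^ j) ^ N) * dyadicSize l f +
      ENNReal.ofReal (((2 : ℝ) ^ j)⁻¹ ^ N) * lowSize f)

variable {I J : Type} [Fintype I] [Fintype J]

/-- The `ℓ²` sum of the bounds `MoserBound` with the weights `wʲ`. Since `2w ≤ 2ᴺ`, the kernel
`(2ˡ / 2ʲ)ᴺ w^(j-l)` of the resulting convolution is at most `2^(l-j)`. -/
lemma MoserBound.sum_highSize_sq_le {N : ℕ} {C : ℝ} {a : J → I → I → E → ℝ} {f : I → E → ℝ}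
    (h : MoserBound N C a f) (hC : 0 ≤ C) {w : ℝ} (hw : 0 ≤ w) (hwN : w * 2 ≤ 2 ^ N) (n : ℕ) :
    ∑ j ∈ Finset.range n, (ENNReal.ofReal (w ^ j) * highSize (2 ^ (j + 3)) a f) ^ 2 ≤
      ENNReal.ofReal (4 * C ^ 2) * dyadicEnergyBelow n w f := by
  set y : ℕ → ℝ≥0∞ := fun k => ENNReal.ofReal (w ^ k) * dyadicSize k f with hy
  set S : ℕ → ℝ≥0∞ := fun j => ∑ l ∈ Finset.range (j + 1), (2⁻¹ : ℝ≥0∞) ^ (j - l) * y l +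
    (2⁻¹ : ℝ≥0∞) ^ j * lowSize f with hS
  have h2inv : (2⁻¹ : ℝ≥0∞) = ENNReal.ofReal 2⁻¹ := by
    rw [ENNReal.ofReal_inv_of_pos (by norm_num)]; simp
  have hw2 : w * (2⁻¹ : ℝ) ^ N ≤ 2⁻¹ := by
    rw [inv_pow, ← div_eq_mul_inv, div_le_iff₀ (by positivity)]
    linarith
  have hterm : ∀ i : ℕ, w ^ i * ((2⁻¹ : ℝ) ^ i) ^ N ≤ 2⁻¹ ^ i := by
    intro i
    rw [← pow_mul, mul_comm i N, pow_mul, ← mul_pow]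
    exact pow_le_pow_left₀ (by positivity) hw2 i
  have hZ : ∀ j, ENNReal.ofReal (w ^ j) * highSize (2 ^ (j + 3)) a f ≤ ENNReal.ofReal C * S j := by
    intro j
    refine (mul_le_mul' le_rfl (h j)).trans ?_
    rw [mul_left_comm]
    refine mul_le_mul' le_rfl ?_
    rw [mul_add, Finset.mul_sum]
    refine add_le_add (Finset.sum_le_sum fun l hl => ?_) ?_
    · have hl' : l ≤ j := by simpa [Nat.lt_succ_iff] using hl
      rw [hy]
      beta_reduce
      rw [← mul_assoc, ← mul_assoc, h2inv, ← ENNReal.ofReal_pow (by norm_num),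
        ← ENNReal.ofReal_mul (by positivity), ← ENNReal.ofReal_mul (by positivity)]
      refine mul_le_mul' (ENNReal.ofReal_le_ofReal ?_) le_rfl
      have e1 : (2 : ℝ) ^ l / 2 ^ j = 2⁻¹ ^ (j - l) := by
        rw [inv_pow, div_eq_iff (by positivity), inv_mul_eq_div, eq_div_iff (by positivity),
          ← pow_add]
        congr 1; omega
      have e2 : w ^ j = w ^ (j - l) * w ^ l := by rw [← pow_add]; congr 1; omega
      rw [e1, e2]
      calc _ = w ^ (j - l) * (2⁻¹ ^ (j - l)) ^ N * w ^ l := by ring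
        _ ≤ _ := mul_le_mul_of_nonneg_right (hterm _) (by positivity)
    · rw [← mul_assoc, h2inv, ← ENNReal.ofReal_pow (by norm_num),
        ← ENNReal.ofReal_mul (by positivity)]
      refine mul_le_mul' (ENNReal.ofReal_le_ofReal ?_) le_rfl
      rw [← inv_pow]
      exact hterm j
  have hschur := sum_sq_le_of_geometric (S := S) (y := y) (d := lowSize f) (by simp [hS])
    (fun j => ?_) n
  · calc _ ≤ ∑ j ∈ Finset.range n, (ENNReal.ofReal C * S j) ^ 2 :=
          Finset.sum_le_sum fun j _ => pow_le_pow_left' (hZ j) 2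
      _ = ENNReal.ofReal C ^ 2 * ∑ j ∈ Finset.range n, S j ^ 2 := by
          rw [Finset.mul_sum]; simp only [mul_pow]
      _ ≤ ENNReal.ofReal C ^ 2 * (4 * (∑ j ∈ Finset.range n, y j ^ 2 + lowSize f ^ 2)) := by gcongr
      _ = _ := by
          rw [ENNReal.ofReal_mul (by norm_num), ENNReal.ofReal_pow hC, dyadicEnergyBelow]
          norm_num
          ring
  · refine le_of_eq ?_
    rw [hS]
    beta_reduce
    rw [Finset.sum_range_succ _ (j + 1), Nat.sub_self, pow_zero, one_mul, ENNReal.div_eq_inv_mul,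
      mul_add, Finset.mul_sum]
    have e : ∀ l ∈ Finset.range (j + 1), (2⁻¹ : ℝ≥0∞) ^ (j + 1 - l) * y l =
        2⁻¹ * (2⁻¹ ^ (j - l) * y l) := by
      intro l hl
      have hl' : l ≤ j := by simpa [Nat.lt_succ_iff] using hl
      rw [Nat.succ_sub hl', pow_succ']
      ring
    rw [Finset.sum_congr rfl e, pow_succ']
    ring

end DyadicEnergy

/-! ### Propagation of the Littlewood-Paley energy -/

section HighRegularity

/-- Propagation of the Littlewood-Paley energy. The constants depend only on the dimensions and on
the weight `w`. -/
lemma exists_dyadicEnergy_le (E : Type) [NormedAddCommGroup E]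
    [InnerProductSpace ℝ E] [FiniteDimensional ℝ E] [MeasurableSpace E] [BorelSpace E]
    (I J : Type) [Fintype I] [Fintype J] {w : ℝ} (hw : 1 ≤ w) {N : ℕ} (hwN : w * 2 ≤ 2 ^ N) :
    ∃ C C' : ℝ, 0 ≤ C ∧ 0 ≤ C' ∧ ∀ (T A M : ℝ) (K : ℝ≥0) (B : ℝ → ℝ≥0∞) (e : J → E)
      (a : ℝ → J → I → I → E → ℝ) (f : ℝ → I → E → ℝ), SystemSolution T A M K B e a f →
      ∀ C₀ : ℝ, 0 ≤ C₀ → lowSize (f 0) ≠ ⊤ →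
      (∀ τ ∈ Icc 0 T, (∀ c, MemLp (f τ c) 2 volume) → MoserBound N C₀ (a τ) (f τ)) →
      ∀ t ∈ Icc 0 T, dyadicEnergy w (f t) ≤
        ENNReal.ofReal C * ENNReal.ofReal (Real.exp (C' * K * (1 + C₀ ^ 2) *
          (∫⁻ τ in Icc 0 t, B τ).toReal)) * dyadicEnergy w (f 0) := by
  obtain ⟨C₁, hC₁0, hC₁⟩ := exists_sum_eLpNorm_highPass_sq_le E I J
  set P : ℝ := (Fintype.card J * Fintype.card I : ℝ) with hP
  have hP0 : 0 ≤ P := by positivity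
  set m : ℝ := (Fintype.card I : ℝ) with hm
  have hm0 : 0 ≤ m := by positivity
  set κ := 1 + kernelMass E 0 with hκ
  have hκ0 : 0 ≤ κ := by have := kernelMass_nonneg (E := E) 0; positivity
  have hw0 : 0 ≤ w := by linarith
  set Q : ℝ := 1 + 3 * (w ^ 2 * κ) ^ 2 with hQ
  have hQ1 : 0 ≤ Q := by positivity
  set C₂ : ℝ := Q * (2 * m) + m * C₁ with hC₂
  have hC₂0 : 0 ≤ C₂ := by positivity
  refine ⟨2 * C₂, 4 * P + 8 * (m * C₁ * w ^ 6), by positivity, by positivity,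
    fun T A M K B e a f h C₀ hC₀ h0 hMos t ht => ?_⟩
  have hfm : ∀ τ c, AEStronglyMeasurable (f τ c) volume := fun τ c =>
    (h.continuous_apply τ c).aestronglyMeasurable
  set β : ℝ → ℝ := fun τ => (∫⁻ r in Icc 0 τ, B r).toReal with hβ
  have hβ0 : ∀ τ, 0 ≤ β τ := fun τ => ENNReal.toReal_nonneg
  have hβmono : ∀ {τ σ : ℝ}, τ ≤ σ → σ ≤ T → β τ ≤ β σ := fun h1 h2 =>
    ENNReal.toReal_mono (h.lintegral_control_ne_top h2)
      (lintegral_mono' (Measure.restrict_mono_set _ (Icc_subset_Icc_right h1)) le_rfl)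
  -- the `L²` bound
  have hlow : ∀ τ ∈ Icc 0 T, lowSize (f τ) ^ 2 ≤
      ENNReal.ofReal (2 * m) * ENNReal.ofReal (Real.exp (4 * P * K * β τ)) * lowSize (f 0) ^ 2 := by
    intro τ hτ
    have h1 := h.lintegral_sq_le hτ
    rw [lintegral_ofReal_sum_sq (hfm τ), lintegral_ofReal_sum_sq (hfm 0)] at h1
    calc _ ≤ (Fintype.card I : ℝ≥0∞) * ∑ c, eLpNorm (f τ c) 2 volume ^ 2 := sq_sum_le_card_mul _
      _ ≤ (Fintype.card I : ℝ≥0∞) * (2 * lowSize (f 0) ^ 2 *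
          ENNReal.ofReal (Real.exp (4 * P * (K * β τ)))) := by
          refine mul_le_mul' le_rfl (h1.trans ?_)
          gcongr
          exact sum_sq_le_sq_sum _
      _ = _ := by
          rw [ENNReal.ofReal_mul zero_le_two, hm, ENNReal.ofReal_natCast, ENNReal.ofReal_ofNat,
            ← mul_assoc (4 * P)]
          ring
  -- uniform finiteness on `[0, T]`
  set Λ : ℝ≥0∞ := ENNReal.ofReal (2 * m) * ENNReal.ofReal (Real.exp (4 * P * K * β T)) *
    lowSize (f 0) ^ 2 with hΛ
  have hΛtop : Λ ≠ ⊤ := ENNReal.mul_ne_top (ENNReal.mul_ne_top ENNReal.ofReal_ne_top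
    ENNReal.ofReal_ne_top) (ENNReal.pow_ne_top h0)
  have hlowΛ : ∀ τ ∈ Icc 0 T, lowSize (f τ) ^ 2 ≤ Λ := by
    intro τ hτ
    refine (hlow τ hτ).trans ?_
    have := hβmono hτ.2 le_rfl
    rw [hΛ]
    gcongr
  set N₂ : ℝ≥0∞ := Λ + 1 with hN₂
  have hN₂top : N₂ ≠ ⊤ := ENNReal.add_ne_top.2 ⟨hΛtop, ENNReal.one_ne_top⟩
  have hlowN : ∀ τ ∈ Icc 0 T, lowSize (f τ) ≤ N₂ := by
    intro τ hτ
    rcases le_total (lowSize (f τ)) 1 with h1 | h1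
    · exact h1.trans le_add_self
    · exact ((le_self_pow h1 two_ne_zero).trans (hlowΛ τ hτ)).trans le_self_add
  have hfN : ∀ τ ∈ Icc 0 T, ∀ c, eLpNorm (f τ c) 2 volume ≤ N₂ := fun τ hτ c =>
    (Finset.single_le_sum (f := fun c => eLpNorm (f τ c) 2 volume) (fun _ _ => zero_le)
      (Finset.mem_univ c)).trans (hlowN τ hτ)
  have hMoser : ∀ τ ∈ Icc 0 T, MoserBound N C₀ (a τ) (f τ) := fun τ hτ =>
    hMos τ hτ fun c => ⟨hfm τ c, (hfN τ hτ c).trans_lt hN₂top.lt_top⟩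
  have hdy : ∀ τ ∈ Icc 0 T, ∀ k, dyadicSize k (f τ) ≤ ENNReal.ofReal κ * N₂ := fun τ hτ k =>
    (dyadicSize_le k (hfm τ)).trans (mul_le_mul' le_rfl (hlowN τ hτ))
  -- The energy inequality at the scale `2^(j+3)`. Its right-hand side involves the scales from `2ʲ`
  -- on, and the shift of the weights by `w³` is absorbed in the constant.
  have hhigh : ∀ j : ℕ, ∀ τ ∈ Icc 0 T, (ENNReal.ofReal (w ^ (j + 3)) * dyadicSize (j + 3) (f τ)) ^ 2 ≤
      ENNReal.ofReal (m * C₁) * ((ENNReal.ofReal (w ^ (j + 3)) * dyadicSize (j + 3) (f 0)) ^ 2 +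
        ∫⁻ r in Icc 0 τ, ENNReal.ofReal (K * w ^ 6) * B r *
          (ENNReal.ofReal (w ^ j) * highSize (2 ^ (j + 3)) (a r) (f r)) ^ 2) := by
    intro j τ hτ
    set Z : ℝ≥0∞ := ENNReal.ofReal C₀ *
      (∑ l ∈ Finset.range (j + 1), ENNReal.ofReal (((2 : ℝ) ^ l / 2 ^ j) ^ N) *
        (ENNReal.ofReal κ * N₂) + ENNReal.ofReal (((2 : ℝ) ^ j)⁻¹ ^ N) * N₂) with hZ
    have hZtop : Z ≠ ⊤ := by
      refine ENNReal.mul_ne_top ENNReal.ofReal_ne_top (ENNReal.add_ne_top.2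
        ⟨(ENNReal.sum_lt_top.2 fun l _ => ?_).ne, ENNReal.mul_ne_top ENNReal.ofReal_ne_top hN₂top⟩)
      exact ENNReal.mul_lt_top ENNReal.ofReal_lt_top
        (ENNReal.mul_lt_top ENNReal.ofReal_lt_top hN₂top.lt_top)
    have hZle : ∀ᵐ r ∂(volume.restrict (Icc 0 T)), highSize (2 ^ (j + 3)) (a r) (f r) ≤ Z := by
      filter_upwards [ae_restrict_mem measurableSet_Icc] with r hr
      refine (hMoser r hr j).trans ?_
      rw [hZ]
      gcongr with l
      · exact hdy r hr l
      · exact hlowN r hr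
    have h1 := hC₁ T A M K B e a f h N₂ hN₂top hfN (2 ^ (j + 3)) (by positivity) Z hZtop hZle τ hτ
    have h2 : dyadicSize (j + 3) (f τ) ^ 2 ≤ ENNReal.ofReal (m * C₁) *
        (dyadicSize (j + 3) (f 0) ^ 2 +
          ∫⁻ r in Icc 0 τ, K * B r * highSize (2 ^ (j + 3)) (a r) (f r) ^ 2) := by
      refine (sq_sum_le_card_mul _).trans ?_
      rw [ENNReal.ofReal_mul hm0, hm, ENNReal.ofReal_natCast, mul_assoc]
      refine mul_le_mul' le_rfl (h1.trans ?_)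
      gcongr
      exact sum_sq_le_sq_sum _
    rw [mul_pow]
    refine (mul_le_mul' le_rfl h2).trans (le_of_eq ?_)
    rw [mul_left_comm]
    congr 1
    rw [mul_add, ← mul_pow]
    congr 1
    rw [← lintegral_const_mul' _ _ (by simp)]
    refine lintegral_congr fun r => ?_
    rw [mul_pow, ENNReal.ofReal_mul (by positivity), ENNReal.ofReal_coe_nnreal,
      pow_add w j 3, ENNReal.ofReal_mul (by positivity), ENNReal.ofReal_pow hw0 3,
      ENNReal.ofReal_pow hw0 6]
    ring
  -- summation over the frequencies
  have hsum : ∀ n : ℕ, ∀ τ ∈ Icc 0 t, dyadicEnergyBelow (n + 3) w (f τ) ≤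
      ENNReal.ofReal C₂ * ENNReal.ofReal (Real.exp (4 * P * K * β t)) *
        dyadicEnergyBelow (n + 3) w (f 0) +
      ∫⁻ r in Icc 0 τ, (ENNReal.ofReal (m * C₁ * (K * w ^ 6) * (4 * C₀ ^ 2)) * B r) *
        dyadicEnergyBelow (n + 3) w (f r) := by
    intro n τ hτ
    have hτT : τ ∈ Icc 0 T := ⟨hτ.1, hτ.2.trans ht.2⟩
    have hτmem : ∀ᵐ r ∂(volume.restrict (Icc 0 τ)), r ∈ Icc 0 T := by
      filter_upwards [ae_restrict_mem measurableSet_Icc] with r hr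
      exact ⟨hr.1, hr.2.trans hτT.2⟩
    set Y : ℕ → ℝ≥0∞ := fun k => (ENNReal.ofReal (w ^ k) * dyadicSize k (f τ)) ^ 2 with hY
    set Y0 : ℕ → ℝ≥0∞ := fun k => (ENNReal.ofReal (w ^ k) * dyadicSize k (f 0)) ^ 2 with hY0
    -- The frequencies below `2³`, which are excluded from the energy inequalities, are controlled by the
    -- `L²` norm.
    have hYlow : ∀ k < 3, Y k ≤ ENNReal.ofReal ((w ^ 2 * κ) ^ 2) * lowSize (f τ) ^ 2 := by
      intro k hk
      rw [hY, ENNReal.ofReal_pow (by positivity), ← mul_pow]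
      refine pow_le_pow_left' ?_ 2
      refine (mul_le_mul' le_rfl (dyadicSize_le k (hfm τ))).trans ?_
      rw [← mul_assoc, ← ENNReal.ofReal_mul (by positivity)]
      have : w ^ k ≤ w ^ 2 := pow_le_pow_right₀ hw (by omega)
      gcongr
    have hsplit : ∑ k ∈ Finset.range (n + 3), Y k =
        ∑ k ∈ Finset.range 3, Y k + ∑ j ∈ Finset.range n, Y (j + 3) := by
      rw [add_comm n 3, Finset.sum_range_add]
      simp only [add_comm 3]
    have hsplit0 : ∑ j ∈ Finset.range n, Y0 (j + 3) ≤ ∑ k ∈ Finset.range (n + 3), Y0 k := by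
      rw [add_comm n 3, Finset.sum_range_add]
      simp only [add_comm 3]
      exact le_add_self
    have hA : lowSize (f τ) ^ 2 + ∑ k ∈ Finset.range 3, Y k ≤ ENNReal.ofReal Q *
        lowSize (f τ) ^ 2 := by
      have h1 : ∑ k ∈ Finset.range 3, Y k ≤ ∑ _k ∈ Finset.range 3,
          ENNReal.ofReal ((w ^ 2 * κ) ^ 2) * lowSize (f τ) ^ 2 :=
        Finset.sum_le_sum fun k hk => hYlow k (Finset.mem_range.1 hk)
      rw [Finset.sum_const, Finset.card_range] at h1
      rw [hQ, ENNReal.ofReal_add zero_le_one (by positivity), ENNReal.ofReal_one, add_mul, one_mul,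
        ENNReal.ofReal_mul (by norm_num), mul_assoc]
      gcongr
      simpa using h1
    have hBsum : ∑ j ∈ Finset.range n, Y (j + 3) ≤ ENNReal.ofReal (m * C₁) *
        (∑ k ∈ Finset.range (n + 3), Y0 k + ∫⁻ r in Icc 0 τ, ENNReal.ofReal (K * w ^ 6) * B r *
          (ENNReal.ofReal (4 * C₀ ^ 2) * dyadicEnergyBelow (n + 3) w (f r))) := by
      refine (Finset.sum_le_sum fun j _ => hhigh j τ hτT).trans ?_
      rw [← Finset.mul_sum, Finset.sum_add_distrib]
      refine mul_le_mul' le_rfl (add_le_add hsplit0 ?_)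
      refine (sum_lintegral_le _ _).trans (lintegral_mono_ae ?_)
      filter_upwards [hτmem] with r hr
      rw [← Finset.mul_sum]
      refine mul_le_mul' le_rfl (((hMoser r hr).sum_highSize_sq_le hC₀ hw0 hwN n).trans ?_)
      refine mul_le_mul' le_rfl (add_le_add le_rfl ?_)
      exact Finset.sum_le_sum_of_subset (Finset.range_mono (by omega))
    have hexp1 : (1 : ℝ≥0∞) ≤ ENNReal.ofReal (Real.exp (4 * P * K * β t)) := by
      rw [ENNReal.one_le_ofReal, Real.one_le_exp_iff]
      have := hβ0 t
      positivity
    set X : ℝ≥0∞ := ENNReal.ofReal (Real.exp (4 * P * K * β t)) with hX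
    have hlow' : lowSize (f τ) ^ 2 ≤ ENNReal.ofReal (2 * m) * X * lowSize (f 0) ^ 2 := by
      refine (hlow τ hτT).trans ?_
      have := hβmono hτ.2 ht.2
      rw [hX]
      gcongr
    have hint : ENNReal.ofReal (m * C₁) * ∫⁻ r in Icc 0 τ, ENNReal.ofReal (K * w ^ 6) * B r *
          (ENNReal.ofReal (4 * C₀ ^ 2) * dyadicEnergyBelow (n + 3) w (f r)) =
        ∫⁻ r in Icc 0 τ, (ENNReal.ofReal (m * C₁ * (K * w ^ 6) * (4 * C₀ ^ 2)) * B r) *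
          dyadicEnergyBelow (n + 3) w (f r) := by
      rw [← lintegral_const_mul' _ _ ENNReal.ofReal_ne_top]
      refine lintegral_congr fun r => ?_
      rw [ENNReal.ofReal_mul (p := m * C₁ * (K * w ^ 6)) (by positivity),
        ENNReal.ofReal_mul (p := m * C₁) (by positivity)]
      ring
    calc dyadicEnergyBelow (n + 3) w (f τ)
        = (lowSize (f τ) ^ 2 + ∑ k ∈ Finset.range 3, Y k) + ∑ j ∈ Finset.range n, Y (j + 3) := by
          rw [dyadicEnergyBelow, hsplit, add_assoc]
      _ ≤ ENNReal.ofReal Q * (ENNReal.ofReal (2 * m) * X * lowSize (f 0) ^ 2) +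
          ENNReal.ofReal (m * C₁) * (∑ k ∈ Finset.range (n + 3), Y0 k +
            ∫⁻ r in Icc 0 τ, ENNReal.ofReal (K * w ^ 6) * B r *
              (ENNReal.ofReal (4 * C₀ ^ 2) * dyadicEnergyBelow (n + 3) w (f r))) :=
          add_le_add (hA.trans (mul_le_mul' le_rfl hlow')) hBsum
      _ = (ENNReal.ofReal (Q * (2 * m)) * X * lowSize (f 0) ^ 2 +
          ENNReal.ofReal (m * C₁) * 1 * ∑ k ∈ Finset.range (n + 3), Y0 k) +
            ∫⁻ r in Icc 0 τ, (ENNReal.ofReal (m * C₁ * (K * w ^ 6) * (4 * C₀ ^ 2)) * B r) *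
              dyadicEnergyBelow (n + 3) w (f r) := by
          rw [mul_add (ENNReal.ofReal (m * C₁)), hint, ENNReal.ofReal_mul (p := Q) hQ1]
          ring
      _ ≤ (ENNReal.ofReal C₂ * X * lowSize (f 0) ^ 2 +
          ENNReal.ofReal C₂ * X * ∑ k ∈ Finset.range (n + 3), Y0 k) + _ := by
          refine add_le_add (add_le_add ?_ ?_) le_rfl
          · refine mul_le_mul' (mul_le_mul' (ENNReal.ofReal_le_ofReal ?_) le_rfl) le_rfl
            rw [hC₂]; exact le_add_of_nonneg_right (by positivity)
          · refine mul_le_mul' (mul_le_mul' (ENNReal.ofReal_le_ofReal ?_) hexp1) le_rfl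
            rw [hC₂]; exact le_add_of_nonneg_left (by positivity)
      _ = _ := by rw [← mul_add, dyadicEnergyBelow]
  -- Grönwall's inequality applies because the truncated energy is bounded on `[0, T]`.
  have hgron : ∀ n : ℕ, dyadicEnergyBelow (n + 3) w (f t) ≤
      ENNReal.ofReal (2 * C₂) * ENNReal.ofReal (Real.exp ((4 * P + 8 * (m * C₁ * w ^ 6)) * K *
        (1 + C₀ ^ 2) * β t)) * dyadicEnergyBelow (n + 3) w (f 0) := by
    intro n
    set C₃ : ℝ := m * C₁ * (K * w ^ 6) * (4 * C₀ ^ 2) with hC₃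
    have hC₃0 : 0 ≤ C₃ := by positivity
    have hI : ∀ τ, ∫⁻ r in Icc 0 τ, ENNReal.ofReal C₃ * B r =
        ENNReal.ofReal C₃ * ∫⁻ r in Icc 0 τ, B r := fun τ =>
      lintegral_const_mul' _ _ ENNReal.ofReal_ne_top
    set F₀ : ℝ≥0∞ := N₂ ^ 2 + ∑ k ∈ Finset.range (n + 3),
      (ENNReal.ofReal (w ^ k) * (ENNReal.ofReal κ * N₂)) ^ 2 with hF₀
    have hF₀top : F₀ ≠ ⊤ := by
      refine ENNReal.add_ne_top.2 ⟨ENNReal.pow_ne_top hN₂top,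
        (ENNReal.sum_lt_top.2 fun k _ => ?_).ne⟩
      exact ENNReal.pow_lt_top (ENNReal.mul_lt_top ENNReal.ofReal_lt_top
        (ENNReal.mul_lt_top ENNReal.ofReal_lt_top hN₂top.lt_top))
    have hg := gronwall_lintegral (T := t) (b := fun r => ENNReal.ofReal C₃ * B r)
      (f := fun τ => dyadicEnergyBelow (n + 3) w (f τ))
      (h.measurable_control.const_mul _).aemeasurable
      (by rw [hI]; exact ENNReal.mul_ne_top ENNReal.ofReal_ne_top (h.lintegral_control_ne_top ht.2))
      hF₀top (fun τ hτ => by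
        have hτT : τ ∈ Icc 0 T := ⟨hτ.1, hτ.2.trans ht.2⟩
        rw [hF₀]
        refine add_le_add (pow_le_pow_left' (hlowN τ hτT) 2) (Finset.sum_le_sum fun k _ => ?_)
        exact pow_le_pow_left' (mul_le_mul' le_rfl (hdy τ hτT k)) 2)
      (hsum n) ⟨ht.1, le_rfl⟩
    rw [hI, ENNReal.toReal_mul, ENNReal.toReal_ofReal hC₃0] at hg
    refine hg.trans ?_
    have e1 : ENNReal.ofReal (Real.exp (4 * P * K * β t)) *
        ENNReal.ofReal (Real.exp (2 * (C₃ * β t))) ≤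
        ENNReal.ofReal (Real.exp ((4 * P + 8 * (m * C₁ * w ^ 6)) * K * (1 + C₀ ^ 2) * β t)) := by
      rw [← ENNReal.ofReal_mul (Real.exp_pos _).le, ← Real.exp_add]
      refine ENNReal.ofReal_le_ofReal (Real.exp_le_exp.2 ?_)
      rw [hC₃]
      have t1 : 0 ≤ 4 * P * K * C₀ ^ 2 * β t := by have := hβ0 t; positivity
      have t2 : 0 ≤ 8 * (m * C₁ * w ^ 6) * K * β t := by have := hβ0 t; positivity
      nlinarith
    calc _ = ENNReal.ofReal (2 * C₂) * (ENNReal.ofReal (Real.exp (4 * P * K * β t)) *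
          ENNReal.ofReal (Real.exp (2 * (C₃ * β t)))) * dyadicEnergyBelow (n + 3) w (f 0) := by
          rw [ENNReal.ofReal_mul zero_le_two, ENNReal.ofReal_ofNat]
          ring
      _ ≤ _ := by gcongr
  have hbelow : ∀ n, dyadicEnergyBelow (n + 3) w (f 0) ≤ dyadicEnergy w (f 0) := fun n =>
    add_le_add le_rfl (ENNReal.sum_le_tsum _)
  rw [dyadicEnergy, ENNReal.tsum_eq_iSup_nat, ENNReal.add_iSup]
  refine iSup_le fun n => ?_
  refine le_trans (add_le_add le_rfl (Finset.sum_le_sum_of_subset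
    (Finset.range_mono (Nat.le_add_right n 3)))) ((hgron n).trans ?_)
  exact mul_le_mul' le_rfl (hbelow n)

end HighRegularity

/-! ### The coefficients of the quasilinear system -/

section Coefficients

variable {E : Type} [NormedAddCommGroup E] [InnerProductSpace ℝ E] [FiniteDimensional ℝ E]
  [MeasurableSpace E] [BorelSpace E] {I J : Type} [Fintype I] [Fintype J]

lemma EuclideanSpace.norm_le_sum (v : EuclideanSpace ℝ I) : ‖v‖ ≤ ∑ c, ‖v c‖ := by
  classical
  conv_lhs => rw [← (EuclideanSpace.basisFun I ℝ).sum_repr v]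
  refine (norm_sum_le _ _).trans (Finset.sum_le_sum fun c _ => ?_)
  rw [norm_smul, (EuclideanSpace.basisFun I ℝ).norm_eq_one, mul_one]
  simp

lemma eLpNorm_le_sum_component {g : E → EuclideanSpace ℝ I}
    (hg : ∀ c, AEStronglyMeasurable (fun x => g x c) volume) :
    eLpNorm g 2 volume ≤ ∑ c, eLpNorm (fun x => g x c) 2 volume := by
  calc eLpNorm g 2 volume ≤ eLpNorm (∑ c, fun x => ‖g x c‖) 2 volume := by
        refine eLpNorm_mono_real fun x => ?_
        rw [Finset.sum_apply]
        exact EuclideanSpace.norm_le_sum _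
    _ ≤ ∑ c, eLpNorm (fun x => ‖g x c‖) 2 volume :=
        eLpNorm_sum_le (fun c _ => (hg c).norm) (by norm_num)
    _ = _ := by simp only [eLpNorm_norm]

/-- The high-pass filter acts on components. -/
lemma highPass_component {r : ℝ} (hr : 0 < r) {u : E → EuclideanSpace ℝ I}
    (hu : AEStronglyMeasurable u volume) {R : ℝ} (hR : ∀ x, ‖u x‖ ≤ R) (c : I) (x : E) :
    highPass r u x c = highPass r (fun y => u y c) x := by
  have h : lowPass r (fun y => u y c) x = lowPass r u x c :=
    lowPass_clm hr (EuclideanSpace.proj c : EuclideanSpace ℝ I →L[ℝ] ℝ) hu hR x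
  rw [highPass, highPass, h, PiLp.sub_apply]

lemma eLpNorm_highPass_le_sum_component {r : ℝ} (hr : 0 < r) {u : E → EuclideanSpace ℝ I}
    (hu : Continuous u) {R : ℝ} (hR : ∀ x, ‖u x‖ ≤ R) :
    eLpNorm (highPass r u) 2 volume ≤ ∑ c, eLpNorm (highPass r fun x => u x c) 2 volume := by
  have e : ∀ c, (fun x => highPass r u x c) = highPass r fun x => u x c := fun c =>
    funext fun x => highPass_component hr hu.aestronglyMeasurable hR c x
  refine (eLpNorm_le_sum_component fun c => ?_).trans (le_of_eq (by simp only [e]))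
  rw [e]
  exact aestronglyMeasurable_highPass (by fun_prop : Continuous fun x => u x c).aestronglyMeasurable

/-- The high frequencies of smooth functions of a bounded function `u` are controlled by the
frequencies of `u`, uniformly for `u` in a ball of `L^∞`. -/
lemma exists_moserBound (E : Type) [NormedAddCommGroup E] [InnerProductSpace ℝ E]
    [FiniteDimensional ℝ E] [MeasurableSpace E] [BorelSpace E] (N : ℕ) (R : ℝ)
    {φ : J → I → I → EuclideanSpace ℝ I → ℝ} (hφ : ∀ j c d, ContDiff ℝ ∞ (φ j c d)) :
    ∃ C : ℝ, 0 ≤ C ∧ ∀ u : E → EuclideanSpace ℝ I, Continuous u → (∀ x, ‖u x‖ ≤ R) →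
      (∀ c, MemLp (fun x => u x c) 2 volume) →
      MoserBound N C (fun j c d x => φ j c d (u x)) (fun c x => u x c) := by
  have hF : ∀ j c d, ContDiff ℝ ∞ fun v => ((φ j c d v : ℝ) : ℂ) := fun j c d =>
    Complex.ofRealCLM.contDiff.comp (hφ j c d)
  choose C hC0 hC using fun j c d => exists_eLpNorm_highPass_comp_le (E := E) N R (hF j c d)
  choose D hD0 hD using fun j c d => exists_norm_sub_le_of_norm_le (hφ j c d) R
  have hκ : 0 ≤ kernelMass E 0 := kernelMass_nonneg 0
  refine ⟨(1 + kernelMass E 0) + ∑ j, ∑ c, ∑ d, C j c d, add_nonneg (by positivity)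
    (Finset.sum_nonneg fun j _ => Finset.sum_nonneg fun c _ => Finset.sum_nonneg fun d _ =>
      hC0 j c d), fun u hu hR hm k => ?_⟩
  have hR0 : 0 ≤ R := (norm_nonneg _).trans (hR 0)
  have huc : ∀ c, Continuous fun x => u x c := fun c => by fun_prop
  have hu2 : MemLp u 2 volume := ⟨hu.aestronglyMeasurable,
    (eLpNorm_le_sum_component fun c => (hm c).1).trans_lt
      (ENNReal.sum_lt_top.2 fun c _ => (hm c).2)⟩
  have huR : ∀ c x, ‖u x c‖ ≤ R := fun c x => (PiLp.norm_apply_le (u x) c).trans (hR x)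
  set S : ℝ≥0∞ := ∑ l ∈ Finset.range (k + 1), ENNReal.ofReal (((2 : ℝ) ^ l / 2 ^ k) ^ N) *
    dyadicSize l (fun c x => u x c) +
      ENNReal.ofReal (((2 : ℝ) ^ k)⁻¹ ^ N) * lowSize (fun c x => u x c) with hS
  have hSk : S = dyadicSize k (fun c x => u x c) +
      ∑ l ∈ Finset.range k, ENNReal.ofReal (((2 : ℝ) ^ l / 2 ^ k) ^ N) *
        dyadicSize l (fun c x => u x c) +
      ENNReal.ofReal (((2 : ℝ) ^ k)⁻¹ ^ N) * lowSize (fun c x => u x c) := by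
    rw [hS, Finset.sum_range_succ, div_self (by positivity), one_pow, ENNReal.ofReal_one, one_mul,
      add_comm (dyadicSize k _)]
  have h1 : ∑ c, eLpNorm (highPass (2 ^ (k + 3) / 4) fun x => u x c) 2 volume ≤
      ENNReal.ofReal (1 + kernelMass E 0) * S := by
    calc _ ≤ ∑ c, ENNReal.ofReal (1 + kernelMass E 0) *
          eLpNorm (highPass (2 ^ k) fun x => u x c) 2 volume := by
          refine Finset.sum_le_sum fun c _ => ?_
          refine eLpNorm_highPass_le_highPass (by positivity) ?_ (huc c).aestronglyMeasurable (huR c)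
          rw [pow_add]; norm_num; linarith [show (0 : ℝ) < 2 ^ k by positivity]
      _ = ENNReal.ofReal (1 + kernelMass E 0) * dyadicSize k (fun c x => u x c) := by
          rw [dyadicSize, Finset.mul_sum]
      _ ≤ _ := by rw [hSk, add_assoc]; exact mul_le_mul' le_rfl le_self_add
  have h2 : ∀ j c d, eLpNorm (highPass (2 ^ (k + 3) / 8) fun x => φ j c d (u x)) 2 volume ≤
      ENNReal.ofReal (C j c d) * S := by
    intro j c d
    have e : (2 : ℝ) ^ (k + 3) / 8 = 2 ^ k := by rw [pow_add]; norm_num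
    have hb : ∀ x, ‖φ j c d (u x)‖ ≤ ‖φ j c d 0‖ + D j c d * R := by
      intro x
      have h := hD j c d 0 (u x) (by simpa using hR0) (hR x)
      rw [sub_zero] at h
      have h' := norm_add_le (φ j c d 0) (φ j c d (u x) - φ j c d 0)
      rw [add_sub_cancel] at h'
      have := mul_le_mul_of_nonneg_left (hR x) (hD0 j c d)
      linarith
    have hcont : Continuous fun x => φ j c d (u x) := (hφ j c d).continuous.comp hu
    rw [e, ← eLpNorm_highPass_ofReal (by positivity) hcont.aestronglyMeasurable hb]
    refine (hC j c d u hu2 hR k).trans (mul_le_mul' le_rfl ?_)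
    rw [hSk]
    refine add_le_add (add_le_add ?_ (Finset.sum_le_sum fun l _ => mul_le_mul' le_rfl ?_))
      (mul_le_mul' le_rfl ?_)
    · exact eLpNorm_highPass_le_sum_component (by positivity) hu hR
    · exact eLpNorm_highPass_le_sum_component (by positivity) hu hR
    · exact eLpNorm_le_sum_component fun c => (hm c).1
  rw [ENNReal.ofReal_add (by positivity) (Finset.sum_nonneg fun j _ => Finset.sum_nonneg fun c _ =>
    Finset.sum_nonneg fun d _ => hC0 j c d), add_mul, highSize]
  refine add_le_add h1 ?_
  rw [ENNReal.ofReal_sum_of_nonneg fun j _ => Finset.sum_nonneg fun c _ =>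
    Finset.sum_nonneg fun d _ => hC0 j c d, Finset.sum_mul]
  refine Finset.sum_le_sum fun j _ => ?_
  rw [ENNReal.ofReal_sum_of_nonneg fun c _ => Finset.sum_nonneg fun d _ => hC0 j c d,
    Finset.sum_mul]
  refine Finset.sum_le_sum fun c _ => ?_
  rw [ENNReal.ofReal_sum_of_nonneg fun d _ => hC0 j c d, Finset.sum_mul]
  exact Finset.sum_le_sum fun d _ => h2 j c d

end Coefficients

/-! ### Lipschitz functions and their derivatives -/

section LipschitzFunctions

variable {E : Type} [NormedAddCommGroup E] [InnerProductSpace ℝ E] [FiniteDimensional ℝ E]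
  [MeasurableSpace E] [BorelSpace E]
  {V : Type} [NormedAddCommGroup V] [NormedSpace ℝ V] [FiniteDimensional ℝ V]

lemma norm_highPass_le_of_lipschitz {r : ℝ} (hr : 0 < r) {f : E → V} {L : ℝ≥0}
    (hL : LipschitzWith L f) {M : ℝ} (hM : ∀ x, ‖f x‖ ≤ M) (x : E) :
    ‖highPass r f x‖ ≤ L * (r⁻¹ * kernelMoment E) := by
  have : CompleteSpace V := FiniteDimensional.complete ℝ V
  have hf := hL.continuous.aestronglyMeasurable (μ := (volume : Measure E))
  have e : highPass r f x = ∫ y, lpKernel r y • (f x - f (x - y)) := by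
    simp only [smul_sub]
    rw [integral_sub ((integrable_lpKernel hr).smul_const _) (integrable_lpKernel_smul hr hf hM x),
      integral_smul_const, integral_lpKernel hr, one_smul]
    rfl
  rw [e, ← integral_norm_lpKernel_mul_norm hr, ← integral_const_mul]
  refine norm_integral_le_of_norm_le ((integrable_lpKernel_mul_norm hr).const_mul _)
    (Filter.Eventually.of_forall fun y => ?_)
  have h := hL.dist_le_mul x (x - y)
  rw [dist_eq_norm, dist_eq_norm, sub_sub_cancel] at h
  rw [norm_smul, mul_left_comm]
  exact mul_le_mul_of_nonneg_left h (norm_nonneg _)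

/-- A bound of the derivative almost everywhere bounds the Lipschitz constant, up to a factor. The
proof regularizes the function by a low-pass filter. -/
lemma lipschitzWith_of_ae_norm_fderiv_le {f : E → V} {L : ℝ≥0}
    (hL : LipschitzWith L f) {M : ℝ} (hM : ∀ x, ‖f x‖ ≤ M) {B : ℝ≥0}
    (hB : ∀ᵐ x, ‖fderiv ℝ f x‖ ≤ B) :
    LipschitzWith ((kernelMass E 0).toNNReal * B) f := by
  have : CompleteSpace V := FiniteDimensional.complete ℝ V
  have hf := hL.continuous.aestronglyMeasurable (μ := (volume : Measure E))
  have hκ : 0 ≤ kernelMass E 0 := kernelMass_nonneg 0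
  have hm : 0 ≤ kernelMoment E := kernelMoment_nonneg
  have h1 : ∀ r : ℝ, 0 < r → ∀ x y,
      ‖lowPass r f y - lowPass r f x‖ ≤ kernelMass E 0 * B * ‖y - x‖ := by
    intro r hr x y
    refine convex_univ.norm_image_sub_le_of_norm_fderiv_le (𝕜 := ℝ)
      (fun z _ => ((contDiff_lowPass hr hf hM).differentiable (by simp)).differentiableAt)
      (fun z _ => ?_) (mem_univ x) (mem_univ y)
    refine ContinuousLinearMap.opNorm_le_bound _ (by positivity) fun v => ?_
    rw [fderiv_lowPass_apply hr hL hM, lowPass, ← integral_norm_lpKernel hr, mul_assoc,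
      ← integral_mul_const]
    refine norm_integral_le_of_norm_le ((integrable_lpKernel hr).norm.mul_const _) ?_
    filter_upwards [(quasiMeasurePreserving_sub_left_of_right_invariant volume z).ae hB] with y hy
    rw [norm_smul]
    refine mul_le_mul_of_nonneg_left ?_ (norm_nonneg _)
    exact (ContinuousLinearMap.le_opNorm _ _).trans (by gcongr)
  refine LipschitzWith.of_dist_le_mul fun x y => ?_
  rw [dist_eq_norm, dist_eq_norm, NNReal.coe_mul, Real.coe_toNNReal _ hκ]
  refine le_of_forall_pos_le_add fun ε hε => ?_
  set c : ℝ := 2 * (L * kernelMoment E) with hc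
  have hc0 : 0 ≤ c := by positivity
  set r : ℝ := (c + 1) / ε with hr
  have hr0 : 0 < r := by positivity
  have h2 := norm_highPass_le_of_lipschitz hr0 hL hM x
  have h3 := norm_highPass_le_of_lipschitz hr0 hL hM y
  have h4 := h1 r hr0 y x
  have e : f x - f y = (lowPass r f x - lowPass r f y) + (highPass r f x - highPass r f y) := by
    simp only [highPass]; abel
  have h5 : 2 * (L * (r⁻¹ * kernelMoment E)) ≤ ε := by
    have : 2 * (L * (r⁻¹ * kernelMoment E)) = c / (c + 1) * ε := by
      rw [hr, hc]; field_simp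
    rw [this]
    refine mul_le_of_le_one_left hε.le ((div_le_one (by positivity)).2 (by linarith))
  rw [e]
  have h6 := norm_add_le (lowPass r f x - lowPass r f y) (highPass r f x - highPass r f y)
  have h7 := norm_sub_le (highPass r f x) (highPass r f y)
  linarith

/-- A closed condition on a continuous function holds everywhere if it holds almost everywhere. -/
lemma forall_le_of_ae_le {f : E → V} (hf : Continuous f) {c : ℝ} (h : ∀ᵐ x, ‖f x‖ ≤ c) (x : E) :
    ‖f x‖ ≤ c := by
  have hd := Measure.dense_of_ae h
  have hc : IsClosed {x | ‖f x‖ ≤ c} := isClosed_le hf.norm continuous_const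
  have : x ∈ closure {x | ‖f x‖ ≤ c} := hd x
  rwa [hc.closure_eq] at this

/-- The essential supremum exceeds `c` exactly if the superlevel set of `c` has positive measure, and
this measure is a measurable function of the parameter. -/
lemma measurable_eLpNorm_top_fderiv {U : ℝ → E → V} (hU : Continuous (Function.uncurry U)) :
    Measurable fun τ => eLpNorm (fderiv ℝ (U τ)) ⊤ volume := by
  have : CompleteSpace V := FiniteDimensional.complete ℝ V
  refine measurable_of_Ioi fun c => ?_
  have hm : Measurable fun p : ℝ × E => ‖fderiv ℝ (U p.1) p.2‖ₑ :=
    (measurable_fderiv_with_param ℝ hU).enorm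
  have e : (fun τ => eLpNorm (fderiv ℝ (U τ)) ⊤ volume) ⁻¹' Ioi c =
      {τ | volume (Prod.mk τ ⁻¹' {p : ℝ × E | c < ‖fderiv ℝ (U p.1) p.2‖ₑ}) = 0}ᶜ := by
    ext τ
    rw [mem_preimage, mem_Ioi, mem_compl_iff, mem_ofPred_eq, ← not_le, not_iff_not,
      eLpNorm_exponent_top]
    have e1 : (Prod.mk τ ⁻¹' {p : ℝ × E | c < ‖fderiv ℝ (U p.1) p.2‖ₑ}) =
      {x | ¬ ‖fderiv ℝ (U τ) x‖ₑ ≤ c} := by ext x; simp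
    rw [e1, ← ae_iff]
    constructor
    · intro h
      filter_upwards [enorm_ae_le_eLpNormEssSup (fderiv ℝ (U τ)) volume] with x hx
      exact hx.trans h
    · exact fun h => essSup_le_of_ae_le _ h
  rw [e]
  exact ((measurable_measure_prodMk_left (measurableSet_lt measurable_const hm))
    (measurableSet_singleton 0)).compl

end LipschitzFunctions

/-! ### Lipschitz solutions as solutions of symmetric systems -/

section Reduction

variable {n m : ℕ} {𝒜 : Fin n → EuclideanSpace ℝ (Fin m) → Matrix (Fin m) (Fin m) ℝ} {T : ℝ}
  {u : ℝ → EuclideanSpace ℝ (Fin n) → EuclideanSpace ℝ (Fin m)}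

/-- The extension of a function on `[0, T]` to all times, constant before `0` and after `T`. -/
def timeExtend {X : Type*} (T : ℝ) (u : ℝ → X) (τ : ℝ) : X := u (max 0 (min τ T))

lemma timeExtend_of_mem {X : Type*} {T : ℝ} (u : ℝ → X) {τ : ℝ} (hτ : τ ∈ Icc 0 T) :
    timeExtend T u τ = u τ := by
  rw [timeExtend, min_eq_left hτ.2, max_eq_right hτ.1]

lemma max_min_mem_Icc {T : ℝ} (hT : 0 ≤ T) (τ : ℝ) : max 0 (min τ T) ∈ Icc 0 T :=
  ⟨le_max_left _ _, max_le hT (min_le_right _ _)⟩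

/-- The components of the quasilinear term. Differentiability is needed, because a component may be
differentiable at a point where the vector-valued function is not, and then the two derivatives
differ by the convention `fderiv = 0`. -/
lemma quasilinearTerm_apply {f : EuclideanSpace ℝ (Fin n) → EuclideanSpace ℝ (Fin m)}
    {x : EuclideanSpace ℝ (Fin n)} (hf : DifferentiableAt ℝ f x) (c : Fin m) :
    quasilinearTerm 𝒜 f x c = systemTerm (fun j => EuclideanSpace.single j (1 : ℝ))
      (fun j c d x => 𝒜 j (f x) c d) (fun c x => f x c) c x := by
  have e : ∀ (d : Fin m) (v : EuclideanSpace ℝ (Fin n)),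
      fderiv ℝ (fun x => f x d) x v = fderiv ℝ f x v d := by
    intro d v
    have h := (EuclideanSpace.proj d : EuclideanSpace ℝ (Fin m) →L[ℝ] ℝ).hasFDerivAt.comp x
      hf.hasFDerivAt
    exact congrArg (fun l => l v) (HasFDerivAt.fderiv h)
  rw [quasilinearTerm, systemTerm, Fintype.sum_prod_type]
  simp only [e, WithLp.ofLp_sum, Finset.sum_apply]
  refine Finset.sum_congr rfl fun j _ => ?_
  rfl

namespace IsLipschitzSolution

lemma continuous_timeExtend (h : IsLipschitzSolution 𝒜 T u) (hT : 0 ≤ T) :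
    Continuous (Function.uncurry (timeExtend T u)) := by
  have h1 : Continuous fun p : ℝ × EuclideanSpace ℝ (Fin n) => (max 0 (min p.1 T), p.2) := by
    fun_prop
  exact h.continuousOn.comp_continuous h1 fun p => ⟨max_min_mem_Icc hT _, mem_univ _⟩

lemma norm_le (h : IsLipschitzSolution 𝒜 T u) {t : ℝ} (ht : t ∈ Icc 0 T)
    (x : EuclideanSpace ℝ (Fin n)) : ‖u t x‖ ≤ (controlA T u).toReal := by
  have hc : Continuous (u t) := by
    have h1 := h.continuous_timeExtend (ht.1.trans ht.2)
    have h2 : Continuous fun x => timeExtend T u t x :=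
      h1.comp (continuous_const.prodMk continuous_id)
    rwa [timeExtend_of_mem u ht] at h2
  refine forall_le_of_ae_le hc ?_ x
  have h1 : eLpNorm (u t) ⊤ volume ≤ controlA T u :=
    le_iSup₂ (f := fun t (_ : t ∈ Icc (0 : ℝ) T) => eLpNorm (u t) ⊤ volume) t ht
  rw [eLpNorm_exponent_top] at h1
  filter_upwards [enorm_ae_le_eLpNormEssSup (u t) volume] with y hy
  rw [← toReal_enorm]
  exact ENNReal.toReal_mono h.controlA_ne_top (hy.trans h1)

lemma norm_timeExtend_le (h : IsLipschitzSolution 𝒜 T u) (hT : 0 ≤ T) (τ : ℝ)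
    (x : EuclideanSpace ℝ (Fin n)) : ‖timeExtend T u τ x‖ ≤ (controlA T u).toReal :=
  h.norm_le (max_min_mem_Icc hT τ) x

lemma lintegral_gradNorm_timeExtend {t : ℝ} (ht : t ≤ T) :
    ∫⁻ τ in Icc 0 t, gradNorm (timeExtend T u τ) = integralB t u := by
  refine setLIntegral_congr_fun measurableSet_Icc fun τ hτ => ?_
  rw [timeExtend_of_mem u ⟨hτ.1, hτ.2.trans ht⟩]

/-- Rademacher's theorem at almost every time, with the quantifiers exchanged by Fubini's theorem. -/
lemma ae_differentiableAt (h : IsLipschitzSolution 𝒜 T u) (hT : 0 ≤ T) :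
    ∀ᵐ x, ∀ᵐ τ ∂(volume.restrict (Icc 0 T)), DifferentiableAt ℝ (u τ) x := by
  have hm := measurableSet_of_differentiableAt_with_param ℝ (h.continuous_timeExtend hT)
  have h1 : ∀ᵐ τ ∂(volume.restrict (Icc 0 T)), ∀ᵐ x, DifferentiableAt ℝ (timeExtend T u τ) x := by
    filter_upwards [h.lipschitz, ae_restrict_mem measurableSet_Icc] with τ hτ hτm
    obtain ⟨L, hL⟩ := hτ
    rw [timeExtend_of_mem u hτm]
    exact hL.ae_differentiableAt
  rw [Measure.ae_ae_comm hm] at h1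
  filter_upwards [h1] with x hx
  filter_upwards [hx, ae_restrict_mem measurableSet_Icc] with τ hτ hτm
  rwa [timeExtend_of_mem u hτm] at hτ

/-- A Lipschitz solution, in components, is a solution of a symmetric system whose constants depend
only on the nonlinearity and on the size of the solution. -/
lemma exists_systemSolution (h𝒜_smooth : ∀ j a b, ContDiff ℝ ∞ (fun v => 𝒜 j v a b))
    (h𝒜_symm : ∀ j v, (𝒜 j v).IsSymm) (R : ℝ) :
    ∃ (A : ℝ) (K : ℝ≥0), ∀ (T : ℝ)
      (u : ℝ → EuclideanSpace ℝ (Fin n) → EuclideanSpace ℝ (Fin m)), 0 ≤ T →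
      IsLipschitzSolution 𝒜 T u → (controlA T u).toReal ≤ R →
      SystemSolution T A R K (fun τ => gradNorm (timeExtend T u τ))
        (fun j => EuclideanSpace.single j (1 : ℝ))
        (fun τ j c d x => 𝒜 j (timeExtend T u τ x) c d) (fun τ c x => timeExtend T u τ x c) := by
  choose C hC0 hC using fun j c d => exists_iteratedFDeriv_le_of_norm_le (h𝒜_smooth j c d) 0 R
  choose D hD0 hD using fun j c d => exists_norm_sub_le_of_norm_le (h𝒜_smooth j c d) R
  have hCsum : ∀ j c d, C j c d ≤ ∑ j, ∑ c, ∑ d, C j c d := by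
    intro j c d
    refine (Finset.single_le_sum (f := C j c) (fun d _ => hC0 j c d) (Finset.mem_univ d)).trans ?_
    refine (Finset.single_le_sum (f := fun c => ∑ d, C j c d)
      (fun c _ => Finset.sum_nonneg fun d _ => hC0 j c d) (Finset.mem_univ c)).trans ?_
    exact Finset.single_le_sum (f := fun j => ∑ c, ∑ d, C j c d)
      (fun j _ => Finset.sum_nonneg fun c _ => Finset.sum_nonneg fun d _ => hC0 j c d)
      (Finset.mem_univ j)
  have hDsum : ∀ j c d, D j c d ≤ ∑ j, ∑ c, ∑ d, D j c d := by
    intro j c d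
    refine (Finset.single_le_sum (f := D j c) (fun d _ => hD0 j c d) (Finset.mem_univ d)).trans ?_
    refine (Finset.single_le_sum (f := fun c => ∑ d, D j c d)
      (fun c _ => Finset.sum_nonneg fun d _ => hD0 j c d) (Finset.mem_univ c)).trans ?_
    exact Finset.single_le_sum (f := fun j => ∑ c, ∑ d, D j c d)
      (fun j _ => Finset.sum_nonneg fun c _ => Finset.sum_nonneg fun d _ => hD0 j c d)
      (Finset.mem_univ j)
  set A : ℝ := ∑ j, ∑ c, ∑ d, C j c d with hA
  set D' : ℝ := ∑ j, ∑ c, ∑ d, D j c d with hD'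
  have hA0 : 0 ≤ A := Finset.sum_nonneg fun j _ => Finset.sum_nonneg fun c _ =>
    Finset.sum_nonneg fun d _ => hC0 j c d
  have hD'0 : 0 ≤ D' := Finset.sum_nonneg fun j _ => Finset.sum_nonneg fun c _ =>
    Finset.sum_nonneg fun d _ => hD0 j c d
  set κ : ℝ≥0 := (kernelMass (EuclideanSpace ℝ (Fin n)) 0).toNNReal
  -- The Lipschitz constant of the nonlinearity enters for the coefficients, and the summand `1`
  -- for the solution itself.
  refine ⟨A, (1 + D'.toNNReal) * κ, fun T u hT h hR => ?_⟩
  set U := timeExtend T u with hU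
  have hUc : Continuous (Function.uncurry U) := h.continuous_timeExtend hT
  have hUR : ∀ τ x, ‖U τ x‖ ≤ R := fun τ x => (h.norm_timeExtend_le hT τ x).trans hR
  have hcomp : ∀ c, Continuous (Function.uncurry fun τ x => U τ x c) := by
    intro c
    exact (EuclideanSpace.proj c : EuclideanSpace ℝ (Fin m) →L[ℝ] ℝ).continuous.comp hUc
  have hB : ∫⁻ τ in Icc 0 T, gradNorm (U τ) ≠ ⊤ := by
    rw [lintegral_gradNorm_timeExtend le_rfl]
    exact h.integralB_ne_top
  refine
    { measurable_control := measurable_eLpNorm_top_fderiv hUc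
      control_ne_top := hB
      continuous_fun := hcomp
      bound := fun τ c x => (PiLp.norm_apply_le (U τ x) c).trans (hUR τ x)
      bound_nonneg := hA0
      symmetric := ?_
      measurable_term := fun c => ?_
      equation := ?_ }
  · filter_upwards [h.lipschitz, ae_restrict_mem measurableSet_Icc] with τ hτ hτm
    obtain ⟨L, hL⟩ := hτ
    rw [← timeExtend_of_mem u hτm] at hL
    have hfin : gradNorm (U τ) ≠ ⊤ := by
      refine ne_top_of_le_ne_top (b := (L : ℝ≥0∞)) ENNReal.coe_ne_top ?_
      rw [gradNorm, eLpNorm_exponent_top]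
      refine essSup_le_of_ae_le _ (Filter.Eventually.of_forall fun x => ?_)
      exact enorm_le_coe.2 (norm_fderiv_le_of_lipschitz ℝ hL)
    have hae : ∀ᵐ x, ‖fderiv ℝ (U τ) x‖ ≤ (gradNorm (U τ)).toNNReal := by
      filter_upwards [enorm_ae_le_eLpNormEssSup (fderiv ℝ (U τ)) volume] with x hx
      rw [← toReal_enorm]
      refine ENNReal.toReal_mono hfin (hx.trans (le_of_eq ?_))
      rw [gradNorm, eLpNorm_exponent_top]
    have hlip : LipschitzWith (κ * (gradNorm (U τ)).toNNReal) (U τ) :=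
      lipschitzWith_of_ae_norm_fderiv_le hL (hUR τ) hae
    set b : ℝ≥0 := (gradNorm (U τ)).toNNReal
    refine
      { norm_dir := fun j => by simp
        lip_coeff := fun j c d => LipschitzWith.of_dist_le_mul fun x y => ?_
        lip := fun c => LipschitzWith.of_dist_le_mul fun x y => ?_
        bound_coeff := fun j c d x => ?_
        bound := fun c x => (PiLp.norm_apply_le (U τ x) c).trans (hUR τ x)
        symm := fun j c d => funext fun x => ((h𝒜_symm j (U τ x)).apply c d).symm }
    · rw [dist_eq_norm]
      refine (hD j c d _ _ (hUR τ y) (hUR τ x)).trans ?_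
      have h1 := hlip.dist_le_mul x y
      rw [dist_eq_norm] at h1
      push_cast at h1 ⊢
      rw [Real.coe_toNNReal _ hD'0]
      calc _ ≤ D' * (κ * b * dist x y) := mul_le_mul (hDsum j c d) h1 (norm_nonneg _) hD'0
        _ ≤ (1 + D') * (κ * b * dist x y) := by gcongr; linarith
        _ = _ := by ring
    · have h1 := hlip.dist_le_mul x y
      rw [dist_eq_norm] at h1 ⊢
      have h2 := PiLp.norm_apply_le (U τ x - U τ y) c
      push_cast at h1 ⊢
      rw [Real.coe_toNNReal _ hD'0]
      calc _ ≤ κ * b * dist x y := h2.trans h1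
        _ ≤ (1 + D') * (κ * b * dist x y) := le_mul_of_one_le_left (by positivity) (by linarith)
        _ = _ := by ring
    · have h1 := hC j c d 0 le_rfl _ (hUR τ x)
      rw [norm_iteratedFDeriv_zero] at h1
      exact h1.trans (hCsum j c d)
  · refine Finset.measurable_sum _ fun p _ => Measurable.mul ?_ ?_
    · exact ((h𝒜_smooth p.1 c p.2).continuous.comp hUc).measurable
    · exact measurable_fderiv_apply_const_with_param ℝ (hcomp p.2) _
  · filter_upwards [h.equation, h.ae_differentiableAt hT] with x hx hdiff c
    set e : Fin n → EuclideanSpace ℝ (Fin n) := fun j => EuclideanSpace.single j (1 : ℝ)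
    have hae : ∀ r ∈ Icc 0 T, (fun τ => quasilinearTerm 𝒜 (u τ) x c) =ᵐ[volume.restrict (uIoc 0 r)]
        fun τ => systemTerm e (fun j c d x => 𝒜 j (U τ x) c d) (fun c x => U τ x c) c x := by
      intro r hr
      have hsub : uIoc 0 r ⊆ Icc 0 T := by
        rw [uIoc_of_le hr.1]
        exact fun τ hτ => ⟨hτ.1.le, hτ.2.trans hr.2⟩
      filter_upwards [ae_restrict_of_ae_restrict_of_subset hsub hdiff,
        ae_restrict_mem measurableSet_uIoc] with τ hτ hτm
      rw [quasilinearTerm_apply hτ, hU, timeExtend_of_mem u (hsub hτm)]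
    have hint : ∀ r ∈ Icc 0 T, IntervalIntegrable (fun τ => quasilinearTerm 𝒜 (u τ) x c)
        volume 0 r := by
      intro r hr
      have h1 := (hx r hr).1
      rw [intervalIntegrable_iff] at h1 ⊢
      exact (EuclideanSpace.proj c : EuclideanSpace ℝ (Fin m) →L[ℝ] ℝ).integrable_comp h1
    have hTm : T ∈ Icc 0 T := ⟨hT, le_rfl⟩
    refine ⟨(hint T hTm).congr_ae (hae T hTm), fun r hr => ?_⟩
    have h0m : (0 : ℝ) ∈ Icc 0 T := ⟨le_rfl, hT⟩
    have h1 := congrArg (fun v : EuclideanSpace ℝ (Fin m) => v c) (hx r hr).2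
    have h2 := ContinuousLinearMap.intervalIntegral_comp_comm
      (EuclideanSpace.proj c : EuclideanSpace ℝ (Fin m) →L[ℝ] ℝ) (hx r hr).1
    beta_reduce at h1
    rw [PiLp.add_apply] at h1
    rw [hU, timeExtend_of_mem u hr, timeExtend_of_mem u h0m, h1]
    congr 1
    refine h2.symm.trans (intervalIntegral.integral_congr_ae ?_)
    exact (ae_restrict_iff' measurableSet_uIoc).1 (hae r hr)

end IsLipschitzSolution

end Reduction

/-! ### The Sobolev norm and the Littlewood-Paley energy -/

section SobolevNorm

variable {E : Type} [NormedAddCommGroup E] [InnerProductSpace ℝ E] [FiniteDimensional ℝ E]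
  [MeasurableSpace E] [BorelSpace E]
  {F : Type} [NormedAddCommGroup F] [InnerProductSpace ℂ F] [CompleteSpace F]

/-- The Fourier multiplier of the Littlewood-Paley energy with weights `wᵏ`. -/
def energyMultiplier (w : ℝ) (ξ : E) : ℝ≥0∞ :=
  1 + ∑' k : ℕ, ENNReal.ofReal ((w ^ 2) ^ k * (1 - cutoff ((2 : ℝ) ^ k) ξ) ^ 2)

/-- The Littlewood-Paley energy on the Fourier side. -/
lemma lintegral_energyMultiplier {w : ℝ} {g : E → F} (hg : MemLp g 2 volume)
    {M : ℝ} (hM : ∀ x, ‖g x‖ ≤ M) :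
    ∫⁻ ξ, energyMultiplier w ξ * ‖l2Fourier hg ξ‖ₑ ^ 2 = eLpNorm g 2 volume ^ 2 +
      ∑' k : ℕ, ENNReal.ofReal ((w ^ 2) ^ k) * eLpNorm (highPass (2 ^ k) g) 2 volume ^ 2 := by
  have hm := (aestronglyMeasurable_l2Fourier hg).enorm.pow_const 2
  have hc : ∀ k : ℕ, Measurable fun ξ : E =>
      ENNReal.ofReal ((w ^ 2) ^ k * (1 - cutoff ((2 : ℝ) ^ k) ξ) ^ 2) := fun k =>
    (((measurable_const.sub (continuous_cutoff _).measurable).pow_const 2).const_mul _).ennreal_ofReal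
  simp only [energyMultiplier, add_mul, one_mul, ← ENNReal.tsum_mul_right]
  rw [lintegral_add_left' hm, lintegral_enorm_l2Fourier_sq, ← eLpNorm_two_sq,
    lintegral_tsum (f := fun (k : ℕ) ξ => ENNReal.ofReal ((w ^ 2) ^ k *
      (1 - cutoff ((2 : ℝ) ^ k) ξ) ^ 2) * ‖l2Fourier hg ξ‖ₑ ^ 2) fun k =>
      (hc k).aemeasurable.mul hm]
  congr 1
  refine tsum_congr fun k => ?_
  rw [eLpNorm_highPass_sq (by positivity) hg hM, ← lintegral_const_mul' _ _ ENNReal.ofReal_ne_top]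
  refine lintegral_congr fun ξ => ?_
  rw [ENNReal.ofReal_mul (by positivity), mul_assoc]

/-- At a frequency `2ⁿ ≤ ‖ξ‖ < 2ⁿ⁺¹`, only the terms `k ≤ n` of the multiplier contribute, and for `s > 0`
their geometric sum is comparable to the last of them. -/
lemma energyMultiplier_le {s : ℝ} (hs : 0 < s) (ξ : E) :
    energyMultiplier (2 ^ s) ξ ≤ ENNReal.ofReal (1 + (2 ^ s) ^ 2 / ((2 ^ s) ^ 2 - 1)) *
      ENNReal.ofReal ((1 + (2 * Real.pi * ‖ξ‖) ^ 2) ^ s) := by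
  set v : ℝ := ((2 : ℝ) ^ s) ^ 2 with hv
  have h2s : 1 < (2 : ℝ) ^ s := Real.one_lt_rpow (by norm_num) hs
  have hv1 : 1 < v := one_lt_pow₀ h2s two_ne_zero
  set P : ℝ := (1 + (2 * Real.pi * ‖ξ‖) ^ 2) ^ s with hP
  have hP1 : 1 ≤ P := Real.one_le_rpow (by nlinarith [sq_nonneg (2 * Real.pi * ‖ξ‖)]) hs.le
  have hq : 0 ≤ v / (v - 1) := div_nonneg (by linarith) (by linarith)
  have hzero : ∀ k : ℕ, ‖ξ‖ ≤ 2 ^ k →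
      ENNReal.ofReal (v ^ k * (1 - cutoff ((2 : ℝ) ^ k) ξ) ^ 2) = 0 := by
    intro k hk
    rw [cutoff_eq_one (by positivity) hk]
    simp
  rw [ENNReal.ofReal_add zero_le_one hq, add_mul, ENNReal.ofReal_one, one_mul, energyMultiplier]
  refine add_le_add (ENNReal.one_le_ofReal.2 hP1) ?_
  rcases lt_or_ge ‖ξ‖ 1 with h1 | h1
  · rw [ENNReal.tsum_eq_zero.2 fun k => hzero k (h1.le.trans (one_le_pow₀ one_le_two))]
    exact zero_le
  obtain ⟨n, hn1, hn2⟩ := exists_nat_pow_near h1 (one_lt_two (α := ℝ))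
  rw [tsum_eq_sum (s := Finset.range (n + 1)) fun k hk => hzero k (hn2.le.trans
    (pow_le_pow_right₀ one_le_two (by simpa using hk))), ← ENNReal.ofReal_mul hq,
    ← ENNReal.ofReal_sum_of_nonneg fun k _ => by positivity]
  refine ENNReal.ofReal_le_ofReal ?_
  have h2 : ∑ k ∈ Finset.range (n + 1), v ^ k * (1 - cutoff ((2 : ℝ) ^ k) ξ) ^ 2 ≤
      ∑ k ∈ Finset.range (n + 1), v ^ k := by
    refine Finset.sum_le_sum fun k _ => mul_le_of_le_one_right (by positivity) ?_
    have h3 := cutoff_nonneg ((2 : ℝ) ^ k) ξ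
    have h4 := cutoff_le_one ((2 : ℝ) ^ k) ξ
    exact pow_le_one₀ (by linarith) (by linarith)
  have h5 : v ^ n ≤ P := by
    have e : v ^ n = ((2 ^ n) ^ 2 : ℝ) ^ s := by
      rw [hv, ← pow_mul, ← pow_mul, Real.rpow_pow_comm zero_le_two, mul_comm]
    rw [e, hP]
    refine Real.rpow_le_rpow (by positivity) ?_ hs.le
    have h6 : ‖ξ‖ ≤ 2 * Real.pi * ‖ξ‖ :=
      le_mul_of_one_le_left (norm_nonneg _) (by linarith [Real.pi_gt_three])
    have h7 : ((2 : ℝ) ^ n) ^ 2 ≤ (2 * Real.pi * ‖ξ‖) ^ 2 :=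
      pow_le_pow_left₀ (by positivity) (hn1.trans h6) 2
    linarith
  refine h2.trans ?_
  rw [geom_sum_eq hv1.ne', div_mul_eq_mul_div]
  refine div_le_div_of_nonneg_right ?_ (by linarith)
  have : v ^ (n + 1) ≤ v * P := by
    rw [pow_succ']; exact mul_le_mul_of_nonneg_left h5 (by linarith)
  linarith

/-- At a frequency `2ⁿ⁺¹ ≤ ‖ξ‖ < 2ⁿ⁺²`, the `n`-th term of the multiplier is `4^(sn)`. -/
lemma le_energyMultiplier {s : ℝ} (hs : 0 ≤ s) (ξ : E) :
    ENNReal.ofReal ((1 + (2 * Real.pi * ‖ξ‖) ^ 2) ^ s) ≤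
      ENNReal.ofReal ((1 + 64 * Real.pi ^ 2) ^ s) * energyMultiplier (2 ^ s) ξ := by
  rcases lt_or_ge ‖ξ‖ 2 with h1 | h1
  · refine le_trans ?_ (mul_le_mul' le_rfl le_self_add)
    rw [mul_one]
    refine ENNReal.ofReal_le_ofReal (Real.rpow_le_rpow (by positivity) ?_ hs)
    have : (2 * Real.pi * ‖ξ‖) ^ 2 ≤ (8 * Real.pi) ^ 2 := by
      refine pow_le_pow_left₀ (by positivity) ?_ 2
      nlinarith [Real.pi_pos]
    nlinarith
  obtain ⟨n, hn1, hn2⟩ := exists_nat_pow_near (x := ‖ξ‖ / 2) (by linarith) (one_lt_two (α := ℝ))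
  have hterm : ENNReal.ofReal ((((2 : ℝ) ^ s) ^ 2) ^ n) ≤ energyMultiplier (2 ^ s) ξ := by
    refine le_trans (le_of_eq ?_) ((ENNReal.le_tsum (f := fun k : ℕ => ENNReal.ofReal
      ((((2 : ℝ) ^ s) ^ 2) ^ k * (1 - cutoff ((2 : ℝ) ^ k) ξ) ^ 2)) n).trans le_add_self)
    rw [cutoff_eq_zero (by positivity) (by linarith)]
    simp
  refine le_trans ?_ (mul_le_mul' le_rfl hterm)
  rw [← ENNReal.ofReal_mul (by positivity)]
  refine ENNReal.ofReal_le_ofReal ?_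
  have e : (((2 : ℝ) ^ s) ^ 2) ^ n = ((2 ^ n) ^ 2 : ℝ) ^ s := by
    rw [← pow_mul, ← pow_mul, Real.rpow_pow_comm zero_le_two, mul_comm]
  rw [e, ← Real.mul_rpow (by positivity) (by positivity)]
  refine Real.rpow_le_rpow (by positivity) ?_ hs
  have h2 : ‖ξ‖ ≤ 4 * 2 ^ n := by rw [pow_succ] at hn2; linarith
  have h3 : (2 * Real.pi * ‖ξ‖) ^ 2 ≤ (2 * Real.pi * (4 * 2 ^ n)) ^ 2 := by
    refine pow_le_pow_left₀ (by positivity) ?_ 2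
    exact mul_le_mul_of_nonneg_left h2 (by positivity)
  have h4 : (1 : ℝ) ≤ (2 ^ n) ^ 2 := one_le_pow₀ (one_le_pow₀ one_le_two)
  nlinarith

variable {n m : ℕ}

/-- The isometric inclusion of `ℝᵐ` in `ℂᵐ`. -/
def complexifyIsometry (m : ℕ) : EuclideanSpace ℝ (Fin m) →ₗᵢ[ℝ] EuclideanSpace ℂ (Fin m) where
  toFun v := WithLp.toLp 2 fun i => ((v i : ℝ) : ℂ)
  map_add' v w := by ext i; simp
  map_smul' c v := by ext i; simp
  norm_map' v := by simp [EuclideanSpace.norm_eq]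

lemma norm_complexify (f : EuclideanSpace ℝ (Fin n) → EuclideanSpace ℝ (Fin m))
    (x : EuclideanSpace ℝ (Fin n)) : ‖complexify f x‖ = ‖f x‖ :=
  (complexifyIsometry m).norm_map (f x)

lemma memLp_complexify_iff {f : EuclideanSpace ℝ (Fin n) → EuclideanSpace ℝ (Fin m)}
    (hf : Continuous f) : MemLp (complexify f) 2 volume ↔ MemLp f 2 volume := by
  have hc : Continuous (complexify f) := (complexifyIsometry m).continuous.comp hf
  exact memLp_congr_norm hc.aestronglyMeasurable hf.aestronglyMeasurable
    (Filter.Eventually.of_forall (norm_complexify f))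

lemma eLpNorm_highPass_complexify {r : ℝ} (hr : 0 < r)
    {f : EuclideanSpace ℝ (Fin n) → EuclideanSpace ℝ (Fin m)} (hf : Continuous f)
    {M : ℝ} (hM : ∀ x, ‖f x‖ ≤ M) :
    eLpNorm (highPass r (complexify f)) 2 volume = eLpNorm (highPass r f) 2 volume := by
  refine eLpNorm_congr_norm_ae (Filter.Eventually.of_forall fun x => ?_)
  have h := lowPass_clm hr (complexifyIsometry m).toContinuousLinearMap hf.aestronglyMeasurable hM x
  have e : highPass r (complexify f) x = complexifyIsometry m (highPass r f x) := by
    rw [highPass, highPass, map_sub]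
    exact congrArg₂ _ rfl h
  rw [e, LinearIsometry.norm_map]

lemma sobolevNorm_of_not_memLp {s : ℝ}
    {f : EuclideanSpace ℝ (Fin n) → EuclideanSpace ℝ (Fin m)}
    (hf : ¬ MemLp (complexify f) 2 volume) : sobolevNorm s f = ⊤ := by
  rw [sobolevNorm, iInf_neg hf]

lemma sobolevNorm_sq {s : ℝ} {f : EuclideanSpace ℝ (Fin n) → EuclideanSpace ℝ (Fin m)}
    (hf : MemLp (complexify f) 2 volume) :
    sobolevNorm s f ^ 2 = ∫⁻ ξ, ENNReal.ofReal ((1 + (2 * Real.pi * ‖ξ‖) ^ 2) ^ s) *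
      ‖l2Fourier hf ξ‖ₑ ^ 2 := by
  rw [sobolevNorm, iInf_pos hf, ← ENNReal.rpow_natCast, ← ENNReal.rpow_mul]
  norm_num
  rfl

/-- Plancherel's identity. Both sides are infinite if `f` is not square integrable. -/
lemma sobolevNorm_zero_sq {f : EuclideanSpace ℝ (Fin n) → EuclideanSpace ℝ (Fin m)}
    (hf : Continuous f) :
    sobolevNorm 0 f ^ 2 = ∫⁻ x, ENNReal.ofReal (∑ c, f x c ^ 2) := by
  have e : ∀ x, ENNReal.ofReal (∑ c, f x c ^ 2) = ‖complexify f x‖ₑ ^ 2 := by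
    intro x
    rw [← ofReal_norm, norm_complexify, ← ENNReal.ofReal_pow (norm_nonneg _),
      EuclideanSpace.real_norm_sq_eq]
  simp only [e]
  by_cases h : MemLp (complexify f) 2 volume
  · rw [sobolevNorm_sq h]
    simp only [Real.rpow_zero, ENNReal.ofReal_one, one_mul]
    exact lintegral_enorm_l2Fourier_sq h
  · have hc : Continuous (complexify f) := (complexifyIsometry m).continuous.comp hf
    have h1 : eLpNorm (complexify f) 2 volume = ⊤ := by
      by_contra h2
      exact h ⟨hc.aestronglyMeasurable, lt_top_iff_ne_top.2 h2⟩
    rw [sobolevNorm_of_not_memLp h, ← eLpNorm_two_sq, h1]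

/-- The Littlewood-Paley energy of a vector-valued function, in which the components are not
separated, is comparable to `dyadicEnergy`. -/
lemma energy_le_dyadicEnergy {w : ℝ} (hw : 0 ≤ w)
    {f : EuclideanSpace ℝ (Fin n) → EuclideanSpace ℝ (Fin m)} (hf : Continuous f)
    {M : ℝ} (hM : ∀ x, ‖f x‖ ≤ M) :
    eLpNorm f 2 volume ^ 2 +
      ∑' k : ℕ, ENNReal.ofReal ((w ^ 2) ^ k) * eLpNorm (highPass (2 ^ k) f) 2 volume ^ 2 ≤
    dyadicEnergy w fun c x => f x c := by
  have hfc : ∀ c, Continuous fun x => f x c := fun c => by fun_prop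
  refine add_le_add (pow_le_pow_left' (eLpNorm_le_sum_component fun c =>
    (hfc c).aestronglyMeasurable) 2) (ENNReal.tsum_le_tsum fun k => ?_)
  rw [mul_pow, ← ENNReal.ofReal_pow (by positivity), pow_right_comm]
  exact mul_le_mul' le_rfl (pow_le_pow_left'
    (eLpNorm_highPass_le_sum_component (by positivity) hf hM) 2)

lemma dyadicEnergy_le_energy {w : ℝ} (hw : 0 ≤ w)
    {f : EuclideanSpace ℝ (Fin n) → EuclideanSpace ℝ (Fin m)} (hf : Continuous f)
    {M : ℝ} (hM : ∀ x, ‖f x‖ ≤ M) :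
    (dyadicEnergy w fun c x => f x c) ≤ (m : ℝ≥0∞) ^ 2 * (eLpNorm f 2 volume ^ 2 +
      ∑' k : ℕ, ENNReal.ofReal ((w ^ 2) ^ k) * eLpNorm (highPass (2 ^ k) f) 2 volume ^ 2) := by
  have h1 : lowSize (fun c x => f x c) ≤ m * eLpNorm f 2 volume := by
    refine (Finset.sum_le_sum (g := fun _ => eLpNorm f 2 volume) fun c _ =>
      eLpNorm_mono fun x => PiLp.norm_apply_le (f x) c).trans (le_of_eq (by simp))
  have h2 : ∀ k, dyadicSize k (fun c x => f x c) ≤ m * eLpNorm (highPass (2 ^ k) f) 2 volume := by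
    intro k
    refine (Finset.sum_le_sum (g := fun _ => eLpNorm (highPass (2 ^ k) f) 2 volume) fun c _ =>
      eLpNorm_mono fun x => ?_).trans (le_of_eq (by simp))
    rw [← highPass_component (by positivity) hf.aestronglyMeasurable hM]
    exact PiLp.norm_apply_le _ c
  rw [dyadicEnergy, mul_add, ← ENNReal.tsum_mul_left]
  refine add_le_add ?_ (ENNReal.tsum_le_tsum fun k => ?_)
  · rw [← mul_pow]; exact pow_le_pow_left' h1 2
  · rw [mul_left_comm, ← mul_pow, mul_pow (ENNReal.ofReal _), ← ENNReal.ofReal_pow (by positivity),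
      pow_right_comm]
    exact mul_le_mul' le_rfl (pow_le_pow_left' (h2 k) 2)

lemma lintegral_energyMultiplier_complexify (w : ℝ)
    {f : EuclideanSpace ℝ (Fin n) → EuclideanSpace ℝ (Fin m)} (hf : Continuous f)
    (h2 : MemLp (complexify f) 2 volume) {M : ℝ} (hM : ∀ x, ‖f x‖ ≤ M) :
    ∫⁻ ξ, energyMultiplier w ξ * ‖l2Fourier h2 ξ‖ₑ ^ 2 = eLpNorm f 2 volume ^ 2 +
      ∑' k : ℕ, ENNReal.ofReal ((w ^ 2) ^ k) * eLpNorm (highPass (2 ^ k) f) 2 volume ^ 2 := by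
  rw [lintegral_energyMultiplier h2 (M := M) fun x => (norm_complexify f x).trans_le (hM x)]
  congr 1
  · rw [eLpNorm_congr_norm_ae (Filter.Eventually.of_forall (norm_complexify f))]
  · exact tsum_congr fun k => by rw [eLpNorm_highPass_complexify (by positivity) hf hM]

/-- The norm of `Hˢ` is bounded by the Littlewood-Paley energy with weights `2ˢᵏ`. -/
lemma sobolevNorm_sq_le_dyadicEnergy {s : ℝ} (hs : 0 ≤ s)
    {f : EuclideanSpace ℝ (Fin n) → EuclideanSpace ℝ (Fin m)} (hf : Continuous f)
    {M : ℝ} (hM : ∀ x, ‖f x‖ ≤ M) :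
    sobolevNorm s f ^ 2 ≤ ENNReal.ofReal ((1 + 64 * Real.pi ^ 2) ^ s) *
      dyadicEnergy (2 ^ s) fun c x => f x c := by
  by_cases h2 : MemLp (complexify f) 2 volume
  · refine le_trans ?_ (mul_le_mul' le_rfl (energy_le_dyadicEnergy (by positivity) hf hM))
    rw [sobolevNorm_sq h2, ← lintegral_energyMultiplier_complexify _ hf h2 hM,
      ← lintegral_const_mul' _ _ ENNReal.ofReal_ne_top]
    refine lintegral_mono fun ξ => ?_
    rw [← mul_assoc]
    exact mul_le_mul' (le_energyMultiplier hs ξ) le_rfl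
  · have h1 : eLpNorm f 2 volume = ⊤ := by
      by_contra h
      exact h2 ((memLp_complexify_iff hf).2 ⟨hf.aestronglyMeasurable, lt_top_iff_ne_top.2 h⟩)
    have h3 := energy_le_dyadicEnergy (w := (2 : ℝ) ^ s) (by positivity) hf hM
    rw [h1, ENNReal.top_pow two_ne_zero, top_add, top_le_iff] at h3
    rw [h3, ENNReal.mul_top]
    · exact le_top
    · rw [ENNReal.ofReal_ne_zero_iff]; positivity

/-- The Littlewood-Paley energy with weights `2ˢᵏ` is bounded by the norm of `Hˢ`, for `s > 0`. -/
lemma dyadicEnergy_le_sobolevNorm_sq {s : ℝ} (hs : 0 < s)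
    {f : EuclideanSpace ℝ (Fin n) → EuclideanSpace ℝ (Fin m)} (hf : Continuous f)
    {M : ℝ} (hM : ∀ x, ‖f x‖ ≤ M) (h2 : MemLp (complexify f) 2 volume) :
    (dyadicEnergy (2 ^ s) fun c x => f x c) ≤
      ENNReal.ofReal (m ^ 2 * (1 + (2 ^ s) ^ 2 / ((2 ^ s) ^ 2 - 1))) * sobolevNorm s f ^ 2 := by
  refine (dyadicEnergy_le_energy (by positivity) hf hM).trans ?_
  rw [sobolevNorm_sq h2, ← lintegral_energyMultiplier_complexify _ hf h2 hM,
    ENNReal.ofReal_mul (by positivity), ENNReal.ofReal_pow (by positivity), ENNReal.ofReal_natCast,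
    mul_assoc]
  refine mul_le_mul' le_rfl ?_
  rw [← lintegral_const_mul' _ _ ENNReal.ofReal_ne_top]
  refine lintegral_mono fun ξ => ?_
  rw [← mul_assoc]
  exact mul_le_mul' (energyMultiplier_le hs ξ) le_rfl

end SobolevNorm

/-! ### The bound of the Sobolev norm -/

section SobolevBound

variable {n m : ℕ} {𝒜 : Fin n → EuclideanSpace ℝ (Fin m) → Matrix (Fin m) (Fin m) ℝ}

/-- The bound with constants that depend on an upper bound `R` of the solution. The constant in
front of the exponential does not depend on `R`. -/
lemma IsLipschitzSolution.exists_sobolevNorm_sq_le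
    (h𝒜_smooth : ∀ j a b, ContDiff ℝ ∞ (fun v => 𝒜 j v a b))
    (h𝒜_symm : ∀ j v, (𝒜 j v).IsSymm) {s : ℝ} (hs : 0 ≤ s) :
    ∃ C : ℝ, 0 ≤ C ∧ ∀ R : ℝ, ∃ D : ℝ, 0 ≤ D ∧ ∀ (T : ℝ)
      (u : ℝ → EuclideanSpace ℝ (Fin n) → EuclideanSpace ℝ (Fin m)),
      IsLipschitzSolution 𝒜 T u → (controlA T u).toReal ≤ R →
      sobolevNorm s (u 0) ≠ ⊤ → ∀ t ∈ Icc (0 : ℝ) T,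
        sobolevNorm s (u t) ^ 2 ≤ ENNReal.ofReal C *
          ENNReal.ofReal (Real.exp (D * (integralB t u).toReal)) * sobolevNorm s (u 0) ^ 2 := by
  rcases hs.eq_or_lt with rfl | hs0
  · refine ⟨2, zero_le_two, fun R => ?_⟩
    obtain ⟨A, K, hsol⟩ := exists_systemSolution h𝒜_smooth h𝒜_symm R
    refine ⟨4 * (n * m) * K, by positivity, fun T u h hR _ t ht => ?_⟩
    have hT : 0 ≤ T := ht.1.trans ht.2
    have hS := hsol T u hT h hR
    have hc : ∀ τ, Continuous (timeExtend T u τ) := fun τ =>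
      (h.continuous_timeExtend hT).comp (continuous_const.prodMk continuous_id)
    have h1 := hS.lintegral_sq_le ht
    rw [lintegral_gradNorm_timeExtend ht.2, ← sobolevNorm_zero_sq (hc t),
      ← sobolevNorm_zero_sq (hc 0), timeExtend_of_mem u ht,
      timeExtend_of_mem u ⟨le_rfl, hT⟩] at h1
    refine h1.trans (le_of_eq ?_)
    rw [Fintype.card_fin, Fintype.card_fin, ← mul_assoc, ENNReal.ofReal_ofNat]
    ring
  set w : ℝ := 2 ^ s with hw
  have hw1 : 1 ≤ w := Real.one_le_rpow one_le_two hs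
  set N : ℕ := ⌈s⌉₊ + 1 with hN
  have hwN : w * 2 ≤ 2 ^ N := by
    rw [hN, pow_succ, hw, ← Real.rpow_natCast]
    have := Real.rpow_le_rpow_of_exponent_le one_le_two (Nat.le_ceil s)
    linarith
  obtain ⟨C, C', hC, hC', hen⟩ := exists_dyadicEnergy_le (EuclideanSpace ℝ (Fin n)) (Fin m) (Fin n)
    hw1 hwN
  set c₁ : ℝ := (1 + 64 * Real.pi ^ 2) ^ s with hc₁
  have hc₁0 : 0 ≤ c₁ := by positivity
  set c₂ : ℝ := m ^ 2 * (1 + w ^ 2 / (w ^ 2 - 1)) with hc₂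
  have hc₂0 : 0 ≤ c₂ := mul_nonneg (by positivity)
    (add_nonneg zero_le_one (div_nonneg (sq_nonneg _) (by nlinarith)))
  refine ⟨c₁ * C * c₂, by positivity, fun R => ?_⟩
  obtain ⟨A, K, hsol⟩ := exists_systemSolution h𝒜_smooth h𝒜_symm R
  obtain ⟨C₀, hC₀, hMoser⟩ := exists_moserBound (EuclideanSpace ℝ (Fin n)) N R h𝒜_smooth
  refine ⟨C' * K * (1 + C₀ ^ 2), by positivity, fun T u h hR h0 t ht => ?_⟩
  have hT : 0 ≤ T := ht.1.trans ht.2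
  have hS := hsol T u hT h hR
  have h0m : (0 : ℝ) ∈ Icc 0 T := ⟨le_rfl, hT⟩
  have hc : ∀ τ, Continuous (timeExtend T u τ) := fun τ =>
    (h.continuous_timeExtend hT).comp (continuous_const.prodMk continuous_id)
  have hUR : ∀ τ x, ‖timeExtend T u τ x‖ ≤ R := fun τ x => (h.norm_timeExtend_le hT τ x).trans hR
  rw [← timeExtend_of_mem u h0m] at h0 ⊢
  have hmem : MemLp (complexify (timeExtend T u 0)) 2 volume := by
    by_contra hn
    exact h0 (sobolevNorm_of_not_memLp hn)
  have hupper := dyadicEnergy_le_sobolevNorm_sq hs0 (hc 0) (hUR 0) hmem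
  have hlow : lowSize (fun c x => timeExtend T u 0 x c) ≠ ⊤ := by
    refine (ENNReal.sum_lt_top.2 fun c _ => ?_).ne
    refine (eLpNorm_mono fun x => PiLp.norm_apply_le (timeExtend T u 0 x) c).trans_lt ?_
    exact ((memLp_complexify_iff (hc 0)).1 hmem).2
  have h1 := hen T A R K _ _ _ _ hS C₀ hC₀ hlow
    (fun τ _ hf => hMoser _ (hc τ) (hUR τ) hf) t ht
  rw [lintegral_gradNorm_timeExtend ht.2] at h1
  have h2 := sobolevNorm_sq_le_dyadicEnergy hs (hc t) (hUR t)
  rw [timeExtend_of_mem u ht] at h1 h2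
  refine h2.trans ((mul_le_mul' le_rfl (h1.trans (mul_le_mul' le_rfl hupper))).trans ?_)
  set X := ENNReal.ofReal (Real.exp (C' * K * (1 + C₀ ^ 2) * (integralB t u).toReal))
  set Y := sobolevNorm s (timeExtend T u 0) ^ 2
  rw [ENNReal.ofReal_mul (p := c₁ * C) (by positivity), ENNReal.ofReal_mul hc₁0]
  exact le_of_eq (by ring)

end SobolevBound

end

theorem theorem3 (n m : ℕ)
    (𝒜 : Fin n → EuclideanSpace ℝ (Fin m) → Matrix (Fin m) (Fin m) ℝ)
    (h𝒜_smooth : ∀ j a b, ContDiff ℝ ∞ (fun v => 𝒜 j v a b))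
    (h𝒜_symm : ∀ j v, (𝒜 j v).IsSymm)
    (s : ℝ) (hs : 0 ≤ s) :
    ∃ (K : ℝ≥0) (C : ℝ → ℝ), Monotone C ∧
      ∀ (T : ℝ) (u : ℝ → EuclideanSpace ℝ (Fin n) → EuclideanSpace ℝ (Fin m)),
        IsLipschitzSolution 𝒜 T u →
        ∀ t ∈ Icc (0 : ℝ) T,
          sobolevNorm s (u t) ≤
            K * ENNReal.ofReal (Real.exp (C (controlA T u).toReal * (integralB t u).toReal)) *
              sobolevNorm s (u 0) := by
  obtain ⟨C, hC, h⟩ := IsLipschitzSolution.exists_sobolevNorm_sq_le h𝒜_smooth h𝒜_symm hs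
  choose D hD0 hD using h
  -- The bounds for the integer sizes `i ≥ A` are summed to obtain a monotone function of `A`.
  refine ⟨(1 + C).toNNReal, fun A => ∑ i ∈ Finset.range (⌈A⌉₊ + 1), D i, fun A A' hA => ?_,
    fun T u hu t ht => ?_⟩
  · exact Finset.sum_le_sum_of_subset_of_nonneg
      (Finset.range_mono (Nat.succ_le_succ (Nat.ceil_mono hA))) fun i _ _ => hD0 i
  have hC1 : (0 : ℝ) < 1 + C := by positivity
  set i := ⌈(controlA T u).toReal⌉₊ with hi
  have hDi : D i ≤ ∑ i ∈ Finset.range (i + 1), D i :=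
    Finset.single_le_sum (f := fun i : ℕ => D i) (fun i _ => hD0 i) (Finset.self_mem_range_succ i)
  beta_reduce
  set b := (integralB t u).toReal with hb
  have hb0 : 0 ≤ b := ENNReal.toReal_nonneg
  change _ ≤ ENNReal.ofReal (1 + C) * _ * _
  rcases eq_or_ne (sobolevNorm s (u 0)) ⊤ with h0 | h0
  · rw [h0, ENNReal.mul_top]
    · exact le_top
    · refine mul_ne_zero ?_ ?_ <;> rw [ENNReal.ofReal_ne_zero_iff]
      · exact hC1
      · exact Real.exp_pos _
  rw [← ENNReal.pow_le_pow_left_iff two_ne_zero]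
  refine (hD i T u hu (Nat.le_ceil _) h0 t ht).trans ?_
  rw [mul_pow, mul_pow, ← ENNReal.ofReal_pow hC1.le, ← ENNReal.ofReal_pow (Real.exp_pos _).le]
  have h1 : C ≤ (1 + C) ^ 2 := by nlinarith
  have h2 : Real.exp (D i * b) ≤ Real.exp ((∑ i ∈ Finset.range (i + 1), D i) * b) ^ 2 := by
    have h3 : Real.exp (D i * b) ≤ Real.exp ((∑ i ∈ Finset.range (i + 1), D i) * b) := by gcongr
    have h4 : 1 ≤ Real.exp ((∑ i ∈ Finset.range (i + 1), D i) * b) :=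
      Real.one_le_exp (mul_nonneg ((hD0 i).trans hDi) hb0)
    nlinarith
  gcongr
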